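/- **Theorem (Linear stability).** Let $\mathbb T=\mathbb R/2\pi\mathbb Z$, $\nu>0$, $\alpha>0$, $\beta\in\mathbb R$ with $B_\beta:=\beta(\beta-1)>0$. Let $u_{\rm in}=(u^1_{\rm in},u^2_{\rm in},u^3_{\rm in})$ be a smooth divergence-free vector field and $\theta_{\rm in}$ a smooth function on $\mathbb T\times\mathbb R\times\mathbb T$, and let $(u,\theta)$, with pressure $p$, be a solution for $t\ge 0$ of the linearization of the rotating Boussinesq system around $V_s=(y,0,0)$, $\Theta_s=1+\alpha^2z$: $$\partial_tu+y\partial_{x}u-\nu\Delta u+\nabla p+\big((1-\beta)u^2,\ \beta u^1,\ \alpha\theta\big)^{T}=0,\quad \partial_t\theta+y\partial_{x}\theta-\nu\Delta\theta-\alpha u^3=0,\quad \nabla\cdot u=0,$$ $(u,\theta)|_{t=0}=(u_{\rm in},\theta_{\rm in})$. Here a solution is smooth for $t>0$, continuous up to $t=0$, and $u,\theta,\nabla p$ are bounded in $L^2(\mathbb T\times\mathbb R\times\mathbb T)$ locally uniformly in time. Notation. $f_0$ is the average of $f$ in $x$, $f_{\neq}=f-f_0$, $\overline f_0$ is the average in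 $(x,z)$, $\widetilde f_0=f_0-\overline f_0$. Hats are Fourier transforms, $\widehat f(k,\eta,l)=(2\pi)^{-2}\int f e^{-i(kx+\eta y+lz)}$ on $\mathbb T\times\mathbb R\times\mathbb T$ and $\widehat g(\eta,l)=(2\pi)^{-1}\int g e^{-i(\eta y+lz)}$ on $\mathbb R\times\mathbb T$ (in the $L^2$ sense). $\|f\|_{H^s}=\|\langle k,\eta,l\rangle^s\widehat f\|_{L^2}$, $\langle t\rangle=\sqrt{1+t^2}$, $|\eta,l|=\sqrt{\eta^2+l^2}$, the norm of a tuple is the square root of the sum of the squares of the norms of its entries, and norms may be infinite. $(U,\Theta)(t,x,y,z)=(u,\theta)(t,x+ty,y,z)$, and $w^3_{\rm in}=\partial_xu^2_{\rm in}-\partial_yu^1_{\rm in}$. (1) For every $s\ge0$ and $K\in\mathbb R$ there is a constant $C>0$ depending only on $s,\alpha,K$ such that, whenever $\frac{\beta-1}{\beta}\le K$ (so that $C$ is uniform in $\beta>1$ and in $\beta\le-\delta$ for each $\delta>0$), for all $t\ge0$: $$\|U^1_{\neq}(t)\|_{H^s}\le C\max\Big\{\sqrt{\tfrac{\beta-1}{\beta}},\sqrt{\tfrac{\beta}{\beta-1}}\Big\}e^{-\frac1{16}\nu^{1/3}t}\big(\|u_{\rm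 in}\|_{H^{s+3}}+\|\theta_{\rm in}\|_{H^{s+2}}\big),$$ $$\langle t\rangle\|U^2_{\neq}(t)\|_{H^s}\le C\max\Big\{\sqrt{\tfrac{\beta-1}{\beta}},\sqrt{\tfrac{\beta}{\beta-1}}\Big\}e^{-\frac1{16}\nu^{1/3}t}\big(\|u_{\rm in}\|_{H^{s+5}}+\|\theta_{\rm in}\|_{H^{s+4}}\big),$$ $$\|(U^3_{\neq},\Theta_{\neq})(t)\|_{H^s}\le C e^{-\frac1{16}\nu^{1/3}t}\Big(\|u^3_{\rm in}\|_{H^{s+3}}+\sqrt{\tfrac{\beta}{\beta-1}}\|w^3_{\rm in}\|_{H^{s+2}}+\|\theta_{\rm in}\|_{H^{s+2}}\Big).$$ (2) Let $h=\sqrt{\alpha^2\eta^2+B_\beta l^2}$, $\lambda_1=-\nu(\eta^2+l^2)$, $\lambda_2=\lambda_1+i\frac{h}{|\eta,l|}$, $\lambda_3=\lambda_1-i\frac{h}{|\eta,l|}$. For all $t\ge0$, all integers $l\ne0$ and almost every $\eta\in\mathbb R$, writing $a_1,a_2,b$ for the Fourier transforms at $(\eta,l)$ of $\widetilde{(u^1_{\rm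 in})_0},\widetilde{(u^2_{\rm in})_0},\widetilde{(\theta_{\rm in})_0}$, $$\widehat{\widetilde u^1_0}=\Big[\tfrac{\alpha^2\eta^2}{h^2}e^{\lambda_1t}+\tfrac{\beta(\beta-1)l^2}{2h^2}(e^{\lambda_2t}+e^{\lambda_3t})\Big]a_1+\tfrac{i(\beta-1)|\eta,l|}{2h}(e^{\lambda_3t}-e^{\lambda_2t})a_2+\Big[\tfrac{\alpha(\beta-1)\eta l}{h^2}e^{\lambda_1t}-\tfrac{\alpha(\beta-1)\eta l}{2h^2}(e^{\lambda_2t}+e^{\lambda_3t})\Big]b,$$ $$\widehat{\widetilde u^2_0}=\tfrac{i\beta l^2}{2h|\eta,l|}(e^{\lambda_2t}-e^{\lambda_3t})a_1+\tfrac12(e^{\lambda_2t}+e^{\lambda_3t})a_2+\tfrac{i\alpha\eta l}{2h|\eta,l|}(e^{\lambda_3t}-e^{\lambda_2t})b,\qquad \widehat{\widetilde u^3_0}=-\tfrac{\eta}{l}\widehat{\widetilde u^2_0},$$ $$\widehat{\widetilde\theta_0}=\Big[\tfrac{\alpha\beta\eta l}{h^2}e^{\lambda_1t}-\tfrac{\alpha\beta\eta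 l}{2h^2}(e^{\lambda_2t}+e^{\lambda_3t})\Big]a_1+\tfrac{i\alpha\eta|\eta,l|}{2hl}(e^{\lambda_2t}-e^{\lambda_3t})a_2+\Big[\tfrac{\beta(\beta-1)l^2}{h^2}e^{\lambda_1t}+\tfrac{\alpha^2\eta^2}{2h^2}(e^{\lambda_2t}+e^{\lambda_3t})\Big]b.$$ The double-zero modes are, for all $t\ge0$ and $y\in\mathbb R$, $$\overline u^1_0=e^{\nu t\partial_{yy}}\overline{(u^1_{\rm in})_0},\qquad \overline u^2_0=0,$$ $$\overline u^3_0=e^{\nu t\partial_{yy}}\big[\cos(\alpha t)\overline{(u^3_{\rm in})_0}-\sin(\alpha t)\overline{(\theta_{\rm in})_0}\big],\qquad \overline\theta_0=e^{\nu t\partial_{yy}}\big[\sin(\alpha t)\overline{(u^3_{\rm in})_0}+\cos(\alpha t)\overline{(\theta_{\rm in})_0}\big].$$ (3) Let $q=|B_\beta-\alpha^2|/\alpha$. For every $R>0$ there is a constant $C>0$ depending only on $\alpha,R$ such that, whenever $R^{-1}\le B_\beta\le R$ and $B_\beta\neq\alpha^2$, for all $t>0$: $$\|(\widetilde u^2_0,\widetilde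 u^3_0)(t)\|_{L^\infty(\mathbb R\times\mathbb T)}\le C e^{-\nu t}(qt)^{-1/3}\big\|\big(\widetilde{(u_{\rm in})_0},\widetilde{(\theta_{\rm in})_0}\big)\big\|_{W^{3,1}(\mathbb R\times\mathbb T)}.$$ All constants are independent of $\nu$, $t$ and the data. -/

import Mathlib

open MeasureTheory Set
open scoped ENNReal ContDiff FourierTransform

noncomputable section

namespace RotatingBoussinesq

/-! Functions on `𝕋 × ℝ × 𝕋` (with `𝕋` of length `2π`) are functions of `(x, y, z) ∈ ℝ³` that are
`2π`-periodic in `x` and in `z`; functions on `ℝ × 𝕋` are functions of `(y, z)` that are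
`2π`-periodic in `z`. Velocity components `u¹, u², u³` are indexed by `0, 1, 2 : Fin 3`. -/

/-- `2π`-periodicity in the first and in the third variable. -/
def IsPeriodic (f : ℝ × ℝ × ℝ → ℝ) : Prop :=
  ∀ x y z : ℝ, f (x + 2 * Real.pi, y, z) = f (x, y, z) ∧ f (x, y, z + 2 * Real.pi) = f (x, y, z)

/-- Lebesgue measure on a period cell of `𝕋 × ℝ × 𝕋`. -/
def cell3 : Measure (ℝ × ℝ × ℝ) :=
  volume.restrict (Ioc 0 (2 * Real.pi) ×ˢ (univ ×ˢ Ioc 0 (2 * Real.pi)))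

/-- Lebesgue measure on a period cell of `ℝ × 𝕋`. -/
def cell2 : Measure (ℝ × ℝ) :=
  volume.restrict (univ ×ˢ Ioc 0 (2 * Real.pi))

/-! ### Differential operators in space -/

def dX (f : ℝ × ℝ × ℝ → ℝ) : ℝ × ℝ × ℝ → ℝ := fun X => fderiv ℝ f X (1, 0, 0)
def dY (f : ℝ × ℝ × ℝ → ℝ) : ℝ × ℝ × ℝ → ℝ := fun X => fderiv ℝ f X (0, 1, 0)
def dZ (f : ℝ × ℝ × ℝ → ℝ) : ℝ × ℝ × ℝ → ℝ := fun X => fderiv ℝ f X (0, 0, 1)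

def lap (f : ℝ × ℝ × ℝ → ℝ) : ℝ × ℝ × ℝ → ℝ :=
  fun X => dX (dX f) X + dY (dY f) X + dZ (dZ f) X

def divergence (v : Fin 3 → ℝ × ℝ × ℝ → ℝ) : ℝ × ℝ × ℝ → ℝ :=
  fun X => dX (v 0) X + dY (v 1) X + dZ (v 2) X

/-! ### Projections in the periodic variables -/

/-- `f₀`, the average in `x`. -/
def zeroMode (f : ℝ × ℝ × ℝ → ℝ) : ℝ × ℝ → ℝ :=
  fun Y => (2 * Real.pi)⁻¹ * ∫ x in (0 : ℝ)..(2 * Real.pi), f (x, Y.1, Y.2)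

/-- `f_≠ = f - f₀`. -/
def nonzeroMode (f : ℝ × ℝ × ℝ → ℝ) : ℝ × ℝ × ℝ → ℝ :=
  fun X => f X - zeroMode f X.2

/-- The double-zero mode: the average in `x` and `z`. -/
def doubleZero (f : ℝ × ℝ × ℝ → ℝ) : ℝ → ℝ :=
  fun y => (2 * Real.pi)⁻¹ * ∫ z in (0 : ℝ)..(2 * Real.pi), zeroMode f (y, z)

/-- The simple-zero mode: `f₀` minus the double-zero mode. -/
def simpleZero (f : ℝ × ℝ × ℝ → ℝ) : ℝ × ℝ → ℝ :=
  fun Y => zeroMode f Y - doubleZero f Y.1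

/-- The function in the moving frame `x = x₁ - t y`: `F(x, y, z) = f(x + t y, y, z)`. -/
def moving (t : ℝ) (f : ℝ × ℝ × ℝ → ℝ) : ℝ × ℝ × ℝ → ℝ :=
  fun X => f (X.1 + t * X.2.1, X.2.1, X.2.2)

/-! ### Fourier transform and norms -/

/-- The `L²` (Plancherel) version of `η ↦ ∫ g(y) e^{-iηy} dy`, defined for almost every `η`. -/
def lineFourier (g : ℝ → ℂ) (η : ℝ) : ℂ :=
  open Classical in
  if h : MemLp g 2 (volume : Measure ℝ) then
    (𝓕 (h.toLp g) : Lp ℂ 2 (volume : Measure ℝ)) (η / (2 * Real.pi))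
  else 0

/-- `f̂(k, η, l) = (2π)⁻² ∫∫∫ f(x, y, z) e^{-i(kx + ηy + lz)} dx dy dz`. -/
def fourier3 (f : ℝ × ℝ × ℝ → ℝ) (k : ℤ) (η : ℝ) (l : ℤ) : ℂ :=
  lineFourier (fun y => (((2 * Real.pi) ^ 2)⁻¹ : ℂ) *
    ∫ x in (0 : ℝ)..(2 * Real.pi), ∫ z in (0 : ℝ)..(2 * Real.pi),
      (f (x, y, z) : ℂ) * Complex.exp (-Complex.I * (k * x + l * z))) η

/-- `ĝ(η, l) = (2π)⁻¹ ∫∫ g(y, z) e^{-i(ηy + lz)} dy dz`. -/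
def fourier2 (g : ℝ × ℝ → ℝ) (η : ℝ) (l : ℤ) : ℂ :=
  lineFourier (fun y => ((2 * Real.pi)⁻¹ : ℂ) *
    ∫ z in (0 : ℝ)..(2 * Real.pi), (g (y, z) : ℂ) * Complex.exp (-Complex.I * (l * z))) η

/-- `‖f‖_{H^s} = ‖⟨k, η, l⟩^s f̂‖_{L²}` for `s ≥ 0`; it is `∞` for `f` outside `L²`. -/
def sobolevNorm (s : ℝ) (f : ℝ × ℝ × ℝ → ℝ) : ℝ≥0∞ :=
  open Classical in
  if MemLp f 2 cell3 then
    (∑' k : ℤ, ∑' l : ℤ, ∫⁻ η : ℝ,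
      ENNReal.ofReal ((1 + (k : ℝ) ^ 2 + η ^ 2 + (l : ℝ) ^ 2) ^ s) *
        ‖fourier3 f k η l‖ₑ ^ 2) ^ (1 / 2 : ℝ)
  else ⊤

/-- `‖g‖_{W^{3,1}(ℝ × 𝕋)}`: the sum of the `L¹` norms of `∂_y^i ∂_z^j g` with `i + j ≤ 3`. -/
def w31Norm (g : ℝ × ℝ → ℝ) : ℝ≥0∞ :=
  ∑ i ∈ Finset.range 4, ∑ j ∈ Finset.range (4 - i),
    ∫⁻ Y, ‖iteratedDeriv i (fun y => iteratedDeriv j (fun z => g (y, z)) Y.2) Y.1‖ₑ ∂cell2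

/-- The norm of a vector whose components have norms `a i`: `(∑ᵢ (a i)²)^{1/2}`. -/
def vecNorm {n : ℕ} (a : Fin n → ℝ≥0∞) : ℝ≥0∞ := (∑ i, a i ^ 2) ^ (1 / 2 : ℝ)

/-- The heat semigroup `e^{ν t ∂_yy}` on the line. -/
def heatFlow (ν t : ℝ) (g : ℝ → ℝ) (y : ℝ) : ℝ :=
  if t = 0 then g y
  else ∫ y' : ℝ, (Real.sqrt (4 * Real.pi * ν * t))⁻¹ *
    Real.exp (-(y - y') ^ 2 / (4 * ν * t)) * g y'

/-! ### The linearized system -/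

/-- Bound in `L²(𝕋 × ℝ × 𝕋)`, uniform for `t` in bounded subsets of `S`. -/
def LocallyBoundedL2 (S : Set ℝ) (f : ℝ → ℝ × ℝ × ℝ → ℝ) : Prop :=
  ∀ T : ℝ, ∃ M : ℝ≥0∞, M ≠ ⊤ ∧ ∀ t ∈ S, t ≤ T → MemLp (f t) 2 cell3 ∧ eLpNorm (f t) 2 cell3 ≤ M

/-- Smooth initial data on `𝕋 × ℝ × 𝕋` with divergence-free velocity. -/
structure IsInitialData (uin : Fin 3 → ℝ × ℝ × ℝ → ℝ) (θin : ℝ × ℝ × ℝ → ℝ) : Prop where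
  smooth_u : ∀ i, ContDiff ℝ ∞ (uin i)
  smooth_θ : ContDiff ℝ ∞ θin
  periodic_u : ∀ i, IsPeriodic (uin i)
  periodic_θ : IsPeriodic θin
  div_free : ∀ X, divergence uin X = 0

/-- `(u, θ)` with pressure `π` is a classical finite-energy solution on `[0, ∞)` of
`∂_t u + y ∂_x u - ν Δ u + ∇π + ((1 - β) u², β u¹, α θ) = 0`,
`∂_t θ + y ∂_x θ - ν Δ θ - α u³ = 0`, `∇ · u = 0`, with initial data `(uin, θin)`.
It is smooth for `t > 0`, continuous up to `t = 0`, and `u`, `θ`, `∇π` are in `L²`, locally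
uniformly in time (which determines `∇π`, as `∇Δ⁻¹` of its source). -/
structure IsLinearSolution (ν α β : ℝ)
    (uin : Fin 3 → ℝ × ℝ × ℝ → ℝ) (θin : ℝ × ℝ × ℝ → ℝ)
    (u : Fin 3 → ℝ → ℝ × ℝ × ℝ → ℝ) (θ π : ℝ → ℝ × ℝ × ℝ → ℝ) : Prop where
  periodic_u : ∀ i, ∀ t, 0 ≤ t → IsPeriodic (u i t)
  periodic_θ : ∀ t, 0 ≤ t → IsPeriodic (θ t)
  periodic_π : ∀ t, 0 < t → IsPeriodic (π t)
  cont_u : ∀ i, ContinuousOn (fun q : ℝ × (ℝ × ℝ × ℝ) => u i q.1 q.2) (Ici 0 ×ˢ univ)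
  cont_θ : ContinuousOn (fun q : ℝ × (ℝ × ℝ × ℝ) => θ q.1 q.2) (Ici 0 ×ˢ univ)
  smooth_u : ∀ i, ContDiffOn ℝ ∞ (fun q : ℝ × (ℝ × ℝ × ℝ) => u i q.1 q.2) (Ioi 0 ×ˢ univ)
  smooth_θ : ContDiffOn ℝ ∞ (fun q : ℝ × (ℝ × ℝ × ℝ) => θ q.1 q.2) (Ioi 0 ×ˢ univ)
  smooth_π : ∀ t, 0 < t → ContDiff ℝ ∞ (π t)
  energy_u : ∀ i, LocallyBoundedL2 (Ici 0) (u i)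
  energy_θ : LocallyBoundedL2 (Ici 0) θ
  energy_π : LocallyBoundedL2 (Ioi 0) (fun t => dX (π t)) ∧
    LocallyBoundedL2 (Ioi 0) (fun t => dY (π t)) ∧ LocallyBoundedL2 (Ioi 0) (fun t => dZ (π t))
  eq_u1 : ∀ t, 0 < t → ∀ X : ℝ × ℝ × ℝ,
    deriv (fun τ => u 0 τ X) t + X.2.1 * dX (u 0 t) X - ν * lap (u 0 t) X + dX (π t) X
      + (1 - β) * u 1 t X = 0
  eq_u2 : ∀ t, 0 < t → ∀ X : ℝ × ℝ × ℝ,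
    deriv (fun τ => u 1 τ X) t + X.2.1 * dX (u 1 t) X - ν * lap (u 1 t) X + dY (π t) X
      + β * u 0 t X = 0
  eq_u3 : ∀ t, 0 < t → ∀ X : ℝ × ℝ × ℝ,
    deriv (fun τ => u 2 τ X) t + X.2.1 * dX (u 2 t) X - ν * lap (u 2 t) X + dZ (π t) X
      + α * θ t X = 0
  eq_θ : ∀ t, 0 < t → ∀ X : ℝ × ℝ × ℝ,
    deriv (fun τ => θ τ X) t + X.2.1 * dX (θ t) X - ν * lap (θ t) X - α * u 2 t X = 0
  div_free : ∀ t, 0 < t → ∀ X, divergence (fun i => u i t) X = 0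
  init_u : ∀ i, u i 0 = uin i
  init_θ : θ 0 = θin

/-! ### The dispersion relation -/

/-- `h(α, β, η, l) = √(α² η² + β(β-1) l²)`. -/
def hSym (α β η l : ℝ) : ℝ := Real.sqrt (α ^ 2 * η ^ 2 + β * (β - 1) * l ^ 2)

/-- `|η, l|`. -/
def absSym (η l : ℝ) : ℝ := Real.sqrt (η ^ 2 + l ^ 2)

def lam1 (ν η l : ℝ) : ℂ := -(ν : ℂ) * ((η : ℂ) ^ 2 + (l : ℂ) ^ 2)

def lam2 (ν α β η l : ℝ) : ℂ :=
  -(ν : ℂ) * ((η : ℂ) ^ 2 + (l : ℂ) ^ 2) + Complex.I * ((hSym α β η l / absSym η l : ℝ) : ℂ)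

def lam3 (ν α β η l : ℝ) : ℂ :=
  -(ν : ℂ) * ((η : ℂ) ^ 2 + (l : ℂ) ^ 2) - Complex.I * ((hSym α β η l / absSym η l : ℝ) : ℂ)

/-! ### The three groups of conclusions -/

/-- Enhanced dissipation and inviscid damping of the non-zero modes at time `t`, in `H^s`, with
implicit constant `C`. -/
def NonzeroModeBounds (C s ν β : ℝ)
    (uin : Fin 3 → ℝ × ℝ × ℝ → ℝ) (θin : ℝ × ℝ × ℝ → ℝ)
    (u : Fin 3 → ℝ → ℝ × ℝ × ℝ → ℝ) (θ : ℝ → ℝ × ℝ × ℝ → ℝ) (t : ℝ) : Prop :=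
  sobolevNorm s (nonzeroMode (moving t (u 0 t))) ≤
      ENNReal.ofReal (C * max (Real.sqrt ((β - 1) / β)) (Real.sqrt (β / (β - 1))) *
          Real.exp (-(1 / 16) * ν ^ (1 / 3 : ℝ) * t)) *
        (vecNorm (fun i => sobolevNorm (s + 3) (uin i)) + sobolevNorm (s + 2) θin) ∧
  ENNReal.ofReal (Real.sqrt (1 + t ^ 2)) * sobolevNorm s (nonzeroMode (moving t (u 1 t))) ≤
      ENNReal.ofReal (C * max (Real.sqrt ((β - 1) / β)) (Real.sqrt (β / (β - 1))) *
          Real.exp (-(1 / 16) * ν ^ (1 / 3 : ℝ) * t)) *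
        (vecNorm (fun i => sobolevNorm (s + 5) (uin i)) + sobolevNorm (s + 4) θin) ∧
  vecNorm ![sobolevNorm s (nonzeroMode (moving t (u 2 t))),
        sobolevNorm s (nonzeroMode (moving t (θ t)))] ≤
      ENNReal.ofReal (C * Real.exp (-(1 / 16) * ν ^ (1 / 3 : ℝ) * t)) *
        (sobolevNorm (s + 3) (uin 2) +
          ENNReal.ofReal (Real.sqrt (β / (β - 1))) *
            sobolevNorm (s + 2) (fun X => dX (uin 1) X - dY (uin 0) X) +
          sobolevNorm (s + 2) θin)

/-- The Fourier representation of the simple-zero modes at time `t` and frequency `(η, l)`. -/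
def SimpleZeroFormula (ν α β : ℝ)
    (uin : Fin 3 → ℝ × ℝ × ℝ → ℝ) (θin : ℝ × ℝ × ℝ → ℝ)
    (u : Fin 3 → ℝ → ℝ × ℝ × ℝ → ℝ) (θ : ℝ → ℝ × ℝ × ℝ → ℝ) (t η : ℝ) (l : ℤ) : Prop :=
  let h : ℂ := (hSym α β η l : ℂ)
  let r : ℂ := (absSym η l : ℂ)
  let E1 : ℂ := Complex.exp (lam1 ν η l * t)
  let E2 : ℂ := Complex.exp (lam2 ν α β η l * t)
  let E3 : ℂ := Complex.exp (lam3 ν α β η l * t)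
  let a1 : ℂ := fourier2 (simpleZero (uin 0)) η l
  let a2 : ℂ := fourier2 (simpleZero (uin 1)) η l
  let b : ℂ := fourier2 (simpleZero θin) η l
  fourier2 (simpleZero (u 0 t)) η l =
      ((α : ℂ) ^ 2 * η ^ 2 / h ^ 2 * E1 + β * (β - 1) * l ^ 2 / (2 * h ^ 2) * (E2 + E3)) * a1
      + Complex.I * (β - 1) * r / (2 * h) * (E3 - E2) * a2
      + (α * (β - 1) * η * l / h ^ 2 * E1 - α * (β - 1) * η * l / (2 * h ^ 2) * (E2 + E3)) * b ∧
  fourier2 (simpleZero (u 1 t)) η l =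
      Complex.I * β * l ^ 2 / (2 * h * r) * (E2 - E3) * a1
      + 1 / 2 * (E2 + E3) * a2
      + Complex.I * α * η * l / (2 * h * r) * (E3 - E2) * b ∧
  fourier2 (simpleZero (u 2 t)) η l = -(η / l : ℂ) * fourier2 (simpleZero (u 1 t)) η l ∧
  fourier2 (simpleZero (θ t)) η l =
      (α * β * η * l / h ^ 2 * E1 - α * β * η * l / (2 * h ^ 2) * (E2 + E3)) * a1
      + Complex.I * α * η * r / (2 * h * l) * (E2 - E3) * a2
      + (β * (β - 1) * l ^ 2 / h ^ 2 * E1 + (α : ℂ) ^ 2 * η ^ 2 / (2 * h ^ 2) * (E2 + E3)) * b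

/-- The formulas for the double-zero modes at time `t`. -/
def DoubleZeroFormula (ν α : ℝ)
    (uin : Fin 3 → ℝ × ℝ × ℝ → ℝ) (θin : ℝ × ℝ × ℝ → ℝ)
    (u : Fin 3 → ℝ → ℝ × ℝ × ℝ → ℝ) (θ : ℝ → ℝ × ℝ × ℝ → ℝ) (t y : ℝ) : Prop :=
  doubleZero (u 0 t) y = heatFlow ν t (doubleZero (uin 0)) y ∧
  doubleZero (u 1 t) y = 0 ∧
  doubleZero (u 2 t) y = heatFlow ν t (fun y' =>
    Real.cos (α * t) * doubleZero (uin 2) y' - Real.sin (α * t) * doubleZero θin y') y ∧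
  doubleZero (θ t) y = heatFlow ν t (fun y' =>
    Real.sin (α * t) * doubleZero (uin 2) y' + Real.cos (α * t) * doubleZero θin y') y

/-- The dispersive bound for the simple-zero modes of `(u², u³)` at time `t`, with implicit
constant `C` and `q = |β(β-1) - α²| / α`. -/
def DispersiveBound (C ν α β : ℝ)
    (uin : Fin 3 → ℝ × ℝ × ℝ → ℝ) (θin : ℝ × ℝ × ℝ → ℝ)
    (u : Fin 3 → ℝ → ℝ × ℝ × ℝ → ℝ) (t : ℝ) : Prop :=
  vecNorm ![eLpNorm (simpleZero (u 1 t)) ⊤ cell2, eLpNorm (simpleZero (u 2 t)) ⊤ cell2] ≤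
    ENNReal.ofReal (C * Real.exp (-ν * t) *
        (|β * (β - 1) - α ^ 2| / α * t) ^ (-(1 / 3) : ℝ)) *
      vecNorm ![w31Norm (simpleZero (uin 0)), w31Norm (simpleZero (uin 1)),
        w31Norm (simpleZero (uin 2)), w31Norm (simpleZero θin)]

end RotatingBoussinesq

end

open RotatingBoussinesq

noncomputable section

namespace RotatingBoussinesq

open Filter Topology

open scoped SchwartzMap

/-! ### The Fourier transform on the line -/

/-! Take Fourier series in `x, z` and the transform in `y`, in the moving frame. There the transport
term disappears, `∂_y` acts as `iξ` with `ξ = η - kt`, and the system becomes an ODE for each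
frequency `(k, η, l)`. Write `H = k² + ξ²`, `P = H + l²`.

Justifying the ODE. The solution is only in `L²`: neither `y ∂_x u`, nor the derivatives of `u`, nor
the pressure has a transform a priori. All transforms in `y` are therefore truncated by smooth
cutoffs `χ_n` (`tf`). The phase `e^{-i(η-kt)y}` still cancels the transport term exactly, and all
other defects are commutators carrying a derivative of `χ_n`, which is `O(1/n)`. Plancherel and
Fatou make them small in `L²(0,t)` and at both end times for almost every `η`
(`ae_exists_truncation`). The one defect without an a priori bound, the pressure tested against
`χ_n'`, is removed by a change of unknown (`ae_exists_approxSolution`). Every estimate or identity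
is proved for such an `IsApproxSolution` and passed to the limit.

Non-zero modes. In terms of `X = u³`, `Θ = θ` and the vorticity `W = w³` the pressure drops out, and
the energy `(P/H)|X|² + |Θ|² + (β/(β-1))|W|²/H` is chosen so that the couplings of order one cancel.
Of the terms left, one is bounded by `2κk²/H` times the energy, integrable in time, and two change
sign at the critical time `t₀ = η/k`. Weights integrating these rates exactly, one before and one
after `t₀`, give a loss of only `(1+(η/k)²)(1+(l/k)²)`, while the dissipation `2νP ≥ 2ν(s-t₀)²`
gives `e^{-νt³/6}`, hence decay at rate `ν^{1/3}/8` of the energy (`IsApproxSolution.energy_le`).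
Then `u¹, u²` are recovered from `W`, `X` and the divergence; the factor `k²/H` in `u²` is the
inviscid damping (`horizontal_velocity_le`, `IsApproxSolution.bounds`).

Zero modes. For `k = 0` the coefficients do not depend on time, and the reduced system is
diagonalised by one stationary and two oscillating combinations (`IsApproxSolution.modes_zero`). For
`k = l = 0` incompressibility kills `u²`, and `(u³, θ)` rotates while it diffuses
(`IsLinearSolution.lineFourier_doubleZero`).

Dispersion. The frequency `h/|η,l|` is a function `phase` of the slope `x = η/l` alone. Its second
derivative is `B_β - α²` up to sign times a weight with exactly one zero on `x ≥ 0`, which is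
simple, and decay `x^{-4}`. Van der Corput's lemma with a window around the zero and geometric
blocks at infinity yields `|B_β - α²|^{-1/3} t^{-1/3}` (`dispersive_oscBound`). Two derivatives of
the datum supply the integrable amplitude `1/(1+x²)`, a third one the factor `l^{-2}` that makes the
sum over `l` converge. -/

lemma integral_mul_fourier_Lp (f : Lp ℂ 2 (volume : Measure ℝ)) (φ : 𝓢(ℝ, ℂ)) :
    ∫ x, φ x * (𝓕 f : Lp ℂ 2 (volume : Measure ℝ)) x = ∫ x, (𝓕 φ) x * f x := by
  have h := congrArg (fun T => T φ) (Lp.fourier_toTemperedDistribution_eq f)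
  simp only [TemperedDistribution.fourier_apply, Lp.toTemperedDistribution_apply, smul_eq_mul] at h
  exact h.symm

/-- Smooth compactly supported functions are Schwartz. The `L²` transform is accessible here through
duality with Schwartz functions, and this turns dual identities into pointwise ones. -/
lemma ae_eq_of_schwartz {f g : ℝ → ℂ} (hf : LocallyIntegrable f) (hg : LocallyIntegrable g)
    (h : ∀ φ : 𝓢(ℝ, ℂ), ∫ x, φ x * f x = ∫ x, φ x * g x) : f =ᵐ[volume] g := by
  refine ae_eq_of_integral_contDiff_smul_eq hf hg fun ψ hψ hc => ?_
  have hc' : HasCompactSupport (fun x => (ψ x : ℂ)) := hc.comp_left (g := ((↑) : ℝ → ℂ)) (by simp)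
  have hd : ContDiff ℝ ∞ (fun x => (ψ x : ℂ)) := Complex.ofRealCLM.contDiff.comp hψ
  have := h (hc'.toSchwartzMap hd)
  simpa using this

/-- Both transforms are self-adjoint against Schwartz functions, one as a tempered distribution and
the other by Fubini. -/
lemma fourier_toLp_ae_eq {g : ℝ → ℂ} (h1 : Integrable g) (h2 : MemLp g 2) :
    (𝓕 (h2.toLp g) : Lp ℂ 2 (volume : Measure ℝ)) =ᵐ[volume] 𝓕 g := by
  refine ae_eq_of_schwartz ((Lp.memLp _).locallyIntegrable (by norm_num))
    (VectorFourier.fourierIntegral_continuous Real.continuous_fourierChar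
      (by fun_prop) h1).locallyIntegrable fun φ => ?_
  rw [integral_mul_fourier_Lp]
  have e : ∫ x, (𝓕 φ) x * h2.toLp g x = ∫ x, (𝓕 φ) x * g x := by
    refine integral_congr_ae ?_
    filter_upwards [h2.coeFn_toLp] with x hx
    rw [hx]
  rw [e]
  have := VectorFourier.integral_fourierIntegral_smul_eq_flip (μ := volume) (ν := volume)
    (L := innerₗ ℝ) (e := Real.fourierChar) (f := φ) (g := g) Real.continuous_fourierChar
    (by fun_prop) φ.integrable h1
  rw [flip_innerₗ] at this
  exact this

/-- The same duality, tested against `𝓕⁻ φ`. Only the transform is required to be integrable, not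
`g`, which is all that is known of the solution. -/
lemma ae_eq_fourierInv_of_fourier_ae_eq {g F : ℝ → ℂ} (h2 : MemLp g 2) (hF : Integrable F)
    (h : (𝓕 (h2.toLp g) : Lp ℂ 2 (volume : Measure ℝ)) =ᵐ[volume] F) : g =ᵐ[volume] 𝓕⁻ F := by
  have hinv : 𝓕⁻ F = fun x => 𝓕 F (-x) := by
    ext x; rw [Real.fourierInv_eq_fourier_neg]
  have hcont : Continuous (𝓕 F) := VectorFourier.fourierIntegral_continuous
    Real.continuous_fourierChar (by fun_prop) hF
  refine ae_eq_of_schwartz (h2.locallyIntegrable (by norm_num)) ?_ fun φ => ?_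
  · rw [hinv]
    exact (hcont.comp continuous_neg).locallyIntegrable
  have h1 := integral_mul_fourier_Lp (h2.toLp g) (𝓕⁻ φ)
  rw [FourierTransform.fourier_fourierInv_eq] at h1
  have e1 : ∫ x, φ x * h2.toLp g x = ∫ x, φ x * g x := by
    refine integral_congr_ae ?_
    filter_upwards [h2.coeFn_toLp] with x hx
    rw [hx]
  have e2 : ∫ x, (𝓕⁻ φ) x * (𝓕 (h2.toLp g) : Lp ℂ 2 (volume : Measure ℝ)) x
      = ∫ x, (𝓕⁻ φ) x * F x := by
    refine integral_congr_ae ?_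
    filter_upwards [h] with x hx
    rw [hx]
  rw [e1, e2] at h1
  rw [← h1]
  -- The inverse transform is the transform for the negated pairing, which is still symmetric.
  have := VectorFourier.integral_fourierIntegral_smul_eq_flip (μ := volume) (ν := volume)
    (L := -innerₗ ℝ) (e := Real.fourierChar) (f := φ) (g := F) Real.continuous_fourierChar
    (by fun_prop) φ.integrable hF
  have hflip : (-innerₗ ℝ : ℝ →ₗ[ℝ] ℝ →ₗ[ℝ] ℝ).flip = -innerₗ ℝ := by
    ext; simp
  rw [hflip] at this
  rw [SchwartzMap.fourierInv_coe]
  exact this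

/-! ### The transform `lineFourier` -/

/-- The classical version of `lineFourier`. -/
def classicalFourier (g : ℝ → ℂ) (η : ℝ) : ℂ := ∫ y : ℝ, Complex.exp (-Complex.I * (η * y)) * g y

lemma fourier_div_two_pi (g : ℝ → ℂ) (η : ℝ) : 𝓕 g (η / (2 * Real.pi)) = classicalFourier g η := by
  rw [Real.fourier_eq', classicalFourier]
  refine integral_congr_ae (.of_forall fun y => ?_)
  simp only [smul_eq_mul]
  congr 2
  simp only [RCLike.inner_apply, conj_trivial]
  push_cast
  field_simp

lemma quasiMeasurePreserving_div_two_pi :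
    Measure.QuasiMeasurePreserving (fun η : ℝ => η / (2 * Real.pi)) := by
  refine ⟨by fun_prop, ?_⟩
  have := Real.map_volume_mul_right (a := (2 * Real.pi)⁻¹) (by positivity)
  simp only [div_eq_mul_inv]
  rw [this]
  exact Measure.smul_absolutelyContinuous

lemma lintegral_comp_div_two_pi (f : ℝ → ℝ≥0∞) :
    ∫⁻ η : ℝ, f (η / (2 * Real.pi)) = ENNReal.ofReal (2 * Real.pi) * ∫⁻ x, f x := by
  have hm := Real.map_volume_mul_right (a := (2 * Real.pi)⁻¹) (by positivity)
  have he : MeasurableEmbedding (fun x : ℝ => x * (2 * Real.pi)⁻¹) :=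
    (Homeomorph.mulRight₀ ((2 * Real.pi)⁻¹) (by positivity)).measurableEmbedding
  simp only [div_eq_mul_inv]
  rw [← he.lintegral_map f, hm, lintegral_smul_measure, inv_inv,
    abs_of_pos (by positivity : 0 < 2 * Real.pi)]
  rfl

lemma lineFourier_of_memLp {g : ℝ → ℂ} (h : MemLp g 2) :
    lineFourier g = fun η => (𝓕 (h.toLp g) : Lp ℂ 2 (volume : Measure ℝ)) (η / (2 * Real.pi)) := by
  ext η
  rw [lineFourier, dif_pos h]

lemma aestronglyMeasurable_lineFourier (g : ℝ → ℂ) : AEStronglyMeasurable (lineFourier g) := by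
  by_cases h : MemLp g 2
  · rw [lineFourier_of_memLp h]
    exact (Lp.aestronglyMeasurable _).comp_quasiMeasurePreserving quasiMeasurePreserving_div_two_pi
  · have : lineFourier g = fun _ => 0 := by
      ext η
      rw [lineFourier, dif_neg h]
    rw [this]
    exact aestronglyMeasurable_const

lemma lineFourier_ae_eq_classical {g : ℝ → ℂ} (h1 : Integrable g) (h2 : MemLp g 2) :
    lineFourier g =ᵐ[volume] classicalFourier g := by
  rw [lineFourier_of_memLp h2]
  filter_upwards [quasiMeasurePreserving_div_two_pi.ae (fourier_toLp_ae_eq h1 h2)] with η hη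
  rw [hη, fourier_div_two_pi]

/-- Plancherel; `2π` is the Jacobian of passing to the angular frequency `η = 2πx`. -/
lemma lintegral_lineFourier_sq {g : ℝ → ℂ} (h : MemLp g 2) :
    ∫⁻ η, ‖lineFourier g η‖ₑ ^ 2 = ENNReal.ofReal (2 * Real.pi) * ∫⁻ y, ‖g y‖ₑ ^ 2 := by
  rw [lineFourier_of_memLp h, lintegral_comp_div_two_pi
    (fun x => ‖(𝓕 (h.toLp g) : Lp ℂ 2 (volume : Measure ℝ)) x‖ₑ ^ 2)]
  have key (f : Lp ℂ 2 (volume : Measure ℝ)) : ∫⁻ x, ‖f x‖ₑ ^ 2 = ‖f‖ₑ ^ 2 := by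
    rw [Lp.enorm_def, eLpNorm_eq_lintegral_rpow_enorm_toReal (by norm_num) (by norm_num)]
    rw [← ENNReal.rpow_natCast, ← ENNReal.rpow_mul]
    norm_num
  have hn : ‖(𝓕 (h.toLp g) : Lp ℂ 2 (volume : Measure ℝ))‖ₑ = ‖h.toLp g‖ₑ := by
    rw [← ofReal_norm, ← ofReal_norm, Lp.norm_fourier_eq]
  rw [key, hn, ← key]
  congr 1
  refine lintegral_congr_ae ?_
  filter_upwards [h.coeFn_toLp] with x hx
  rw [hx]

lemma lineFourier_sub {f g : ℝ → ℂ} (hf : MemLp f 2) (hg : MemLp g 2) :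
    lineFourier (fun y => f y - g y) =ᵐ[volume] fun η => lineFourier f η - lineFourier g η := by
  have e : (hf.sub hg).toLp (f - g) = hf.toLp f - hg.toLp g := rfl
  have e2 : (fun y => f y - g y) = f - g := rfl
  rw [e2, lineFourier_of_memLp (hf.sub hg), lineFourier_of_memLp hf, lineFourier_of_memLp hg, e,
    sub_eq_add_neg, FourierTransform.fourier_add, ← neg_one_smul ℂ (hg.toLp g),
    FourierTransform.fourier_smul]
  have h1 := Lp.coeFn_add (𝓕 (hf.toLp f) : Lp ℂ 2 (volume : Measure ℝ))
    ((-1 : ℂ) • (𝓕 (hg.toLp g) : Lp ℂ 2 (volume : Measure ℝ)))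
  have h2 := Lp.coeFn_smul (-1 : ℂ) (𝓕 (hg.toLp g) : Lp ℂ 2 (volume : Measure ℝ))
  filter_upwards [quasiMeasurePreserving_div_two_pi.ae h1,
    quasiMeasurePreserving_div_two_pi.ae h2] with η h1 h2
  rw [h1, Pi.add_apply, h2, Pi.smul_apply]
  simp [sub_eq_add_neg]

lemma lineFourier_const_mul (c : ℂ) {g : ℝ → ℂ} (hg : MemLp g 2) :
    lineFourier (fun y => c * g y) =ᵐ[volume] fun η => c * lineFourier g η := by
  have e : (hg.const_smul c).toLp (c • g) = c • hg.toLp g := rfl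
  have e2 : (fun y => c * g y) = c • g := rfl
  rw [e2, lineFourier_of_memLp (hg.const_smul c), lineFourier_of_memLp hg, e,
    FourierTransform.fourier_smul]
  have h2 := Lp.coeFn_smul c (𝓕 (hg.toLp g) : Lp ℂ 2 (volume : Measure ℝ))
  filter_upwards [quasiMeasurePreserving_div_two_pi.ae h2] with η h2
  rw [h2, Pi.smul_apply, smul_eq_mul]

/-- Fourier inversion for an `L²` function whose transform is integrable. -/
lemma eq_integral_of_lineFourier_ae_eq {g F : ℝ → ℂ} (hg : MemLp g 2) (hF : Integrable F)
    (h : lineFourier g =ᵐ[volume] F) :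
    g =ᵐ[volume] fun y =>
      ((2 * Real.pi)⁻¹ : ℂ) * ∫ η : ℝ, Complex.exp (Complex.I * (η * y)) * F η := by
  have hpi : (2 * Real.pi) ≠ 0 := by positivity
  have hF' : Integrable (fun x => F (2 * Real.pi * x)) := hF.comp_mul_left' hpi
  have hq : Measure.QuasiMeasurePreserving (fun η : ℝ => (2 * Real.pi) * η) := by
    refine ⟨by fun_prop, ?_⟩
    rw [Real.map_volume_mul_left hpi]
    exact Measure.smul_absolutelyContinuous
  have h' : (𝓕 (hg.toLp g) : Lp ℂ 2 (volume : Measure ℝ)) =ᵐ[volume]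
      fun x => F (2 * Real.pi * x) := by
    filter_upwards [hq.ae h] with x hx
    rw [← hx, lineFourier_of_memLp hg]
    simp only
    congr 1
    field_simp
  refine (ae_eq_fourierInv_of_fourier_ae_eq hg hF' h').trans (.of_forall fun y => ?_)
  rw [Real.fourierInv_eq']
  have := Measure.integral_comp_mul_left
    (fun η : ℝ => Complex.exp (Complex.I * (η * y)) * F η) (2 * Real.pi)
  rw [abs_of_pos (by positivity : 0 < (2 * Real.pi)⁻¹)] at this
  simp only [Complex.real_smul] at this
  push_cast at this
  simp only
  rw [← this]
  refine integral_congr_ae (.of_forall fun x => ?_)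
  simp only [smul_eq_mul, RCLike.inner_apply, conj_trivial]
  congr 2
  push_cast
  ring

/-! ### Integrals depending on a parameter -/

lemma continuousOn_intervalIntegral {X : Type*} [TopologicalSpace X] {S : Set X} {F : X → ℝ → ℂ}
    (hF : ContinuousOn (Function.uncurry F) (S ×ˢ univ)) (a b : ℝ) :
    ContinuousOn (fun x => ∫ t in a..b, F x t) S := by
  rw [continuousOn_iff_continuous_domRestrict]
  have : Continuous (Function.uncurry fun (x : S) (t : ℝ) => F x t) := by
    have h := hF.comp_continuous (f := fun p : S × ℝ => ((p.1 : X), p.2)) (by fun_prop)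
      (fun p => ⟨p.1.2, mem_univ _⟩)
    exact h
  exact intervalIntegral.continuous_parametric_intervalIntegral_of_continuous' this a b

lemma hasDerivAt_intervalIntegral {S : Set ℝ} (hS : IsOpen S) {F F' : ℝ → ℝ → ℂ}
    (hF : ContinuousOn (Function.uncurry F) (S ×ˢ univ))
    (hF' : ContinuousOn (Function.uncurry F') (S ×ˢ univ))
    (hd : ∀ s ∈ S, ∀ x, HasDerivAt (fun r => F r x) (F' s x) s) (a b : ℝ) {s : ℝ} (hs : s ∈ S) :
    HasDerivAt (fun r => ∫ x in a..b, F r x) (∫ x in a..b, F' s x) s := by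
  obtain ⟨ε, hε, hball⟩ := Metric.isOpen_iff.1 hS s hs
  have hsub : Metric.closedBall s (ε / 2) ⊆ S :=
    (Metric.closedBall_subset_ball (by linarith)).trans hball
  have hcomp : IsCompact (Metric.closedBall s (ε / 2) ×ˢ uIcc a b) :=
    (isCompact_closedBall _ _).prod isCompact_uIcc
  obtain ⟨M, hM⟩ := hcomp.exists_bound_of_continuousOn
    (hF'.mono (prod_mono hsub (subset_univ _)))
  have hc (G : ℝ → ℝ → ℂ) (hG : ContinuousOn (Function.uncurry G) (S ×ˢ univ)) {r : ℝ}
      (hr : r ∈ S) : Continuous (G r) :=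
    hG.comp_continuous (f := fun x : ℝ => (r, x)) (by fun_prop) (fun x => ⟨hr, mem_univ _⟩)
  refine (intervalIntegral.hasDerivAt_integral_of_dominated_loc_of_deriv_le
    (F := F) (F' := F') (bound := fun _ => M) (Metric.closedBall_mem_nhds s (half_pos hε))
    ?_ ?_ ?_ ?_ ?_ ?_).2
  · filter_upwards [hS.mem_nhds hs] with r hr
    exact (hc F hF hr).aestronglyMeasurable
  · exact (hc F hF hs).intervalIntegrable _ _
  · exact (hc F' hF' hs).aestronglyMeasurable
  · exact .of_forall fun x hx r hr => hM (r, x) ⟨hr, uIoc_subset_uIcc hx⟩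
  · exact intervalIntegrable_const
  · exact .of_forall fun x _ r hr => hd r (hsub hr) x

lemma integral_deriv_mul_exp {h h' : ℝ → ℂ} (hd : ∀ x, HasDerivAt h (h' x) x)
    (hc : Continuous h') (hp : h (2 * Real.pi) = h 0) (k : ℤ) :
    ∫ x in (0 : ℝ)..(2 * Real.pi), h' x * Complex.exp (-Complex.I * (k * x)) =
      Complex.I * k * ∫ x in (0 : ℝ)..(2 * Real.pi), h x * Complex.exp (-Complex.I * (k * x)) := by
  have he (x : ℝ) : HasDerivAt (fun x : ℝ => Complex.exp (-Complex.I * (k * x)))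
      (Complex.exp (-Complex.I * (k * x)) * (-Complex.I * k)) x := by
    have := (((hasDerivAt_id x).ofReal_comp.const_mul (k : ℂ)).const_mul (-Complex.I)).cexp
    simpa using this
  have hch : Continuous h := continuous_iff_continuousAt.2 fun x => (hd x).continuousAt
  have := intervalIntegral.integral_eq_sub_of_hasDerivAt (a := 0) (b := 2 * Real.pi)
    (f := fun x => h x * Complex.exp (-Complex.I * (k * x)))
    (fun x _ => (hd x).mul (he x)) (Continuous.intervalIntegrable (by fun_prop) _ _)
  rw [intervalIntegral.integral_add (Continuous.intervalIntegrable (by fun_prop) _ _)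
    (Continuous.intervalIntegrable (by fun_prop) _ _)] at this
  have e1 : Complex.exp (-Complex.I * (k * ((2 * Real.pi : ℝ) : ℂ))) = 1 := by
    rw [Complex.exp_eq_one_iff]
    exact ⟨-k, by push_cast; ring⟩
  rw [hp, e1] at this
  simp only [Complex.ofReal_zero, mul_zero, Complex.exp_zero, mul_one, sub_self] at this
  rw [add_eq_zero_iff_eq_neg] at this
  rw [this, ← intervalIntegral.integral_const_mul, ← intervalIntegral.integral_neg]
  refine intervalIntegral.integral_congr fun x _ => ?_
  ring

lemma integral_exp_eq_zero {k : ℤ} (hk : k ≠ 0) :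
    ∫ x in (0 : ℝ)..(2 * Real.pi), Complex.exp (-Complex.I * (k * x)) = 0 := by
  -- Integration by parts for the constant `1` reads `0 = ik ∫ e^{-ikx}`.
  have := integral_deriv_mul_exp (h := fun _ => 1) (h' := fun _ => 0)
    (fun x => hasDerivAt_const _ _) continuous_const rfl k
  simp only [zero_mul, intervalIntegral.integral_zero, one_mul] at this
  have hk' : Complex.I * (k : ℂ) ≠ 0 := by simp [hk]
  exact (mul_eq_zero.1 this.symm).resolve_left hk'

lemma intervalIntegral_swap {F : ℝ → ℝ → ℂ} (hF : Continuous (Function.uncurry F)) (a b c d : ℝ) :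
    ∫ x in a..b, ∫ z in c..d, F x z = ∫ z in c..d, ∫ x in a..b, F x z := by
  refine intervalIntegral_intervalIntegral_swap ?_
  exact (hF.continuousOn.integrableOn_compact (isCompact_uIcc.prod isCompact_uIcc)).mono_set
    (prod_mono uIoc_subset_uIcc uIoc_subset_uIcc)

/-! ### Fourier coefficients in the periodic variables -/

/-- The Fourier coefficient in `(x, z)` as a function of `y`. -/
def coef (k l : ℤ) (f : ℝ × ℝ × ℝ → ℝ) (y : ℝ) : ℂ := (((2 * Real.pi) ^ 2)⁻¹ : ℂ) *
    ∫ x in (0 : ℝ)..(2 * Real.pi), ∫ z in (0 : ℝ)..(2 * Real.pi),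
      (f (x, y, z) : ℂ) * Complex.exp (-Complex.I * (k * x + l * z))

lemma fourier3_eq (f : ℝ × ℝ × ℝ → ℝ) (k : ℤ) (η : ℝ) (l : ℤ) :
    fourier3 f k η l = lineFourier (coef k l f) η := rfl

lemma continuousOn_coef {X : Type*} [TopologicalSpace X] {S : Set X} {F : X → ℝ × ℝ × ℝ → ℝ}
    (hF : ContinuousOn (fun q : X × (ℝ × ℝ × ℝ) => F q.1 q.2) (S ×ˢ univ)) (k l : ℤ) :
    ContinuousOn (fun q : X × ℝ => coef k l (F q.1) q.2) (S ×ˢ univ) := by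
  unfold coef
  refine continuousOn_const.mul ?_
  refine continuousOn_intervalIntegral
    (F := fun (q : X × ℝ) (x : ℝ) => ∫ z in (0 : ℝ)..(2 * Real.pi),
      (F q.1 (x, q.2, z) : ℂ) * Complex.exp (-Complex.I * (k * x + l * z))) ?_ _ _
  refine continuousOn_intervalIntegral
    (F := fun (q : (X × ℝ) × ℝ) (z : ℝ) =>
      (F q.1.1 (q.2, q.1.2, z) : ℂ) * Complex.exp (-Complex.I * (k * q.2 + l * z))) ?_ _ _
  refine ContinuousOn.mul ?_ (by fun_prop)
  refine Complex.continuous_ofReal.comp_continuousOn ?_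
  exact hF.comp (f := fun p : ((X × ℝ) × ℝ) × ℝ => (p.1.1.1, (p.1.2, p.1.1.2, p.2)))
    (by fun_prop) (fun p hp => ⟨hp.1.1.1, mem_univ _⟩)

lemma continuous_coef {f : ℝ × ℝ × ℝ → ℝ} (hf : Continuous f) (k l : ℤ) :
    Continuous (coef k l f) := by
  have := continuousOn_coef (X := Unit) (S := univ) (F := fun _ => f) (by fun_prop) k l
  rw [univ_prod_univ, continuousOn_univ] at this
  exact this.comp (f := fun y : ℝ => ((), y)) (by fun_prop)

/-- Differentiation of coefficients with respect to a parameter. -/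
lemma hasDerivAt_coef_param {S : Set ℝ} (hS : IsOpen S) {F F' : ℝ → ℝ × ℝ × ℝ → ℝ} {y : ℝ}
    (hF : ContinuousOn (fun q : ℝ × (ℝ × ℝ × ℝ) => F q.1 q.2) (S ×ˢ univ))
    (hF' : ContinuousOn (fun q : ℝ × (ℝ × ℝ × ℝ) => F' q.1 q.2) (S ×ˢ univ))
    (hd : ∀ s ∈ S, ∀ x z, HasDerivAt (fun r => F r (x, y, z)) (F' s (x, y, z)) s) (k l : ℤ)
    {s : ℝ} (hs : s ∈ S) :
    HasDerivAt (fun r => coef k l (F r) y) (coef k l (F' s) y) s := by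
  have hcont (G : ℝ → ℝ × ℝ × ℝ → ℝ)
      (hG : ContinuousOn (fun q : ℝ × (ℝ × ℝ × ℝ) => G q.1 q.2) (S ×ˢ univ)) :
      ContinuousOn (fun q : (ℝ × ℝ) × ℝ => (G q.1.1 (q.1.2, y, q.2) : ℂ) *
        Complex.exp (-Complex.I * (k * q.1.2 + l * q.2))) ((S ×ˢ univ) ×ˢ univ) := by
    refine ContinuousOn.mul ?_ (by fun_prop)
    refine Complex.continuous_ofReal.comp_continuousOn ?_
    exact hG.comp (f := fun p : (ℝ × ℝ) × ℝ => (p.1.1, (p.1.2, y, p.2)))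
      (by fun_prop) (fun p hp => ⟨hp.1.1, mem_univ _⟩)
  have hcont2 (x : ℝ) (G : ℝ → ℝ × ℝ × ℝ → ℝ)
      (hG : ContinuousOn (fun q : ℝ × (ℝ × ℝ × ℝ) => G q.1 q.2) (S ×ˢ univ)) :
      ContinuousOn (fun q : ℝ × ℝ => (G q.1 (x, y, q.2) : ℂ) *
        Complex.exp (-Complex.I * (k * x + l * q.2))) (S ×ˢ univ) := by
    refine ContinuousOn.mul ?_ (by fun_prop)
    refine Complex.continuous_ofReal.comp_continuousOn ?_
    exact hG.comp (f := fun p : ℝ × ℝ => (p.1, (x, y, p.2)))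
      (by fun_prop) (fun p hp => ⟨hp.1, mem_univ _⟩)
  unfold coef
  refine HasDerivAt.const_mul _ ?_
  refine hasDerivAt_intervalIntegral hS (F := fun r x => ∫ z in (0 : ℝ)..(2 * Real.pi),
      (F r (x, y, z) : ℂ) * Complex.exp (-Complex.I * (k * x + l * z)))
    (F' := fun r x => ∫ z in (0 : ℝ)..(2 * Real.pi),
      (F' r (x, y, z) : ℂ) * Complex.exp (-Complex.I * (k * x + l * z)))
    (continuousOn_intervalIntegral (hcont F hF) _ _)
    (continuousOn_intervalIntegral (hcont F' hF') _ _) (fun r hr x => ?_) _ _ hs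
  refine hasDerivAt_intervalIntegral hS (F := fun r z =>
      (F r (x, y, z) : ℂ) * Complex.exp (-Complex.I * (k * x + l * z)))
    (F' := fun r z =>
      (F' r (x, y, z) : ℂ) * Complex.exp (-Complex.I * (k * x + l * z)))
    (hcont2 x F hF) (hcont2 x F' hF') (fun r hr z => ?_) _ _ hr
  exact (hd r hr x z).ofReal_comp.mul_const _

lemma coef_add {f g : ℝ × ℝ × ℝ → ℝ} (hf : Continuous f) (hg : Continuous g) (k l : ℤ) (y : ℝ) :
    coef k l (fun X => f X + g X) y = coef k l f y + coef k l g y := by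
  have hc (f : ℝ × ℝ × ℝ → ℝ) (hf : Continuous f) : Continuous (fun q : ℝ × ℝ =>
      (f (q.1, y, q.2) : ℂ) * Complex.exp (-Complex.I * (k * q.1 + l * q.2))) := by fun_prop
  have hi (f : ℝ × ℝ × ℝ → ℝ) (hf : Continuous f) (x : ℝ) : IntervalIntegrable (fun z : ℝ =>
      (f (x, y, z) : ℂ) * Complex.exp (-Complex.I * (k * x + l * z))) volume 0 (2 * Real.pi) :=
    Continuous.intervalIntegrable (by fun_prop) _ _
  have ho (f : ℝ × ℝ × ℝ → ℝ) (hf : Continuous f) : IntervalIntegrable (fun x : ℝ =>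
      ∫ z in (0 : ℝ)..(2 * Real.pi),
      (f (x, y, z) : ℂ) * Complex.exp (-Complex.I * (k * x + l * z))) volume 0 (2 * Real.pi) :=
    Continuous.intervalIntegrable
      (intervalIntegral.continuous_parametric_intervalIntegral_of_continuous' (hc f hf) _ _) _ _
  unfold coef
  rw [← mul_add, ← intervalIntegral.integral_add (ho f hf) (ho g hg)]
  congr 1
  refine intervalIntegral.integral_congr fun x _ => ?_
  rw [← intervalIntegral.integral_add (hi f hf x) (hi g hg x)]
  refine intervalIntegral.integral_congr fun z _ => ?_
  simp only
  push_cast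
  ring

lemma coef_mul (c : ℝ → ℝ) (f : ℝ × ℝ × ℝ → ℝ) (k l : ℤ) (y : ℝ) :
    coef k l (fun X => c X.2.1 * f X) y = c y * coef k l f y := by
  unfold coef
  rw [mul_left_comm]
  congr 1
  rw [← intervalIntegral.integral_const_mul]
  refine intervalIntegral.integral_congr fun x _ => ?_
  simp only
  rw [← intervalIntegral.integral_const_mul]
  refine intervalIntegral.integral_congr fun z _ => ?_
  push_cast
  ring

lemma coef_const_mul (c : ℝ) (f : ℝ × ℝ × ℝ → ℝ) (k l : ℤ) (y : ℝ) :
    coef k l (fun X => c * f X) y = c * coef k l f y :=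
  coef_mul (fun _ => c) f k l y

lemma contDiff_dX {f : ℝ × ℝ × ℝ → ℝ} (hf : ContDiff ℝ ∞ f) : ContDiff ℝ ∞ (dX f) :=
  (hf.fderiv_right (m := ∞) (by simp)).clm_apply contDiff_const

lemma contDiff_dY {f : ℝ × ℝ × ℝ → ℝ} (hf : ContDiff ℝ ∞ f) : ContDiff ℝ ∞ (dY f) :=
  (hf.fderiv_right (m := ∞) (by simp)).clm_apply contDiff_const

lemma contDiff_dZ {f : ℝ × ℝ × ℝ → ℝ} (hf : ContDiff ℝ ∞ f) : ContDiff ℝ ∞ (dZ f) :=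
  (hf.fderiv_right (m := ∞) (by simp)).clm_apply contDiff_const

lemma hasDerivAt_dX {f : ℝ × ℝ × ℝ → ℝ} (hf : ContDiff ℝ ∞ f) (x y z : ℝ) :
    HasDerivAt (fun r => f (r, y, z)) (dX f (x, y, z)) x :=
  ((hf.differentiable (by simp)) (x, y, z)).hasFDerivAt.comp_hasDerivAt x
    ((hasDerivAt_id x).prodMk (hasDerivAt_const x (y, z)))

lemma hasDerivAt_dY {f : ℝ × ℝ × ℝ → ℝ} (hf : ContDiff ℝ ∞ f) (x y z : ℝ) :
    HasDerivAt (fun r => f (x, r, z)) (dY f (x, y, z)) y :=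
  ((hf.differentiable (by simp)) (x, y, z)).hasFDerivAt.comp_hasDerivAt y
    ((hasDerivAt_const y x).prodMk ((hasDerivAt_id y).prodMk (hasDerivAt_const y z)))

lemma hasDerivAt_dZ {f : ℝ × ℝ × ℝ → ℝ} (hf : ContDiff ℝ ∞ f) (x y z : ℝ) :
    HasDerivAt (fun r => f (x, y, r)) (dZ f (x, y, z)) z :=
  ((hf.differentiable (by simp)) (x, y, z)).hasFDerivAt.comp_hasDerivAt z
    ((hasDerivAt_const z x).prodMk ((hasDerivAt_const z y).prodMk (hasDerivAt_id z)))

lemma IsPeriodic.dX {f : ℝ × ℝ × ℝ → ℝ} (hf : ContDiff ℝ ∞ f) (hp : IsPeriodic f) :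
    IsPeriodic (dX f) := by
  intro x y z
  constructor
  · have h1 := (hasDerivAt_dX hf (x + 2 * Real.pi) y z).comp_add_const x (2 * Real.pi)
    simp only [(hp _ y z).1] at h1
    exact h1.unique (hasDerivAt_dX hf x y z)
  · have h1 := hasDerivAt_dX hf x y (z + 2 * Real.pi)
    simp only [(hp _ y z).2] at h1
    exact h1.unique (hasDerivAt_dX hf x y z)

lemma IsPeriodic.dY {f : ℝ × ℝ × ℝ → ℝ} (hf : ContDiff ℝ ∞ f) (hp : IsPeriodic f) :
    IsPeriodic (dY f) := by
  intro x y z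
  constructor
  · have h1 := hasDerivAt_dY hf (x + 2 * Real.pi) y z
    simp only [(hp x _ z).1] at h1
    exact h1.unique (hasDerivAt_dY hf x y z)
  · have h1 := hasDerivAt_dY hf x y (z + 2 * Real.pi)
    simp only [(hp x _ z).2] at h1
    exact h1.unique (hasDerivAt_dY hf x y z)

lemma IsPeriodic.dZ {f : ℝ × ℝ × ℝ → ℝ} (hf : ContDiff ℝ ∞ f) (hp : IsPeriodic f) :
    IsPeriodic (dZ f) := by
  intro x y z
  constructor
  · have h1 := hasDerivAt_dZ hf (x + 2 * Real.pi) y z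
    simp only [(hp x y _).1] at h1
    exact h1.unique (hasDerivAt_dZ hf x y z)
  · have h1 := (hasDerivAt_dZ hf x y (z + 2 * Real.pi)).comp_add_const z (2 * Real.pi)
    simp only [(hp x y _).2] at h1
    exact h1.unique (hasDerivAt_dZ hf x y z)

lemma hasDerivAt_coef {f : ℝ × ℝ × ℝ → ℝ} (hf : ContDiff ℝ ∞ f) (k l : ℤ) (y : ℝ) :
    HasDerivAt (coef k l f) (coef k l (dY f) y) y := by
  have hc := hf.continuous
  have hc' := (contDiff_dY hf).continuous
  -- The variable `y` itself plays the role of the parameter; the slot fixed at `0` is ignored by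
  -- the integrand.
  have := hasDerivAt_coef_param (S := univ) isOpen_univ (y := 0)
    (F := fun r X => f (X.1, r, X.2.2)) (F' := fun r X => dY f (X.1, r, X.2.2))
    (by fun_prop) (by fun_prop) (fun s _ x z => hasDerivAt_dY hf x s z) k l (mem_univ y)
  exact this

lemma coef_dZ {f : ℝ × ℝ × ℝ → ℝ} (hf : ContDiff ℝ ∞ f) (hp : IsPeriodic f) (k l : ℤ) (y : ℝ) :
    coef k l (dZ f) y = Complex.I * l * coef k l f y := by
  unfold coef
  rw [mul_left_comm]
  congr 1
  rw [← intervalIntegral.integral_const_mul]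
  refine intervalIntegral.integral_congr fun x _ => ?_
  have hc' := (contDiff_dZ hf).continuous
  have h := integral_deriv_mul_exp (h := fun z => (f (x, y, z) : ℂ))
    (h' := fun z => (dZ f (x, y, z) : ℂ)) (fun z => (hasDerivAt_dZ hf x y z).ofReal_comp)
    (by fun_prop) (by simpa using (hp x y 0).2) l
  have e (g : ℝ → ℂ) : ∫ z in (0 : ℝ)..(2 * Real.pi), g z *
      Complex.exp (-Complex.I * (k * x + l * z)) = Complex.exp (-Complex.I * (k * x)) *
      ∫ z in (0 : ℝ)..(2 * Real.pi), g z * Complex.exp (-Complex.I * (l * z)) := by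
    rw [← intervalIntegral.integral_const_mul]
    refine intervalIntegral.integral_congr fun z _ => ?_
    rw [mul_add, Complex.exp_add]
    ring
  simp only [e, h]
  ring

/-- The Fourier coefficient in `z` alone. -/
def coefZ (l : ℤ) (f : ℝ × ℝ × ℝ → ℝ) (x y : ℝ) : ℂ :=
  ∫ z in (0 : ℝ)..(2 * Real.pi), (f (x, y, z) : ℂ) * Complex.exp (-Complex.I * (l * z))

lemma coef_eq_integral_coefZ (f : ℝ × ℝ × ℝ → ℝ) (k l : ℤ) (y : ℝ) :
    coef k l f y = (((2 * Real.pi) ^ 2)⁻¹ : ℂ) * ∫ x in (0 : ℝ)..(2 * Real.pi),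
      coefZ l f x y * Complex.exp (-Complex.I * (k * x)) := by
  unfold coef coefZ
  congr 1
  refine intervalIntegral.integral_congr fun x _ => ?_
  rw [← intervalIntegral.integral_mul_const]
  refine intervalIntegral.integral_congr fun z _ => ?_
  rw [mul_add, Complex.exp_add]
  ring

lemma continuous_coefZ {f : ℝ × ℝ × ℝ → ℝ} (hf : Continuous f) (l : ℤ) (y : ℝ) :
    Continuous fun x => coefZ l f x y :=
  intervalIntegral.continuous_parametric_intervalIntegral_of_continuous'
    (f := fun x z : ℝ => (f (x, y, z) : ℂ) * Complex.exp (-Complex.I * (l * z)))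
    (by fun_prop) _ _

lemma coefZ_periodic {f : ℝ × ℝ × ℝ → ℝ} (hp : IsPeriodic f) (l : ℤ) (x y : ℝ) :
    coefZ l f (x + 2 * Real.pi) y = coefZ l f x y := by
  unfold coefZ
  simp only [(hp x y _).1]

lemma coef_dX {f : ℝ × ℝ × ℝ → ℝ} (hf : ContDiff ℝ ∞ f) (hp : IsPeriodic f) (k l : ℤ) (y : ℝ) :
    coef k l (dX f) y = Complex.I * k * coef k l f y := by
  have hc := hf.continuous
  have hc' := (contDiff_dX hf).continuous
  rw [coef_eq_integral_coefZ, coef_eq_integral_coefZ, mul_left_comm]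
  congr 1
  refine integral_deriv_mul_exp (fun x => ?_) (continuous_coefZ hc' l y)
    (by simpa using coefZ_periodic hp l 0 y) k
  refine hasDerivAt_intervalIntegral (S := univ) isOpen_univ
    (F := fun x z => (f (x, y, z) : ℂ) * Complex.exp (-Complex.I * (l * z)))
    (F' := fun x z => (dX f (x, y, z) : ℂ) * Complex.exp (-Complex.I * (l * z)))
    ?_ ?_ (fun s _ z => (hasDerivAt_dX hf s y z).ofReal_comp.mul_const _) _ _ (mem_univ x)
  · exact Continuous.continuousOn (by fun_prop)
  · exact Continuous.continuousOn (by fun_prop)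

lemma coef_lap {f : ℝ × ℝ × ℝ → ℝ} (hf : ContDiff ℝ ∞ f) (hp : IsPeriodic f) (k l : ℤ) (y : ℝ) :
    coef k l (lap f) y = coef k l (dY (dY f)) y - ((k : ℂ) ^ 2 + (l : ℂ) ^ 2) * coef k l f y := by
  have hX := contDiff_dX hf
  have hY := contDiff_dY hf
  have hZ := contDiff_dZ hf
  have hXX := (contDiff_dX hX).continuous
  have hYY := (contDiff_dY hY).continuous
  have hZZ := (contDiff_dZ hZ).continuous
  unfold lap
  rw [coef_add (by fun_prop) hZZ, coef_add hXX hYY, coef_dX hX (hp.dX hf), coef_dX hf hp,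
    coef_dZ hZ (hp.dZ hf), coef_dZ hf hp]
  linear_combination ((k : ℂ) ^ 2 + (l : ℂ) ^ 2) * coef k l f y * Complex.I_sq

/-- Translation of a periodic function multiplies its `k`-th coefficient by a phase. As the
translation `ty` depends on `y`, the phase is a modulation in `y`, i.e. the shift of `η` to `η -
kt`. -/
lemma coef_moving {f : ℝ × ℝ × ℝ → ℝ} (hp : IsPeriodic f) (k l : ℤ) (t y : ℝ) :
    coef k l (moving t f) y = Complex.exp (Complex.I * (k * t * y)) * coef k l f y := by
  rw [coef_eq_integral_coefZ, coef_eq_integral_coefZ, mul_left_comm]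
  congr 1
  set G : ℝ → ℂ := fun x => coefZ l f x y * Complex.exp (-Complex.I * (k * x)) with hG
  have hper : Function.Periodic G (2 * Real.pi) := by
    intro x
    simp only [hG, coefZ_periodic hp]
    congr 1
    rw [Complex.exp_eq_exp_iff_exists_int]
    exact ⟨-k, by push_cast; ring⟩
  have h1 : ∀ x : ℝ, coefZ l (moving t f) x y * Complex.exp (-Complex.I * (k * x)) =
      Complex.exp (Complex.I * (k * t * y)) * G (x + t * y) := by
    intro x
    have : coefZ l (moving t f) x y = coefZ l f (x + t * y) y := rfl
    simp only [hG]
    rw [this, mul_left_comm (Complex.exp _), ← Complex.exp_add]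
    congr 2
    push_cast
    ring
  simp only [h1]
  rw [intervalIntegral.integral_const_mul, intervalIntegral.integral_comp_add_right]
  have := hper.intervalIntegral_add_eq (t * y) 0
  rw [zero_add] at this
  rw [zero_add, add_comm (2 * Real.pi), this]

/-! ### Square integrability of coefficients and projections -/

lemma two_pi_pos : (0 : ℝ) < 2 * Real.pi := by positivity

lemma sq_lintegral_le {α : Type*} [MeasurableSpace α] (μ : Measure α) {f : α → ℝ≥0∞}
    (hf : AEMeasurable f μ) : (∫⁻ x, f x ∂μ) ^ 2 ≤ μ univ * ∫⁻ x, f x ^ 2 ∂μ := by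
  have h := ENNReal.lintegral_mul_le_Lp_mul_Lq μ Real.HolderConjugate.two_two
    (f := fun _ => 1) (g := f) aemeasurable_const hf
  simp only [Pi.mul_apply, one_mul, ENNReal.one_rpow, lintegral_one] at h
  calc (∫⁻ x, f x ∂μ) ^ 2 ≤ (μ univ ^ (1 / (2 : ℝ)) *
        (∫⁻ x, f x ^ (2 : ℝ) ∂μ) ^ (1 / (2 : ℝ))) ^ 2 := by gcongr
    _ = _ := by
      rw [mul_pow, ← ENNReal.rpow_natCast, ← ENNReal.rpow_mul, ← ENNReal.rpow_natCast,
        ← ENNReal.rpow_mul]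
      norm_num

lemma enorm_intervalIntegral_sq_le {f : ℝ → ℂ} (hf : Continuous f) :
    ‖∫ x in (0 : ℝ)..(2 * Real.pi), f x‖ₑ ^ 2 ≤
      ENNReal.ofReal (2 * Real.pi) * ∫⁻ x in Ioc 0 (2 * Real.pi), ‖f x‖ₑ ^ 2 := by
  rw [intervalIntegral.integral_of_le two_pi_pos.le]
  calc _ ≤ (∫⁻ x in Ioc 0 (2 * Real.pi), ‖f x‖ₑ) ^ 2 := by
        gcongr
        exact enorm_integral_le_lintegral_enorm _
    _ ≤ _ := by
      refine (sq_lintegral_le _ (by fun_prop)).trans_eq ?_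
      simp

lemma cell3_eq : cell3 = (volume.restrict (Ioc 0 (2 * Real.pi))).prod
    ((volume : Measure ℝ).prod (volume.restrict (Ioc 0 (2 * Real.pi)))) := by
  rw [cell3, Measure.volume_eq_prod, ← Measure.prod_restrict, Measure.volume_eq_prod,
    ← Measure.prod_restrict, Measure.restrict_univ]

lemma cell2_eq : cell2 = (volume : Measure ℝ).prod (volume.restrict (Ioc 0 (2 * Real.pi))) := by
  rw [cell2, Measure.volume_eq_prod, ← Measure.prod_restrict, Measure.restrict_univ]

lemma lintegral_cell3 {f : ℝ × ℝ × ℝ → ℝ≥0∞} (hf : Measurable f) :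
    ∫⁻ X, f X ∂cell3 = ∫⁻ y : ℝ, ∫⁻ x in Ioc 0 (2 * Real.pi), ∫⁻ z in Ioc 0 (2 * Real.pi),
      f (x, y, z) := by
  rw [cell3_eq, lintegral_prod _ hf.aemeasurable]
  have : ∀ x, ∫⁻ Y, f (x, Y) ∂((volume : Measure ℝ).prod (volume.restrict (Ioc 0 (2 * Real.pi))))
      = ∫⁻ y, ∫⁻ z in Ioc 0 (2 * Real.pi), f (x, y, z) := fun x =>
    lintegral_prod _ (by fun_prop)
  simp only [this]
  refine lintegral_lintegral_swap (Measurable.aemeasurable ?_)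
  exact Measurable.lintegral_prod_right' (f := fun p : (ℝ × ℝ) × ℝ => f (p.1.1, p.1.2, p.2))
    (by fun_prop)

/-- Cauchy–Schwarz in `z` and in `x`. The constant `1` is not sharp; only a bound independent of
time and of the cutoff matters. -/
lemma lintegral_coef_sq_le {f : ℝ × ℝ × ℝ → ℝ} (hf : Continuous f) (k l : ℤ) :
    ∫⁻ y, ‖coef k l f y‖ₑ ^ 2 ≤ ∫⁻ X, ‖f X‖ₑ ^ 2 ∂cell3 := by
  rw [lintegral_cell3 (by fun_prop)]
  refine lintegral_mono fun y => ?_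
  have hc : Continuous (fun q : ℝ × ℝ =>
      (f (q.1, y, q.2) : ℂ) * Complex.exp (-Complex.I * (k * q.1 + l * q.2))) := by fun_prop
  unfold coef
  rw [enorm_mul, mul_pow]
  have h1 := enorm_intervalIntegral_sq_le
    (intervalIntegral.continuous_parametric_intervalIntegral_of_continuous'
      (μ := volume) (f := fun x z => (f (x, y, z) : ℂ) * Complex.exp (-Complex.I * (k * x + l * z)))
      hc 0 (2 * Real.pi))
  have h2 (x : ℝ) := enorm_intervalIntegral_sq_le
    (f := fun z : ℝ => (f (x, y, z) : ℂ) * Complex.exp (-Complex.I * (k * x + l * z)))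
    (by fun_prop)
  have hexp (x z : ℝ) : ‖(f (x, y, z) : ℂ) * Complex.exp (-Complex.I * (k * x + l * z))‖ₑ =
      ‖f (x, y, z)‖ₑ := by
    have : -Complex.I * (k * x + l * z) = ((-(k * x + l * z) : ℝ) : ℂ) * Complex.I := by
      push_cast; ring
    rw [← ofReal_norm, ← ofReal_norm, norm_mul, this, Complex.norm_exp_ofReal_mul_I, mul_one,
      Complex.norm_real]
  simp only [hexp] at h2
  have hP : ‖(((2 * Real.pi) ^ 2)⁻¹ : ℂ)‖ₑ ^ 2 * (ENNReal.ofReal (2 * Real.pi) *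
      ENNReal.ofReal (2 * Real.pi)) ≤ 1 := by
    have : ‖(((2 * Real.pi) ^ 2)⁻¹ : ℂ)‖ₑ = ENNReal.ofReal (((2 * Real.pi) ^ 2)⁻¹) := by
      rw [← ofReal_norm]
      congr 1
      rw [norm_inv, norm_pow, norm_mul, Complex.norm_real]
      simp [abs_of_pos Real.pi_pos]
    rw [this, ← ENNReal.ofReal_mul two_pi_pos.le, ← ENNReal.ofReal_pow (by positivity),
      ← ENNReal.ofReal_mul (by positivity), ENNReal.ofReal_le_one]
    have : (((2 * Real.pi) ^ 2)⁻¹) ^ 2 * (2 * Real.pi * (2 * Real.pi)) = ((2 * Real.pi) ^ 2)⁻¹ := by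
      field_simp
    rw [this]
    refine inv_le_one_of_one_le₀ ?_
    have := Real.pi_gt_three
    nlinarith
  calc _ ≤ ‖(((2 * Real.pi) ^ 2)⁻¹ : ℂ)‖ₑ ^ 2 * (ENNReal.ofReal (2 * Real.pi) *
        ∫⁻ x in Ioc 0 (2 * Real.pi), ENNReal.ofReal (2 * Real.pi) *
          ∫⁻ z in Ioc 0 (2 * Real.pi), ‖f (x, y, z)‖ₑ ^ 2) := by
        refine mul_le_mul_right (h1.trans (mul_le_mul_right (lintegral_mono fun x => h2 x) _)) _
    _ = ‖(((2 * Real.pi) ^ 2)⁻¹ : ℂ)‖ₑ ^ 2 * (ENNReal.ofReal (2 * Real.pi) *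
        ENNReal.ofReal (2 * Real.pi)) * ∫⁻ x in Ioc 0 (2 * Real.pi),
          ∫⁻ z in Ioc 0 (2 * Real.pi), ‖f (x, y, z)‖ₑ ^ 2 := by
        rw [lintegral_const_mul' _ _ ENNReal.ofReal_ne_top]
        ring
    _ ≤ _ := by
        refine (mul_le_mul_left hP _).trans_eq (one_mul _)

lemma eLpNorm_two_sq {α E : Type*} [MeasurableSpace α] [NormedAddCommGroup E] (μ : Measure α)
    (f : α → E) : eLpNorm f 2 μ ^ 2 = ∫⁻ x, ‖f x‖ₑ ^ 2 ∂μ := by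
  rw [eLpNorm_eq_lintegral_rpow_enorm_toReal (by norm_num) (by norm_num),
    ← ENNReal.rpow_natCast, ← ENNReal.rpow_mul]
  norm_num

lemma memLp_two_iff_lintegral {α E : Type*} [MeasurableSpace α] [NormedAddCommGroup E]
    {μ : Measure α} {f : α → E} (hf : AEStronglyMeasurable f μ) :
    MemLp f 2 μ ↔ ∫⁻ x, ‖f x‖ₑ ^ 2 ∂μ < ⊤ := by
  rw [← eLpNorm_two_sq, MemLp, and_iff_right hf]
  exact ⟨fun h => ENNReal.pow_lt_top h, fun h => by simpa using h⟩

lemma memLp_coef {f : ℝ × ℝ × ℝ → ℝ} (hf : Continuous f) (h2 : MemLp f 2 cell3) (k l : ℤ) :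
    MemLp (coef k l f) 2 := by
  rw [memLp_two_iff_lintegral (continuous_coef hf k l).aestronglyMeasurable]
  refine (lintegral_coef_sq_le hf k l).trans_lt ?_
  rwa [← memLp_two_iff_lintegral hf.aestronglyMeasurable]

lemma setLIntegral_periodic_shift {g : ℝ → ℝ≥0∞} (hg : Function.Periodic g (2 * Real.pi))
    (a : ℝ) : ∫⁻ x in Ioc 0 (2 * Real.pi), g (x + a) = ∫⁻ x in Ioc 0 (2 * Real.pi), g x := by
  have h1 : ∫⁻ x in Ioc 0 (2 * Real.pi), g (x + a) = ∫⁻ x in Ioc a (a + 2 * Real.pi), g x := by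
    have := (measurePreserving_add_right (volume : Measure ℝ) a).setLIntegral_comp_preimage_emb
      (measurableEmbedding_addRight a) g (Ioc a (a + 2 * Real.pi))
    rw [← this]
    congr 2
    ext x
    simp only [mem_Ioc, mem_preimage]
    constructor <;> rintro ⟨h, h'⟩ <;> constructor <;> linarith
  rw [h1]
  have := (isAddFundamentalDomain_Ioc two_pi_pos a).setLIntegral_eq
    (isAddFundamentalDomain_Ioc two_pi_pos 0) g hg.map_vadd_zmultiples
  rwa [zero_add] at this

lemma continuous_moving {f : ℝ × ℝ × ℝ → ℝ} (hf : Continuous f) (t : ℝ) :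
    Continuous (moving t f) := by
  unfold moving; fun_prop

/-- For fixed `y` the shear is a translation in the periodic variable `x`. -/
lemma memLp_moving {f : ℝ × ℝ × ℝ → ℝ} (hf : Continuous f) (hp : IsPeriodic f)
    (h2 : MemLp f 2 cell3) (t : ℝ) : MemLp (moving t f) 2 cell3 := by
  have hm := continuous_moving hf t
  rw [memLp_two_iff_lintegral hf.aestronglyMeasurable] at h2
  rw [memLp_two_iff_lintegral hm.aestronglyMeasurable]
  convert! h2 using 1
  rw [lintegral_cell3 (by fun_prop), lintegral_cell3 (by fun_prop)]
  refine lintegral_congr fun y => ?_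
  refine setLIntegral_periodic_shift (g := fun x => ∫⁻ z in Ioc 0 (2 * Real.pi),
    ‖f (x, y, z)‖ₑ ^ 2) (fun x => ?_) (t * y)
  simp only [(hp x y _).1]

lemma continuous_zeroMode {f : ℝ × ℝ × ℝ → ℝ} (hf : Continuous f) : Continuous (zeroMode f) := by
  unfold zeroMode
  refine continuous_const.mul ?_
  exact intervalIntegral.continuous_parametric_intervalIntegral_of_continuous'
    (f := fun (Y : ℝ × ℝ) x => f (x, Y.1, Y.2)) (by fun_prop) _ _

lemma continuous_nonzeroMode {f : ℝ × ℝ × ℝ → ℝ} (hf : Continuous f) :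
    Continuous (nonzeroMode f) := by
  have := continuous_zeroMode hf
  unfold nonzeroMode
  fun_prop

lemma ofReal_zeroMode (f : ℝ × ℝ × ℝ → ℝ) (Y : ℝ × ℝ) : (zeroMode f Y : ℂ) =
    ((2 * Real.pi)⁻¹ : ℂ) * ∫ x in (0 : ℝ)..(2 * Real.pi), (f (x, Y.1, Y.2) : ℂ) := by
  rw [zeroMode, intervalIntegral.integral_ofReal]
  push_cast
  rfl

lemma enorm_zeroMode_sq_le {f : ℝ × ℝ × ℝ → ℝ} (hf : Continuous f) (y z : ℝ) :
    ENNReal.ofReal (2 * Real.pi) * ‖zeroMode f (y, z)‖ₑ ^ 2 ≤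
      ∫⁻ x in Ioc 0 (2 * Real.pi), ‖f (x, y, z)‖ₑ ^ 2 := by
  have h1 := enorm_intervalIntegral_sq_le (f := fun x => (f (x, y, z) : ℂ)) (by fun_prop)
  have e (r : ℝ) : ‖(r : ℂ)‖ₑ = ‖r‖ₑ := by rw [← ofReal_norm, ← ofReal_norm, Complex.norm_real]
  simp only [e] at h1
  rw [← e, ofReal_zeroMode, enorm_mul, mul_pow]
  have hP : ‖((2 * Real.pi)⁻¹ : ℂ)‖ₑ = ENNReal.ofReal (2 * Real.pi)⁻¹ := by
    rw [← ofReal_norm]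
    congr 1
    rw [norm_inv, norm_mul, Complex.norm_real]
    simp [abs_of_pos Real.pi_pos]
  calc _ ≤ ENNReal.ofReal (2 * Real.pi) * (ENNReal.ofReal (2 * Real.pi)⁻¹ ^ 2 *
        (ENNReal.ofReal (2 * Real.pi) * ∫⁻ x in Ioc 0 (2 * Real.pi), ‖f (x, y, z)‖ₑ ^ 2)) := by
        rw [hP]
        gcongr
    _ = (ENNReal.ofReal (2 * Real.pi) * ENNReal.ofReal (2 * Real.pi)⁻¹) ^ 2 *
        ∫⁻ x in Ioc 0 (2 * Real.pi), ‖f (x, y, z)‖ₑ ^ 2 := by ring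
    _ = _ := by
      rw [← ENNReal.ofReal_mul two_pi_pos.le, mul_inv_cancel₀ two_pi_pos.ne']
      simp

lemma memLp_nonzeroMode {f : ℝ × ℝ × ℝ → ℝ} (hf : Continuous f) (h2 : MemLp f 2 cell3) :
    MemLp (nonzeroMode f) 2 cell3 := by
  have hz := continuous_zeroMode hf
  have hc : Continuous (fun X : ℝ × ℝ × ℝ => zeroMode f X.2) := by fun_prop
  refine h2.sub (g := fun X => zeroMode f X.2) ?_
  rw [memLp_two_iff_lintegral hf.aestronglyMeasurable] at h2
  rw [memLp_two_iff_lintegral hc.aestronglyMeasurable]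
  refine lt_of_le_of_lt ?_ h2
  rw [lintegral_cell3 (hc.measurable.enorm.pow_const 2), lintegral_cell3 (by fun_prop)]
  refine lintegral_mono fun y => ?_
  simp only
  rw [lintegral_const, Measure.restrict_apply_univ, Real.volume_Ioc, sub_zero,
    mul_comm, ← lintegral_const_mul' _ _ ENNReal.ofReal_ne_top, lintegral_lintegral_swap
      (f := fun x z => ‖f (x, y, z)‖ₑ ^ 2) (by fun_prop)]
  exact lintegral_mono fun z => enorm_zeroMode_sq_le hf y z

/-! ### Coefficients of the projections -/

lemma coef_swap {f : ℝ × ℝ × ℝ → ℝ} (hf : Continuous f) (k l : ℤ) (y : ℝ) :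
    coef k l f y = (((2 * Real.pi) ^ 2)⁻¹ : ℂ) * ∫ z in (0 : ℝ)..(2 * Real.pi),
      (∫ x in (0 : ℝ)..(2 * Real.pi), (f (x, y, z) : ℂ) * Complex.exp (-Complex.I * (k * x))) *
        Complex.exp (-Complex.I * (l * z)) := by
  unfold coef
  congr 1
  rw [intervalIntegral_swap (by fun_prop)]
  refine intervalIntegral.integral_congr fun z _ => ?_
  rw [← intervalIntegral.integral_mul_const]
  refine intervalIntegral.integral_congr fun x _ => ?_
  rw [mul_add, Complex.exp_add]
  ring

lemma coef_zero_eq {f : ℝ × ℝ × ℝ → ℝ} (hf : Continuous f) (l : ℤ) (y : ℝ) :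
    coef 0 l f y = ((2 * Real.pi)⁻¹ : ℂ) * ∫ z in (0 : ℝ)..(2 * Real.pi),
      (zeroMode f (y, z) : ℂ) * Complex.exp (-Complex.I * (l * z)) := by
  rw [coef_swap hf, pow_two, mul_inv, mul_assoc]
  congr 1
  rw [← intervalIntegral.integral_const_mul]
  refine intervalIntegral.integral_congr fun z _ => ?_
  simp only [ofReal_zeroMode]
  simp [mul_assoc]

lemma coef_nonzeroMode {f : ℝ × ℝ × ℝ → ℝ} (hf : Continuous f) (k l : ℤ) (y : ℝ) :
    coef k l (nonzeroMode f) y = if k = 0 then 0 else coef k l f y := by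
  have hz := continuous_zeroMode hf
  rw [coef_swap (continuous_nonzeroMode hf)]
  have h1 (z : ℝ) : (∫ x in (0 : ℝ)..(2 * Real.pi), (nonzeroMode f (x, y, z) : ℂ) *
      Complex.exp (-Complex.I * (k * x))) = (∫ x in (0 : ℝ)..(2 * Real.pi), (f (x, y, z) : ℂ) *
      Complex.exp (-Complex.I * (k * x))) - zeroMode f (y, z) *
        ∫ x in (0 : ℝ)..(2 * Real.pi), Complex.exp (-Complex.I * (k * x)) := by
    rw [← intervalIntegral.integral_const_mul, ← intervalIntegral.integral_sub
      (Continuous.intervalIntegrable (by fun_prop) _ _)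
      (Continuous.intervalIntegrable (by fun_prop) _ _)]
    refine intervalIntegral.integral_congr fun x _ => ?_
    simp only [nonzeroMode]
    push_cast
    ring
  simp only [h1]
  split_ifs with hk
  · subst hk
    have : ((Real.pi : ℝ) : ℂ) ≠ 0 := by exact_mod_cast Real.pi_ne_zero
    have h2 (z : ℝ) : (∫ x in (0 : ℝ)..(2 * Real.pi), (f (x, y, z) : ℂ) *
      Complex.exp (-Complex.I * ((0 : ℤ) * x))) - zeroMode f (y, z) *
        ∫ x in (0 : ℝ)..(2 * Real.pi), Complex.exp (-Complex.I * ((0 : ℤ) * x)) = 0 := by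
      rw [ofReal_zeroMode]
      simp only [Int.cast_zero, zero_mul, mul_zero, Complex.exp_zero, mul_one,
        intervalIntegral.integral_const, sub_zero, Complex.real_smul]
      push_cast
      field_simp
      ring
    simp only [h2, zero_mul, intervalIntegral.integral_zero, mul_zero]
  · simp only [integral_exp_eq_zero hk, mul_zero, sub_zero]
    exact (coef_swap hf k l y).symm

lemma ofReal_doubleZero {f : ℝ × ℝ × ℝ → ℝ} (hf : Continuous f) (y : ℝ) :
    (doubleZero f y : ℂ) = coef 0 0 f y := by
  rw [coef_zero_eq hf, doubleZero]
  push_cast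
  rw [← intervalIntegral.integral_ofReal]
  simp

lemma continuous_doubleZero {f : ℝ × ℝ × ℝ → ℝ} (hf : Continuous f) :
    Continuous (doubleZero f) := by
  have := continuous_zeroMode hf
  unfold doubleZero
  exact continuous_const.mul
    (intervalIntegral.continuous_parametric_intervalIntegral_of_continuous' (by fun_prop) _ _)

lemma continuous_simpleZero {f : ℝ × ℝ × ℝ → ℝ} (hf : Continuous f) :
    Continuous (simpleZero f) := by
  have := continuous_zeroMode hf
  have := continuous_doubleZero hf
  unfold simpleZero
  fun_prop

lemma coef_simpleZero {f : ℝ × ℝ × ℝ → ℝ} (hf : Continuous f) (l : ℤ) (y : ℝ) :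
    ((2 * Real.pi)⁻¹ : ℂ) * ∫ z in (0 : ℝ)..(2 * Real.pi),
      (simpleZero f (y, z) : ℂ) * Complex.exp (-Complex.I * (l * z)) =
    if l = 0 then 0 else coef 0 l f y := by
  have hz := continuous_zeroMode hf
  have h1 : ∫ z in (0 : ℝ)..(2 * Real.pi),
      (simpleZero f (y, z) : ℂ) * Complex.exp (-Complex.I * (l * z)) =
      (∫ z in (0 : ℝ)..(2 * Real.pi),
      (zeroMode f (y, z) : ℂ) * Complex.exp (-Complex.I * (l * z))) - doubleZero f y *
      ∫ z in (0 : ℝ)..(2 * Real.pi), Complex.exp (-Complex.I * (l * z)) := by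
    rw [← intervalIntegral.integral_const_mul, ← intervalIntegral.integral_sub
      (Continuous.intervalIntegrable (by fun_prop) _ _)
      (Continuous.intervalIntegrable (by fun_prop) _ _)]
    refine intervalIntegral.integral_congr fun x _ => ?_
    simp only [simpleZero]
    push_cast
    ring
  rw [h1, mul_sub, ← coef_zero_eq hf]
  split_ifs with hl
  · subst hl
    have : ((Real.pi : ℝ) : ℂ) ≠ 0 := by exact_mod_cast Real.pi_ne_zero
    rw [ofReal_doubleZero hf]
    simp only [Int.cast_zero, zero_mul, mul_zero, Complex.exp_zero,
        intervalIntegral.integral_const, sub_zero, Complex.real_smul]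
    push_cast
    field_simp
    ring
  · rw [integral_exp_eq_zero hl]
    simp

lemma fourier2_simpleZero {f : ℝ × ℝ × ℝ → ℝ} (hf : Continuous f) {l : ℤ} (hl : l ≠ 0) (η : ℝ) :
    fourier2 (simpleZero f) η l = lineFourier (coef 0 l f) η := by
  unfold fourier2
  simp only [coef_simpleZero hf, if_neg hl]

lemma fourier3_nonzeroMode {f : ℝ × ℝ × ℝ → ℝ} (hf : Continuous f) {k : ℤ} (hk : k ≠ 0)
    (η : ℝ) (l : ℤ) : fourier3 (nonzeroMode f) k η l = fourier3 f k η l := by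
  rw [fourier3_eq, fourier3_eq]
  congr 1
  ext y
  rw [coef_nonzeroMode hf, if_neg hk]

lemma lineFourier_zero : lineFourier (fun _ => 0) =ᵐ[volume] fun _ => 0 := by
  refine (lineFourier_ae_eq_classical (integrable_zero _ _ _) MemLp.zero').trans
    (.of_forall fun η => ?_)
  simp [classicalFourier]

lemma fourier3_nonzeroMode_zero {f : ℝ × ℝ × ℝ → ℝ} (hf : Continuous f) (l : ℤ) :
    ∀ᵐ η : ℝ, fourier3 (nonzeroMode f) 0 η l = 0 := by
  have : coef 0 l (nonzeroMode f) = fun _ => 0 := by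
    ext y
    rw [coef_nonzeroMode hf, if_pos rfl]
  filter_upwards [lineFourier_zero] with η hη
  rw [fourier3_eq, this, hη]

/-! ### Truncated transforms -/

/-- Smooth compactly supported functions on the line. -/
structure IsTest (χ : ℝ → ℂ) : Prop where
  smooth : ContDiff ℝ ∞ χ
  compact : HasCompactSupport χ

lemma IsTest.deriv {χ : ℝ → ℂ} (h : IsTest χ) : IsTest (deriv χ) :=
  ⟨(contDiff_infty_iff_deriv.1 h.smooth).2, h.compact.deriv⟩

lemma IsTest.iterate_deriv {χ : ℝ → ℂ} (h : IsTest χ) (j : ℕ) : IsTest (_root_.deriv^[j] χ) := by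
  induction j generalizing χ with
  | zero => exact h
  | succ j ih => exact ih h.deriv

lemma IsTest.continuous {χ : ℝ → ℂ} (h : IsTest χ) : Continuous χ := h.smooth.continuous

lemma IsTest.hasDerivAt {χ : ℝ → ℂ} (h : IsTest χ) (y : ℝ) : HasDerivAt χ (_root_.deriv χ y) y :=
  ((h.smooth.differentiable (by simp)) y).hasDerivAt

lemma IsTest.exists_support {χ : ℝ → ℂ} (h : IsTest χ) : ∃ N : ℝ, 0 < N ∧ ∀ y, N ≤ |y| → χ y = 0 := by
  obtain ⟨N, hN⟩ := h.compact.isCompact.isBounded.subset_ball 0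
  refine ⟨max N 1, by positivity, fun y hy => ?_⟩
  by_contra hne
  have := hN (subset_tsupport _ hne)
  rw [Metric.mem_ball, dist_zero_right, Real.norm_eq_abs] at this
  exact absurd (le_trans (le_max_left _ _) hy) (not_le.2 this)

/-- The Fourier transform truncated by `χ`. -/
def tf (χ : ℝ → ℂ) (ξ : ℝ) (g : ℝ → ℂ) : ℂ :=
  ∫ y : ℝ, χ y * Complex.exp (-Complex.I * (ξ * y)) * g y

lemma tf_eq_intervalIntegral {χ : ℝ → ℂ} {N : ℝ} (hN : 0 < N) (h : ∀ y, N ≤ |y| → χ y = 0) (ξ : ℝ)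
    (g : ℝ → ℂ) : tf χ ξ g = ∫ y in (-N)..N, χ y * Complex.exp (-Complex.I * (ξ * y)) * g y := by
  rw [tf, intervalIntegral.integral_of_le (by linarith)]
  refine (setIntegral_eq_integral_of_forall_compl_eq_zero fun y hy => ?_).symm
  rw [h y, zero_mul, zero_mul]
  rw [mem_Ioc, not_and_or, not_lt, not_le] at hy
  rcases hy with hy | hy
  · exact le_trans (by linarith) (neg_le_abs y)
  · exact hy.le.trans (le_abs_self y)

lemma continuousOn_tf {S : Set ℝ} {χ : ℝ → ℂ} (hχ : IsTest χ) {g : ℝ → ℝ → ℂ}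
    (hg : ContinuousOn (fun q : ℝ × ℝ => g q.1 q.2) (S ×ˢ univ)) (k : ℝ) :
    ContinuousOn (fun q : ℝ × ℝ => tf χ (q.2 - k * q.1) (g q.1)) (S ×ˢ univ) := by
  obtain ⟨N, hN, h⟩ := hχ.exists_support
  simp only [tf_eq_intervalIntegral hN h]
  have hc := hχ.continuous
  refine continuousOn_intervalIntegral (F := fun (q : ℝ × ℝ) (y : ℝ) => χ y *
    Complex.exp (-Complex.I * ((q.2 - k * q.1 : ℝ) * y)) * g q.1 y) ?_ _ _
  refine ContinuousOn.mul (Continuous.continuousOn (by fun_prop)) ?_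
  exact hg.comp (f := fun p : (ℝ × ℝ) × ℝ => (p.1.1, p.2)) (by fun_prop)
    (fun p hp => ⟨hp.1.1, mem_univ _⟩)

/-- Moving the shift of frequency into a unimodular factor makes Plancherel in `η` available with
constants independent of `t`. -/
lemma tf_eq_classicalFourier (χ g : ℝ → ℂ) (k t η : ℝ) : tf χ (η - k * t) g =
    classicalFourier (fun y => χ y * (Complex.exp (Complex.I * (k * t * y)) * g y)) η := by
  refine integral_congr_ae (.of_forall fun y => ?_)
  simp only
  rw [mul_left_comm (Complex.exp _), mul_assoc, ← mul_assoc (Complex.exp _) (Complex.exp _),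
    ← Complex.exp_add]
  congr 3
  push_cast
  ring

lemma enorm_exp_I_mul (k t y : ℝ) : ‖Complex.exp (Complex.I * (k * t * y))‖ₑ = 1 := by
  have : Complex.I * (k * t * y) = ((k * t * y : ℝ) : ℂ) * Complex.I := by push_cast; ring
  rw [← ofReal_norm, this, Complex.norm_exp_ofReal_mul_I, ENNReal.ofReal_one]

lemma lintegral_tf_sq {χ g : ℝ → ℂ} (hχ : IsTest χ) (hg : Continuous g) (k t : ℝ) :
    ∫⁻ η : ℝ, ‖tf χ (η - k * t) g‖ₑ ^ 2 =
      ENNReal.ofReal (2 * Real.pi) * ∫⁻ y, ‖χ y‖ₑ ^ 2 * ‖g y‖ₑ ^ 2 := by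
  have hc := hχ.continuous
  set G : ℝ → ℂ := fun y => χ y * (Complex.exp (Complex.I * (k * t * y)) * g y) with hG
  have hGc : Continuous G := by fun_prop
  have hGs : HasCompactSupport G := hχ.compact.mul_right
  have h2 : MemLp G 2 := hGc.memLp_of_hasCompactSupport hGs
  have h1 := lineFourier_ae_eq_classical (hGc.integrable_of_hasCompactSupport hGs) h2
  have h3 := lintegral_lineFourier_sq h2
  calc _ = ∫⁻ η : ℝ, ‖lineFourier G η‖ₑ ^ 2 := by
        refine lintegral_congr_ae ?_
        filter_upwards [h1] with η hη
        rw [hη, tf_eq_classicalFourier]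
    _ = _ := by
      rw [h3]
      congr 1
      refine lintegral_congr fun y => ?_
      simp only [hG]
      rw [enorm_mul, enorm_mul, enorm_exp_I_mul, one_mul, mul_pow]

/-- Plancherel for `(χ - 1) g`. The truncated part is integrable, so its `L²` transform agrees with
the classical one. -/
lemma lintegral_tf_sub_sq {χ g : ℝ → ℂ} (hχ : IsTest χ) (hg : Continuous g) (h2 : MemLp g 2)
    (k t : ℝ) :
    ∫⁻ η : ℝ, ‖tf χ (η - k * t) g -
        lineFourier (fun y => Complex.exp (Complex.I * (k * t * y)) * g y) η‖ₑ ^ 2 =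
      ENNReal.ofReal (2 * Real.pi) * ∫⁻ y, ‖χ y - 1‖ₑ ^ 2 * ‖g y‖ₑ ^ 2 := by
  have hc := hχ.continuous
  set G₀ : ℝ → ℂ := fun y => Complex.exp (Complex.I * (k * t * y)) * g y with hG₀
  set G : ℝ → ℂ := fun y => χ y * G₀ y with hG
  have hGc₀ : Continuous G₀ := by fun_prop
  have hGc : Continuous G := by fun_prop
  have hGs : HasCompactSupport G := hχ.compact.mul_right
  have h2G : MemLp G 2 := hGc.memLp_of_hasCompactSupport hGs
  have h2G₀ : MemLp G₀ 2 := by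
    rw [memLp_two_iff_lintegral hGc₀.aestronglyMeasurable]
    rw [memLp_two_iff_lintegral hg.aestronglyMeasurable] at h2
    convert! h2 using 4
    simp only [hG₀]
    rw [enorm_mul, enorm_exp_I_mul, one_mul]
  have h1 := lineFourier_ae_eq_classical (hGc.integrable_of_hasCompactSupport hGs) h2G
  have h3 := lintegral_lineFourier_sq (h2G.sub h2G₀)
  have h4 := lineFourier_sub h2G h2G₀
  calc _ = ∫⁻ η : ℝ, ‖lineFourier (G - G₀) η‖ₑ ^ 2 := by
        refine lintegral_congr_ae ?_
        filter_upwards [h1, h4] with η hη h4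
        have e : G - G₀ = fun y => G y - G₀ y := rfl
        rw [e, h4, hη, tf_eq_classicalFourier]
    _ = _ := by
      rw [h3]
      congr 1
      refine lintegral_congr fun y => ?_
      have : (G - G₀) y = (χ y - 1) * (Complex.exp (Complex.I * (k * t * y)) * g y) := by
        simp only [hG, hG₀, Pi.sub_apply]
        ring
      rw [this, enorm_mul, enorm_mul, enorm_exp_I_mul, one_mul, mul_pow]

/-- A sequence of smooth cutoffs exhausting the line. -/
lemma exists_cutoff : ∃ χ : ℕ → ℝ → ℂ, (∀ n, IsTest (χ n)) ∧ (∀ n y, ‖χ n y‖ ≤ 1) ∧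
    (∀ y, ∀ᶠ n in atTop, χ n y = 1) ∧
    ∀ j : ℕ, 1 ≤ j → ∃ M : ℝ, 0 ≤ M ∧ ∀ n y, ‖_root_.deriv^[j] (χ n) y‖ ≤ M / (n + 1) := by
  obtain ⟨b⟩ : Nonempty (ContDiffBump (0 : ℝ)) := inferInstance
  set χ₀ : ℝ → ℂ := fun y => (b y : ℂ) with hχ₀
  have ht : IsTest χ₀ := ⟨Complex.ofRealCLM.contDiff.comp b.contDiff,
    b.hasCompactSupport.comp_left (g := ((↑) : ℝ → ℂ)) (by simp)⟩
  have hscale (n : ℕ) : IsTest (fun y => χ₀ ((n + 1 : ℝ)⁻¹ * y)) := by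
    refine ⟨ht.smooth.comp (contDiff_const.mul contDiff_id), ?_⟩
    exact ht.compact.comp_homeomorph
      (Homeomorph.mulLeft₀ ((n + 1 : ℝ)⁻¹) (by positivity))
  have hder (j : ℕ) : ∀ (n : ℕ) (y : ℝ), _root_.deriv^[j] (fun y => χ₀ ((n + 1 : ℝ)⁻¹ * y)) y =
      ((n + 1 : ℝ)⁻¹) ^ j • _root_.deriv^[j] χ₀ ((n + 1 : ℝ)⁻¹ * y) := by
    intro n y
    rw [← iteratedDeriv_eq_iterate, ← iteratedDeriv_eq_iterate]
    exact congrFun (iteratedDeriv_comp_const_smul (contDiff_infty.1 ht.smooth j) _) y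
  refine ⟨fun n y => χ₀ ((n + 1 : ℝ)⁻¹ * y), hscale, fun n y => ?_, fun y => ?_, fun j hj => ?_⟩
  · simp only [hχ₀, Complex.norm_real, Real.norm_eq_abs, abs_of_nonneg b.nonneg]
    exact b.le_one
  · have h1 : Tendsto (fun n : ℕ => (n + 1 : ℝ)⁻¹ * y) atTop (𝓝 (0 * y)) :=
      (tendsto_inv_atTop_zero.comp (tendsto_natCast_atTop_atTop.atTop_add
        (tendsto_const_nhds (x := (1 : ℝ))))).mul_const y
    rw [zero_mul] at h1
    have h2 := h1.eventually b.eventuallyEq_one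
    filter_upwards [h2] with n hn
    simp [hχ₀, hn]
  · obtain ⟨M, hM⟩ := (ht.iterate_deriv j).continuous.bounded_above_of_compact_support
      (ht.iterate_deriv j).compact
    have hM0 : 0 ≤ M := (norm_nonneg _).trans (hM 0)
    refine ⟨M, hM0, fun n y => ?_⟩
    rw [hder, norm_smul, div_eq_inv_mul]
    refine mul_le_mul ?_ (hM _) (norm_nonneg _) (by positivity)
    rw [Real.norm_of_nonneg (by positivity)]
    refine pow_le_of_le_one (by positivity) (inv_le_one_of_one_le₀ (by linarith [n.cast_nonneg (α := ℝ)])) (by omega)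

/-- By Fatou the sum of the finitely many sequences has liminf zero almost everywhere. Summing first
lets one index `n` serve all of them at once, without extracting subsequences. -/
lemma ae_exists_lt_of_tendsto_lintegral {ι : Type*} [Fintype ι] (a : ι → ℕ → ℝ → ℝ≥0∞)
    (hm : ∀ i n, AEMeasurable (a i n)) (h : ∀ i, Tendsto (fun n => ∫⁻ η, a i n η) atTop (𝓝 0)) :
    ∀ᵐ η : ℝ, ∀ ε : ℝ≥0∞, 0 < ε → ∃ n, ∀ i, a i n η < ε := by
  have hms (n : ℕ) : AEMeasurable (fun η => ∑ i, a i n η) :=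
    Finset.aemeasurable_fun_sum _ fun i _ => hm i n
  have hsum : Tendsto (fun n => ∫⁻ η, (hms n).mk _ η) atTop (𝓝 0) := by
    have h1 : ∀ n, ∫⁻ η, (hms n).mk _ η = ∑ i, ∫⁻ η, a i n η := fun n => by
      rw [lintegral_congr_ae (hms n).ae_eq_mk.symm]
      exact lintegral_finsetSum' _ fun i _ => hm i n
    simp only [h1]
    have := tendsto_finsetSum (Finset.univ : Finset ι) fun i _ => h i
    simpa using this
  have hl : ∫⁻ η, liminf (fun n => (hms n).mk _ η) atTop = 0 := by
    refine le_antisymm ((lintegral_liminf_le fun n => ?_).trans_eq hsum.liminf_eq) zero_le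
    exact (hms n).measurable_mk
  rw [lintegral_eq_zero_iff (Measurable.liminf fun n => (hms n).measurable_mk)] at hl
  filter_upwards [hl, ae_all_iff.2 fun n => (hms n).ae_eq_mk] with η hη hmk ε hε
  have : liminf (fun n => (hms n).mk _ η) atTop < ε := by
    rw [hη]; exact hε
  obtain ⟨n, hn⟩ := (frequently_lt_of_liminf_lt (by isBoundedDefault) this).exists
  rw [← hmk] at hn
  exact ⟨n, fun i => (Finset.single_le_sum (f := fun i => a i n η) (fun _ _ => zero_le)
    (Finset.mem_univ i)).trans_lt hn⟩

lemma exp_mul_coef_eq_coef_moving {f : ℝ × ℝ × ℝ → ℝ} (hp : IsPeriodic f) (k l : ℤ) (t : ℝ) :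
    (fun y : ℝ => Complex.exp (Complex.I * ((k : ℝ) * t * y)) * coef k l f y) =
      coef k l (moving t f) := by
  ext y
  rw [coef_moving hp]
  simp

lemma continuous_slice {v : ℝ → ℝ × ℝ × ℝ → ℝ}
    (hc : ContinuousOn (fun q : ℝ × (ℝ × ℝ × ℝ) => v q.1 q.2) (Ici 0 ×ˢ univ))
    {s : ℝ} (hs : 0 ≤ s) : Continuous (v s) :=
  hc.comp_continuous (f := fun X => (s, X)) (by fun_prop) fun X => ⟨hs, mem_univ _⟩

/-! ### Truncation errors vanish for almost every frequency -/

section Truncation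

variable {v : ℝ → ℝ × ℝ × ℝ → ℝ} {χ : ℕ → ℝ → ℂ}

lemma lintegral_tf_sq_le {M : ℝ≥0∞} {f : ℝ × ℝ × ℝ → ℝ} (hf : Continuous f) {ψ : ℝ → ℂ}
    (hψ : IsTest ψ) {B : ℝ} (hB : ∀ y, ‖ψ y‖ ≤ B) (hM : eLpNorm f 2 cell3 ≤ M) (k l : ℤ) (s : ℝ) :
    ∫⁻ η : ℝ, ‖tf ψ (η - (k : ℝ) * s) (coef k l f)‖ₑ ^ 2 ≤
      ENNReal.ofReal (2 * Real.pi) * (ENNReal.ofReal B ^ 2 * M ^ 2) := by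
  rw [lintegral_tf_sq hψ (continuous_coef hf k l)]
  refine mul_le_mul_right ?_ _
  calc _ ≤ ∫⁻ y, ENNReal.ofReal B ^ 2 * ‖coef k l f y‖ₑ ^ 2 := by
        refine lintegral_mono fun y => ?_
        refine mul_le_mul_left ?_ _
        gcongr
        rw [← ofReal_norm]
        exact ENNReal.ofReal_le_ofReal (hB y)
    _ = ENNReal.ofReal B ^ 2 * ∫⁻ y, ‖coef k l f y‖ₑ ^ 2 :=
        lintegral_const_mul' _ _ (by finiteness)
    _ ≤ _ := by
        refine mul_le_mul_right ((lintegral_coef_sq_le hf k l).trans ?_) _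
        rw [← eLpNorm_two_sq]
        gcongr

lemma tendsto_const_mul_div_sq (A M : ℝ≥0∞) (hA : A ≠ ⊤) (hM : M ≠ ⊤) (B : ℝ) :
    Tendsto (fun n : ℕ => A * (ENNReal.ofReal (B / (n + 1)) ^ 2 * M ^ 2)) atTop (𝓝 0) := by
  have h1 : Tendsto (fun n : ℕ => B / (n + 1 : ℝ)) atTop (𝓝 0) :=
    tendsto_const_nhds.div_atTop (tendsto_natCast_atTop_atTop.atTop_add
      (tendsto_const_nhds (x := (1 : ℝ))))
  have h2 := ENNReal.tendsto_ofReal h1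
  rw [ENNReal.ofReal_zero] at h2
  have h3 := ENNReal.Tendsto.const_mul (a := A * M ^ 2) (ENNReal.Tendsto.pow (n := 2) h2) (Or.inr (by finiteness))
  rw [zero_pow two_ne_zero, mul_zero] at h3
  refine h3.congr fun n => by ring

/-- After Plancherel, dominated convergence with `|χ_n - 1| ≤ 2`. -/
lemma tendsto_lintegral_tf_sub_sq {f : ℝ × ℝ × ℝ → ℝ} (hf : Continuous f) (hp : IsPeriodic f)
    (h2 : MemLp f 2 cell3) (hχ : ∀ n, IsTest (χ n)) (h1 : ∀ n y, ‖χ n y‖ ≤ 1)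
    (hlim : ∀ y, ∀ᶠ n in atTop, χ n y = 1) (k l : ℤ) (s : ℝ) :
    Tendsto (fun n => ∫⁻ η : ℝ, ‖tf (χ n) (η - (k : ℝ) * s) (coef k l f) -
      fourier3 (moving s f) k η l‖ₑ ^ 2) atTop (𝓝 0) := by
  have hcc := continuous_coef hf k l
  have hm := memLp_coef hf h2 k l
  have e (n : ℕ) := lintegral_tf_sub_sq (hχ n) hcc hm k s
  simp only [exp_mul_coef_eq_coef_moving hp] at e
  simp only [fourier3_eq, e]
  have hfin := (memLp_two_iff_lintegral hcc.aestronglyMeasurable).1 hm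
  have hlimit : Tendsto (fun n => ∫⁻ y, ‖χ n y - 1‖ₑ ^ 2 * ‖coef k l f y‖ₑ ^ 2) atTop
      (𝓝 (∫⁻ _ : ℝ, 0)) := by
    refine tendsto_lintegral_of_dominated_convergence
      (fun y => ENNReal.ofReal 2 ^ 2 * ‖coef k l f y‖ₑ ^ 2) (fun n => ?_) (fun n => ?_) ?_ ?_
    · have := (hχ n).continuous
      fun_prop
    · refine .of_forall fun y => mul_le_mul_left ?_ _
      gcongr
      rw [← ofReal_norm]
      refine ENNReal.ofReal_le_ofReal ((norm_sub_le _ _).trans ?_)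
      rw [norm_one]
      linarith [h1 n y]
    · rw [lintegral_const_mul' _ _ (by finiteness)]
      finiteness
    · refine .of_forall fun y => tendsto_const_nhds.congr' ?_
      filter_upwards [hlim y] with n hn
      simp [hn]
  rw [lintegral_zero] at hlimit
  have := ENNReal.Tendsto.const_mul (a := ENNReal.ofReal (2 * Real.pi)) hlimit (Or.inr (by finiteness))
  rwa [mul_zero] at this

lemma aemeasurable_tf_sq (hc : ContinuousOn (fun q : ℝ × (ℝ × ℝ × ℝ) => v q.1 q.2) (Ici 0 ×ˢ univ))
    {ψ : ℝ → ℂ} (hψ : IsTest ψ) (k l : ℤ) (t : ℝ) :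
    AEMeasurable (fun q : ℝ × ℝ => ‖tf ψ (q.2 - (k : ℝ) * q.1) (coef k l (v q.1))‖ₑ ^ 2)
      ((volume.restrict (Icc 0 t)).prod volume) := by
  have h1 := continuousOn_tf (g := fun τ => coef k l (v τ)) hψ (continuousOn_coef hc k l) k
  have h2 : ((volume.restrict (Icc 0 t)).prod volume : Measure (ℝ × ℝ)) =
      (volume.prod volume).restrict (Icc 0 t ×ˢ univ) := by
    rw [← Measure.prod_restrict, Measure.restrict_univ]
  rw [h2]
  have h3 := (h1.mono (prod_mono (fun x (hx : x ∈ Icc 0 t) => hx.1) subset_rfl)).aestronglyMeasurable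
    (μ := volume.prod volume) (measurableSet_Icc.prod MeasurableSet.univ)
  exact h3.enorm.pow_const 2

/-- For almost every frequency, the truncation errors can be made arbitrarily small. -/
theorem ae_exists_truncation {m : ℕ} {v : Fin m → ℝ → ℝ × ℝ × ℝ → ℝ}
    (hc : ∀ i, ContinuousOn (fun q : ℝ × (ℝ × ℝ × ℝ) => v i q.1 q.2) (Ici 0 ×ˢ univ))
    (h2 : ∀ i, LocallyBoundedL2 (Ici 0) (v i)) (hp : ∀ i t, 0 ≤ t → IsPeriodic (v i t))
    (k l : ℤ) {t : ℝ} (ht : 0 ≤ t) :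
    ∀ᵐ η : ℝ, ∀ ε : ℝ≥0∞, 0 < ε → ∃ χ : ℝ → ℂ, IsTest χ ∧ ∀ i, ∀ j : Fin 3,
      ∫⁻ τ in Icc 0 t, ‖tf (deriv^[j + 1] χ) (η - (k : ℝ) * τ) (coef k l (v i τ))‖ₑ ^ 2 < ε ∧
      ∀ s ∈ ({0, t} : Set ℝ),
        ‖tf (deriv^[j + 1] χ) (η - (k : ℝ) * s) (coef k l (v i s))‖ₑ ^ 2 < ε ∧
        ‖tf χ (η - (k : ℝ) * s) (coef k l (v i s)) - fourier3 (moving s (v i s)) k η l‖ₑ ^ 2 < ε := by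
  obtain ⟨χ, hχ, h1, hlim, hder⟩ := exists_cutoff
  let S : Fin 2 → ℝ := ![0, t]
  have hS (b : Fin 2) : S b ∈ Ici (0 : ℝ) := by
    fin_cases b
    · exact mem_Ici.2 le_rfl
    · exact ht
  let a₁ : Fin m × Fin 3 → ℕ → ℝ → ℝ≥0∞ := fun p n η =>
    ∫⁻ τ in Icc 0 t, ‖tf (deriv^[p.2 + 1] (χ n)) (η - (k : ℝ) * τ) (coef k l (v p.1 τ))‖ₑ ^ 2
  let a₂ : (Fin m × Fin 3) × Fin 2 → ℕ → ℝ → ℝ≥0∞ := fun p n η =>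
    ‖tf (deriv^[p.1.2 + 1] (χ n)) (η - (k : ℝ) * S p.2) (coef k l (v p.1.1 (S p.2)))‖ₑ ^ 2
  let a₃ : Fin m × Fin 2 → ℕ → ℝ → ℝ≥0∞ := fun p n η =>
    ‖tf (χ n) (η - (k : ℝ) * S p.2) (coef k l (v p.1 (S p.2))) -
      fourier3 (moving (S p.2) (v p.1 (S p.2))) k η l‖ₑ ^ 2
  have hcont (ψ : ℝ → ℂ) (hψ : IsTest ψ) (i : Fin m) (b : Fin 2) :
      Continuous fun η : ℝ => tf ψ (η - (k : ℝ) * S b) (coef k l (v i (S b))) := by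
    have h := continuousOn_tf (g := fun τ => coef k l (v i τ)) hψ (continuousOn_coef (hc i) k l) k
    exact h.comp_continuous (f := fun η : ℝ => (S b, η)) (by fun_prop)
      fun η => ⟨hS b, mem_univ _⟩
  -- The families are the commutators in `L²` in time, the commutators at the end times, and the
  -- truncation errors at the end times.
  have key := ae_exists_lt_of_tendsto_lintegral (Sum.elim a₁ (Sum.elim a₂ a₃)) ?_ ?_
  · filter_upwards [key] with η hη ε hε
    obtain ⟨n, hn⟩ := hη ε hε
    refine ⟨χ n, hχ n, fun i j => ⟨hn (Sum.inl (i, j)), fun s hs => ?_⟩⟩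
    obtain ⟨b, rfl⟩ : ∃ b, S b = s := by
      rcases hs with hs | hs
      · exact ⟨0, hs.symm⟩
      · exact ⟨1, hs.symm⟩
    exact ⟨hn (Sum.inr (Sum.inl ((i, j), b))), hn (Sum.inr (Sum.inr (i, b)))⟩
  · rintro (⟨i, j⟩ | ⟨⟨i, j⟩, b⟩ | ⟨i, b⟩) n
    · exact (aemeasurable_tf_sq (hc i) ((hχ n).iterate_deriv (j + 1)) k l t).lintegral_prod_left'
    · exact ((hcont _ ((hχ n).iterate_deriv (j + 1)) i b).enorm.measurable.pow_const 2).aemeasurable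
    · refine AEMeasurable.pow_const (AEStronglyMeasurable.enorm ?_) 2
      refine (hcont _ (hχ n) i b).aestronglyMeasurable.sub ?_
      exact aestronglyMeasurable_lineFourier _
  · rintro (⟨i, j⟩ | ⟨⟨i, j⟩, b⟩ | ⟨i, b⟩)
    · obtain ⟨M, hM, hb⟩ := h2 i t
      obtain ⟨B, hB, hBb⟩ := hder (j + 1) (by omega)
      refine tendsto_of_tendsto_of_tendsto_of_le_of_le tendsto_const_nhds
        (tendsto_const_mul_div_sq (ENNReal.ofReal (2 * Real.pi) * volume (Icc 0 t)) M
          (ENNReal.mul_ne_top ENNReal.ofReal_ne_top (by simp)) hM B) (fun n => zero_le) (fun n => ?_)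
      simp only [Sum.elim_inl, a₁]
      -- With the frequency integral inside, Plancherel applies at each time, and the `L²` bound is
      -- uniform on `[0, t]`.
      rw [lintegral_lintegral_swap
        (aemeasurable_tf_sq (hc i) ((hχ n).iterate_deriv (j + 1)) k l t).prod_swap]
      calc _ ≤ ∫⁻ _ in Icc 0 t, ENNReal.ofReal (2 * Real.pi) *
            (ENNReal.ofReal (B / (n + 1)) ^ 2 * M ^ 2) := by
            refine setLIntegral_mono' measurableSet_Icc fun τ hτ => ?_
            exact lintegral_tf_sq_le (continuous_slice (hc i) hτ.1)
              ((hχ n).iterate_deriv (j + 1)) (hBb n) (hb τ hτ.1 hτ.2).2 k l τ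
        _ = _ := by
          rw [setLIntegral_const]
          ring
    · obtain ⟨M, hM, hb⟩ := h2 i (S b)
      obtain ⟨B, hB, hBb⟩ := hder (j + 1) (by omega)
      refine tendsto_of_tendsto_of_tendsto_of_le_of_le tendsto_const_nhds
        (tendsto_const_mul_div_sq (ENNReal.ofReal (2 * Real.pi)) M
          (by finiteness) hM B) (fun n => zero_le) (fun n => ?_)
      exact lintegral_tf_sq_le (continuous_slice (hc i) (hS b))
              ((hχ n).iterate_deriv (j + 1)) (hBb n) (hb _ (hS b) le_rfl).2 k l _
    · obtain ⟨M, hM, hb⟩ := h2 i (S b)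
      exact tendsto_lintegral_tf_sub_sq (continuous_slice (hc i) (hS b)) (hp i _ (hS b))
        (hb _ (hS b) le_rfl).1 hχ h1 hlim k l _

end Truncation

/-! ### Calculus of truncated transforms -/

lemma integrable_tf_integrand {χ g : ℝ → ℂ} (hχ : IsTest χ) (hg : Continuous g) (ξ : ℝ) :
    Integrable (fun y : ℝ => χ y * Complex.exp (-Complex.I * (ξ * y)) * g y) := by
  have := hχ.continuous
  refine Continuous.integrable_of_hasCompactSupport (by fun_prop) ?_
  exact hχ.compact.mul_right.mul_right

lemma tf_add {χ g₁ g₂ : ℝ → ℂ} (hχ : IsTest χ) (h₁ : Continuous g₁) (h₂ : Continuous g₂) (ξ : ℝ) :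
    tf χ ξ (fun y => g₁ y + g₂ y) = tf χ ξ g₁ + tf χ ξ g₂ := by
  unfold tf
  rw [← integral_add (integrable_tf_integrand hχ h₁ ξ) (integrable_tf_integrand hχ h₂ ξ)]
  refine integral_congr_ae (.of_forall fun y => ?_)
  simp only
  ring

lemma tf_const_mul (χ g : ℝ → ℂ) (c : ℂ) (ξ : ℝ) :
    tf χ ξ (fun y => c * g y) = c * tf χ ξ g := by
  unfold tf
  rw [← integral_const_mul]
  refine integral_congr_ae (.of_forall fun y => ?_)
  simp only
  ring

lemma tf_zero (χ : ℝ → ℂ) (ξ : ℝ) : tf χ ξ (fun _ => 0) = 0 := by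
  simp [tf]

lemma hasDerivAt_exp_mul (ξ y : ℝ) : HasDerivAt (fun y : ℝ => Complex.exp (-Complex.I * (ξ * y)))
    (Complex.exp (-Complex.I * (ξ * y)) * (-Complex.I * ξ)) y := by
  have := (((hasDerivAt_id y).ofReal_comp.const_mul (ξ : ℂ)).const_mul (-Complex.I)).cexp
  simpa using this

/-- Integration by parts. The last term is the commutator with the cutoff, the only difference from
the exact transform. -/
lemma tf_deriv {χ g g' : ℝ → ℂ} (hχ : IsTest χ) (hg : ∀ y, HasDerivAt g (g' y) y)
    (hg' : Continuous g') (ξ : ℝ) :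
    tf χ ξ g' = Complex.I * ξ * tf χ ξ g - tf (deriv χ) ξ g := by
  have hgc : Continuous g := continuous_iff_continuousAt.2 fun x => (hg x).continuousAt
  have hd (y : ℝ) : HasDerivAt (fun y : ℝ => χ y * Complex.exp (-Complex.I * (ξ * y)) * g y)
      ((deriv χ y * Complex.exp (-Complex.I * (ξ * y)) +
        χ y * (Complex.exp (-Complex.I * (ξ * y)) * (-Complex.I * ξ))) * g y +
        χ y * Complex.exp (-Complex.I * (ξ * y)) * g' y) y :=
    ((hχ.hasDerivAt y).mul (hasDerivAt_exp_mul ξ y)).mul (hg y)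
  have e (y : ℝ) : (deriv χ y * Complex.exp (-Complex.I * (ξ * y)) +
        χ y * (Complex.exp (-Complex.I * (ξ * y)) * (-Complex.I * ξ))) * g y +
        χ y * Complex.exp (-Complex.I * (ξ * y)) * g' y =
      deriv χ y * Complex.exp (-Complex.I * (ξ * y)) * g y +
      (-Complex.I * ξ) * (χ y * Complex.exp (-Complex.I * (ξ * y)) * g y) +
      χ y * Complex.exp (-Complex.I * (ξ * y)) * g' y := by ring
  simp only [e] at hd
  have i1 := integrable_tf_integrand hχ.deriv hgc ξ
  have i2 := (integrable_tf_integrand hχ hgc ξ).const_mul (-Complex.I * ξ)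
  have i3 := integrable_tf_integrand hχ hg' ξ
  have i12 : Integrable (fun y : ℝ => deriv χ y * Complex.exp (-Complex.I * (ξ * y)) * g y +
      (-Complex.I * ξ) * (χ y * Complex.exp (-Complex.I * (ξ * y)) * g y)) := i1.add i2
  have := integral_eq_zero_of_hasDerivAt_of_integrable hd (i12.add i3)
    (integrable_tf_integrand hχ hgc ξ)
  rw [integral_add i12 i3, integral_add i1 i2, integral_const_mul] at this
  unfold tf
  linear_combination this

lemma tf_deriv_deriv {χ g g' g'' : ℝ → ℂ} (hχ : IsTest χ) (hg : ∀ y, HasDerivAt g (g' y) y)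
    (hg' : ∀ y, HasDerivAt g' (g'' y) y) (hg'' : Continuous g'') (ξ : ℝ) :
    tf χ ξ g'' = -(ξ : ℂ) ^ 2 * tf χ ξ g - 2 * Complex.I * ξ * tf (deriv χ) ξ g +
      tf (deriv (deriv χ)) ξ g := by
  have hgc : Continuous g' := continuous_iff_continuousAt.2 fun x => (hg' x).continuousAt
  rw [tf_deriv hχ hg' hg'', tf_deriv hχ hg hgc, tf_deriv hχ.deriv hg hgc]
  linear_combination (ξ : ℂ) ^ 2 * tf χ ξ g * Complex.I_sq

/-- The symbol of `-Δ` in the moving frame. -/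
def symb (k l : ℤ) (η s : ℝ) : ℝ := (k : ℝ) ^ 2 + (η - k * s) ^ 2 + (l : ℝ) ^ 2

lemma hasDerivAt_time {v : ℝ → ℝ × ℝ × ℝ → ℝ}
    (hv : ContDiffOn ℝ ∞ (fun q : ℝ × (ℝ × ℝ × ℝ) => v q.1 q.2) (Ioi 0 ×ˢ univ)) {s : ℝ}
    (hs : 0 < s) (X : ℝ × ℝ × ℝ) : HasDerivAt (fun τ => v τ X) (deriv (fun τ => v τ X) s) s := by
  have ho : IsOpen (Ioi (0 : ℝ) ×ˢ (univ : Set (ℝ × ℝ × ℝ))) := isOpen_Ioi.prod isOpen_univ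
  have hd := (hv.differentiableOn (by simp)).differentiableAt (ho.mem_nhds (x := (s, X))
    ⟨hs, mem_univ _⟩)
  have : DifferentiableAt ℝ (fun τ => v τ X) s :=
    hd.comp s (f := fun τ : ℝ => (τ, X)) (by fun_prop)
  exact this.hasDerivAt

lemma continuousOn_deriv_time {v : ℝ → ℝ × ℝ × ℝ → ℝ}
    (hv : ContDiffOn ℝ ∞ (fun q : ℝ × (ℝ × ℝ × ℝ) => v q.1 q.2) (Ioi 0 ×ˢ univ)) :
    ContinuousOn (fun q : ℝ × (ℝ × ℝ × ℝ) => deriv (fun τ => v τ q.2) q.1) (Ioi 0 ×ˢ univ) := by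
  have ho : IsOpen (Ioi (0 : ℝ) ×ˢ (univ : Set (ℝ × ℝ × ℝ))) := isOpen_Ioi.prod isOpen_univ
  have h1 := (hv.continuousOn_fderiv_of_isOpen ho (by simp)).clm_apply
    (continuousOn_const (c := ((1 : ℝ), (0 : ℝ × ℝ × ℝ))))
  refine h1.congr fun q hq => ?_
  have hd := ((hv.differentiableOn (by simp)).differentiableAt (ho.mem_nhds hq)).hasFDerivAt
  exact (hd.comp_hasDerivAt q.1 (f := fun τ : ℝ => (τ, q.2))
    ((hasDerivAt_id q.1).prodMk (hasDerivAt_const q.1 q.2))).deriv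

lemma contDiff_slice {v : ℝ → ℝ × ℝ × ℝ → ℝ}
    (hv : ContDiffOn ℝ ∞ (fun q : ℝ × (ℝ × ℝ × ℝ) => v q.1 q.2) (Ioi 0 ×ˢ univ)) {s : ℝ}
    (hs : 0 < s) : ContDiff ℝ ∞ (v s) := by
  have := hv.comp (s := univ) (f := fun X : ℝ × ℝ × ℝ => (s, X)) (by fun_prop)
    (fun X _ => ⟨hs, mem_univ _⟩)
  exact contDiffOn_univ.1 this

lemma continuous_lap {f : ℝ × ℝ × ℝ → ℝ} (hf : ContDiff ℝ ∞ f) : Continuous (lap f) := by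
  have h1 := (contDiff_dX (contDiff_dX hf)).continuous
  have h2 := (contDiff_dY (contDiff_dY hf)).continuous
  have h3 := (contDiff_dZ (contDiff_dZ hf)).continuous
  unfold lap
  fun_prop

/-- Differentiating the phase produces the factor `iky` that compensates `y ∂_x`, so that no
unbounded factor `y` survives in `hasDerivAt_tf_of_eq`. -/
lemma hasDerivAt_tf_time {v w : ℝ → ℝ × ℝ × ℝ → ℝ} {χ : ℝ → ℂ} (hχ : IsTest χ)
    (hv : ContinuousOn (fun q : ℝ × (ℝ × ℝ × ℝ) => v q.1 q.2) (Ioi 0 ×ˢ univ))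
    (hw : ContinuousOn (fun q : ℝ × (ℝ × ℝ × ℝ) => w q.1 q.2) (Ioi 0 ×ˢ univ))
    (hd : ∀ s, 0 < s → ∀ X, HasDerivAt (fun τ => v τ X) (w s X) s) (k l : ℤ) (η : ℝ) {t : ℝ}
    (ht : 0 < t) :
    HasDerivAt (fun τ => tf χ (η - k * τ) (coef k l (v τ)))
      (tf χ (η - k * t) (fun y => Complex.I * (k * y) * coef k l (v t) y + coef k l (w t) y)) t := by
  obtain ⟨N, hN, h⟩ := hχ.exists_support
  simp only [tf_eq_intervalIntegral hN h]
  have hc := hχ.continuous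
  have hcv := continuousOn_coef hv k l
  have hcw := continuousOn_coef hw k l
  have swp (G : ℝ → ℝ → ℂ) (hG : ContinuousOn (fun q : ℝ × ℝ => G q.1 q.2) (Ioi 0 ×ˢ univ)) :
      ContinuousOn (Function.uncurry fun (τ : ℝ) (y : ℝ) => χ y *
        Complex.exp (-Complex.I * ((η - k * τ : ℝ) * y)) * G τ y) (Ioi 0 ×ˢ univ) := by
    unfold Function.uncurry
    exact ContinuousOn.mul (Continuous.continuousOn (by fun_prop)) hG
  refine hasDerivAt_intervalIntegral isOpen_Ioi
    (F := fun (τ : ℝ) (y : ℝ) => χ y *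
      Complex.exp (-Complex.I * ((η - k * τ : ℝ) * y)) * coef k l (v τ) y)
    (F' := fun (τ : ℝ) (y : ℝ) => χ y * Complex.exp (-Complex.I * ((η - k * τ : ℝ) * y)) *
      (Complex.I * (k * y) * coef k l (v τ) y + coef k l (w τ) y))
    (swp _ hcv) (swp (fun τ y => Complex.I * (k * y) * coef k l (v τ) y + coef k l (w τ) y) ?_)
    (fun s hs y => ?_) _ _ ht
  · exact (ContinuousOn.mul (Continuous.continuousOn (by fun_prop)) hcv).add hcw
  · have h1 := hasDerivAt_coef_param isOpen_Ioi (y := y) hv hw (fun s hs x z => hd s hs (x, y, z))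
      k l hs
    have h2 : HasDerivAt (fun τ : ℝ => Complex.exp (-Complex.I * ((η - k * τ : ℝ) * y)))
        (Complex.exp (-Complex.I * ((η - k * s : ℝ) * y)) * (-Complex.I * ((-k : ℝ) * y))) s := by
      have h3 : HasDerivAt (fun τ : ℝ => η - k * τ) (-k : ℝ) s := by
        simpa using ((hasDerivAt_id s).const_mul (k : ℝ)).const_sub η
      exact ((h3.ofReal_comp.mul_const (y : ℂ)).const_mul (-Complex.I)).cexp
    convert! (h2.mul h1).const_mul (χ y) using 1
    · ext τ
      simp only [Pi.mul_apply]
      ring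
    · push_cast
      ring

/-- The truncated transform of a solution of an advection-diffusion equation. -/
lemma hasDerivAt_tf_of_eq {v : ℝ → ℝ × ℝ × ℝ → ℝ} {χ : ℝ → ℂ} (hχ : IsTest χ)
    (hv : ContDiffOn ℝ ∞ (fun q : ℝ × (ℝ × ℝ × ℝ) => v q.1 q.2) (Ioi 0 ×ˢ univ)) {t : ℝ}
    (ht : 0 < t) (hp : IsPeriodic (v t)) {S : ℝ × ℝ × ℝ → ℝ} (hS : Continuous S) {ν : ℝ}
    (heq : ∀ X, deriv (fun τ => v τ X) t + X.2.1 * dX (v t) X - ν * lap (v t) X + S X = 0)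
    (k l : ℤ) (η : ℝ) :
    HasDerivAt (fun τ => tf χ (η - k * τ) (coef k l (v τ)))
      (-ν * symb k l η t * tf χ (η - k * t) (coef k l (v t)) +
        ν * (tf (deriv (deriv χ)) (η - k * t) (coef k l (v t)) -
          2 * Complex.I * (η - k * t) * tf (deriv χ) (η - k * t) (coef k l (v t))) -
        tf χ (η - k * t) (coef k l S)) t := by
  have hf := contDiff_slice hv ht
  have hX := (contDiff_dX hf).continuous
  have hY := contDiff_dY hf
  have hL := continuous_lap hf
  have h1 := hasDerivAt_tf_time hχ hv.continuousOn (continuousOn_deriv_time hv)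
    (fun s hs X => hasDerivAt_time hv hs X) k l η ht
  convert! h1 using 1
  have e1 : (fun X : ℝ × ℝ × ℝ => deriv (fun τ => v τ X) t) = fun X =>
      ((-X.2.1) * dX (v t) X + ν * lap (v t) X) + (-1) * S X := by
    ext X
    linarith [heq X]
  have e2 (y : ℝ) : Complex.I * (k * y) * coef k l (v t) y +
      coef k l (fun X : ℝ × ℝ × ℝ => deriv (fun τ => v τ X) t) y =
      (ν * coef k l (dY (dY (v t))) y + (-ν * ((k : ℂ) ^ 2 + (l : ℂ) ^ 2)) * coef k l (v t) y) +
        (-1) * coef k l S y := by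
    rw [e1, coef_add (by fun_prop) (by fun_prop), coef_add (by fun_prop) (by fun_prop),
      coef_mul (fun y => -y), coef_const_mul, coef_const_mul, coef_dX hf hp, coef_lap hf hp]
    push_cast
    ring
  have hcf := continuous_coef hf.continuous k l
  have hcyy := continuous_coef (contDiff_dY hY).continuous k l
  have hcS := continuous_coef hS k l
  simp only [e2]
  rw [tf_add hχ (by fun_prop) (by fun_prop), tf_add hχ (by fun_prop) (by fun_prop),
    tf_const_mul, tf_const_mul, tf_const_mul,
    tf_deriv_deriv hχ (hasDerivAt_coef hf k l) (hasDerivAt_coef hY k l) hcyy, symb]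
  push_cast
  ring

lemma tf_coef_add {χ : ℝ → ℂ} (hχ : IsTest χ) {f g : ℝ × ℝ × ℝ → ℝ} (hf : Continuous f)
    (hg : Continuous g) (k l : ℤ) (ξ : ℝ) :
    tf χ ξ (coef k l fun X => f X + g X) = tf χ ξ (coef k l f) + tf χ ξ (coef k l g) := by
  rw [← tf_add hχ (continuous_coef hf k l) (continuous_coef hg k l)]
  congr 1
  ext y
  exact coef_add hf hg k l y

lemma tf_coef_const_mul (χ : ℝ → ℂ) (c : ℝ) (f : ℝ × ℝ × ℝ → ℝ) (k l : ℤ) (ξ : ℝ) :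
    tf χ ξ (coef k l fun X => c * f X) = c * tf χ ξ (coef k l f) := by
  rw [← tf_const_mul]
  congr 1
  ext y
  exact coef_const_mul c f k l y

lemma tf_coef_dX (χ : ℝ → ℂ) {f : ℝ × ℝ × ℝ → ℝ} (hf : ContDiff ℝ ∞ f) (hp : IsPeriodic f)
    (k l : ℤ) (ξ : ℝ) : tf χ ξ (coef k l (dX f)) = Complex.I * k * tf χ ξ (coef k l f) := by
  rw [← tf_const_mul]
  congr 1
  ext y
  exact coef_dX hf hp k l y

lemma tf_coef_dZ (χ : ℝ → ℂ) {f : ℝ × ℝ × ℝ → ℝ} (hf : ContDiff ℝ ∞ f) (hp : IsPeriodic f)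
    (k l : ℤ) (ξ : ℝ) : tf χ ξ (coef k l (dZ f)) = Complex.I * l * tf χ ξ (coef k l f) := by
  rw [← tf_const_mul]
  congr 1
  ext y
  exact coef_dZ hf hp k l y

lemma tf_coef_dY {χ : ℝ → ℂ} (hχ : IsTest χ) {f : ℝ × ℝ × ℝ → ℝ} (hf : ContDiff ℝ ∞ f)
    (k l : ℤ) (ξ : ℝ) : tf χ ξ (coef k l (dY f)) =
      Complex.I * ξ * tf χ ξ (coef k l f) - tf (deriv χ) ξ (coef k l f) :=
  tf_deriv hχ (hasDerivAt_coef hf k l) (continuous_coef (contDiff_dY hf).continuous k l) ξ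

lemma tf_divergence {χ : ℝ → ℂ} (hχ : IsTest χ) {v : Fin 3 → ℝ × ℝ × ℝ → ℝ}
    (hv : ∀ i, ContDiff ℝ ∞ (v i)) (hp : ∀ i, IsPeriodic (v i)) (hdiv : ∀ X, divergence v X = 0)
    (k l : ℤ) (ξ : ℝ) :
    Complex.I * k * tf χ ξ (coef k l (v 0)) + Complex.I * ξ * tf χ ξ (coef k l (v 1)) +
      Complex.I * l * tf χ ξ (coef k l (v 2)) = tf (deriv χ) ξ (coef k l (v 1)) := by
  have h0 := (contDiff_dX (hv 0)).continuous
  have h1 := (contDiff_dY (hv 1)).continuous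
  have h2 := (contDiff_dZ (hv 2)).continuous
  have e : (fun X => (dX (v 0) X + dY (v 1) X) + dZ (v 2) X) = fun _ => 0 := by
    ext X
    exact hdiv X
  have h3 : tf χ ξ (coef k l fun X => (dX (v 0) X + dY (v 1) X) + dZ (v 2) X) = 0 := by
    rw [e]
    have : coef k l (fun _ => 0) = fun _ => 0 := by
      ext y
      simp [coef]
    rw [this, tf_zero]
  rw [tf_coef_add hχ (by fun_prop) h2, tf_coef_add hχ h0 h1, tf_coef_dX χ (hv 0) (hp 0),
    tf_coef_dY hχ (hv 1), tf_coef_dZ χ (hv 2) (hp 2)] at h3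
  linear_combination h3

/-! ### Approximate solutions of the mode equations -/

/-- Sequences of functions on `[0, t]` that vanish in the limit, in `L²(0, t)` and at both ends. -/
structure IsSmall (t : ℝ) (f : ℕ → ℝ → ℂ) : Prop where
  cont : ∀ n, ContinuousOn (f n) (Icc 0 t)
  lim : Tendsto (fun n => ∫ s in (0 : ℝ)..t, ‖f n s‖ ^ 2) atTop (𝓝 0)
  left : Tendsto (fun n => f n 0) atTop (𝓝 0)
  right : Tendsto (fun n => f n t) atTop (𝓝 0)

lemma IsSmall.add {t : ℝ} (ht : 0 ≤ t) {f g : ℕ → ℝ → ℂ} (hf : IsSmall t f) (hg : IsSmall t g) :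
    IsSmall t (fun n s => f n s + g n s) where
  cont n := (hf.cont n).add (hg.cont n)
  lim := by
    have hi (f : ℕ → ℝ → ℂ) (hf : IsSmall t f) (n : ℕ) :
        IntervalIntegrable (fun s => 2 * ‖f n s‖ ^ 2) volume 0 t :=
      (ContinuousOn.mul continuousOn_const ((hf.cont n).norm.pow 2)).intervalIntegrable_of_Icc ht
    have h := ((hf.lim.const_mul 2).add (hg.lim.const_mul 2))
    rw [mul_zero, add_zero] at h
    refine tendsto_of_tendsto_of_tendsto_of_le_of_le tendsto_const_nhds h
      (fun n => intervalIntegral.integral_nonneg ht fun s _ => by positivity) (fun n => ?_)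
    simp only
    rw [← intervalIntegral.integral_const_mul, ← intervalIntegral.integral_const_mul,
      ← intervalIntegral.integral_add (hi f hf n) (hi g hg n)]
    refine intervalIntegral.integral_mono_on ht
      ((((hf.cont n).add (hg.cont n)).norm.pow 2).intervalIntegrable_of_Icc ht)
      ((hi f hf n).add (hi g hg n)) fun s _ => ?_
    have := norm_add_le (f n s) (g n s)
    nlinarith [norm_nonneg (f n s + g n s), sq_nonneg (‖f n s‖ - ‖g n s‖)]
  left := by simpa using hf.left.add hg.left
  right := by simpa using hf.right.add hg.right

lemma IsSmall.mul {t : ℝ} (ht : 0 ≤ t) {f : ℕ → ℝ → ℂ} (hf : IsSmall t f) {c : ℝ → ℂ}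
    (hc : ContinuousOn c (Icc 0 t)) : IsSmall t (fun n s => c s * f n s) where
  cont n := hc.mul (hf.cont n)
  lim := by
    obtain ⟨K, hK⟩ := isCompact_Icc.exists_bound_of_continuousOn hc
    have h := hf.lim.const_mul (K ^ 2)
    rw [mul_zero] at h
    refine tendsto_of_tendsto_of_tendsto_of_le_of_le tendsto_const_nhds h
      (fun n => intervalIntegral.integral_nonneg ht fun s _ => by positivity) (fun n => ?_)
    simp only
    rw [← intervalIntegral.integral_const_mul]
    refine intervalIntegral.integral_mono_on ht
      (((hc.mul (hf.cont n)).norm.pow 2).intervalIntegrable_of_Icc ht)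
      ((ContinuousOn.mul continuousOn_const
        ((hf.cont n).norm.pow 2)).intervalIntegrable_of_Icc ht) fun s hs => ?_
    rw [norm_mul, mul_pow]
    gcongr
    exact hK s hs
  left := by simpa using hf.left.const_mul (c 0)
  right := by simpa using hf.right.const_mul (c t)

lemma IsSmall.congr {t : ℝ} {f g : ℕ → ℝ → ℂ} (hf : IsSmall t f) (h : ∀ n s, g n s = f n s) :
    IsSmall t g := by
  have : g = f := by ext n s; exact h n s
  rwa [this]

/-- Sequences `a` (for `u¹, u², u³, θ`) solving the equations of the mode `(k, η, l)` up to small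
errors `e`, with pressure `P` and divergence `d`, and with limits `A₀`, `A₁` at times `0`, `t`. -/
structure IsApproxSolution (ν α β : ℝ) (k l : ℤ) (η t : ℝ) (A₀ A₁ : Fin 4 → ℂ)
    (a e : Fin 4 → ℕ → ℝ → ℂ) (P d : ℕ → ℝ → ℂ) : Prop where
  cont : ∀ i n, ContinuousOn (a i n) (Icc 0 t)
  small : ∀ i, IsSmall t (e i)
  small_div : IsSmall t d
  eq0 : ∀ n, ∀ s ∈ Ioo 0 t, HasDerivAt (a 0 n) (-ν * symb k l η s * a 0 n s
    - Complex.I * k * P n s - (1 - β) * a 1 n s + e 0 n s) s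
  eq1 : ∀ n, ∀ s ∈ Ioo 0 t, HasDerivAt (a 1 n) (-ν * symb k l η s * a 1 n s
    - Complex.I * (η - k * s : ℝ) * P n s - β * a 0 n s + e 1 n s) s
  eq2 : ∀ n, ∀ s ∈ Ioo 0 t, HasDerivAt (a 2 n) (-ν * symb k l η s * a 2 n s
    - Complex.I * l * P n s - α * a 3 n s + e 2 n s) s
  eq3 : ∀ n, ∀ s ∈ Ioo 0 t, HasDerivAt (a 3 n) (-ν * symb k l η s * a 3 n s
    + α * a 2 n s + e 3 n s) s
  div : ∀ n, ∀ s ∈ Icc 0 t, Complex.I * k * a 0 n s + Complex.I * (η - k * s : ℝ) * a 1 n s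
    + Complex.I * l * a 2 n s = d n s
  left : ∀ i, Tendsto (fun n => a i n 0) atTop (𝓝 (A₀ i))
  right : ∀ i, Tendsto (fun n => a i n t) atTop (𝓝 (A₁ i))

/-- The four unknowns `u¹, u², u³, θ`. -/
def fields (u : Fin 3 → ℝ → ℝ × ℝ × ℝ → ℝ) (θ : ℝ → ℝ × ℝ × ℝ → ℝ) :
    Fin 4 → ℝ → ℝ × ℝ × ℝ → ℝ := ![u 0, u 1, u 2, θ]

/-- The Fourier transforms of the unknowns in the moving frame at time `s`. -/
def modeAt (u : Fin 3 → ℝ → ℝ × ℝ × ℝ → ℝ) (θ : ℝ → ℝ × ℝ × ℝ → ℝ) (k l : ℤ) (η s : ℝ) (i : Fin 4) :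
    ℂ := fourier3 (moving s (fields u θ i s)) k η l

/-- `ae_exists_truncation` with `ε = 1/(n+1)`. Derivatives of the cutoff up to the third are needed:
viscosity costs two, and the pressure correction starts from an equation already tested with `χ'`.
-/
lemma exists_truncation_seq {m : ℕ} {v : Fin m → ℝ → ℝ × ℝ × ℝ → ℝ}
    (hc : ∀ i, ContinuousOn (fun q : ℝ × (ℝ × ℝ × ℝ) => v i q.1 q.2) (Ici 0 ×ˢ univ))
    (h2 : ∀ i, LocallyBoundedL2 (Ici 0) (v i)) (hp : ∀ i t, 0 ≤ t → IsPeriodic (v i t))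
    (k l : ℤ) {t : ℝ} (ht : 0 ≤ t) :
    ∀ᵐ η : ℝ, ∃ χ : ℕ → ℝ → ℂ, (∀ n, IsTest (χ n)) ∧
      (∀ i, ∀ j ∈ ({1, 2, 3} : Set ℕ),
        IsSmall t fun n s => tf (deriv^[j] (χ n)) (η - (k : ℝ) * s) (coef k l (v i s))) ∧
      (∀ i n, ContinuousOn (fun s => tf (χ n) (η - (k : ℝ) * s) (coef k l (v i s))) (Icc 0 t)) ∧
      ∀ i, ∀ s ∈ ({0, t} : Set ℝ), Tendsto
        (fun n => tf (χ n) (η - (k : ℝ) * s) (coef k l (v i s))) atTop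
        (𝓝 (fourier3 (moving s (v i s)) k η l)) := by
  filter_upwards [ae_exists_truncation hc h2 hp k l ht] with η hη
  have hpos (n : ℕ) : (0 : ℝ≥0∞) < ENNReal.ofReal (1 / ((n : ℝ) + 1)) :=
    ENNReal.ofReal_pos.2 (by positivity)
  choose χ hχ h using fun n : ℕ => hη _ (hpos n)
  have hcont (ψ : ℝ → ℂ) (hψ : IsTest ψ) (i : Fin m) :
      ContinuousOn (fun s => tf ψ (η - (k : ℝ) * s) (coef k l (v i s))) (Icc 0 t) := by
    have h := continuousOn_tf (g := fun τ => coef k l (v i τ)) hψ (continuousOn_coef (hc i) k l) k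
    exact h.comp (f := fun s : ℝ => (s, η)) (by fun_prop) fun s hs => ⟨hs.1, mem_univ _⟩
  have hto (f : ℕ → ℂ) (hf : ∀ n : ℕ, ‖f n‖ₑ ^ 2 < ENNReal.ofReal (1 / ((n : ℝ) + 1))) :
      Tendsto f atTop (𝓝 0) := by
    have h1 : Tendsto (fun n => ‖f n‖ ^ 2) atTop (𝓝 0) := by
      refine tendsto_of_tendsto_of_tendsto_of_le_of_le tendsto_const_nhds
        tendsto_one_div_add_atTop_nhds_zero_nat (fun n => by positivity) (fun n => ?_)
      have := hf n
      rw [← ofReal_norm, ← ENNReal.ofReal_pow (norm_nonneg _),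
        ENNReal.ofReal_lt_ofReal_iff (by positivity)] at this
      exact this.le
    rw [tendsto_zero_iff_norm_tendsto_zero]
    have h2 := h1.sqrt
    simpa [Real.sqrt_sq] using h2
  refine ⟨χ, hχ, fun i j hj => ?_, fun i n => hcont _ (hχ n) i, fun i s hs => ?_⟩
  · obtain ⟨j', rfl⟩ : ∃ j' : Fin 3, (j' : ℕ) + 1 = j := by
      rcases hj with rfl | rfl | rfl
      exacts [⟨0, rfl⟩, ⟨1, rfl⟩, ⟨2, rfl⟩]
    refine ⟨fun n => hcont _ ((hχ n).iterate_deriv _) i, ?_,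
      hto _ fun n => ((h n i j').2 0 (by simp)).1, hto _ fun n => ((h n i j').2 t (by simp)).1⟩
    refine tendsto_of_tendsto_of_tendsto_of_le_of_le tendsto_const_nhds
        tendsto_one_div_add_atTop_nhds_zero_nat
        (fun n => intervalIntegral.integral_nonneg ht fun s _ => by positivity) (fun n => ?_)
    have h1 := (h n i j').1
    have hc1 : ContinuousOn (fun s => ‖tf (deriv^[j' + 1] (χ n)) (η - (k : ℝ) * s)
        (coef k l (v i s))‖ ^ 2) (Icc 0 t) :=
      (hcont _ ((hχ n).iterate_deriv (j' + 1)) i).norm.pow 2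
    simp only
    rw [intervalIntegral.integral_of_le ht, ← integral_Icc_eq_integral_Ioc,
      ← ENNReal.ofReal_le_ofReal_iff (by positivity), ofReal_integral_eq_lintegral_ofReal
        (hc1.integrableOn_compact isCompact_Icc) (.of_forall fun s => by positivity)]
    refine le_trans (le_of_eq ?_) h1.le
    refine lintegral_congr fun s => ?_
    rw [ENNReal.ofReal_pow (norm_nonneg _), ofReal_norm]
  · rw [← tendsto_sub_nhds_zero_iff]
    exact hto _ fun n => ((h n i 0).2 s hs).2

/-- Testing the equations with `χ_n` leaves commutators, all small except one: in the `u²` equation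
`∂_y π` leaves the pressure tested against `χ_n'`, and `π` itself has no bound. That quantity also
appears, multiplied by `ik` or `il`, in the `u¹` or `u³` equation tested with `χ_n'`, where
everything else is small or the time derivative of something small. It is thus removed by a small
change of the second unknown. This is where `(k, l) ≠ (0, 0)` enters. -/
theorem ae_exists_approxSolution {ν α β : ℝ} {uin : Fin 3 → ℝ × ℝ × ℝ → ℝ}
    {θin : ℝ × ℝ × ℝ → ℝ} {u : Fin 3 → ℝ → ℝ × ℝ × ℝ → ℝ} {θ π : ℝ → ℝ × ℝ × ℝ → ℝ}
    (hin : IsInitialData uin θin) (hsol : IsLinearSolution ν α β uin θin u θ π) {k l : ℤ}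
    (hkl : k ≠ 0 ∨ l ≠ 0) {t : ℝ} (ht : 0 ≤ t) :
    ∀ᵐ η : ℝ, ∃ (a e : Fin 4 → ℕ → ℝ → ℂ) (P d : ℕ → ℝ → ℂ),
      IsApproxSolution ν α β k l η t (modeAt u θ k l η 0) (modeAt u θ k l η t) a e P d := by
  have hc : ∀ i, ContinuousOn (fun q : ℝ × (ℝ × ℝ × ℝ) => fields u θ i q.1 q.2)
      (Ici 0 ×ˢ univ) := by
    intro i
    fin_cases i
    exacts [hsol.cont_u 0, hsol.cont_u 1, hsol.cont_u 2, hsol.cont_θ]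
  have h2 : ∀ i, LocallyBoundedL2 (Ici 0) (fields u θ i) := by
    intro i
    fin_cases i
    exacts [hsol.energy_u 0, hsol.energy_u 1, hsol.energy_u 2, hsol.energy_θ]
  have hp : ∀ i t, 0 ≤ t → IsPeriodic (fields u θ i t) := by
    intro i
    fin_cases i
    exacts [hsol.periodic_u 0, hsol.periodic_u 1, hsol.periodic_u 2, hsol.periodic_θ]
  have hpu (s : ℝ) (hs : 0 ≤ s) (i : Fin 3) : IsPeriodic (u i s) := hsol.periodic_u i s hs
  filter_upwards [exists_truncation_seq hc h2 hp k l ht] with η hη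
  obtain ⟨χ, hχ, hsm, hcont, hlim⟩ := hη
  set c : Fin 4 → ℕ → ℕ → ℝ → ℂ := fun i j n s =>
    tf (deriv^[j] (χ n)) (η - k * s) (coef k l (fields u θ i s)) with hcdef
  set Q : ℕ → ℕ → ℝ → ℂ := fun j n s => tf (deriv^[j] (χ n)) (η - k * s) (coef k l (π s)) with hQdef
  have hχj (n j : ℕ) : IsTest (deriv^[j] (χ n)) := (hχ n).iterate_deriv j
  have hsucc (n j : ℕ) : deriv (deriv^[j] (χ n)) = deriv^[j + 1] (χ n) :=
    (Function.iterate_succ_apply' _ _ _).symm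
  have E0 (j n : ℕ) (s : ℝ) (hs : 0 < s) : HasDerivAt (c 0 j n) (-ν * symb k l η s * c 0 j n s
      + ν * (c 0 (j + 2) n s - 2 * Complex.I * (η - k * s) * c 0 (j + 1) n s)
      - (Complex.I * k * Q j n s + (1 - β) * c 1 j n s)) s := by
    have hπ := hsol.smooth_π s hs
    have h1 := (contDiff_slice (hsol.smooth_u 1) hs).continuous
    have hX := (contDiff_dX hπ).continuous
    have := hasDerivAt_tf_of_eq (hχj n j) (hsol.smooth_u 0) hs (hpu s hs.le 0)
      (S := fun X => dX (π s) X + (1 - β) * u 1 s X) (by fun_prop) (ν := ν)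
      (fun X => by linarith [hsol.eq_u1 s hs X]) k l η
    rw [tf_coef_add (hχj n j) hX (by fun_prop), tf_coef_const_mul,
      tf_coef_dX _ hπ (hsol.periodic_π s hs), hsucc, hsucc] at this
    convert! this using 1
    simp [hcdef, hQdef, fields]
  have E1 (j n : ℕ) (s : ℝ) (hs : 0 < s) : HasDerivAt (c 1 j n) (-ν * symb k l η s * c 1 j n s
      + ν * (c 1 (j + 2) n s - 2 * Complex.I * (η - k * s) * c 1 (j + 1) n s)
      - (Complex.I * (η - k * s) * Q j n s - Q (j + 1) n s + β * c 0 j n s)) s := by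
    have hπ := hsol.smooth_π s hs
    have h1 := (contDiff_slice (hsol.smooth_u 0) hs).continuous
    have hX := (contDiff_dY hπ).continuous
    have := hasDerivAt_tf_of_eq (hχj n j) (hsol.smooth_u 1) hs (hpu s hs.le 1)
      (S := fun X => dY (π s) X + β * u 0 s X) (by fun_prop) (ν := ν)
      (fun X => by linarith [hsol.eq_u2 s hs X]) k l η
    rw [tf_coef_add (hχj n j) hX (by fun_prop), tf_coef_const_mul,
      tf_coef_dY (hχj n j) hπ, hsucc, hsucc] at this
    convert! this using 1
    simp [hcdef, hQdef, fields]
  have E2 (j n : ℕ) (s : ℝ) (hs : 0 < s) : HasDerivAt (c 2 j n) (-ν * symb k l η s * c 2 j n s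
      + ν * (c 2 (j + 2) n s - 2 * Complex.I * (η - k * s) * c 2 (j + 1) n s)
      - (Complex.I * l * Q j n s + α * c 3 j n s)) s := by
    have hπ := hsol.smooth_π s hs
    have h1 := (contDiff_slice hsol.smooth_θ hs).continuous
    have hX := (contDiff_dZ hπ).continuous
    have := hasDerivAt_tf_of_eq (hχj n j) (hsol.smooth_u 2) hs (hpu s hs.le 2)
      (S := fun X => dZ (π s) X + α * θ s X) (by fun_prop) (ν := ν)
      (fun X => by linarith [hsol.eq_u3 s hs X]) k l η
    rw [tf_coef_add (hχj n j) hX (by fun_prop), tf_coef_const_mul,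
      tf_coef_dZ _ hπ (hsol.periodic_π s hs), hsucc, hsucc] at this
    convert! this using 1
  have E3 (j n : ℕ) (s : ℝ) (hs : 0 < s) : HasDerivAt (c 3 j n) (-ν * symb k l η s * c 3 j n s
      + ν * (c 3 (j + 2) n s - 2 * Complex.I * (η - k * s) * c 3 (j + 1) n s)
      - (-α * c 2 j n s)) s := by
    have h1 := (contDiff_slice (hsol.smooth_u 2) hs).continuous
    have := hasDerivAt_tf_of_eq (hχj n j) hsol.smooth_θ hs (hsol.periodic_θ s hs.le)
      (S := fun X => (-α) * u 2 s X) (by fun_prop) (ν := ν)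
      (fun X => by linarith [hsol.eq_θ s hs X]) k l η
    rw [tf_coef_const_mul, hsucc, hsucc] at this
    convert! this using 1
    simp [hcdef, fields]
  have D (n : ℕ) (s : ℝ) (hs : 0 ≤ s) : Complex.I * k * c 0 0 n s +
      Complex.I * (η - k * s : ℝ) * c 1 0 n s + Complex.I * l * c 2 0 n s = c 1 1 n s := by
    have hsm : ∀ i, ContDiff ℝ ∞ (u i s) := by
      rcases hs.eq_or_lt with rfl | hs
      · intro i; rw [hsol.init_u]; exact hin.smooth_u i
      · exact fun i => contDiff_slice (hsol.smooth_u i) hs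
    have hdiv : ∀ X, divergence (fun i => u i s) X = 0 := by
      rcases hs.eq_or_lt with rfl | hs
      · have : (fun i => u i 0) = uin := funext hsol.init_u
        rw [this]; exact hin.div_free
      · exact hsol.div_free s hs
    exact tf_divergence (hχ n) hsm (hpu s hs) hdiv k l (η - k * s)
  have hs (i : Fin 4) (j : ℕ) (hj : j ∈ ({1, 2, 3} : Set ℕ)) : IsSmall t (c i j) := hsm i j hj
  have hR (i : Fin 4) (j : ℕ) (hj : j = 0 ∨ j = 1) : IsSmall t (fun n s =>
      ν * (c i (j + 2) n s - 2 * Complex.I * (η - k * s) * c i (j + 1) n s)) := by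
    have h1 : IsSmall t (c i (j + 1)) := hs i _ (by rcases hj with rfl | rfl <;> simp)
    have h2 : IsSmall t (c i (j + 2)) := hs i _ (by rcases hj with rfl | rfl <;> simp)
    have h3 := (h2.mul ht (c := fun _ => (ν : ℂ)) continuousOn_const).add ht
      (h1.mul ht (c := fun s => -ν * (2 * Complex.I * (η - k * s)))
        (Continuous.continuousOn (by fun_prop)))
    exact h3.congr fun n s => by ring
  -- `q` is `u¹` (if `k ≠ 0`) or `u³` (if `k = 0`) tested with `χ'`, and `κ` is the symbol `ik` or
  -- `il` of the pressure derivative in its equation.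
  obtain ⟨q, κ, r, hκ, hq, hr, hqd⟩ : ∃ (q : ℕ → ℝ → ℂ) (κ : ℂ) (r : ℕ → ℝ → ℂ), κ ≠ 0 ∧
      IsSmall t q ∧ IsSmall t r ∧ ∀ n, ∀ s, 0 < s →
        HasDerivAt (q n) (-ν * symb k l η s * q n s - κ * Q 1 n s + r n s) s := by
    rcases eq_or_ne k 0 with hk | hk
    · have hl := hkl.resolve_left (not_not.2 hk)
      refine ⟨c 2 1, Complex.I * l, _, by simp [hl], hs 2 1 (by simp),
        (hR 2 1 (Or.inr rfl)).add ht
          ((hs 3 1 (by simp)).mul ht (c := fun _ => -(α : ℂ)) continuousOn_const), fun n s h => ?_⟩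
      convert! E2 1 n s h using 1
      ring
    · refine ⟨c 0 1, Complex.I * k, _, by simp [hk], hs 0 1 (by simp),
        (hR 0 1 (Or.inr rfl)).add ht
          ((hs 1 1 (by simp)).mul ht (c := fun _ => -(1 - β : ℂ)) continuousOn_const),
          fun n s h => ?_⟩
      convert! E0 1 n s h using 1
      ring
  have hξ : ContinuousOn (fun s : ℝ => Complex.I * (η - k * s : ℝ) * κ⁻¹) (Icc 0 t) :=
    Continuous.continuousOn (by fun_prop)
  have hc0 (i : Fin 4) (n : ℕ) : ContinuousOn (c i 0 n) (Icc 0 t) := hcont i n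
  have hl0 (i : Fin 4) : Tendsto (fun n => c i 0 n 0) atTop (𝓝 (modeAt u θ k l η 0 i)) :=
    hlim i 0 (by simp)
  have hl1 (i : Fin 4) : Tendsto (fun n => c i 0 n t) atTop (𝓝 (modeAt u θ k l η t i)) :=
    hlim i t (by simp)
  -- The derivative of `κ⁻¹ q` contributes `-Q 1`, cancelling the uncontrolled `+Q 1` in the `u²`
  -- equation. The substitution creates terms in `q` in the first equation and in the divergence,
  -- which are small.
  refine ⟨![c 0 0, fun n s => c 1 0 n s + κ⁻¹ * q n s, c 2 0, c 3 0],
    ![fun n s => ν * (c 0 (0 + 2) n s - 2 * Complex.I * (η - k * s) * c 0 (0 + 1) n s) +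
        (1 - β) * κ⁻¹ * q n s,
      fun n s => ν * (c 1 (0 + 2) n s - 2 * Complex.I * (η - k * s) * c 1 (0 + 1) n s) +
        κ⁻¹ * r n s,
      fun n s => ν * (c 2 (0 + 2) n s - 2 * Complex.I * (η - k * s) * c 2 (0 + 1) n s),
      fun n s => ν * (c 3 (0 + 2) n s - 2 * Complex.I * (η - k * s) * c 3 (0 + 1) n s)],
    Q 0, fun n s => c 1 1 n s + Complex.I * (η - k * s : ℝ) * κ⁻¹ * q n s, ?_⟩
  constructor
  · intro i n
    fin_cases i
    exacts [hc0 0 n, (hc0 1 n).add (continuousOn_const.mul (hq.cont n)), hc0 2 n, hc0 3 n]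
  · intro i
    fin_cases i
    exacts [(hR 0 0 (Or.inl rfl)).add ht (hq.mul ht (c := fun _ => (1 - β) * κ⁻¹) continuousOn_const),
      (hR 1 0 (Or.inl rfl)).add ht (hr.mul ht (c := fun _ => κ⁻¹) continuousOn_const),
      hR 2 0 (Or.inl rfl), hR 3 0 (Or.inl rfl)]
  · exact (hs 1 1 (by simp)).add ht (hq.mul ht hξ)
  · intro n s h
    convert! E0 0 n s h.1 using 1
    simp
    ring
  · intro n s h
    convert! (E1 0 n s h.1).add ((hqd n s h.1).const_mul κ⁻¹) using 1
    simp
    field_simp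
    ring
  · intro n s h
    convert! E2 0 n s h.1 using 1
    simp
    ring
  · intro n s h
    convert! E3 0 n s h.1 using 1
    simp
    ring
  · intro n s h
    have := D n s h.1
    simp
    push_cast at this
    linear_combination this
  · intro i
    fin_cases i
    · exact hl0 0
    · simpa using (hl0 1).add (hq.left.const_mul κ⁻¹)
    · exact hl0 2
    · exact hl0 3
  · intro i
    fin_cases i
    · exact hl1 0
    · simpa using (hl1 1).add (hq.right.const_mul κ⁻¹)
    · exact hl1 2
    · exact hl1 3

/-! ### The energy estimate for the non-zero modes -/

/-- The weights `P/H`, `1`, `γ/H` are dictated by cancellation: `P/H` against `H/P` removes the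
coupling of `X` and `Θ`, and `γ (β - 1) = β` the part of the coupling of `X` and `W` proportional to
`β`. Only the part with `2k²/H` remains, together with terms in `kξ`, which come from
differentiating the weights and from the last linear term in the equation of `X`. -/
lemma energy_identity {k l ξ H P ν α β γ b : ℝ} (hH : 0 < H) (hP : 0 < P)
    (hβγ : β = γ * b) (hb : β - 1 = b)
    (X W Θ f g h X' W' Θ' : ℂ)
    (hX : X' = -ν * P * X - α * (H / P) * Θ + Complex.I * l / P * (β - 2 * k ^ 2 / H) * W
      - 2 * k * ξ * l ^ 2 / (P * H) * X + f)
    (hW : W' = -ν * P * W + (β - 1) * (Complex.I * l) * X + g)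
    (hΘ : Θ' = -ν * P * Θ + α * X + h) :
    (2 * k * ξ * l ^ 2 / H ^ 2) * ‖X‖ ^ 2 + (P / H) * (2 * inner ℝ X X') +
      2 * inner ℝ Θ Θ' + γ * ((2 * k * ξ / H ^ 2) * ‖W‖ ^ 2 + (1 / H) * (2 * inner ℝ W W')) =
      -2 * ν * P * (P / H * ‖X‖ ^ 2 + ‖Θ‖ ^ 2 + γ * (1 / H * ‖W‖ ^ 2)) -
      (2 * k * ξ * l ^ 2 / (H * P)) * (P / H * ‖X‖ ^ 2) +
      (2 * k * ξ / H) * (γ * (1 / H * ‖W‖ ^ 2)) +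
      (4 * k ^ 2 * l / H ^ 2) * (X.re * W.im - X.im * W.re) +
      (P / H * (2 * inner ℝ X f) + 2 * inner ℝ Θ h + γ * (1 / H * (2 * inner ℝ W g))) := by
  have e1 : X'.re = -ν * P * X.re - α * (H / P) * Θ.re - l / P * (β - 2 * k ^ 2 / H) * W.im
    - 2 * k * ξ * l ^ 2 / (P * H) * X.re + f.re := by
    have : X' = ((-ν * P : ℝ) : ℂ) * X - ((α * (H / P) : ℝ) : ℂ) * Θ +
        Complex.I * (((l / P * (β - 2 * k ^ 2 / H) : ℝ) : ℂ) * W)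
        - ((2 * k * ξ * l ^ 2 / (P * H) : ℝ) : ℂ) * X + f := by
      rw [hX]; push_cast; ring
    rw [this]
    simp only [Complex.add_re, Complex.sub_re, Complex.re_ofReal_mul, Complex.I_mul_re,
      Complex.im_ofReal_mul]
    ring
  have e2 : X'.im = -ν * P * X.im - α * (H / P) * Θ.im + l / P * (β - 2 * k ^ 2 / H) * W.re
    - 2 * k * ξ * l ^ 2 / (P * H) * X.im + f.im := by
    have : X' = ((-ν * P : ℝ) : ℂ) * X - ((α * (H / P) : ℝ) : ℂ) * Θ +
        Complex.I * (((l / P * (β - 2 * k ^ 2 / H) : ℝ) : ℂ) * W)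
        - ((2 * k * ξ * l ^ 2 / (P * H) : ℝ) : ℂ) * X + f := by
      rw [hX]; push_cast; ring
    rw [this]
    simp only [Complex.add_im, Complex.sub_im, Complex.re_ofReal_mul, Complex.I_mul_im,
      Complex.im_ofReal_mul]
  have e3 : W'.re = -ν * P * W.re - (β - 1) * l * X.im + g.re := by
    have : W' = ((-ν * P : ℝ) : ℂ) * W + Complex.I * ((((β - 1) * l : ℝ) : ℂ) * X) + g := by
      rw [hW]; push_cast; ring
    rw [this]
    simp only [Complex.add_re, Complex.re_ofReal_mul, Complex.I_mul_re, Complex.im_ofReal_mul]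
    ring
  have e4 : W'.im = -ν * P * W.im + (β - 1) * l * X.re + g.im := by
    have : W' = ((-ν * P : ℝ) : ℂ) * W + Complex.I * ((((β - 1) * l : ℝ) : ℂ) * X) + g := by
      rw [hW]; push_cast; ring
    rw [this]
    simp only [Complex.add_im, Complex.re_ofReal_mul, Complex.I_mul_im, Complex.im_ofReal_mul]
  have e5 : Θ'.re = -ν * P * Θ.re + α * X.re + h.re := by
    have : Θ' = ((-ν * P : ℝ) : ℂ) * Θ + ((α : ℝ) : ℂ) * X + h := by
      rw [hΘ]; push_cast; ring
    rw [this]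
    simp only [Complex.add_re, Complex.re_ofReal_mul]
  have e6 : Θ'.im = -ν * P * Θ.im + α * X.im + h.im := by
    have : Θ' = ((-ν * P : ℝ) : ℂ) * Θ + ((α : ℝ) : ℂ) * X + h := by
      rw [hΘ]; push_cast; ring
    rw [this]
    simp only [Complex.add_im, Complex.im_ofReal_mul]
  have n (z : ℂ) : ‖z‖ ^ 2 = z.re ^ 2 + z.im ^ 2 := by
    rw [Complex.sq_norm, Complex.normSq_apply]; ring
  have i (z w : ℂ) : inner ℝ z w = z.re * w.re + z.im * w.im := by
    rw [Complex.inner]; simp; ring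
  simp only [n, i, e1, e2, e3, e4, e5, e6]
  rw [show β - 1 = b by linarith, hβγ]
  field_simp
  ring

/-- The remaining coupling is bounded by `2κk²/H` times the energy, and the errors `f, g, h` are
split off by Young's inequality at the price of a rate `δ`. The three conditions on `r` are the
resulting growth rates of the `Θ`, `X` and `W` parts. -/
lemma energy_algebra {k l ξ H P ν α β κ δ r : ℝ} (hH : 0 < H) (hP : P = H + l ^ 2)
    (hβ : 0 < β * (β - 1)) (hδ : 0 < δ) (hκ : 0 < κ) (hκβ : (β - 1) / β ≤ κ ^ 2)
    (hr0 : -2 * ν * P + δ + 2 * κ * k ^ 2 / H ≤ r)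
    (hr1 : -2 * ν * P + δ + 2 * κ * k ^ 2 / H - 2 * k * ξ * l ^ 2 / (H * P) ≤ r)
    (hr2 : -2 * ν * P + δ + 2 * κ * k ^ 2 / H + 2 * k * ξ / H ≤ r)
    (X W Θ f g h X' W' Θ' : ℂ)
    (hX : X' = -ν * P * X - α * (H / P) * Θ + Complex.I * l / P * (β - 2 * k ^ 2 / H) * W
      - 2 * k * ξ * l ^ 2 / (P * H) * X + f)
    (hW : W' = -ν * P * W + (β - 1) * (Complex.I * l) * X + g)
    (hΘ : Θ' = -ν * P * Θ + α * X + h) :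
    (2 * k * ξ * l ^ 2 / H ^ 2) * ‖X‖ ^ 2 + (P / H) * (2 * inner ℝ X X') + 2 * inner ℝ Θ Θ' +
      (β / (β - 1)) * ((2 * k * ξ / H ^ 2) * ‖W‖ ^ 2 + (1 / H) * (2 * inner ℝ W W')) ≤
    r * (P / H * ‖X‖ ^ 2 + ‖Θ‖ ^ 2 + β / (β - 1) * (1 / H * ‖W‖ ^ 2)) +
      1 / δ * (P / H * ‖f‖ ^ 2 + ‖h‖ ^ 2 + β / (β - 1) * (1 / H * ‖g‖ ^ 2)) := by
  have hPpos : 0 < P := by rw [hP]; positivity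
  have hβ0 : β ≠ 0 := by rintro rfl; simp at hβ
  have hβ1 : β - 1 ≠ 0 := by intro h; simp [h] at hβ
  set γ := β / (β - 1) with hγ
  have hγpos : 0 < γ := by
    rw [hγ, div_eq_mul_inv, show (β - 1)⁻¹ = (β - 1) / (β - 1) ^ 2 by field_simp]
    rw [← mul_div_assoc]; positivity
  have hγκ : 1 ≤ γ * κ ^ 2 := by
    have : γ * ((β - 1) / β) = 1 := by rw [hγ]; field_simp
    rw [← this]; gcongr
  have hγβ : γ * (β - 1) = β := by rw [hγ]; field_simp
  have key : (2 * k * ξ * l ^ 2 / H ^ 2) * ‖X‖ ^ 2 + (P / H) * (2 * inner ℝ X X') +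
      2 * inner ℝ Θ Θ' + γ * ((2 * k * ξ / H ^ 2) * ‖W‖ ^ 2 + (1 / H) * (2 * inner ℝ W W')) =
      -2 * ν * P * (P / H * ‖X‖ ^ 2 + ‖Θ‖ ^ 2 + γ * (1 / H * ‖W‖ ^ 2)) -
      (2 * k * ξ * l ^ 2 / (H * P)) * (P / H * ‖X‖ ^ 2) +
      (2 * k * ξ / H) * (γ * (1 / H * ‖W‖ ^ 2)) +
      (4 * k ^ 2 * l / H ^ 2) * (X.re * W.im - X.im * W.re) +
      (P / H * (2 * inner ℝ X f) + 2 * inner ℝ Θ h + γ * (1 / H * (2 * inner ℝ W g))) :=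
    energy_identity hH hPpos hγβ.symm rfl X W Θ f g h X' W' Θ' hX hW hΘ
  have hcross : (4 * k ^ 2 * l / H ^ 2) * (X.re * W.im - X.im * W.re) ≤
      2 * κ * k ^ 2 / H * (P / H * ‖X‖ ^ 2 + γ * (1 / H * ‖W‖ ^ 2)) := by
    have h1 : l * (X.re * W.im - X.im * W.re) ≤ |l| * ‖X‖ * ‖W‖ := by
      have h2 : X.re * W.im - X.im * W.re = ((starRingEnd ℂ) X * W).im := by
        simp [Complex.mul_im]; ring
      rw [h2]
      refine (le_abs_self _).trans ?_
      rw [abs_mul, mul_assoc]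
      refine mul_le_mul_of_nonneg_left ?_ (abs_nonneg _)
      refine (Complex.abs_im_le_norm _).trans ?_
      rw [norm_mul, Complex.norm_conj]
    -- Young's inequality for `κ|l|‖X‖` and `‖W‖`; then `l² ≤ P` and `1 ≤ γκ²` turn both squares
    -- into energy terms.
    have h3 : 2 * (|l| * ‖X‖ * ‖W‖) ≤ κ * (P * ‖X‖ ^ 2 + γ * ‖W‖ ^ 2) := by
      have h4 : 0 ≤ (κ * (|l| * ‖X‖) - ‖W‖) ^ 2 := sq_nonneg _
      have h5 : κ * (2 * (|l| * ‖X‖ * ‖W‖)) ≤ κ * (κ * (P * ‖X‖ ^ 2 + γ * ‖W‖ ^ 2)) := by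
        have h6 : l ^ 2 * ‖X‖ ^ 2 ≤ P * ‖X‖ ^ 2 := by
          gcongr; rw [hP]; linarith
        have h7 : 1 * ‖W‖ ^ 2 ≤ γ * κ ^ 2 * ‖W‖ ^ 2 := by gcongr
        have h8 : κ ^ 2 * (l ^ 2 * ‖X‖ ^ 2) ≤ κ ^ 2 * (P * ‖X‖ ^ 2) := by gcongr
        have h9 := sq_abs l
        have h10 : (|l| * ‖X‖) ^ 2 = l ^ 2 * ‖X‖ ^ 2 := by rw [mul_pow, h9]
        nlinarith
      exact le_of_mul_le_mul_left h5 hκ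
    calc (4 * k ^ 2 * l / H ^ 2) * (X.re * W.im - X.im * W.re)
        = (4 * k ^ 2 / H ^ 2) * (l * (X.re * W.im - X.im * W.re)) := by ring
      _ ≤ (4 * k ^ 2 / H ^ 2) * (|l| * ‖X‖ * ‖W‖) := by gcongr
      _ = (2 * k ^ 2 / H ^ 2) * (2 * (|l| * ‖X‖ * ‖W‖)) := by ring
      _ ≤ (2 * k ^ 2 / H ^ 2) * (κ * (P * ‖X‖ ^ 2 + γ * ‖W‖ ^ 2)) := by gcongr
      _ = _ := by field_simp
  have hin (z w : ℂ) : 2 * inner ℝ z w ≤ δ * ‖z‖ ^ 2 + 1 / δ * ‖w‖ ^ 2 := by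
    have h1 := real_inner_le_norm z w
    have h2 : 0 ≤ (δ * ‖z‖ - ‖w‖) ^ 2 := sq_nonneg _
    have h3 : δ * (2 * inner ℝ z w) ≤ δ * (δ * ‖z‖ ^ 2 + 1 / δ * ‖w‖ ^ 2) := by
      have : δ * (1 / δ * ‖w‖ ^ 2) = ‖w‖ ^ 2 := by field_simp
      nlinarith
    exact le_of_mul_le_mul_left h3 hδ
  have hf : P / H * (2 * inner ℝ X f) ≤ P / H * (δ * ‖X‖ ^ 2 + 1 / δ * ‖f‖ ^ 2) := by
    gcongr; exact hin _ _
  have hg : γ * (1 / H * (2 * inner ℝ W g)) ≤ γ * (1 / H * (δ * ‖W‖ ^ 2 + 1 / δ * ‖g‖ ^ 2)) := by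
    gcongr; exact hin _ _
  have hh := hin Θ h
  rw [key]
  have a1 : (-2 * ν * P + δ + 2 * κ * k ^ 2 / H - 2 * k * ξ * l ^ 2 / (H * P)) * (P / H * ‖X‖ ^ 2) ≤
      r * (P / H * ‖X‖ ^ 2) := by gcongr
  have a2 : (-2 * ν * P + δ + 2 * κ * k ^ 2 / H + 2 * k * ξ / H) * (γ * (1 / H * ‖W‖ ^ 2)) ≤
      r * (γ * (1 / H * ‖W‖ ^ 2)) := by gcongr
  have a3 : (-2 * ν * P + δ) * ‖Θ‖ ^ 2 ≤ r * ‖Θ‖ ^ 2 := by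
    gcongr
    have : 0 ≤ 2 * κ * k ^ 2 / H := by positivity
    linarith
  linarith

/-- The energy of a non-zero mode, in terms of `u³`, the vorticity `w³` and `θ`. -/
def modeEnergy (β : ℝ) (k l : ℤ) (η s : ℝ) (X W Θ : ℂ) : ℝ :=
  symb k l η s / symb k 0 η s * ‖X‖ ^ 2 + ‖Θ‖ ^ 2 + β / (β - 1) * (1 / symb k 0 η s * ‖W‖ ^ 2)

lemma symb_zero_pos {k : ℤ} (hk : k ≠ 0) (η s : ℝ) : 0 < symb k 0 η s := by
  have : (k : ℝ) ≠ 0 := by exact_mod_cast hk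
  unfold symb
  positivity

lemma symb_eq (k l : ℤ) (η s : ℝ) : symb k l η s = symb k 0 η s + (l : ℝ) ^ 2 := by
  simp [symb]

lemma hasDerivAt_symb (k l : ℤ) (η s : ℝ) :
    HasDerivAt (symb k l η) (-2 * k * (η - k * s)) s := by
  have h := ((((hasDerivAt_id s).const_mul (k : ℝ)).const_sub η).pow 2).const_add ((k : ℝ) ^ 2)
  convert! h.add_const ((l : ℝ) ^ 2) using 1
  simp
  ring

lemma continuous_symb (k l : ℤ) (η : ℝ) : Continuous (symb k l η) :=
  continuous_iff_continuousAt.2 fun s => (hasDerivAt_symb k l η s).continuousAt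

lemma continuousOn_modeEnergy (β : ℝ) {k : ℤ} (hk : k ≠ 0) (l : ℤ) (η : ℝ) {S : Set ℝ}
    {X W Θ : ℝ → ℂ} (hX : ContinuousOn X S) (hW : ContinuousOn W S) (hΘ : ContinuousOn Θ S) :
    ContinuousOn (fun s => modeEnergy β k l η s (X s) (W s) (Θ s)) S := by
  have h1 := continuous_symb k l η
  have h2 := continuous_symb k 0 η
  have h3 : ∀ s, symb k 0 η s ≠ 0 := fun s => (symb_zero_pos hk η s).ne'
  have h4 : Continuous fun s => symb k l η s / symb k 0 η s := h1.div h2 h3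
  have h5 : Continuous fun s => 1 / symb k 0 η s := continuous_const.div h2 h3
  unfold modeEnergy
  exact ((h4.continuousOn.mul (hX.norm.pow 2)).add (hΘ.norm.pow 2)).add
    (continuousOn_const.mul (h5.continuousOn.mul (hW.norm.pow 2)))

/-- Grönwall's inequality in integrating-factor form, with `m' = -r m`. Stated on a subinterval
because the dominant rate changes at the critical time, so two different weights are needed. -/
lemma energy_step {k l : ℤ} (hk : k ≠ 0) {η ν α β κ δ a b : ℝ} (hab : a ≤ b)
    (hβ : 0 < β * (β - 1)) (hδ : 0 < δ) (hκ : 0 < κ) (hκβ : (β - 1) / β ≤ κ ^ 2)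
    {X W Θ f g h : ℝ → ℂ} {m r : ℝ → ℝ}
    (cX : ContinuousOn X (Icc a b)) (cW : ContinuousOn W (Icc a b)) (cΘ : ContinuousOn Θ (Icc a b))
    (cf : ContinuousOn f (Icc a b)) (cg : ContinuousOn g (Icc a b)) (ch : ContinuousOn h (Icc a b))
    (hm0 : ∀ s, 0 < m s) (hm : ∀ s, HasDerivAt m (-r s * m s) s)
    (hr0 : ∀ s ∈ Ioo a b, -2 * ν * symb k l η s + δ + 2 * κ * k ^ 2 / symb k 0 η s ≤ r s)
    (hr1 : ∀ s ∈ Ioo a b, -2 * ν * symb k l η s + δ + 2 * κ * k ^ 2 / symb k 0 η s -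
      2 * k * (η - k * s) * l ^ 2 / (symb k 0 η s * symb k l η s) ≤ r s)
    (hr2 : ∀ s ∈ Ioo a b, -2 * ν * symb k l η s + δ + 2 * κ * k ^ 2 / symb k 0 η s +
      2 * k * (η - k * s) / symb k 0 η s ≤ r s)
    (hX : ∀ s ∈ Ioo a b, HasDerivAt X (-ν * symb k l η s * X s
      - α * (symb k 0 η s / symb k l η s) * Θ s
      + Complex.I * l / symb k l η s * (β - 2 * k ^ 2 / symb k 0 η s) * W s
      - 2 * k * (η - k * s : ℝ) * l ^ 2 / (symb k l η s * symb k 0 η s) * X s + f s) s)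
    (hW : ∀ s ∈ Ioo a b, HasDerivAt W (-ν * symb k l η s * W s
      + (β - 1) * (Complex.I * l) * X s + g s) s)
    (hΘ : ∀ s ∈ Ioo a b, HasDerivAt Θ (-ν * symb k l η s * Θ s + α * X s + h s) s) :
    m b * modeEnergy β k l η b (X b) (W b) (Θ b) ≤ m a * modeEnergy β k l η a (X a) (W a) (Θ a) +
      ∫ s in a..b, m s * (1 / δ * modeEnergy β k l η s (f s) (g s) (h s)) := by
  have cm : Continuous m := continuous_iff_continuousAt.2 fun s => (hm s).continuousAt
  have cE := cm.continuousOn.mul (continuousOn_modeEnergy β hk l η cX cW cΘ)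
  have cF : ContinuousOn (fun s => m s * (1 / δ * modeEnergy β k l η s (f s) (g s) (h s)))
      (Icc a b) := cm.continuousOn.mul
    (continuousOn_const.mul (continuousOn_modeEnergy β hk l η cf cg ch))
  rw [← sub_le_iff_le_add']
  refine intervalIntegral.sub_le_integral_of_hasDeriv_right_of_le hab cE
    (g' := fun s => -r s * m s * modeEnergy β k l η s (X s) (W s) (Θ s) + m s *
      ((2 * k * (η - k * s) * l ^ 2 / symb k 0 η s ^ 2) * ‖X s‖ ^ 2 +
        (symb k l η s / symb k 0 η s) * (2 * inner ℝ (X s) (deriv X s)) +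
        2 * inner ℝ (Θ s) (deriv Θ s) +
      (β / (β - 1)) * ((2 * k * (η - k * s) / symb k 0 η s ^ 2) * ‖W s‖ ^ 2 +
        (1 / symb k 0 η s) * (2 * inner ℝ (W s) (deriv W s)))))
    (fun s hs => ?_) (cF.integrableOn_compact isCompact_Icc) (fun s hs => ?_)
  · have hH := (symb_zero_pos hk η s).ne'
    have dX := (hX s hs).differentiableAt.hasDerivAt.norm_sq
    have dW := (hW s hs).differentiableAt.hasDerivAt.norm_sq
    have dΘ := (hΘ s hs).differentiableAt.hasDerivAt.norm_sq
    have dq := (hasDerivAt_symb k l η s).div (hasDerivAt_symb k 0 η s) hH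
    have di := (hasDerivAt_const s (1 : ℝ)).div (hasDerivAt_symb k 0 η s) hH
    have dE := ((dq.mul dX).add dΘ).add ((di.mul dW).const_mul (β / (β - 1)))
    have := ((hm s).mul dE).hasDerivWithinAt (s := Ioi s)
    refine this.congr_deriv ?_
    simp only [Pi.add_apply, Pi.mul_apply, Pi.div_apply, modeEnergy]
    rw [symb_eq k l]
    field_simp
    ring
  · have hH := symb_zero_pos hk η s
    have h1 := energy_algebra (k := k) (l := l) (ξ := η - k * s) (ν := ν) (α := α) hH (symb_eq k l η s) hβ hδ hκ hκβ
      (hr0 s hs) (hr1 s hs) (hr2 s hs) (X s) (W s) (Θ s) (f s) (g s) (h s)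
      (deriv X s) (deriv W s) (deriv Θ s) (by rw [(hX s hs).deriv]; push_cast; ring)
      (by rw [(hW s hs).deriv]; push_cast; ring) (by rw [(hΘ s hs).deriv])
    have h2 := mul_le_mul_of_nonneg_left h1 (hm0 s).le
    simp only [modeEnergy]
    linarith

/-- The weight before the critical time. -/
def weightBefore (ν κ δ t₀ s : ℝ) : ℝ :=
  Real.exp (2 * ν / 3 * (s - t₀) ^ 3 - δ * s - 2 * κ * Real.arctan (s - t₀)) * (1 + (s - t₀) ^ 2)

/-- The weight after the critical time. -/
def weightAfter (ν κ δ t₀ L s : ℝ) : ℝ :=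
  Real.exp (2 * ν / 3 * (s - t₀) ^ 3 - δ * s - 2 * κ * Real.arctan (s - t₀)) *
    ((1 + (s - t₀) ^ 2 + L) / (1 + (s - t₀) ^ 2))

lemma hasDerivAt_weight_exp (ν κ δ t₀ s : ℝ) : HasDerivAt (fun s =>
    Real.exp (2 * ν / 3 * (s - t₀) ^ 3 - δ * s - 2 * κ * Real.arctan (s - t₀)))
    (Real.exp (2 * ν / 3 * (s - t₀) ^ 3 - δ * s - 2 * κ * Real.arctan (s - t₀)) *
      (2 * ν * (s - t₀) ^ 2 - δ - 2 * κ / (1 + (s - t₀) ^ 2))) s := by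
  have h0 : HasDerivAt (fun s => s - t₀) 1 s := (hasDerivAt_id s).sub_const t₀
  have h1 := (((h0.pow 3).const_mul (2 * ν / 3)).sub ((hasDerivAt_id s).const_mul δ)).sub
    (h0.arctan.const_mul (2 * κ))
  convert! h1.exp using 1
  simp
  ring

/-- The cubic exponential integrates the dissipation, the arctangent the coupling `2κk²/H`, and `1 +
(s - t₀)²` the rate `2kξ/H` of the vorticity part, positive before `t₀`. -/
lemma hasDerivAt_weightBefore (ν κ δ t₀ s : ℝ) : HasDerivAt (weightBefore ν κ δ t₀)
    (-(-2 * ν * (s - t₀) ^ 2 + δ + 2 * κ / (1 + (s - t₀) ^ 2) -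
      2 * (s - t₀) / (1 + (s - t₀) ^ 2)) * weightBefore ν κ δ t₀ s) s := by
  have h0 : HasDerivAt (fun s => s - t₀) 1 s := (hasDerivAt_id s).sub_const t₀
  convert! (hasDerivAt_weight_exp ν κ δ t₀ s).mul ((h0.pow 2).const_add 1) using 1
  simp only [weightBefore, Pi.pow_apply]
  have : 1 + (s - t₀) ^ 2 ≠ 0 := by positivity
  field_simp
  ring

/-- After `t₀` the growing part is that of `X`, at rate `-2kξl²/(HP)`, which the quotient `P/H`
integrates; here `L = (l/k)²`. -/
lemma hasDerivAt_weightAfter (ν κ δ t₀ : ℝ) {L : ℝ} (hL : 0 ≤ L) (s : ℝ) :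
    HasDerivAt (weightAfter ν κ δ t₀ L)
    (-(-2 * ν * (s - t₀) ^ 2 + δ + 2 * κ / (1 + (s - t₀) ^ 2) +
      2 * (s - t₀) * L / ((1 + (s - t₀) ^ 2) * (1 + (s - t₀) ^ 2 + L))) *
      weightAfter ν κ δ t₀ L s) s := by
  have h0 : HasDerivAt (fun s => s - t₀) 1 s := (hasDerivAt_id s).sub_const t₀
  have h1 : 1 + (s - t₀) ^ 2 ≠ 0 := by positivity
  have h2 : 1 + (s - t₀) ^ 2 + L ≠ 0 := by positivity
  convert! (hasDerivAt_weight_exp ν κ δ t₀ s).mul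
    ((((h0.pow 2).const_add 1).add_const L).div ((h0.pow 2).const_add 1) h1) using 1
  simp only [weightAfter, Pi.pow_apply, Pi.div_apply]
  field_simp
  ring

lemma IsSmall.tendsto_integral_mul {t : ℝ} {f : ℕ → ℝ → ℂ} (hf : IsSmall t f) {a b : ℝ}
    (ha : 0 ≤ a) (hab : a ≤ b) (hb : b ≤ t) {c : ℝ → ℝ} (hc : Continuous c) :
    Tendsto (fun n => ∫ s in a..b, c s * ‖f n s‖ ^ 2) atTop (𝓝 0) := by
  have ht : 0 ≤ t := ha.trans (hab.trans hb)
  obtain ⟨K, hK⟩ := isCompact_Icc.exists_bound_of_continuousOn (hc.continuousOn (s := Icc 0 t))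
  have hK0 : 0 ≤ K := (norm_nonneg _).trans (hK 0 ⟨le_rfl, ht⟩)
  have h := hf.lim.const_mul K
  rw [mul_zero] at h
  have hi (n : ℕ) : IntervalIntegrable (fun s => K * ‖f n s‖ ^ 2) volume 0 t :=
    (continuousOn_const.mul ((hf.cont n).norm.pow 2)).intervalIntegrable_of_Icc ht
  refine squeeze_zero_norm (fun n => ?_) h
  refine (intervalIntegral.norm_integral_le_of_norm_le hab (g := fun s => K * ‖f n s‖ ^ 2)
    (.of_forall fun s hs => ?_) ?_).trans ?_
  · rw [norm_mul, norm_pow, norm_norm]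
    gcongr
    exact hK s ⟨ha.trans hs.1.le, hs.2.trans hb⟩
  · exact (hi n).mono_set (by
      rw [uIcc_of_le hab, uIcc_of_le ht]; exact Icc_subset_Icc ha hb)
  · rw [← intervalIntegral.integral_const_mul]
    refine intervalIntegral.integral_mono_interval ha hab hb
      (.of_forall fun s => ?_) (hi n)
    simp only [Pi.zero_apply]; positivity

lemma tendsto_integral_modeEnergy {β t η : ℝ} {k l : ℤ} (hk : k ≠ 0) {f g h : ℕ → ℝ → ℂ}
    (hf : IsSmall t f) (hg : IsSmall t g) (hh : IsSmall t h) {a b δ : ℝ}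
    (ha : 0 ≤ a) (hab : a ≤ b) (hb : b ≤ t) {m : ℝ → ℝ} (hm : Continuous m) :
    Tendsto (fun n => ∫ s in a..b, m s * (1 / δ * modeEnergy β k l η s (f n s) (g n s) (h n s)))
      atTop (𝓝 0) := by
  have h1 := continuous_symb k l η
  have h2 := continuous_symb k 0 η
  have h3 : ∀ s, symb k 0 η s ≠ 0 := fun s => (symb_zero_pos hk η s).ne'
  have c1 : Continuous fun s => m s * (1 / δ) * (symb k l η s / symb k 0 η s) :=
    (hm.mul continuous_const).mul (h1.div h2 h3)
  have c2 : Continuous fun s => m s * (1 / δ) := hm.mul continuous_const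
  have c3 : Continuous fun s => m s * (1 / δ) * (β / (β - 1)) * (1 / symb k 0 η s) :=
    ((hm.mul continuous_const).mul continuous_const).mul (continuous_const.div h2 h3)
  have key := ((hf.tendsto_integral_mul ha hab hb c1).add
    (hh.tendsto_integral_mul ha hab hb c2)).add (hg.tendsto_integral_mul ha hab hb c3)
  rw [add_zero, add_zero] at key
  refine key.congr fun n => ?_
  have hi {c : ℝ → ℝ} (hc : Continuous c) {f : ℕ → ℝ → ℂ} (hf : IsSmall t f) :
      IntervalIntegrable (fun s => c s * ‖f n s‖ ^ 2) volume a b :=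
    (hc.continuousOn.mul (((hf.cont n).mono (Icc_subset_Icc ha hb)).norm.pow
      2)).intervalIntegrable_of_Icc hab
  rw [← intervalIntegral.integral_add (hi c1 hf) (hi c2 hh),
    ← intervalIntegral.integral_add ((hi c1 hf).add (hi c2 hh)) (hi c3 hg)]
  refine intervalIntegral.integral_congr fun s _ => ?_
  simp only [modeEnergy]
  ring

/-- The right side is the derivative of `(H u³ - l(k u¹ + ξ u²))/P`. The pressure `p` drops out
because `H l - l(k² + ξ²) = 0`. -/
lemma reduced_velocity_algebra {H P k l ξ ν α β a0 a1 a2 a3 p e0 e1 e2 : ℂ} (hH : H ≠ 0)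
    (hP : P ≠ 0) (hPH : P = H + l ^ 2) (hHk : H = k ^ 2 + ξ ^ 2) :
    -ν * P * ((H * a2 - l * (k * a0 + ξ * a1)) / P) - α * (H / P) * a3
      + Complex.I * l / P * (β - 2 * k ^ 2 / H) * (Complex.I * k * a1 - Complex.I * ξ * a0)
      - 2 * k * ξ * l ^ 2 / (P * H) * ((H * a2 - l * (k * a0 + ξ * a1)) / P)
      + (H / P * e2 + (-(l * k) / P * e0 + -(l * ξ) / P * e1)) =
    ((-2 * k * ξ * a2 + H * (-ν * P * a2 - Complex.I * l * p - α * a3 + e2)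
      - l * (k * (-ν * P * a0 - Complex.I * k * p - (1 - β) * a1 + e0)
        + (-k * a1 + ξ * (-ν * P * a1 - Complex.I * ξ * p - β * a0 + e1)))) * P
      - (H * a2 - l * (k * a0 + ξ * a1)) * (-2 * k * ξ)) / P ^ 2 := by
  have hI : Complex.I * l / P * (β - 2 * k ^ 2 / H) * (Complex.I * k * a1 - Complex.I * ξ * a0) =
      l / P * (β - 2 * k ^ 2 / H) * (ξ * a0 - k * a1) := by
    linear_combination (l / P * (β - 2 * k ^ 2 / H) * (k * a1 - ξ * a0)) * Complex.I_sq
  rw [hI]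
  field_simp
  subst hPH
  subst hHk
  ring

/-- The good unknowns of an approximate solution satisfy the reduced system. -/
lemma IsApproxSolution.exists_reduced {ν α β : ℝ} {k l : ℤ} (hk : k ≠ 0) {η t : ℝ} (ht : 0 ≤ t)
    {A₀ A₁ : Fin 4 → ℂ} {a e : Fin 4 → ℕ → ℝ → ℂ} {P d : ℕ → ℝ → ℂ}
    (h : IsApproxSolution ν α β k l η t A₀ A₁ a e P d) :
    ∃ X W Θ f g j : ℕ → ℝ → ℂ,
      (∀ n, ContinuousOn (X n) (Icc 0 t)) ∧ (∀ n, ContinuousOn (W n) (Icc 0 t)) ∧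
      (∀ n, ContinuousOn (Θ n) (Icc 0 t)) ∧ IsSmall t f ∧ IsSmall t g ∧ IsSmall t j ∧
      (∀ n, ∀ s ∈ Ioo 0 t, HasDerivAt (X n) (-ν * symb k l η s * X n s
        - α * (symb k 0 η s / symb k l η s) * Θ n s
        + Complex.I * l / symb k l η s * (β - 2 * k ^ 2 / symb k 0 η s) * W n s
        - 2 * k * (η - k * s : ℝ) * l ^ 2 / (symb k l η s * symb k 0 η s) * X n s + f n s) s) ∧
      (∀ n, ∀ s ∈ Ioo 0 t, HasDerivAt (W n) (-ν * symb k l η s * W n s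
        + (β - 1) * (Complex.I * l) * X n s + g n s) s) ∧
      (∀ n, ∀ s ∈ Ioo 0 t, HasDerivAt (Θ n) (-ν * symb k l η s * Θ n s + α * X n s + j n s) s) ∧
      Tendsto (fun n => X n 0) atTop (𝓝 (A₀ 2)) ∧ Tendsto (fun n => X n t) atTop (𝓝 (A₁ 2)) ∧
      Tendsto (fun n => W n 0) atTop (𝓝 (Complex.I * k * A₀ 1 - Complex.I * η * A₀ 0)) ∧
      Tendsto (fun n => W n t) atTop
        (𝓝 (Complex.I * k * A₁ 1 - Complex.I * (η - k * t : ℝ) * A₁ 0)) ∧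
      Tendsto (fun n => Θ n 0) atTop (𝓝 (A₀ 3)) ∧ Tendsto (fun n => Θ n t) atTop (𝓝 (A₁ 3)) := by
  have hH (s : ℝ) : (symb k 0 η s : ℂ) ≠ 0 := by exact_mod_cast (symb_zero_pos hk η s).ne'
  have hP0 (s : ℝ) : (symb k l η s : ℂ) ≠ 0 := by
    have := symb_zero_pos hk η s
    rw [symb_eq]
    exact_mod_cast (by positivity)
  have cH : Continuous fun s => (symb k 0 η s : ℂ) :=
    Complex.continuous_ofReal.comp (continuous_symb k 0 η)
  have cP : Continuous fun s => (symb k l η s : ℂ) :=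
    Complex.continuous_ofReal.comp (continuous_symb k l η)
  have cξ : Continuous fun s : ℝ => ((η - k * s : ℝ) : ℂ) := by fun_prop
  have cLP : ContinuousOn (fun s => Complex.I * l / symb k l η s) (Icc 0 t) :=
    (continuous_const.div cP hP0).continuousOn
  have sd := h.small_div
  have s0 := h.small 0
  have s1 := h.small 1
  have s2 := h.small 2
  have s3 := h.small 3
  have sX := sd.mul ht cLP
  have dξ (s : ℝ) : HasDerivAt (fun s : ℝ => ((η - k * s : ℝ) : ℂ)) (-k : ℂ) s := by
    have h := ((hasDerivAt_id s).const_mul (k : ℝ)).const_sub η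
    convert! h.ofReal_comp using 1
    simp
  -- The multiple of the divergence makes the first unknown the Leray projection of `u³`, in which
  -- no pressure is left; it disappears in the limit.
  refine ⟨fun n s => a 2 n s + Complex.I * l / symb k l η s * d n s,
    fun n s => Complex.I * k * a 1 n s - Complex.I * (η - k * s : ℝ) * a 0 n s,
    fun n s => a 3 n s,
    fun n s => symb k 0 η s / symb k l η s * e 2 n s + (-(l * k) / symb k l η s * e 0 n s
      + -(l * (η - k * s : ℝ)) / symb k l η s * e 1 n s),
    fun n s => (1 - β) * (symb k 0 η s / symb k l η s) * d n s + (Complex.I * k * e 1 n s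
      + -(Complex.I * (η - k * s : ℝ)) * e 0 n s),
    fun n s => -(α * (Complex.I * l / symb k l η s)) * d n s + e 3 n s,
    fun n => (h.cont 2 n).add (sX.cont n),
    fun n => (continuousOn_const.mul (h.cont 1 n)).sub
      ((continuousOn_const.mul cξ.continuousOn).mul (h.cont 0 n)), fun n => h.cont 3 n,
    (s2.mul ht (cH.div cP hP0).continuousOn).add ht
      ((s0.mul ht (continuous_const.div cP hP0).continuousOn).add ht
        (s1.mul ht ((continuous_const.mul cξ).neg.div cP hP0).continuousOn)),
    (sd.mul ht (continuous_const.mul (cH.div cP hP0)).continuousOn).add ht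
      ((s1.mul ht continuousOn_const).add ht
        (s0.mul ht (continuous_const.mul cξ).neg.continuousOn)),
    (sd.mul ht (continuousOn_const.mul cLP).neg).add ht s3,
    fun n s hs => ?_, fun n s hs => ?_, fun n s hs => ?_, ?_, ?_, ?_, ?_, h.left 3, h.right 3⟩
  · have d0 := h.eq0 n s hs
    have d1 := h.eq1 n s hs
    have d2 := h.eq2 n s hs
    have hd (r : ℝ) (hr : r ∈ Icc 0 t) := h.div n r hr
    have dH := (hasDerivAt_symb k 0 η s).ofReal_comp
    have dP := (hasDerivAt_symb k l η s).ofReal_comp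
    have dq := ((dH.mul d2).sub (((d0.const_mul (k : ℂ)).add ((dξ s).mul d1)).const_mul
      (l : ℂ))).div dP (hP0 s)
    have hform (r : ℝ) (hr : r ∈ Icc 0 t) : a 2 n r + Complex.I * l / symb k l η r * d n r =
        (symb k 0 η r * a 2 n r - l * (k * a 0 n r + (η - k * r : ℝ) * a 1 n r)) /
          symb k l η r := by
      have h1 := hP0 r
      rw [← hd r hr]
      field_simp
      rw [symb_eq k l]
      push_cast
      linear_combination (l * (k * a 0 n r + (η - k * r) * a 1 n r) + l ^ 2 * a 2 n r) *
        Complex.I_sq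
    have hev : (fun s => a 2 n s + Complex.I * l / symb k l η s * d n s) =ᶠ[𝓝 s] fun r =>
        (symb k 0 η r * a 2 n r - l * (k * a 0 n r + (η - k * r : ℝ) * a 1 n r)) /
          symb k l η r := by
      filter_upwards [Icc_mem_nhds hs.1 hs.2] with r hr using hform r hr
    refine HasDerivAt.congr_of_eventuallyEq ?_ hev
    convert! dq using 1
    beta_reduce
    rw [hform s (Ioo_subset_Icc_self hs)]
    have h1 := hP0 s
    have h2 := hH s
    have hPH : (symb k l η s : ℂ) = symb k 0 η s + l ^ 2 := by rw [symb_eq k l]; push_cast; ring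
    have hH' : (symb k 0 η s : ℂ) = k ^ 2 + ((η - k * s : ℝ) : ℂ) ^ 2 := by
      simp [symb]
    refine (reduced_velocity_algebra (p := P n s) h2 h1 hPH hH').trans ?_
    have hr : (((-2 * k * (η - k * s) : ℝ)) : ℂ) = -2 * k * ((η - k * s : ℝ) : ℂ) := by
      push_cast; ring
    simp only [Pi.mul_apply, Pi.add_apply, Pi.sub_apply, hr]
  · have d0 := h.eq0 n s hs
    have d1 := h.eq1 n s hs
    have hd := h.div n s (Ioo_subset_Icc_self hs)
    have dq := (d1.const_mul (Complex.I * k)).sub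
      (((dξ s).const_mul Complex.I).mul d0)
    convert! dq using 1
    have h1 := hP0 s
    have hPH : (symb k l η s : ℂ) = symb k 0 η s + l ^ 2 := by rw [symb_eq k l]; push_cast; ring
    have hq : (symb k 0 η s : ℂ) / symb k l η s = 1 - l ^ 2 / symb k l η s := by
      rw [eq_sub_iff_add_eq, ← add_div, ← hPH, div_self h1]
    simp only [hq, ← hd]
    linear_combination (β - 1) * l ^ 2 / symb k l η s * (Complex.I * k * a 0 n s +
      Complex.I * (η - k * s : ℝ) * a 1 n s + Complex.I * l * a 2 n s) * Complex.I_sq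
  · convert! h.eq3 n s hs using 1
    simp only
    ring
  · simpa using (h.left 2).add (sX.left)
  · simpa using (h.right 2).add (sX.right)
  · have := ((h.left 1).const_mul (Complex.I * k)).sub ((h.left 0).const_mul (Complex.I * η))
    simpa using this
  · exact ((h.right 1).const_mul (Complex.I * k)).sub
      ((h.right 0).const_mul (Complex.I * (η - k * t : ℝ)))

/-- With `x = ν^{1/3} t`, the decay `x³/6` dominates `x/8` up to the constant `1`. The rate `1/8` is
that of the energy; square roots halve it to `1/16`. -/
lemma exp_cube_le {ν t : ℝ} (hν : 0 < ν) (ht : 0 ≤ t) :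
    -(ν * t ^ 3 / 6) ≤ 1 - ν ^ (1 / 3 : ℝ) * t / 8 := by
  set x := ν ^ (1 / 3 : ℝ) * t with hx
  have hx0 : 0 ≤ x := by positivity
  have h3 : x ^ 3 = ν * t ^ 3 := by
    rw [hx, mul_pow, ← Real.rpow_natCast, ← Real.rpow_mul hν.le]
    norm_num
  rw [← h3]
  rcases le_total x 1 with h | h
  · nlinarith [pow_nonneg hx0 3]
  · have : x ≤ x ^ 3 := le_self_pow₀ h (by norm_num)
    linarith

/-- `(t - t₀)³ + t₀³` is smallest at `t₀ = t/2`, where it equals `t³/4`: this makes the decay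
uniform in `η`. The constant `2` collects `δt ≤ 1` and the `1` of `exp_cube_le`; `2πκ` bounds the
variation of the arctangent. -/
lemma weight_ratio_le {ν κ t₀ t : ℝ} (hν : 0 < ν) (hκ : 0 < κ) (ht : 0 ≤ t) :
    (2 * ν / 3 * (0 - t₀) ^ 3 - 1 / (t + 1) * 0 - 2 * κ * Real.arctan (0 - t₀)) -
      (2 * ν / 3 * (t - t₀) ^ 3 - 1 / (t + 1) * t - 2 * κ * Real.arctan (t - t₀)) ≤
    2 + 2 * Real.pi * κ - ν ^ (1 / 3 : ℝ) * t / 8 := by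
  have h1 := exp_cube_le hν ht
  have h2 := Real.arctan_lt_pi_div_two (t - t₀)
  have h3 := Real.neg_pi_div_two_lt_arctan (0 - t₀)
  have h4 : 1 / (t + 1) * t ≤ 1 := by
    rw [one_div_mul_eq_div, div_le_one (by positivity)]; linarith
  have h5 : t ^ 3 / 4 ≤ (t - t₀) ^ 3 - (0 - t₀) ^ 3 := by
    nlinarith [mul_nonneg ht (sq_nonneg (2 * t₀ - t))]
  have h6 : ν * (t ^ 3 / 4) ≤ ν * ((t - t₀) ^ 3 - (0 - t₀) ^ 3) := by gcongr
  have h7 : κ * (Real.arctan (t - t₀) - Real.arctan (0 - t₀)) ≤ κ * Real.pi := by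
    gcongr; linarith
  linarith

theorem IsApproxSolution.energy_le {ν α β κ : ℝ} {k l : ℤ} (hk : k ≠ 0) {η t : ℝ} (ht : 0 ≤ t)
    (hν : 0 < ν) (hβ : 0 < β * (β - 1)) (hκ : 0 < κ) (hκβ : (β - 1) / β ≤ κ ^ 2)
    {A₀ A₁ : Fin 4 → ℂ} {a e : Fin 4 → ℕ → ℝ → ℂ} {P d : ℕ → ℝ → ℂ}
    (h : IsApproxSolution ν α β k l η t A₀ A₁ a e P d) :
    modeEnergy β k l η t (A₁ 2) (Complex.I * k * A₁ 1 - Complex.I * (η - k * t : ℝ) * A₁ 0) (A₁ 3) ≤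
      Real.exp (2 + 2 * Real.pi * κ - ν ^ (1 / 3 : ℝ) * t / 8) *
        ((1 + (l / k : ℝ) ^ 2) * (1 + (η / k) ^ 2)) *
        modeEnergy β k l η 0 (A₀ 2) (Complex.I * k * A₀ 1 - Complex.I * η * A₀ 0) (A₀ 3) := by
  obtain ⟨X, W, Θ, f, g, j, cX, cW, cΘ, sf, sg, sj, hX, hW, hΘ, X0, X1, W0, W1, Θ0, Θ1⟩ :=
    h.exists_reduced hk ht
  have hkr : (k : ℝ) ≠ 0 := by exact_mod_cast hk
  have hk1 : (1 : ℝ) ≤ (k : ℝ) ^ 2 := by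
    have : (1 : ℤ) ≤ k ^ 2 := by
      have := sq_pos_of_ne_zero hk
      omega
    exact_mod_cast this
  set t₀ := η / k with ht₀
  set L := (l / k : ℝ) ^ 2 with hL
  -- Any positive rate serves for absorbing the errors, which disappear in the limit; this one costs
  -- at most a factor `e` on `[0, t]`, also when `t = 0`.
  set δ := 1 / (t + 1) with hδ
  have hL0 : 0 ≤ L := by positivity
  have hδ0 : 0 < δ := by positivity
  have eξ (s : ℝ) : η - k * s = -k * (s - t₀) := by rw [ht₀]; field_simp; ring
  have eH (s : ℝ) : symb k 0 η s = k ^ 2 * (1 + (s - t₀) ^ 2) := by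
    simp only [symb, eξ]; push_cast; ring
  have eP (s : ℝ) : symb k l η s = k ^ 2 * (1 + (s - t₀) ^ 2 + L) := by
    rw [symb_eq, eH, hL]; field_simp
  have hPge (s : ℝ) : -2 * ν * symb k l η s ≤ -2 * ν * (s - t₀) ^ 2 := by
    rw [neg_mul, neg_mul, neg_mul, neg_le_neg_iff]
    have : (s - t₀) ^ 2 ≤ symb k l η s := by
      rw [eP]
      nlinarith [sq_nonneg (s - t₀)]
    gcongr
  have e2 (s : ℝ) : 2 * κ * k ^ 2 / symb k 0 η s = 2 * κ / (1 + (s - t₀) ^ 2) := by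
    rw [eH]; field_simp
  have e3 (s : ℝ) : 2 * k * (η - k * s) / symb k 0 η s = -(2 * (s - t₀) / (1 + (s - t₀) ^ 2)) := by
    rw [eH, eξ]; field_simp
  have e4 (s : ℝ) : 2 * k * (η - k * s) * l ^ 2 / (symb k 0 η s * symb k l η s) =
      -(2 * (s - t₀) * L / ((1 + (s - t₀) ^ 2) * (1 + (s - t₀) ^ 2 + L))) := by
    have : (l : ℝ) ^ 2 = k ^ 2 * L := by rw [hL]; field_simp
    rw [eH, eP, eξ, this]; field_simp
  -- The critical time clamped to `[0, t]`; one of the two intervals may be degenerate.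
  set c := max 0 (min t₀ t) with hc
  have hc0 : 0 ≤ c := le_max_left _ _
  have hct : c ≤ t := max_le ht (min_le_right _ _)
  have hbefore (s : ℝ) (hs : s ∈ Ioo 0 c) : s - t₀ ≤ 0 := by
    have h1 : s < max 0 (min t₀ t) := hs.2
    rcases lt_max_iff.1 h1 with h | h
    · linarith [hs.1]
    · linarith [min_le_left t₀ t]
  have hafter (s : ℝ) (hs : s ∈ Ioo c t) : 0 ≤ s - t₀ := by
    have h1 : max 0 (min t₀ t) < s := hs.1
    have h2 := (max_lt_iff.1 h1).2
    rcases min_lt_iff.1 h2 with h | h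
    · linarith
    · linarith [hs.2]
  have pB (s : ℝ) : 0 < weightBefore ν κ δ t₀ s := by unfold weightBefore; positivity
  have pA (s : ℝ) : 0 < weightAfter ν κ δ t₀ L s := by unfold weightAfter; positivity
  have hbefore (n : ℕ) := energy_step (k := k) (l := l) (η := η) hk hc0 hβ hδ0 hκ hκβ
    ((cX n).mono (Icc_subset_Icc le_rfl hct)) ((cW n).mono (Icc_subset_Icc le_rfl hct))
    ((cΘ n).mono (Icc_subset_Icc le_rfl hct)) ((sf.cont n).mono (Icc_subset_Icc le_rfl hct))
    ((sg.cont n).mono (Icc_subset_Icc le_rfl hct)) ((sj.cont n).mono (Icc_subset_Icc le_rfl hct))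
    pB (hasDerivAt_weightBefore ν κ δ t₀)
    (fun s hs => by
      have h1 := hPge s
      have h2 : 2 * (s - t₀) / (1 + (s - t₀) ^ 2) ≤ 0 :=
        div_nonpos_of_nonpos_of_nonneg (by linarith [hbefore s hs]) (by positivity)
      rw [e2]; linarith)
    (fun s hs => by
      have h1 := hPge s
      have h2 : 2 * (s - t₀) / (1 + (s - t₀) ^ 2) ≤ 0 :=
        div_nonpos_of_nonpos_of_nonneg (by linarith [hbefore s hs]) (by positivity)
      have h3 : 2 * (s - t₀) * L / ((1 + (s - t₀) ^ 2) * (1 + (s - t₀) ^ 2 + L)) ≤ 0 :=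
        div_nonpos_of_nonpos_of_nonneg
          (mul_nonpos_of_nonpos_of_nonneg (by linarith [hbefore s hs]) hL0) (by positivity)
      rw [e2, e4]; linarith)
    (fun s hs => by
      have h1 := hPge s
      rw [e2, e3]; linarith)
    (fun s hs => hX n s ⟨hs.1, hs.2.trans_le hct⟩) (fun s hs => hW n s ⟨hs.1, hs.2.trans_le hct⟩)
    (fun s hs => hΘ n s ⟨hs.1, hs.2.trans_le hct⟩)
  have hafter (n : ℕ) := energy_step (k := k) (l := l) (η := η) hk hct hβ hδ0 hκ hκβ
    ((cX n).mono (Icc_subset_Icc hc0 le_rfl)) ((cW n).mono (Icc_subset_Icc hc0 le_rfl))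
    ((cΘ n).mono (Icc_subset_Icc hc0 le_rfl)) ((sf.cont n).mono (Icc_subset_Icc hc0 le_rfl))
    ((sg.cont n).mono (Icc_subset_Icc hc0 le_rfl)) ((sj.cont n).mono (Icc_subset_Icc hc0 le_rfl))
    pA (hasDerivAt_weightAfter ν κ δ t₀ hL0)
    (fun s hs => by
      have h1 := hPge s
      have h3 : 0 ≤ 2 * (s - t₀) * L / ((1 + (s - t₀) ^ 2) * (1 + (s - t₀) ^ 2 + L)) := by
        have := hafter s hs
        positivity
      rw [e2]; linarith)
    (fun s hs => by
      have h1 := hPge s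
      rw [e2, e4]; linarith)
    (fun s hs => by
      have h1 := hPge s
      have h2 : 0 ≤ 2 * (s - t₀) / (1 + (s - t₀) ^ 2) := by
        have := hafter s hs
        positivity
      have h3 : 0 ≤ 2 * (s - t₀) * L / ((1 + (s - t₀) ^ 2) * (1 + (s - t₀) ^ 2 + L)) := by
        have := hafter s hs
        positivity
      rw [e2, e3]; linarith)
    (fun s hs => hX n s ⟨hc0.trans_lt hs.1, hs.2⟩) (fun s hs => hW n s ⟨hc0.trans_lt hs.1, hs.2⟩)
    (fun s hs => hΘ n s ⟨hc0.trans_lt hs.1, hs.2⟩)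
  have cB : Continuous (weightBefore ν κ δ t₀) :=
    continuous_iff_continuousAt.2 fun s => (hasDerivAt_weightBefore ν κ δ t₀ s).continuousAt
  have cA : Continuous (weightAfter ν κ δ t₀ L) :=
    continuous_iff_continuousAt.2 fun s => (hasDerivAt_weightAfter ν κ δ t₀ hL0 s).continuousAt
  have lim1 := tendsto_integral_modeEnergy (β := β) (η := η) (k := k) (l := l) (δ := δ) hk
    sf sg sj le_rfl hc0 hct cB
  have lim2 := tendsto_integral_modeEnergy (β := β) (η := η) (k := k) (l := l) (δ := δ) hk
    sf sg sj hc0 hct le_rfl cA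
  have limE {s : ℝ} {x w θ : ℂ} (hx : Tendsto (fun n => X n s) atTop (𝓝 x))
      (hw : Tendsto (fun n => W n s) atTop (𝓝 w)) (hθ : Tendsto (fun n => Θ n s) atTop (𝓝 θ)) :
      Tendsto (fun n => modeEnergy β k l η s (X n s) (W n s) (Θ n s)) atTop
        (𝓝 (modeEnergy β k l η s x w θ)) := by
    unfold modeEnergy
    exact (((hx.norm.pow 2).const_mul _).add (hθ.norm.pow 2)).add
      (((hw.norm.pow 2).const_mul _).const_mul _)
  -- The estimates on `[0, c]` and `[c, t]` are multiplied crosswise by the weights at `c`, so that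
  -- the energy at `c` cancels; then `n → ∞` removes the errors.
  have key := le_of_tendsto_of_tendsto'
    ((limE X1 W1 Θ1).const_mul (weightBefore ν κ δ t₀ c * weightAfter ν κ δ t₀ L t))
    ((((limE X0 W0 Θ0).const_mul (weightBefore ν κ δ t₀ 0)).add lim1).const_mul
      (weightAfter ν κ δ t₀ L c) |>.add (lim2.const_mul (weightBefore ν κ δ t₀ c)))
    (fun n => by
      have h1 := mul_le_mul_of_nonneg_left (hbefore n) (pA c).le
      have h2 := mul_le_mul_of_nonneg_left (hafter n) (pB c).le
      linarith)
  rw [add_zero, mul_zero, add_zero] at key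
  have hE0 : 0 ≤ modeEnergy β k l η 0 (A₀ 2) (Complex.I * k * A₀ 1 - Complex.I * η * A₀ 0)
      (A₀ 3) := by
    have h1 := symb_zero_pos hk η 0
    have h2 : 0 < symb k l η 0 := by rw [eP]; positivity
    have h3 : 0 ≤ β / (β - 1) := by
      rw [div_eq_mul_inv, ← div_self_mul_self', ← mul_div_assoc]
      exact div_nonneg hβ.le (mul_self_nonneg _)
    unfold modeEnergy
    positivity
  set E0 := modeEnergy β k l η 0 (A₀ 2) (Complex.I * k * A₀ 1 - Complex.I * η * A₀ 0) (A₀ 3)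
  set E1 := modeEnergy β k l η t (A₁ 2)
    (Complex.I * k * A₁ 1 - Complex.I * (η - k * t : ℝ) * A₁ 0) (A₁ 3)
  refine le_of_mul_le_mul_left (key.trans ?_) (mul_pos (pB c) (pA t))
  have hr := weight_ratio_le (t₀ := t₀) hν hκ ht
  rw [← hδ] at hr
  rw [← mul_assoc, ← mul_assoc]
  refine mul_le_mul_of_nonneg_right ?_ hE0
  simp only [weightBefore, weightAfter]
  set φ := fun s : ℝ => 2 * ν / 3 * (s - t₀) ^ 3 - δ * s - 2 * κ * Real.arctan (s - t₀)
  have hexp : Real.exp (φ 0) ≤ Real.exp (φ t) *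
      Real.exp (2 + 2 * Real.pi * κ - ν ^ (1 / 3 : ℝ) * t / 8) := by
    rw [← Real.exp_add]
    exact Real.exp_le_exp.2 (by simp only [φ]; linarith)
  change Real.exp (φ c) * ((1 + (c - t₀) ^ 2 + L) / (1 + (c - t₀) ^ 2)) *
    (Real.exp (φ 0) * (1 + (0 - t₀) ^ 2)) ≤ Real.exp (φ c) * (1 + (c - t₀) ^ 2) *
    (Real.exp (φ t) * ((1 + (t - t₀) ^ 2 + L) / (1 + (t - t₀) ^ 2))) *
    (Real.exp (2 + 2 * Real.pi * κ - ν ^ (1 / 3 : ℝ) * t / 8) * ((1 + L) * (1 + t₀ ^ 2)))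
  -- The total loss is `1 + L`, from the second weight at `c`, times `1 + t₀²`, from the first
  -- weight at `0`; the factors on the other side are at least `1`.
  have q1 : (1 + (c - t₀) ^ 2 + L) / (1 + (c - t₀) ^ 2) ≤ 1 + L := by
    rw [div_le_iff₀ (by positivity)]
    nlinarith [mul_nonneg hL0 (sq_nonneg (c - t₀))]
  have q2 : 1 ≤ (1 + (t - t₀) ^ 2 + L) / (1 + (t - t₀) ^ 2) := by
    rw [le_div_iff₀ (by positivity)]; linarith
  have q3 : 1 ≤ 1 + (c - t₀) ^ 2 := by linarith [sq_nonneg (c - t₀)]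
  calc _ ≤ Real.exp (φ c) * (1 + L) * (Real.exp (φ t) *
      Real.exp (2 + 2 * Real.pi * κ - ν ^ (1 / 3 : ℝ) * t / 8) * (1 + (0 - t₀) ^ 2)) := by
        gcongr
    _ = Real.exp (φ c) * 1 * (Real.exp (φ t) * 1) *
      (Real.exp (2 + 2 * Real.pi * κ - ν ^ (1 / 3 : ℝ) * t / 8) * ((1 + L) * (1 + t₀ ^ 2))) := by
        ring
    _ ≤ _ := by gcongr

lemma IsApproxSolution.div_zero {ν α β : ℝ} {k l : ℤ} {η t : ℝ} (ht : 0 ≤ t)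
    {A₀ A₁ : Fin 4 → ℂ} {a e : Fin 4 → ℕ → ℝ → ℂ} {P d : ℕ → ℝ → ℂ}
    (h : IsApproxSolution ν α β k l η t A₀ A₁ a e P d) :
    k * A₀ 0 + η * A₀ 1 + l * A₀ 2 = 0 ∧
      k * A₁ 0 + (η - k * t : ℝ) * A₁ 1 + l * A₁ 2 = 0 := by
  have key {s : ℝ} (hs : s ∈ Icc 0 t) {A : Fin 4 → ℂ}
      (hA : ∀ i, Tendsto (fun n => a i n s) atTop (𝓝 (A i)))
      (hd : Tendsto (fun n => d n s) atTop (𝓝 0)) :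
      k * A 0 + (η - k * s : ℝ) * A 1 + l * A 2 = 0 := by
    have h1 := (((hA 0).const_mul (Complex.I * k)).add
      ((hA 1).const_mul (Complex.I * (η - k * s : ℝ)))).add ((hA 2).const_mul (Complex.I * l))
    simp only [h.div _ s hs] at h1
    have h2 := tendsto_nhds_unique h1 hd
    have h3 : Complex.I * (k * A 0 + (η - k * s : ℝ) * A 1 + l * A 2) = 0 := by
      rw [← h2]; ring
    exact (mul_eq_zero.1 h3).resolve_left Complex.I_ne_zero
  refine ⟨?_, key ⟨ht, le_rfl⟩ h.right h.small_div.right⟩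
  have := key ⟨le_rfl, ht⟩ h.left h.small_div.left
  simpa using this

/-! ### Velocity and initial data against the energy at a single frequency -/

section Pointwise

variable {k l ξ H P γ : ℝ} {X W Θ A₀ A₁ : ℂ}

lemma norm_sq_add_le (z w : ℂ) : ‖z + w‖ ^ 2 ≤ 2 * (‖z‖ ^ 2 + ‖w‖ ^ 2) := by
  have := norm_add_le z w
  nlinarith [norm_nonneg (z + w), sq_nonneg (‖z‖ - ‖w‖)]

/-- Curl and divergence determine the horizontal velocity: `H A₀ = iξW - klX` and `H A₁ = -ikW -
ξlX`. In `A₁` the vorticity carries `k` instead of `ξ`, which leaves the decaying factor `k²/H`; the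
term with `X` has it as well, because `k² ≥ 1`. -/
lemma horizontal_velocity_le (hk : 1 ≤ k ^ 2) (hH : H = k ^ 2 + ξ ^ 2) (hP : P = H + l ^ 2)
    (hγ : 0 < γ) (hW : W = Complex.I * k * A₁ - Complex.I * ξ * A₀)
    (hdiv : k * A₀ + ξ * A₁ + l * X = 0) :
    ‖X‖ ^ 2 + ‖Θ‖ ^ 2 ≤ P / H * ‖X‖ ^ 2 + ‖Θ‖ ^ 2 + γ * (1 / H * ‖W‖ ^ 2) ∧
    ‖A₀‖ ^ 2 ≤ 2 * (1 + 1 / γ) * (P / H * ‖X‖ ^ 2 + ‖Θ‖ ^ 2 + γ * (1 / H * ‖W‖ ^ 2)) ∧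
    ‖A₁‖ ^ 2 ≤ 2 * (k ^ 2 / H) * (1 / γ + l ^ 2) *
      (P / H * ‖X‖ ^ 2 + ‖Θ‖ ^ 2 + γ * (1 / H * ‖W‖ ^ 2)) := by
  have hH0 : 0 < H := by rw [hH]; positivity
  have hHc : (H : ℂ) ≠ 0 := by exact_mod_cast hH0.ne'
  have hPH : 1 ≤ P / H := by rw [le_div_iff₀ hH0, hP]; linarith [sq_nonneg l]
  have hX1 : ‖X‖ ^ 2 ≤ P / H * ‖X‖ ^ 2 := le_mul_of_one_le_left (by positivity) hPH
  have hlP : l ^ 2 / H ≤ P / H := by gcongr; rw [hP]; linarith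
  set E := P / H * ‖X‖ ^ 2 + ‖Θ‖ ^ 2 + γ * (1 / H * ‖W‖ ^ 2) with hE
  have hWpos : 0 ≤ γ * (1 / H * ‖W‖ ^ 2) := by positivity
  have hP0 : 0 ≤ P / H * ‖X‖ ^ 2 := by positivity
  have hE0 : 0 ≤ E := by positivity
  have eW : 1 / H * ‖W‖ ^ 2 ≤ 1 / γ * E := by
    rw [one_div_mul_eq_div γ, le_div_iff₀ hγ]
    nlinarith [sq_nonneg ‖Θ‖]
  have eX : l ^ 2 / H * ‖X‖ ^ 2 ≤ E := by
    have : l ^ 2 / H * ‖X‖ ^ 2 ≤ P / H * ‖X‖ ^ 2 := by gcongr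
    nlinarith [sq_nonneg ‖Θ‖]
  have eX1 : ‖X‖ ^ 2 ≤ E := by nlinarith [sq_nonneg ‖Θ‖]
  have ha (r : ℝ) (z : ℂ) : ‖(r : ℂ) * z‖ ^ 2 = r ^ 2 * ‖z‖ ^ 2 := by
    rw [norm_mul, Complex.norm_real, mul_pow, Real.norm_eq_abs, sq_abs]
  have hI (z : ℂ) : ‖Complex.I * z‖ = ‖z‖ := by rw [norm_mul, Complex.norm_I, one_mul]
  refine ⟨by linarith, ?_, ?_⟩
  · have e : A₀ = (ξ / H : ℝ) * (Complex.I * W) + (-(k * l) / H : ℝ) * X := by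
      have : (H : ℂ) * A₀ = ξ * (Complex.I * W) + (-(k * l)) * X := by
        rw [hW, hH]; push_cast
        linear_combination (-(k : ℂ)) * (-hdiv) + (-ξ * k * A₁ + ξ ^ 2 * A₀) * Complex.I_sq
      field_simp
      push_cast
      field_simp
      linear_combination this
    rw [e]
    refine (norm_sq_add_le _ _).trans ?_
    rw [ha, ha, hI]
    have h1 : (ξ / H) ^ 2 * ‖W‖ ^ 2 ≤ 1 / H * ‖W‖ ^ 2 := by
      gcongr
      rw [div_pow, div_le_div_iff₀ (by positivity) hH0]
      nlinarith [sq_nonneg k, sq_nonneg ξ]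
    have h2 : (-(k * l) / H) ^ 2 * ‖X‖ ^ 2 ≤ l ^ 2 / H * ‖X‖ ^ 2 := by
      gcongr
      rw [div_pow, div_le_div_iff₀ (by positivity) hH0]
      have : l ^ 2 * k ^ 2 ≤ l ^ 2 * H := by gcongr; rw [hH]; linarith [sq_nonneg ξ]
      nlinarith
    nlinarith
  · have e : A₁ = (-k / H : ℝ) * (Complex.I * W) + (-(ξ * l) / H : ℝ) * X := by
      have : (H : ℂ) * A₁ = -k * (Complex.I * W) + (-(ξ * l)) * X := by
        rw [hW, hH]; push_cast
        linear_combination (ξ : ℂ) * hdiv + (k ^ 2 * A₁ - ξ * k * A₀) * Complex.I_sq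
      field_simp
      push_cast
      field_simp
      linear_combination this
    rw [e]
    refine (norm_sq_add_le _ _).trans ?_
    rw [ha, ha, hI]
    have h1 : (-k / H) ^ 2 * ‖W‖ ^ 2 = k ^ 2 / H * (1 / H * ‖W‖ ^ 2) := by
      field_simp
    have h2 : (-(ξ * l) / H) ^ 2 * ‖X‖ ^ 2 ≤ k ^ 2 / H * (l ^ 2 * ‖X‖ ^ 2) := by
      rw [← mul_assoc]
      gcongr
      rw [div_pow, div_mul_eq_mul_div, div_le_div_iff₀ (by positivity) hH0]
      have h3 : ξ ^ 2 * (l ^ 2 * H) ≤ H * (l ^ 2 * H) := by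
        gcongr; rw [hH]; linarith [sq_nonneg k]
      have h4 : 1 * (l ^ 2 * H * H) ≤ k ^ 2 * (l ^ 2 * H * H) := by gcongr
      nlinarith
    have h3 : k ^ 2 / H * (1 / H * ‖W‖ ^ 2) ≤ k ^ 2 / H * (1 / γ * E) := by gcongr
    have h4 : k ^ 2 / H * (l ^ 2 * ‖X‖ ^ 2) ≤ k ^ 2 / H * (l ^ 2 * E) := by gcongr
    rw [h1]
    linarith

/-- The first form keeps the vorticity, for the bound on `(u³, θ)`. The second uses `|W|² ≤ H(|A₀|²
+ |A₁|²)`, so the weight `1/H` spares a derivative. -/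
lemma initial_energy_le (hk : 1 ≤ k ^ 2) (hH : H = k ^ 2 + ξ ^ 2) (hP : P = H + l ^ 2)
    (hγ : 0 < γ) (hW : W = Complex.I * k * A₁ - Complex.I * ξ * A₀) :
    P / H * ‖X‖ ^ 2 + ‖Θ‖ ^ 2 + γ * (1 / H * ‖W‖ ^ 2) ≤
        (1 + l ^ 2) * ‖X‖ ^ 2 + ‖Θ‖ ^ 2 + γ * ‖W‖ ^ 2 ∧
    P / H * ‖X‖ ^ 2 + ‖Θ‖ ^ 2 + γ * (1 / H * ‖W‖ ^ 2) ≤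
        (1 + l ^ 2) * ‖X‖ ^ 2 + ‖Θ‖ ^ 2 + γ * (‖A₀‖ ^ 2 + ‖A₁‖ ^ 2) := by
  have hH0 : 0 < H := by rw [hH]; positivity
  have hH1 : 1 ≤ H := by rw [hH]; linarith [sq_nonneg ξ]
  have hPH : P / H ≤ 1 + l ^ 2 := by
    rw [div_le_iff₀ hH0, hP]
    nlinarith [mul_nonneg (sq_nonneg l) (sub_nonneg.2 hH1)]
  have hX : P / H * ‖X‖ ^ 2 ≤ (1 + l ^ 2) * ‖X‖ ^ 2 := by gcongr
  have hW1 : 1 / H * ‖W‖ ^ 2 ≤ ‖W‖ ^ 2 := by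
    refine mul_le_of_le_one_left (by positivity) ?_
    rw [div_le_one hH0]; exact hH1
  have hW2 : 1 / H * ‖W‖ ^ 2 ≤ ‖A₀‖ ^ 2 + ‖A₁‖ ^ 2 := by
    rw [one_div_mul_eq_div, div_le_iff₀ hH0]
    have : ‖W‖ ≤ |k| * ‖A₁‖ + |ξ| * ‖A₀‖ := by
      rw [hW]
      refine (norm_sub_le _ _).trans_eq ?_
      simp
    have h2 : ‖W‖ ^ 2 ≤ (|k| * ‖A₁‖ + |ξ| * ‖A₀‖) ^ 2 := by gcongr
    rw [hH, ← sq_abs k, ← sq_abs ξ]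
    nlinarith [sq_nonneg (|k| * ‖A₀‖ - |ξ| * ‖A₁‖)]
  have h1 := mul_le_mul_of_nonneg_left hW1 hγ.le
  have h2 := mul_le_mul_of_nonneg_left hW2 hγ.le
  exact ⟨by linarith, by linarith⟩

end Pointwise

/-- Decay away from the critical time `c = η/k` becomes decay in `t` at the price of a weight in
`η`. -/
lemma one_add_sq_le {t c η : ℝ} (h : c ^ 2 ≤ η ^ 2) :
    1 + t ^ 2 ≤ 2 * (1 + η ^ 2) * (1 + (t - c) ^ 2) := by
  have h1 : t ^ 2 ≤ 2 * c ^ 2 + 2 * (t - c) ^ 2 := by linarith [sq_nonneg (t - 2 * c)]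
  have h2 : 0 ≤ η ^ 2 * (t - c) ^ 2 := by positivity
  linarith

set_option maxHeartbeats 800000 in
-- Counting powers of `J`: the energy estimate loses `J²`, and `P/H ≤ 1 + l²` at time `0` one more
-- on the velocity. For `u²`, the factors `1 + l²` from recovering the velocity and `1 + η²` from
-- trading `1 + t²` cost another `J²`. These are squared norms, so a power of `J` is one derivative.
lemma IsApproxSolution.bounds {ν α β κ : ℝ} {k l : ℤ} (hk : k ≠ 0) {η t : ℝ} (ht : 0 ≤ t)
    (hν : 0 < ν) (hβ : 0 < β * (β - 1)) (hκ : 0 < κ) (hκβ : (β - 1) / β ≤ κ ^ 2)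
    {A B : Fin 4 → ℂ} {a e : Fin 4 → ℕ → ℝ → ℂ} {P d : ℕ → ℝ → ℂ}
    (h : IsApproxSolution ν α β k l η t A B a e P d) {M J m D : ℝ}
    (hM : M = Real.exp (2 + 2 * Real.pi * κ)) (hJ : J = 1 + (k : ℝ) ^ 2 + η ^ 2 + (l : ℝ) ^ 2)
    (hm : m = max (Real.sqrt ((β - 1) / β)) (Real.sqrt (β / (β - 1))))
    (hD : D = Real.exp (-(1 / 16) * ν ^ (1 / 3 : ℝ) * t)) :
    ‖B 0‖ ^ 2 ≤ 8 * M * (m * D) ^ 2 *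
      (J ^ 3 * (‖A 0‖ ^ 2 + ‖A 1‖ ^ 2 + ‖A 2‖ ^ 2) + J ^ 2 * ‖A 3‖ ^ 2) ∧
    (1 + t ^ 2) * ‖B 1‖ ^ 2 ≤ 8 * M * (m * D) ^ 2 *
      (J ^ 5 * (‖A 0‖ ^ 2 + ‖A 1‖ ^ 2 + ‖A 2‖ ^ 2) + J ^ 4 * ‖A 3‖ ^ 2) ∧
    ‖B 2‖ ^ 2 + ‖B 3‖ ^ 2 ≤ 8 * M * D ^ 2 *
      (J ^ 3 * ‖A 2‖ ^ 2 + β / (β - 1) * (J ^ 2 *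
        ‖Complex.I * k * A 1 - Complex.I * η * A 0‖ ^ 2) + J ^ 2 * ‖A 3‖ ^ 2) := by
  have hE := h.energy_le hk ht hν hβ hκ hκβ
  obtain ⟨dv0, dv1⟩ := h.div_zero ht
  have hk1 : (1 : ℝ) ≤ (k : ℝ) ^ 2 := by
    have : (1 : ℤ) ≤ k ^ 2 := by
      have := sq_pos_of_ne_zero hk
      omega
    exact_mod_cast this
  have hβ0 : β ≠ 0 := by rintro rfl; simp at hβ
  have hβ1 : β - 1 ≠ 0 := by intro h; simp [h] at hβ
  set γ := β / (β - 1) with hγ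
  have hγ0 : 0 < γ := by
    rw [hγ, div_eq_mul_inv, ← div_self_mul_self', ← mul_div_assoc]
    exact div_pos hβ (mul_self_pos.2 hβ1)
  have hγ1 : (β - 1) / β = 1 / γ := by rw [hγ, one_div_div]
  rw [hγ1] at hm
  have m1 : 1 / γ ≤ m ^ 2 := by
    rw [← Real.sq_sqrt (by positivity : 0 ≤ 1 / γ), hm]
    gcongr; exact le_max_left _ _
  have m2 : γ ≤ m ^ 2 := by
    rw [← Real.sq_sqrt hγ0.le, hm]
    gcongr; exact le_max_right _ _
  have m3 : 1 ≤ m ^ 2 := by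
    rcases le_total 1 γ with h | h
    · exact h.trans m2
    · exact (one_le_one_div hγ0 h).trans m1
  have hDD : Real.exp (2 + 2 * Real.pi * κ - ν ^ (1 / 3 : ℝ) * t / 8) = M * D ^ 2 := by
    rw [hM, hD, ← Real.exp_nat_mul, ← Real.exp_add]
    congr 1; push_cast; ring
  rw [hDD] at hE
  have hM0 : 0 < M := by rw [hM]; positivity
  have hD0 : 0 < D := by rw [hD]; positivity
  obtain ⟨b1, b2, b3⟩ := horizontal_velocity_le (k := k) (l := l) (ξ := η - k * t)
    (H := symb k 0 η t) (P := symb k l η t) (Θ := B 3) hk1 (by simp [symb]) (symb_eq k l η t) hγ0 rfl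
    (by simpa using dv1)
  obtain ⟨c1, c2⟩ := initial_energy_le (k := k) (l := l) (ξ := η) (X := A 2) (A₀ := A 0)
    (A₁ := A 1)
    (H := symb k 0 η 0) (P := symb k l η 0) (Θ := A 3) hk1 (by simp [symb]) (symb_eq k l η 0) hγ0 rfl
  simp only [modeEnergy, ← hγ] at hE
  simp only [Complex.ofReal_intCast] at b1 b2 b3 c1 c2
  set E1 := symb k l η t / symb k 0 η t * ‖B 2‖ ^ 2 + ‖B 3‖ ^ 2 +
    γ * (1 / symb k 0 η t * ‖Complex.I * k * B 1 - Complex.I * (η - k * t : ℝ) * B 0‖ ^ 2)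
  set E0 := symb k l η 0 / symb k 0 η 0 * ‖A 2‖ ^ 2 + ‖A 3‖ ^ 2 +
    γ * (1 / symb k 0 η 0 * ‖Complex.I * k * A 1 - Complex.I * η * A 0‖ ^ 2)
  have hkl : (l / k : ℝ) ^ 2 ≤ (l : ℝ) ^ 2 := by
    rw [div_pow]; exact div_le_self (by positivity) hk1
  have hηk : (η / k : ℝ) ^ 2 ≤ η ^ 2 := by
    rw [div_pow]; exact div_le_self (by positivity) hk1
  have hE0 : 0 ≤ E0 := by
    have := symb_zero_pos hk η 0
    have h2 : 0 < symb k l η 0 := by rw [symb_eq]; positivity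
    positivity
  have hE' : E1 ≤ M * D ^ 2 * ((1 + (l : ℝ) ^ 2) * (1 + η ^ 2)) * E0 := by
    refine hE.trans ?_
    gcongr
  have hJ1 : 1 ≤ J := by rw [hJ]; linarith [sq_nonneg η, sq_nonneg (l : ℝ)]
  have hl : 1 + (l : ℝ) ^ 2 ≤ J := by rw [hJ]; linarith [sq_nonneg η]
  have hη : 1 + η ^ 2 ≤ J := by rw [hJ]; linarith [sq_nonneg (l : ℝ)]
  set S := ‖A 0‖ ^ 2 + ‖A 1‖ ^ 2 + ‖A 2‖ ^ 2 with hS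
  -- Recovering the velocity costs `1 + 1/γ`, while the initial vorticity carries `γ`. Their product
  -- is only `γ + 1`, so a single factor `m²` covers both.
  have hgE : (1 + 1 / γ) * E0 ≤ 2 * m ^ 2 * (J * S + ‖A 3‖ ^ 2) := by
    have hn0 := sq_nonneg ‖A 0‖
    have hn1 := sq_nonneg ‖A 1‖
    have hn2 := sq_nonneg ‖A 2‖
    have hn3 := sq_nonneg ‖A 3‖
    have q1 : 1 + 1 / γ ≤ 2 * m ^ 2 := by linarith
    have q2 : (1 + 1 / γ) * γ ≤ 2 * m ^ 2 := by
      have : (1 + 1 / γ) * γ = γ + 1 := by field_simp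
      linarith
    calc (1 + 1 / γ) * E0 ≤ (1 + 1 / γ) * ((1 + (l : ℝ) ^ 2) * ‖A 2‖ ^ 2 + ‖A 3‖ ^ 2 +
        γ * (‖A 0‖ ^ 2 + ‖A 1‖ ^ 2)) := by gcongr
      _ = (1 + 1 / γ) * ((1 + (l : ℝ) ^ 2) * ‖A 2‖ ^ 2 + ‖A 3‖ ^ 2) +
        (1 + 1 / γ) * γ * (‖A 0‖ ^ 2 + ‖A 1‖ ^ 2) := by ring
      _ ≤ (2 * m ^ 2) * (J * ‖A 2‖ ^ 2 + ‖A 3‖ ^ 2) +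
        (2 * m ^ 2) * (‖A 0‖ ^ 2 + ‖A 1‖ ^ 2) := by gcongr
      _ ≤ (2 * m ^ 2) * (J * ‖A 2‖ ^ 2 + ‖A 3‖ ^ 2) +
        (2 * m ^ 2) * (J * (‖A 0‖ ^ 2 + ‖A 1‖ ^ 2)) := by
          gcongr
          exact le_mul_of_one_le_left (by positivity) hJ1
      _ = _ := by rw [hS]; ring
  refine ⟨?_, ?_, ?_⟩
  · calc ‖B 0‖ ^ 2 ≤ 2 * (1 + 1 / γ) * (M * D ^ 2 * ((1 + (l : ℝ) ^ 2) * (1 + η ^ 2)) * E0) := by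
          refine b2.trans ?_; gcongr
      _ = 2 * (M * D ^ 2 * ((1 + (l : ℝ) ^ 2) * (1 + η ^ 2))) * ((1 + 1 / γ) * E0) := by ring
      _ ≤ 2 * (M * D ^ 2 * (J * J)) * (2 * m ^ 2 * (J * S + ‖A 3‖ ^ 2)) := by gcongr
      _ = 4 * M * (m * D) ^ 2 * (J ^ 3 * S + J ^ 2 * ‖A 3‖ ^ 2) := by ring
      _ ≤ _ := by gcongr; norm_num
  · have hkH : (1 + t ^ 2) * (k ^ 2 / symb k 0 η t) ≤ 2 * (1 + η ^ 2) := by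
      have e : symb k 0 η t = k ^ 2 * (1 + (t - η / k) ^ 2) := by
        have : (k : ℝ) ≠ 0 := by exact_mod_cast hk
        simp only [symb]; push_cast; field_simp; ring
      have hk0 : (k : ℝ) ^ 2 ≠ 0 := by positivity
      rw [e, ← div_div, div_self hk0, mul_one_div, div_le_iff₀ (by positivity)]
      exact one_add_sq_le hηk
    have hg : 1 / γ + (l : ℝ) ^ 2 ≤ (1 + 1 / γ) * (1 + (l : ℝ) ^ 2) := by
      have h1 : 0 ≤ 1 / γ * (l : ℝ) ^ 2 := by positivity
      have h2 : (1 + 1 / γ) * (1 + (l : ℝ) ^ 2) =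
        1 + (l : ℝ) ^ 2 + 1 / γ + 1 / γ * (l : ℝ) ^ 2 := by ring
      linarith
    calc (1 + t ^ 2) * ‖B 1‖ ^ 2 ≤ (1 + t ^ 2) * (2 * (k ^ 2 / symb k 0 η t) *
          (1 / γ + (l : ℝ) ^ 2) * (M * D ^ 2 * ((1 + (l : ℝ) ^ 2) * (1 + η ^ 2)) * E0)) := by
          have := symb_zero_pos hk η t
          have h0 : 0 ≤ 2 * (k ^ 2 / symb k 0 η t) * (1 / γ + (l : ℝ) ^ 2) := by positivity
          gcongr
          exact b3.trans (mul_le_mul_of_nonneg_left hE' h0)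
      _ = 2 * ((1 + t ^ 2) * (k ^ 2 / symb k 0 η t)) *
          (1 / γ + (l : ℝ) ^ 2) * (M * D ^ 2 * ((1 + (l : ℝ) ^ 2) * (1 + η ^ 2)) * E0) := by ring
      _ ≤ 2 * (2 * (1 + η ^ 2)) * ((1 + 1 / γ) * (1 + (l : ℝ) ^ 2)) *
          (M * D ^ 2 * ((1 + (l : ℝ) ^ 2) * (1 + η ^ 2)) * E0) := by gcongr
      _ = 4 * ((1 + η ^ 2) * (1 + (l : ℝ) ^ 2)) * (M * D ^ 2 * ((1 + (l : ℝ) ^ 2) * (1 + η ^ 2))) *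
          ((1 + 1 / γ) * E0) := by ring
      _ ≤ 4 * (J * J) * (M * D ^ 2 * (J * J)) * (2 * m ^ 2 * (J * S + ‖A 3‖ ^ 2)) := by gcongr
      _ = _ := by ring
  · set w := ‖Complex.I * k * A 1 - Complex.I * η * A 0‖ ^ 2
    have hw : 0 ≤ w := by positivity
    calc _ ≤ M * D ^ 2 * ((1 + (l : ℝ) ^ 2) * (1 + η ^ 2)) *
          ((1 + (l : ℝ) ^ 2) * ‖A 2‖ ^ 2 + ‖A 3‖ ^ 2 + γ * w) := by
          refine (b1.trans hE').trans ?_; gcongr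
      _ ≤ M * D ^ 2 * (J * J) * (J * ‖A 2‖ ^ 2 + ‖A 3‖ ^ 2 + γ * w) := by gcongr
      _ = 1 * M * D ^ 2 * (J ^ 3 * ‖A 2‖ ^ 2 + γ * (J ^ 2 * w) + J ^ 2 * ‖A 3‖ ^ 2) := by ring
      _ ≤ _ := by gcongr; norm_num

/-! ### Sobolev bounds for the non-zero modes -/

/-- Integration over all frequencies. -/
def freqSum (F : ℤ → ℤ → ℝ → ℝ≥0∞) : ℝ≥0∞ := ∑' k : ℤ, ∑' l : ℤ, ∫⁻ η : ℝ, F k l η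

lemma freqSum_mono {F G : ℤ → ℤ → ℝ → ℝ≥0∞} (h : ∀ k l, ∀ᵐ η : ℝ, F k l η ≤ G k l η) :
    freqSum F ≤ freqSum G :=
  ENNReal.tsum_le_tsum fun k => ENNReal.tsum_le_tsum fun l => lintegral_mono_ae (h k l)

lemma freqSum_add {F : ℤ → ℤ → ℝ → ℝ≥0∞} (G : ℤ → ℤ → ℝ → ℝ≥0∞)
    (h : ∀ k l, AEMeasurable (F k l)) :
    freqSum (fun k l η => F k l η + G k l η) = freqSum F + freqSum G := by
  simp only [freqSum, ← ENNReal.tsum_add]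
  exact tsum_congr fun k => tsum_congr fun l => lintegral_add_left' (h k l) _

lemma freqSum_const_mul {c : ℝ≥0∞} (hc : c ≠ ⊤) (F : ℤ → ℤ → ℝ → ℝ≥0∞) :
    freqSum (fun k l η => c * F k l η) = c * freqSum F := by
  simp only [freqSum, ← ENNReal.tsum_mul_left]
  exact tsum_congr fun k => tsum_congr fun l => lintegral_const_mul' _ _ hc

/-- The symbol `1 + k² + η² + l²`. -/
def bracket (k l : ℤ) (η : ℝ) : ℝ := 1 + (k : ℝ) ^ 2 + η ^ 2 + (l : ℝ) ^ 2

lemma bracket_pos (k l : ℤ) (η : ℝ) : 0 < bracket k l η := by unfold bracket; positivity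

/-- The density of `‖f‖²` in `H^s`. -/
def sobolevDensity (s : ℝ) (f : ℝ × ℝ × ℝ → ℝ) (k l : ℤ) (η : ℝ) : ℝ≥0∞ :=
  ENNReal.ofReal (bracket k l η ^ s) * ‖fourier3 f k η l‖ₑ ^ 2

lemma sobolevDensity_eq (s : ℝ) (f : ℝ × ℝ × ℝ → ℝ) (k l : ℤ) (η : ℝ) :
    sobolevDensity s f k l η = ENNReal.ofReal (bracket k l η ^ s * ‖fourier3 f k η l‖ ^ 2) := by
  have := bracket_pos k l η
  rw [sobolevDensity, ENNReal.ofReal_mul (by positivity), ENNReal.ofReal_pow (norm_nonneg _),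
    ofReal_norm]

lemma aemeasurable_sobolevDensity (s : ℝ) (f : ℝ × ℝ × ℝ → ℝ) (k l : ℤ) :
    AEMeasurable (sobolevDensity s f k l) := by
  have h1 : Measurable fun η => ENNReal.ofReal (bracket k l η ^ s) := by
    unfold bracket; fun_prop
  exact h1.aemeasurable.mul ((aestronglyMeasurable_lineFourier _).enorm.pow_const 2)

lemma sobolevNorm_sq {f : ℝ × ℝ × ℝ → ℝ} (h : MemLp f 2 cell3) (s : ℝ) :
    sobolevNorm s f ^ 2 = freqSum (sobolevDensity s f) := by
  rw [sobolevNorm, if_pos h, ← ENNReal.rpow_natCast, ← ENNReal.rpow_mul]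
  norm_num
  rfl

lemma ENNReal_le_of_sq_le {a b : ℝ≥0∞} (h : a ^ 2 ≤ b ^ 2) : a ≤ b :=
  (ENNReal.pow_le_pow_left_iff two_ne_zero).1 h

lemma vecNorm_sq {n : ℕ} (a : Fin n → ℝ≥0∞) : vecNorm a ^ 2 = ∑ i, a i ^ 2 := by
  rw [vecNorm, ← ENNReal.rpow_natCast, ← ENNReal.rpow_mul]
  norm_num

lemma sq_add_sq_le (a b : ℝ≥0∞) : a ^ 2 + b ^ 2 ≤ (a + b) ^ 2 := by
  have : (a + b) ^ 2 = a ^ 2 + b ^ 2 + 2 * a * b := by ring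
  rw [this]
  exact le_self_add

lemma moving_zero (f : ℝ × ℝ × ℝ → ℝ) : moving 0 f = f := by
  ext X
  simp [moving]

/-- The Fourier transform of the third vorticity component. -/
lemma fourier3_vorticity {f g : ℝ × ℝ × ℝ → ℝ} (hf : ContDiff ℝ ∞ f) (hg : ContDiff ℝ ∞ g)
    (hpf : IsPeriodic f) (hpg : IsPeriodic g) (h2f : MemLp f 2 cell3) (h2g : MemLp g 2 cell3)
    (hw : MemLp (fun X => dX g X - dY f X) 2 cell3) (k l : ℤ) :
    ∀ᵐ η : ℝ, fourier3 (fun X => dX g X - dY f X) k η l =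
      Complex.I * k * fourier3 g k η l - Complex.I * η * fourier3 f k η l := by
  have cg := (contDiff_dX hg).continuous
  have cf := (contDiff_dY hf).continuous
  set w := fun X => dX g X - dY f X with hwdef
  have cw : Continuous w := cg.sub cf
  have hpw : IsPeriodic w := fun x y z => by
    have h1 := hpg.dX hg x y z
    have h2 := hpf.dY hf x y z
    simp only [hwdef, h1.1, h1.2, h2.1, h2.2, and_self]
  -- The truncation argument is reused for functions constant in time, at `t = 0`: the two
  -- derivatives are not assumed to lie in `L²` separately, only their difference `w` is.
  have key := exists_truncation_seq (v := fun i : Fin 3 => fun _ : ℝ => (![f, g, w] : _ → _) i)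
    (fun i => ?_) (fun i => ?_) (fun i t _ => ?_) k l le_rfl
  · filter_upwards [key] with η ⟨χ, hχ, hsm, _, hlim⟩
    have l0 := hlim 0 0 (by simp)
    have l1 := hlim 1 0 (by simp)
    have l2 := hlim 2 0 (by simp)
    have l3 := (hsm 0 1 (by simp)).left
    simp only [moving_zero, mul_zero, sub_zero, Matrix.cons_val_zero, Matrix.cons_val_one,
      Matrix.cons_val_two, Matrix.tail_cons, Matrix.head_cons] at l0 l1 l2 l3
    have e (n : ℕ) : tf (χ n) η (coef k l w) = Complex.I * k * tf (χ n) η (coef k l g) -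
        (Complex.I * η * tf (χ n) η (coef k l f) - tf (deriv^[1] (χ n)) η (coef k l f)) := by
      have h1 : w = fun X => dX g X + (-1 : ℝ) * dY f X := by ext X; simp only [hwdef]; ring
      rw [h1, tf_coef_add (hχ n) cg (g := fun X => (-1 : ℝ) * dY f X) (continuous_const.mul cf),
        tf_coef_const_mul,
        tf_coef_dX _ hg hpg, tf_coef_dY (hχ n) hf]
      push_cast
      simp only [Function.iterate_one]
      ring
    simp only [e] at l2
    have l4 := (l1.const_mul (Complex.I * k)).sub ((l0.const_mul (Complex.I * η)).sub l3)
    rw [sub_zero] at l4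
    exact tendsto_nhds_unique l2 l4
  · fin_cases i
    exacts [(hf.continuous.comp continuous_snd).continuousOn,
      (hg.continuous.comp continuous_snd).continuousOn, (cw.comp continuous_snd).continuousOn]
  · have hb {f : ℝ × ℝ × ℝ → ℝ} (h : MemLp f 2 cell3) :
        LocallyBoundedL2 (Ici 0) (fun _ => f) := fun _ => ⟨_, h.2.ne, fun _ _ _ => ⟨h, le_rfl⟩⟩
    fin_cases i
    exacts [hb h2f, hb h2g, hb hw]
  · fin_cases i
    exacts [hpf, hpg, hpw]

/-! ### From frequency bounds to Sobolev norms -/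

section Bounds

variable {ν α β : ℝ} {uin : Fin 3 → ℝ × ℝ × ℝ → ℝ} {θin : ℝ × ℝ × ℝ → ℝ}
  {u : Fin 3 → ℝ → ℝ × ℝ × ℝ → ℝ} {θ π : ℝ → ℝ × ℝ × ℝ → ℝ}

lemma IsLinearSolution.continuous_fields (h : IsLinearSolution ν α β uin θin u θ π) {t : ℝ}
    (ht : 0 ≤ t) (i : Fin 4) : Continuous (fields u θ i t) := by
  fin_cases i
  exacts [continuous_slice (h.cont_u 0) ht, continuous_slice (h.cont_u 1) ht,
    continuous_slice (h.cont_u 2) ht, continuous_slice h.cont_θ ht]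

lemma IsLinearSolution.periodic_fields (h : IsLinearSolution ν α β uin θin u θ π) {t : ℝ}
    (ht : 0 ≤ t) (i : Fin 4) : IsPeriodic (fields u θ i t) := by
  fin_cases i
  exacts [h.periodic_u 0 t ht, h.periodic_u 1 t ht, h.periodic_u 2 t ht, h.periodic_θ t ht]

lemma IsLinearSolution.memLp_fields (h : IsLinearSolution ν α β uin θin u θ π) {t : ℝ}
    (ht : 0 ≤ t) (i : Fin 4) : MemLp (fields u θ i t) 2 cell3 := by
  have key {f : ℝ → ℝ × ℝ × ℝ → ℝ} (hf : LocallyBoundedL2 (Ici 0) f) : MemLp (f t) 2 cell3 :=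
    let ⟨_, _, h⟩ := hf t
    (h t ht le_rfl).1
  fin_cases i
  exacts [key (h.energy_u 0), key (h.energy_u 1), key (h.energy_u 2), key h.energy_θ]

lemma IsLinearSolution.memLp_in (h : IsLinearSolution ν α β uin θin u θ π) :
    (∀ i, MemLp (uin i) 2 cell3) ∧ MemLp θin 2 cell3 := by
  have key := h.memLp_fields le_rfl
  refine ⟨fun i => ?_, h.init_θ ▸ key 3⟩
  rw [← h.init_u]
  fin_cases i
  exacts [key 0, key 1, key 2]

lemma IsLinearSolution.modeAt_zero (h : IsLinearSolution ν α β uin θin u θ π) (k l : ℤ) (η : ℝ) :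
    modeAt u θ k l η 0 = ![fourier3 (uin 0) k η l, fourier3 (uin 1) k η l, fourier3 (uin 2) k η l,
      fourier3 θin k η l] := by
  ext i
  simp only [modeAt, moving_zero]
  fin_cases i
  · simp [fields, h.init_u]
  · simp [fields, h.init_u]
  · simp [fields, h.init_u]
  · simp [fields, h.init_θ]

/-- The `i`-th unknown in the moving frame, without its zero mode. -/
def movingNonzero (u : Fin 3 → ℝ → ℝ × ℝ × ℝ → ℝ) (θ : ℝ → ℝ × ℝ × ℝ → ℝ) (t : ℝ) (i : Fin 4) :
    ℝ × ℝ × ℝ → ℝ := nonzeroMode (moving t (fields u θ i t))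

lemma IsLinearSolution.memLp_movingNonzero (h : IsLinearSolution ν α β uin θin u θ π) {t : ℝ}
    (ht : 0 ≤ t) (i : Fin 4) : MemLp (movingNonzero u θ t i) 2 cell3 :=
  memLp_nonzeroMode (continuous_moving (h.continuous_fields ht i) t)
    (memLp_moving (h.continuous_fields ht i) (h.periodic_fields ht i) (h.memLp_fields ht i) t)

lemma bracket_rpow_mul {k l : ℤ} {η s : ℝ} (n : ℕ) (x : ℝ) :
    bracket k l η ^ s * (bracket k l η ^ n * x) = bracket k l η ^ (s + n) * x := by
  rw [Real.rpow_add (bracket_pos k l η), Real.rpow_natCast, mul_assoc]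

/-- The mode `k = 0` is removed on the left, so `IsApproxSolution.bounds` is only used for `k ≠ 0`.
The third bound is conditional, because the transform of the vorticity has no meaning outside `L²`.
-/
lemma IsLinearSolution.density_bounds {κ : ℝ} (hin : IsInitialData uin θin)
    (h : IsLinearSolution ν α β uin θin u θ π)
    (hν : 0 < ν) (hβ : 0 < β * (β - 1)) (hκ : 0 < κ) (hκβ : (β - 1) / β ≤ κ ^ 2) {M m D t s : ℝ}
    (ht : 0 ≤ t) (hM : M = Real.exp (2 + 2 * Real.pi * κ))
    (hm : m = max (Real.sqrt ((β - 1) / β)) (Real.sqrt (β / (β - 1))))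
    (hD : D = Real.exp (-(1 / 16) * ν ^ (1 / 3 : ℝ) * t)) (k l : ℤ) :
    ∀ᵐ η : ℝ,
      (sobolevDensity s (movingNonzero u θ t 0) k l η ≤
        ENNReal.ofReal (8 * M * (m * D) ^ 2) * (∑ i, sobolevDensity (s + 3) (uin i) k l η +
          sobolevDensity (s + 2) θin k l η)) ∧
      (ENNReal.ofReal (1 + t ^ 2) * sobolevDensity s (movingNonzero u θ t 1) k l η ≤
        ENNReal.ofReal (8 * M * (m * D) ^ 2) * (∑ i, sobolevDensity (s + 5) (uin i) k l η +
          sobolevDensity (s + 4) θin k l η)) ∧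
      (MemLp (fun X => dX (uin 1) X - dY (uin 0) X) 2 cell3 →
        sobolevDensity s (movingNonzero u θ t 2) k l η +
        sobolevDensity s (movingNonzero u θ t 3) k l η ≤
        ENNReal.ofReal (8 * M * D ^ 2) * (sobolevDensity (s + 3) (uin 2) k l η +
          ENNReal.ofReal (β / (β - 1)) *
            sobolevDensity (s + 2) (fun X => dX (uin 1) X - dY (uin 0) X) k l η +
          sobolevDensity (s + 2) θin k l η)) := by
  have hcm (i : Fin 4) := continuous_moving (h.continuous_fields ht i) t
  by_cases hk : k = 0
  · subst hk
    filter_upwards [fourier3_nonzeroMode_zero (hcm 0) l, fourier3_nonzeroMode_zero (hcm 1) l,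
      fourier3_nonzeroMode_zero (hcm 2) l, fourier3_nonzeroMode_zero (hcm 3) l] with η e0 e1 e2 e3
    simp [sobolevDensity, movingNonzero, e0, e1, e2, e3]
  · have hvort : ∀ᵐ η : ℝ, MemLp (fun X => dX (uin 1) X - dY (uin 0) X) 2 cell3 →
        fourier3 (fun X => dX (uin 1) X - dY (uin 0) X) k η l =
          Complex.I * k * fourier3 (uin 1) k η l - Complex.I * η * fourier3 (uin 0) k η l := by
      by_cases hw : MemLp (fun X => dX (uin 1) X - dY (uin 0) X) 2 cell3
      · filter_upwards [fourier3_vorticity (hin.smooth_u 0) (hin.smooth_u 1) (hin.periodic_u 0)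
          (hin.periodic_u 1) (h.memLp_in.1 0) (h.memLp_in.1 1) hw k l] with η hη _ using hη
      · exact .of_forall fun η hw' => absurd hw' hw
    filter_upwards [ae_exists_approxSolution hin h (l := l) (Or.inl hk) ht, hvort]
      with η ⟨a, e, P, d, hsol⟩ hv
    obtain ⟨b1, b2, b3⟩ := hsol.bounds hk ht hν hβ hκ hκβ hM rfl hm hD
    have hb (i : Fin 4) : fourier3 (movingNonzero u θ t i) k η l = modeAt u θ k l η t i :=
      fourier3_nonzeroMode (hcm i) hk η l
    have hJ := bracket_pos k l η
    have hM0 : 0 < M := by rw [hM]; positivity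
    have hγ0 : 0 ≤ β / (β - 1) := by
      rw [div_eq_mul_inv, ← div_self_mul_self', ← mul_div_assoc]
      exact div_nonneg hβ.le (mul_self_nonneg _)
    have hJs : 0 ≤ bracket k l η ^ s := by positivity
    change _ ≤ 8 * M * (m * D) ^ 2 * (bracket k l η ^ 3 * _ + bracket k l η ^ 2 * _) at b1
    change _ ≤ 8 * M * (m * D) ^ 2 * (bracket k l η ^ 5 * _ + bracket k l η ^ 4 * _) at b2
    change _ ≤ 8 * M * D ^ 2 * (bracket k l η ^ 3 * _ + _ * (bracket k l η ^ 2 * _) +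
      bracket k l η ^ 2 * _) at b3
    rw [h.modeAt_zero] at b1 b2 b3
    simp only [Matrix.cons_val_zero, Matrix.cons_val_one, Matrix.cons_val] at b1 b2 b3
    refine ⟨?_, ?_, fun hw => ?_⟩
    · simp only [sobolevDensity_eq, Fin.sum_univ_three]
      rw [← ENNReal.ofReal_add (by positivity) (by positivity),
        ← ENNReal.ofReal_add (by positivity) (by positivity),
        ← ENNReal.ofReal_add (by positivity) (by positivity),
        ← ENNReal.ofReal_mul (by positivity), hb]
      refine ENNReal.ofReal_le_ofReal ((mul_le_mul_of_nonneg_left b1 hJs).trans_eq ?_)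
      have e3 := fun x => bracket_rpow_mul (k := k) (l := l) (η := η) (s := s) 3 x
      have e2 := fun x => bracket_rpow_mul (k := k) (l := l) (η := η) (s := s) 2 x
      push_cast at e3 e2
      simp only [← e3, ← e2]
      ring
    · simp only [sobolevDensity_eq, Fin.sum_univ_three]
      rw [← ENNReal.ofReal_add (by positivity) (by positivity),
        ← ENNReal.ofReal_add (by positivity) (by positivity),
        ← ENNReal.ofReal_add (by positivity) (by positivity),
        ← ENNReal.ofReal_mul (by positivity), ← ENNReal.ofReal_mul (by positivity), hb]
      rw [mul_left_comm]
      refine ENNReal.ofReal_le_ofReal ((mul_le_mul_of_nonneg_left b2 hJs).trans_eq ?_)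
      have e3 := fun x => bracket_rpow_mul (k := k) (l := l) (η := η) (s := s) 5 x
      have e2 := fun x => bracket_rpow_mul (k := k) (l := l) (η := η) (s := s) 4 x
      push_cast at e3 e2
      simp only [← e3, ← e2]
      ring
    · simp only [sobolevDensity_eq]
      rw [← ENNReal.ofReal_mul hγ0, ← ENNReal.ofReal_add (by positivity) (by positivity),
        ← ENNReal.ofReal_add (by positivity) (by positivity),
        ← ENNReal.ofReal_add (by positivity) (by positivity),
        ← ENNReal.ofReal_mul (by positivity), hb, hb, ← mul_add, hv hw]
      refine ENNReal.ofReal_le_ofReal ((mul_le_mul_of_nonneg_left b3 hJs).trans_eq ?_)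
      have e3 := fun x => bracket_rpow_mul (k := k) (l := l) (η := η) (s := s) 3 x
      have e2 := fun x => bracket_rpow_mul (k := k) (l := l) (η := η) (s := s) 2 x
      push_cast at e3 e2
      simp only [← e3, ← e2]
      ring

lemma ofReal_mul_sq {c x : ℝ} (hc : 0 ≤ c) : ENNReal.ofReal (c * x ^ 2) =
    ENNReal.ofReal (Real.sqrt c * |x|) ^ 2 := by
  rw [← ENNReal.ofReal_pow (by positivity), mul_pow, Real.sq_sqrt hc, sq_abs]

theorem nonzeroModeBounds {κ s t : ℝ} (hin : IsInitialData uin θin)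
    (h : IsLinearSolution ν α β uin θin u θ π) (hν : 0 < ν) (hβ : 0 < β * (β - 1)) (hκ : 0 < κ)
    (hκβ : (β - 1) / β ≤ κ ^ 2) (ht : 0 ≤ t) :
    NonzeroModeBounds (Real.sqrt (8 * Real.exp (2 + 2 * Real.pi * κ))) s ν β uin θin u θ t := by
  set M := Real.exp (2 + 2 * Real.pi * κ) with hM
  set m := max (Real.sqrt ((β - 1) / β)) (Real.sqrt (β / (β - 1))) with hm
  set D := Real.exp (-(1 / 16) * ν ^ (1 / 3 : ℝ) * t) with hD
  have hM0 : 0 ≤ 8 * M := by positivity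
  have hD0 : 0 < D := by positivity
  have hm0 : 0 ≤ m := (Real.sqrt_nonneg _).trans (le_max_left _ _)
  have key := fun k l => h.density_bounds (s := s) hin hν hβ hκ hκβ ht hM hm hD k l
  have hsum (a b : ℝ) : freqSum (fun k l η => ∑ i, sobolevDensity a (uin i) k l η +
      sobolevDensity b θin k l η) ≤
      (vecNorm (fun i => sobolevNorm a (uin i)) + sobolevNorm b θin) ^ 2 := by
    refine le_trans (le_of_eq ?_) (sq_add_sq_le _ _)
    rw [freqSum_add _ fun k l => Finset.aemeasurable_fun_sum _ fun i _ =>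
      aemeasurable_sobolevDensity a (uin i) k l, vecNorm_sq, ← sobolevNorm_sq h.memLp_in.2]
    simp only [Fin.sum_univ_three]
    rw [freqSum_add (F := fun k l η => sobolevDensity a (uin 0) k l η +
      sobolevDensity a (uin 1) k l η) _ fun k l => (aemeasurable_sobolevDensity a (uin 0) k l).add
      (aemeasurable_sobolevDensity a (uin 1) k l),
      freqSum_add _ fun k l => aemeasurable_sobolevDensity a (uin 0) k l,
      sobolevNorm_sq (h.memLp_in.1 0), sobolevNorm_sq (h.memLp_in.1 1),
      sobolevNorm_sq (h.memLp_in.1 2)]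
  have hmD : |m * D| = m * D := abs_of_nonneg (by positivity)
  refine ⟨?_, ?_, ?_⟩
  · refine ENNReal_le_of_sq_le ?_
    rw [mul_pow, mul_assoc (Real.sqrt _), ← hmD, ← ofReal_mul_sq hM0]
    refine le_trans ?_ (mul_le_mul_right (hsum _ _) _)
    rw [← freqSum_const_mul ENNReal.ofReal_ne_top]
    exact (sobolevNorm_sq (h.memLp_movingNonzero ht 0) s).trans_le
      (freqSum_mono fun k l => (key k l).mono fun η hη => hη.1)
  · refine ENNReal_le_of_sq_le ?_
    rw [mul_pow, mul_pow, mul_assoc (Real.sqrt _), ← hmD, ← ofReal_mul_sq hM0,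
      ← ENNReal.ofReal_pow (Real.sqrt_nonneg _), Real.sq_sqrt (by positivity)]
    refine le_trans ?_ (mul_le_mul_right (hsum _ _) _)
    rw [← freqSum_const_mul ENNReal.ofReal_ne_top]
    refine le_trans (le_of_eq ?_) (freqSum_mono fun k l => (key k l).mono fun η hη => hη.2.1)
    rw [freqSum_const_mul ENNReal.ofReal_ne_top]
    congr 1
    exact sobolevNorm_sq (h.memLp_movingNonzero ht 1) s
  · have hβ1 : β - 1 ≠ 0 := by intro h; simp [h] at hβ
    have hγ0 : 0 < β / (β - 1) := by
      rw [div_eq_mul_inv, ← div_self_mul_self', ← mul_div_assoc]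
      exact div_pos hβ (mul_self_pos.2 hβ1)
    by_cases hw : MemLp (fun X => dX (uin 1) X - dY (uin 0) X) 2 cell3
    · refine ENNReal_le_of_sq_le ?_
      have hD1 : ENNReal.ofReal (Real.sqrt (8 * M) * D) ^ 2 = ENNReal.ofReal (8 * M * D ^ 2) := by
        rw [ofReal_mul_sq hM0, abs_of_pos hD0]
      rw [mul_pow, vecNorm_sq]
      refine le_of_le_of_eq ?_ (congrArg (· * _) hD1.symm)
      have h1 : freqSum (fun k l η => sobolevDensity (s + 3) (uin 2) k l η +
          ENNReal.ofReal (β / (β - 1)) *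
            sobolevDensity (s + 2) (fun X => dX (uin 1) X - dY (uin 0) X) k l η +
          sobolevDensity (s + 2) θin k l η) ≤ (sobolevNorm (s + 3) (uin 2) +
          ENNReal.ofReal (Real.sqrt (β / (β - 1))) *
            sobolevNorm (s + 2) (fun X => dX (uin 1) X - dY (uin 0) X) +
          sobolevNorm (s + 2) θin) ^ 2 := by
        refine le_trans ?_ (sq_add_sq_le _ _)
        rw [freqSum_add (F := fun k l η => sobolevDensity (s + 3) (uin 2) k l η +
          ENNReal.ofReal (β / (β - 1)) *
            sobolevDensity (s + 2) (fun X => dX (uin 1) X - dY (uin 0) X) k l η) _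
          fun k l => (aemeasurable_sobolevDensity _ _ k l).add
          ((aemeasurable_sobolevDensity _ _ k l).const_mul _), ← sobolevNorm_sq h.memLp_in.2]
        gcongr
        refine le_trans (le_of_eq ?_) (sq_add_sq_le _ _)
        rw [freqSum_add _ fun k l => aemeasurable_sobolevDensity _ _ k l,
          freqSum_const_mul ENNReal.ofReal_ne_top, ← sobolevNorm_sq (h.memLp_in.1 2),
          ← sobolevNorm_sq hw, mul_pow, ← ENNReal.ofReal_pow (Real.sqrt_nonneg _),
          Real.sq_sqrt hγ0.le]
      refine le_trans ?_ (mul_le_mul_right h1 _)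
      rw [← freqSum_const_mul ENNReal.ofReal_ne_top]
      refine le_trans (le_of_eq ?_) (freqSum_mono fun k l => (key k l).mono fun η hη => hη.2.2 hw)
      rw [freqSum_add _ fun k l => aemeasurable_sobolevDensity _ _ k l,
        ← sobolevNorm_sq (h.memLp_movingNonzero ht 2), ← sobolevNorm_sq (h.memLp_movingNonzero ht 3)]
      simp [Fin.sum_univ_two]
      rfl
    -- A vorticity outside `L²` has infinite norm and a positive coefficient, so the right side is
    -- infinite.
    · have : sobolevNorm (s + 2) (fun X => dX (uin 1) X - dY (uin 0) X) = ⊤ := by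
        rw [sobolevNorm, if_neg hw]
      rw [this, ENNReal.mul_top (by simpa using Real.sqrt_pos.2 hγ0), add_top, top_add,
        ENNReal.mul_top (by simp only [ne_eq, ENNReal.ofReal_eq_zero, not_le]; positivity)]
      exact le_top

end Bounds

/-! ### The simple-zero modes -/

lemma IsSmall.tendsto_integral {t : ℝ} (ht : 0 ≤ t) {f : ℕ → ℝ → ℂ} (hf : IsSmall t f) :
    Tendsto (fun n => ∫ s in (0 : ℝ)..t, f n s) atTop (𝓝 0) := by
  have h1 : Tendsto (fun n => Real.sqrt (t * ∫ s in (0 : ℝ)..t, ‖f n s‖ ^ 2)) atTop (𝓝 0) := by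
    have := (hf.lim.const_mul t).sqrt
    simpa using this
  refine squeeze_zero_norm (fun n => ?_) h1
  refine Real.le_sqrt_of_sq_le ?_
  have hi : IntervalIntegrable (fun s => ‖f n s‖ ^ 2) volume 0 t :=
    ((hf.cont n).norm.pow 2).intervalIntegrable_of_Icc ht
  have hi1 : IntervalIntegrable (fun s => ‖f n s‖) volume 0 t :=
    (hf.cont n).norm.intervalIntegrable_of_Icc ht
  have h2 := intervalIntegral.norm_integral_le_integral_norm (f := f n) (μ := volume) ht
  set A := ∫ s in (0 : ℝ)..t, ‖f n s‖
  set B := ∫ s in (0 : ℝ)..t, ‖f n s‖ ^ 2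
  have hA : 0 ≤ A := intervalIntegral.integral_nonneg ht fun s _ => norm_nonneg _
  have h3 : ‖∫ s in (0 : ℝ)..t, f n s‖ ^ 2 ≤ A ^ 2 := by gcongr
  refine h3.trans ?_
  rcases ht.eq_or_lt with rfl | ht'
  · simp [A]
  -- Cauchy–Schwarz `A² ≤ tB`, as non-negativity of a variance.
  have h4 : 0 ≤ ∫ s in (0 : ℝ)..t, (t * ‖f n s‖ - A) ^ 2 :=
    intervalIntegral.integral_nonneg ht fun s _ => sq_nonneg _
  have h5 : ∫ s in (0 : ℝ)..t, (t * ‖f n s‖ - A) ^ 2 = t * (t * B - A ^ 2) := by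
    have e : ∀ s, (t * ‖f n s‖ - A) ^ 2 = (t ^ 2 * ‖f n s‖ ^ 2 - 2 * t * A * ‖f n s‖) + A ^ 2 :=
      fun s => by ring
    simp only [e]
    rw [intervalIntegral.integral_add ((hi.const_mul _).sub (hi1.const_mul _))
      intervalIntegrable_const, intervalIntegral.integral_sub (hi.const_mul _) (hi1.const_mul _),
      intervalIntegral.integral_const_mul, intervalIntegral.integral_const_mul]
    simp only [intervalIntegral.integral_const, sub_zero, smul_eq_mul]
    ring
  rw [h5] at h4
  have := nonneg_of_mul_nonneg_right h4 ht'
  linarith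

/-- Duhamel's formula; the integral of the error against the bounded exponential vanishes in the
limit. -/
lemma eq_exp_mul_of_approx {μ : ℂ} {t : ℝ} (ht : 0 ≤ t) {q g : ℕ → ℝ → ℂ} {Q₀ Q₁ : ℂ}
    (hq : ∀ n, ContinuousOn (q n) (Icc 0 t)) (hg : IsSmall t g)
    (h : ∀ n, ∀ s ∈ Ioo 0 t, HasDerivAt (q n) (μ * q n s + g n s) s)
    (h0 : Tendsto (fun n => q n 0) atTop (𝓝 Q₀)) (h1 : Tendsto (fun n => q n t) atTop (𝓝 Q₁)) :
    Q₁ = Complex.exp (μ * t) * Q₀ := by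
  have hexp (s : ℝ) : HasDerivAt (fun s : ℝ => Complex.exp (-μ * s))
      (Complex.exp (-μ * s) * -μ) s := by
    have := ((hasDerivAt_id s).ofReal_comp.const_mul (-μ)).cexp
    simpa using this
  have cexp : Continuous fun s : ℝ => Complex.exp (-μ * s) := by fun_prop
  have hsm := hg.mul ht cexp.continuousOn
  have key (n : ℕ) : ∫ s in (0 : ℝ)..t, Complex.exp (-μ * s) * g n s =
      Complex.exp (-μ * t) * q n t - q n 0 := by
    have := intervalIntegral.integral_eq_sub_of_hasDerivAt_of_le ht
      (f := fun s : ℝ => Complex.exp (-μ * s) * q n s)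
      (f' := fun s => Complex.exp (-μ * s) * g n s)
      (cexp.continuousOn.mul (hq n)) (fun s hs => ?_)
      ((hsm.cont n).intervalIntegrable_of_Icc ht)
    · rw [this]; simp
    · convert! (hexp s).mul (h n s hs) using 1
      ring
  have l1 := hsm.tendsto_integral ht
  simp only [key] at l1
  have l2 := (h1.const_mul (Complex.exp (-μ * t))).sub h0
  have l3 := tendsto_nhds_unique l2 l1
  have l4 : Complex.exp (-μ * t) * Q₁ = Q₀ := sub_eq_zero.1 l3
  rw [← l4, ← mul_assoc, ← Complex.exp_add]
  simp

/-- These are the eigenvectors of the system at `k = 0`. The first is free of `u²` and `u³` by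
incompressibility. With `Z = -βl²u¹ + αlηθ`, the pair `(Z, p u²)` is a harmonic oscillator of
frequency `ϖ = h/|η,l|`, damped by `νp`. -/
lemma IsApproxSolution.modes_zero {ν α β : ℝ} {l : ℤ} (hl : l ≠ 0) {η t : ℝ} (ht : 0 ≤ t)
    {A B : Fin 4 → ℂ} {a e : Fin 4 → ℕ → ℝ → ℂ} {P d : ℕ → ℝ → ℂ}
    (h : IsApproxSolution ν α β 0 l η t A B a e P d) {p ϖ : ℂ} (hp : p = η ^ 2 + l ^ 2)
    (hϖ : ϖ ^ 2 * p = α ^ 2 * η ^ 2 + β * (β - 1) * l ^ 2) :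
    α * η * B 0 + (β - 1) * l * B 3 =
      Complex.exp (-ν * p * t) * (α * η * A 0 + (β - 1) * l * A 3) ∧
    (-β * l ^ 2 * B 0 + α * l * η * B 3) + Complex.I * ϖ * p * B 1 =
      Complex.exp ((-ν * p + Complex.I * ϖ) * t) *
        ((-β * l ^ 2 * A 0 + α * l * η * A 3) + Complex.I * ϖ * p * A 1) ∧
    (-β * l ^ 2 * B 0 + α * l * η * B 3) - Complex.I * ϖ * p * B 1 =
      Complex.exp ((-ν * p - Complex.I * ϖ) * t) *
        ((-β * l ^ 2 * A 0 + α * l * η * A 3) - Complex.I * ϖ * p * A 1) := by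
  have hlc : (l : ℂ) ≠ 0 := by exact_mod_cast hl
  have hp0 : p ≠ 0 := by
    have : (0 : ℝ) < η ^ 2 + (l : ℝ) ^ 2 := by
      have : (l : ℝ) ≠ 0 := by exact_mod_cast hl
      positivity
    rw [hp]
    exact_mod_cast this.ne'
  have hP (s : ℝ) : (symb 0 l η s : ℂ) = p := by
    rw [hp]; simp [symb]
  have hdiv (n : ℕ) (s : ℝ) (hs : s ∈ Icc 0 t) :
      Complex.I * η * a 1 n s + Complex.I * l * a 2 n s = d n s := by
    have := h.div n s hs
    simpa using this
  have d0 (n : ℕ) (s : ℝ) (hs : s ∈ Ioo 0 t) : HasDerivAt (a 0 n)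
      (-ν * p * a 0 n s - (1 - β) * a 1 n s + e 0 n s) s := by
    have := h.eq0 n s hs
    rw [hP] at this
    simpa using this
  have d1 (n : ℕ) (s : ℝ) (hs : s ∈ Ioo 0 t) : HasDerivAt (a 1 n)
      (-ν * p * a 1 n s - Complex.I * η * P n s - β * a 0 n s + e 1 n s) s := by
    have := h.eq1 n s hs
    rw [hP] at this
    simpa using this
  have d2 (n : ℕ) (s : ℝ) (hs : s ∈ Ioo 0 t) : HasDerivAt (a 2 n)
      (-ν * p * a 2 n s - Complex.I * l * P n s - α * a 3 n s + e 2 n s) s := by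
    have := h.eq2 n s hs
    rwa [hP] at this
  have d3 (n : ℕ) (s : ℝ) (hs : s ∈ Ioo 0 t) : HasDerivAt (a 3 n)
      (-ν * p * a 3 n s + α * a 2 n s + e 3 n s) s := by
    have := h.eq3 n s hs
    rwa [hP] at this
  have s0 := h.small 0
  have s1 := h.small 1
  have s2 := h.small 2
  have s3 := h.small 3
  have sm {f : ℕ → ℝ → ℂ} (hf : IsSmall t f) (c : ℂ) := hf.mul ht (continuousOn_const (c := c))
  have sd := h.small_div
  obtain ⟨v0, v1⟩ := h.div_zero ht
  simp only [Int.cast_zero, zero_mul, zero_add, sub_zero] at v0 v1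
  -- Proved for either root `ϖ`; the opposite sign gives the third relation.
  have osc (ϖ : ℂ) (hϖ : ϖ ^ 2 * p = α ^ 2 * η ^ 2 + β * (β - 1) * l ^ 2) :
      (-β * l ^ 2 * B 0 + α * l * η * B 3) + Complex.I * ϖ * p * B 1 =
      Complex.exp ((-ν * p + Complex.I * ϖ) * t) *
        ((-β * l ^ 2 * A 0 + α * l * η * A 3) + Complex.I * ϖ * p * A 1) := by
    -- For divergence-free limits `p u² = l²u² - lηu³`. The right side is the one to use along the
    -- sequence, as it does not contain the pressure.
    have hX0 (X : Fin 4 → ℂ) (hX : η * X 1 + l * X 2 = 0) :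
        (-β * l ^ 2 * X 0 + α * l * η * X 3) + Complex.I * ϖ * p * X 1 =
        (-β * l ^ 2 * X 0 + α * l * η * X 3) + Complex.I * ϖ * (l ^ 2 * X 1 - l * η * X 2) := by
      rw [hp]
      linear_combination (Complex.I * ϖ * η) * hX
    rw [hX0 A v0, hX0 B v1]
    refine eq_exp_mul_of_approx ht
      (q := fun n s => (-β * l ^ 2 * a 0 n s + α * l * η * a 3 n s) +
        Complex.I * ϖ * (l ^ 2 * a 1 n s - l * η * a 2 n s))
      (g := fun n s => (-β * l ^ 2 * e 0 n s + α * l * η * e 3 n s) +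
        (Complex.I * ϖ * l ^ 2 * e 1 n s + (-(Complex.I * ϖ * l * η) * e 2 n s +
          (Complex.I * η * (ϖ ^ 2 - α ^ 2)) * d n s)))
      (fun n => ?_) (((sm s0 _).add ht (sm s3 _)).add ht ((sm s1 _).add ht ((sm s2 _).add ht
        (sm sd _)))) (fun n s hs => ?_) ?_ ?_
    · have c0 := h.cont 0 n
      have c1 := h.cont 1 n
      have c2 := h.cont 2 n
      have c3 := h.cont 3 n
      fun_prop
    · have dq := (((d0 n s hs).const_mul (-β * l ^ 2 : ℂ)).add
        ((d3 n s hs).const_mul (α * l * η : ℂ))).add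
        ((((d1 n s hs).const_mul (l ^ 2 : ℂ)).sub ((d2 n s hs).const_mul (l * η : ℂ))).const_mul
          (Complex.I * ϖ))
      convert! dq using 1
      rw [← hdiv n s (Ioo_subset_Icc_self hs)]
      linear_combination (ϖ ^ 2 * (l ^ 2 * a 1 n s - l * η * a 2 n s) +
        η * (ϖ ^ 2 - α ^ 2) * (η * a 1 n s + l * a 2 n s)) * Complex.I_sq -
        a 1 n s * hϖ + ϖ ^ 2 * a 1 n s * hp
    · exact (((h.left 0).const_mul _).add ((h.left 3).const_mul _)).add
        ((((h.left 1).const_mul _).sub ((h.left 2).const_mul _)).const_mul _)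
    · exact (((h.right 0).const_mul _).add ((h.right 3).const_mul _)).add
        ((((h.right 1).const_mul _).sub ((h.right 2).const_mul _)).const_mul _)
  refine ⟨?_, osc ϖ hϖ, ?_⟩
  · refine eq_exp_mul_of_approx ht
      (q := fun n s => α * η * a 0 n s + (β - 1) * l * a 3 n s)
      (g := fun n s => α * η * e 0 n s + ((β - 1) * l * e 3 n s +
        (-Complex.I * (α * (β - 1))) * d n s))
      (fun n => ?_) ((sm s0 _).add ht ((sm s3 _).add ht (sm sd _))) (fun n s hs => ?_) ?_ ?_
    · have c0 := h.cont 0 n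
      have c3 := h.cont 3 n
      fun_prop
    · convert! ((d0 n s hs).const_mul (α * η : ℂ)).add
        ((d3 n s hs).const_mul ((β - 1) * l : ℂ)) using 1
      rw [← hdiv n s (Ioo_subset_Icc_self hs)]
      linear_combination -(α * (β - 1) * (η * a 1 n s + l * a 2 n s)) * Complex.I_sq
    · exact ((h.left 0).const_mul _).add ((h.left 3).const_mul _)
    · exact ((h.right 0).const_mul _).add ((h.right 3).const_mul _)
  · have := osc (-ϖ) (by rw [neg_sq, hϖ])
    simp only [mul_neg, neg_mul, ← sub_eq_add_neg] at this ⊢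
    exact this

lemma modeAt_zero_eq {u : Fin 3 → ℝ → ℝ × ℝ × ℝ → ℝ} {θ : ℝ → ℝ × ℝ × ℝ → ℝ} {t : ℝ} {i : Fin 4}
    (hc : Continuous (fields u θ i t)) (hp : IsPeriodic (fields u θ i t)) {l : ℤ} (hl : l ≠ 0)
    (η : ℝ) : modeAt u θ 0 l η t i = fourier2 (simpleZero (fields u θ i t)) η l := by
  rw [fourier2_simpleZero hc hl, modeAt, fourier3_eq, ← exp_mul_coef_eq_coef_moving hp]
  simp

theorem simpleZeroFormula {ν α β : ℝ} {uin : Fin 3 → ℝ × ℝ × ℝ → ℝ} {θin : ℝ × ℝ × ℝ → ℝ}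
    {u : Fin 3 → ℝ → ℝ × ℝ × ℝ → ℝ} {θ π : ℝ → ℝ × ℝ × ℝ → ℝ} (hα : 0 < α)
    (hβ : 0 < β * (β - 1)) (hin : IsInitialData uin θin)
    (hsol : IsLinearSolution ν α β uin θin u θ π) {t : ℝ} (ht : 0 ≤ t) {l : ℤ} (hl : l ≠ 0) :
    ∀ᵐ η : ℝ, SimpleZeroFormula ν α β uin θin u θ t η l := by
  filter_upwards [ae_exists_approxSolution hin hsol (k := 0) (Or.inr hl) ht]
    with η ⟨a, e, P, d, h⟩
  have hA (i : Fin 4) : modeAt u θ 0 l η 0 i = fourier2 (simpleZero (fields u θ i 0)) η l :=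
    modeAt_zero_eq (hsol.continuous_fields le_rfl i) (hsol.periodic_fields le_rfl i) hl η
  have hB (i : Fin 4) : modeAt u θ 0 l η t i = fourier2 (simpleZero (fields u θ i t)) η l :=
    modeAt_zero_eq (hsol.continuous_fields ht i) (hsol.periodic_fields ht i) hl η
  have hlr : (l : ℝ) ≠ 0 := by exact_mod_cast hl
  have hlc : (l : ℂ) ≠ 0 := by exact_mod_cast hl
  have hr2 : (absSym η l : ℂ) ^ 2 = η ^ 2 + l ^ 2 := by
    have : absSym η l ^ 2 = η ^ 2 + (l : ℝ) ^ 2 := Real.sq_sqrt (by positivity)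
    exact_mod_cast this
  have hh2 : (hSym α β η l : ℂ) ^ 2 = α ^ 2 * η ^ 2 + β * (β - 1) * l ^ 2 := by
    have : hSym α β η l ^ 2 = α ^ 2 * η ^ 2 + β * (β - 1) * (l : ℝ) ^ 2 :=
      Real.sq_sqrt (by positivity)
    exact_mod_cast this
  have hr0 : (absSym η l : ℂ) ≠ 0 := by
    have : 0 < absSym η l := Real.sqrt_pos.2 (by positivity)
    exact_mod_cast this.ne'
  have hh0 : (hSym α β η l : ℂ) ≠ 0 := by
    have : 0 < hSym α β η l := Real.sqrt_pos.2 (by positivity)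
    exact_mod_cast this.ne'
  obtain ⟨m1, m2, m3⟩ := h.modes_zero hl ht (p := η ^ 2 + l ^ 2)
    (ϖ := ((hSym α β η l / absSym η l : ℝ) : ℂ)) rfl (by
      push_cast; rw [div_pow, hr2, div_mul_cancel₀ _ (hr2 ▸ pow_ne_zero 2 hr0), hh2])
  have hdiv := (h.div_zero ht).2
  have f0 : fields u θ 0 0 = uin 0 := hsol.init_u 0
  have f1 : fields u θ 1 0 = uin 1 := hsol.init_u 1
  have f3 : fields u θ 3 0 = θin := hsol.init_θ
  rw [hA, hA, hB, hB, f0, f3] at m1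
  rw [hA, hA, hA, hB, hB, hB, f0, f1, f3] at m2 m3
  rw [hB, hB, hB] at hdiv
  simp only [SimpleZeroFormula, lam1, lam2, lam3]
  change α * η * fourier2 (simpleZero (u 0 t)) η l +
    (β - 1) * l * fourier2 (simpleZero (θ t)) η l = _ at m1
  change (-β * l ^ 2 * fourier2 (simpleZero (u 0 t)) η l + α * l * η *
    fourier2 (simpleZero (θ t)) η l) + _ * fourier2 (simpleZero (u 1 t)) η l = _ at m2
  change (-β * l ^ 2 * fourier2 (simpleZero (u 0 t)) η l + α * l * η *
    fourier2 (simpleZero (θ t)) η l) - _ * fourier2 (simpleZero (u 1 t)) η l = _ at m3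
  change _ + _ * fourier2 (simpleZero (u 1 t)) η l +
    l * fourier2 (simpleZero (u 2 t)) η l = 0 at hdiv
  push_cast at m1 m2 m3 hdiv ⊢
  generalize fourier2 (simpleZero (u 0 t)) η l = B0 at *
  generalize fourier2 (simpleZero (u 1 t)) η l = B1 at *
  generalize fourier2 (simpleZero (u 2 t)) η l = B2 at *
  generalize fourier2 (simpleZero (θ t)) η l = B3 at *
  generalize fourier2 (simpleZero (uin 0)) η l = A0 at *
  generalize fourier2 (simpleZero (uin 1)) η l = A1 at *
  generalize fourier2 (simpleZero θin) η l = A3 at *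
  generalize (hSym α β η l : ℂ) = H at *
  generalize (absSym η l : ℂ) = r at *
  generalize Complex.exp (-ν * (η ^ 2 + l ^ 2) * t) = E1 at *
  generalize Complex.exp ((-ν * (η ^ 2 + l ^ 2) + Complex.I * (H / r)) * t) = E2 at *
  generalize Complex.exp ((-ν * (η ^ 2 + l ^ 2) - Complex.I * (H / r)) * t) = E3 at *
  rw [← hr2] at m2 m3
  have hrH : Complex.I * (H / r) * r ^ 2 = Complex.I * H * r := by field_simp
  rw [hrH] at m2 m3
  have b1 : B1 = Complex.I * β * l ^ 2 / (2 * H * r) * (E2 - E3) * A0 + 1 / 2 * (E2 + E3) * A1 +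
      Complex.I * α * η * l / (2 * H * r) * (E3 - E2) * A3 := by
    field_simp
    linear_combination (-Complex.I) * (m2 - m3) +
      (2 * H * r * B1 - H * r * (E2 + E3) * A1) * Complex.I_sq
  have hZ : -β * l ^ 2 * B0 + α * l * η * B3 = (E2 + E3) / 2 * (-β * l ^ 2 * A0 + α * l * η * A3) +
      Complex.I * H * r * (E2 - E3) / 2 * A1 := by
    linear_combination (m2 + m3) / 2
  -- Cramer's rule for `u¹, θ` from the stationary combination and `Z`; the determinant is `l h²`.
  have b0 : H ^ 2 * l * B0 = α * η * l * (E1 * (α * η * A0 + (β - 1) * l * A3)) -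
      (β - 1) * l * ((E2 + E3) / 2 * (-β * l ^ 2 * A0 + α * l * η * A3) +
      Complex.I * H * r * (E2 - E3) / 2 * A1) := by
    rw [hh2]
    linear_combination (α * η * l) * m1 - (β - 1) * l * hZ
  have b3 : H ^ 2 * l * B3 = β * l ^ 2 * (E1 * (α * η * A0 + (β - 1) * l * A3)) +
      α * η * ((E2 + E3) / 2 * (-β * l ^ 2 * A0 + α * l * η * A3) +
      Complex.I * H * r * (E2 - E3) / 2 * A1) := by
    rw [hh2]
    linear_combination (β * l ^ 2) * m1 + (α * η) * hZ
  refine ⟨?_, b1, ?_, ?_⟩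
  · refine mul_left_cancel₀ (mul_ne_zero (pow_ne_zero 2 hh0) hlc) (b0.trans ?_)
    field_simp
    ring
  · field_simp
    linear_combination hdiv
  · refine mul_left_cancel₀ (mul_ne_zero (pow_ne_zero 2 hh0) hlc) (b3.trans ?_)
    field_simp
    ring

/-! ### The heat semigroup -/

lemma integral_conj_lineFourier {f g : ℝ → ℂ} (hf : MemLp f 2) (hg : MemLp g 2) :
    ∫ η, lineFourier g η * (starRingEnd ℂ) (lineFourier f η) =
      2 * Real.pi * ∫ y, g y * (starRingEnd ℂ) (f y) := by
  have h := Lp.inner_fourier_eq (hf.toLp f) (hg.toLp g)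
  rw [L2.inner_def, L2.inner_def] at h
  simp only [RCLike.inner_apply] at h
  have h1 : ∫ y, g y * (starRingEnd ℂ) (f y) =
      ∫ y, (hg.toLp g) y * (starRingEnd ℂ) ((hf.toLp f) y) := by
    refine integral_congr_ae ?_
    filter_upwards [hf.coeFn_toLp, hg.coeFn_toLp] with y e1 e2
    rw [e1, e2]
  rw [h1, ← h, lineFourier_of_memLp hf, lineFourier_of_memLp hg]
  have := Measure.integral_comp_div (fun x =>
    (𝓕 (hg.toLp g) : Lp ℂ 2 (volume : Measure ℝ)) x *
      (starRingEnd ℂ) ((𝓕 (hf.toLp f) : Lp ℂ 2 (volume : Measure ℝ)) x)) (2 * Real.pi)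
  rw [this, abs_of_pos two_pi_pos, Complex.real_smul]
  push_cast
  rfl

/-- The heat kernel centred at `y`. -/
def heatKernel (ν t y y' : ℝ) : ℝ :=
  (Real.sqrt (4 * Real.pi * ν * t))⁻¹ * Real.exp (-(y - y') ^ 2 / (4 * ν * t))

lemma integrable_heatKernel {ν t : ℝ} (hν : 0 < ν) (ht : 0 < t) (y : ℝ) :
    Integrable (heatKernel ν t y) := by
  have h1 := (integrable_exp_neg_mul_sq (b := 1 / (4 * ν * t)) (by positivity)).comp_sub_left y
  refine (h1.const_mul (Real.sqrt (4 * Real.pi * ν * t))⁻¹).congr (.of_forall fun y' => ?_)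
  simp only [heatKernel]
  congr 2
  ring

lemma memLp_heatKernel {ν t : ℝ} (hν : 0 < ν) (ht : 0 < t) (y : ℝ) :
    MemLp (fun y' => (heatKernel ν t y y' : ℂ)) 2 := by
  have hc : Continuous fun y' => (heatKernel ν t y y' : ℂ) := by
    unfold heatKernel; fun_prop
  rw [memLp_two_iff_integrable_sq_norm hc.aestronglyMeasurable]
  have h1 := (integrable_exp_neg_mul_sq (b := 2 / (4 * ν * t)) (by positivity)).comp_sub_left y
  refine (h1.const_mul ((Real.sqrt (4 * Real.pi * ν * t))⁻¹ ^ 2)).congr (.of_forall fun y' => ?_)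
  simp only [heatKernel]
  rw [Complex.norm_real, Real.norm_eq_abs, sq_abs, mul_pow, ← Real.exp_nat_mul]
  congr 2
  push_cast
  ring

lemma classicalFourier_heatKernel {ν t : ℝ} (hν : 0 < ν) (ht : 0 < t) (y η : ℝ) :
    classicalFourier (fun y' => (heatKernel ν t y y' : ℂ)) η =
      Complex.exp (-Complex.I * (η * y)) * Complex.exp (-ν * η ^ 2 * t) := by
  have hb : 0 < (1 / (4 * ν * t) : ℂ).re := by
    have : (1 / (4 * ν * t) : ℂ) = ((1 / (4 * ν * t) : ℝ) : ℂ) := by push_cast; rfl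
    rw [this, Complex.ofReal_re]; positivity
  have hg := fourierIntegral_gaussian hb (η : ℂ)
  have hs := integral_sub_left_eq_self (fun y' : ℝ =>
    Complex.exp (-Complex.I * (η * (y - y'))) * ((heatKernel ν t 0 y' : ℝ) : ℂ)) volume y
  have e1 : classicalFourier (fun y' => (heatKernel ν t y y' : ℂ)) η =
      ∫ y' : ℝ, Complex.exp (-Complex.I * (η * (y - (y - y' : ℝ)))) *
        ((heatKernel ν t 0 (y - y') : ℝ) : ℂ) := by
    refine integral_congr_ae (.of_forall fun y' => ?_)
    simp only [heatKernel]
    push_cast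
    ring_nf
  rw [e1, hs]
  have hsq : (0 : ℝ) < Real.sqrt (4 * Real.pi * ν * t) := Real.sqrt_pos.2 (by positivity)
  have e2 : ∀ y' : ℝ, Complex.exp (-Complex.I * (η * (y - y'))) * ((heatKernel ν t 0 y' : ℝ) : ℂ) =
      (Complex.exp (-Complex.I * (η * y)) * ((Real.sqrt (4 * Real.pi * ν * t))⁻¹ : ℝ)) *
      (Complex.exp (Complex.I * η * y') * Complex.exp (-(1 / (4 * ν * t)) * y' ^ 2)) := fun y' => by
    have : -Complex.I * (η * (y - y')) = -Complex.I * (η * y) + Complex.I * η * y' := by ring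
    rw [this, Complex.exp_add, heatKernel]
    push_cast
    have : (-(0 - y' : ℂ) ^ 2 / (4 * ν * t)) = -(1 / (4 * ν * t)) * y' ^ 2 := by ring
    rw [this]
    ring
  simp only [e2]
  rw [integral_const_mul, hg]
  have e3 : ((Real.pi : ℂ) / (1 / (4 * ν * t))) ^ (1 / 2 : ℂ) =
      (Real.sqrt (4 * Real.pi * ν * t) : ℝ) := by
    rw [Real.sqrt_eq_rpow, Complex.ofReal_cpow (by positivity)]
    push_cast
    congr 1
    field_simp
  have hone : (((Real.sqrt (4 * Real.pi * ν * t))⁻¹ : ℝ) : ℂ) *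
      (Real.sqrt (4 * Real.pi * ν * t) : ℝ) = 1 := by
    rw [← Complex.ofReal_mul, inv_mul_cancel₀ hsq.ne', Complex.ofReal_one]
  rw [e3, mul_assoc, ← mul_assoc _ _ (Complex.exp (-(η : ℂ) ^ 2 / _)), hone, one_mul]
  have hνc : (ν : ℂ) ≠ 0 := by exact_mod_cast hν.ne'
  have htc : (t : ℂ) ≠ 0 := by exact_mod_cast ht.ne'
  congr 2
  field_simp

lemma norm_exp_neg_sq (ν t η : ℝ) : ‖Complex.exp (-ν * η ^ 2 * t)‖ = Real.exp (-(ν * t) * η ^ 2) := by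
  rw [Complex.norm_exp]
  congr 1
  have : (-ν * η ^ 2 * t : ℂ) = ((-(ν * t) * η ^ 2 : ℝ) : ℂ) := by push_cast; ring
  rw [this, Complex.ofReal_re]

lemma memLp_lineFourier {g : ℝ → ℂ} (h : MemLp g 2) : MemLp (lineFourier g) 2 := by
  rw [memLp_two_iff_lintegral (aestronglyMeasurable_lineFourier g), lintegral_lineFourier_sq h]
  have := (memLp_two_iff_lintegral h.1).1 h
  finiteness

lemma integrable_heat_mul {ν t : ℝ} (hν : 0 < ν) (ht : 0 < t) {F : ℝ → ℂ} (hF : MemLp F 2) :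
    Integrable (fun η : ℝ => Complex.exp (-ν * η ^ 2 * t) * F η) := by
  have h1 : MemLp (fun η : ℝ => Complex.exp (-ν * η ^ 2 * t)) 2 := by
    have hc : Continuous fun η : ℝ => Complex.exp (-ν * η ^ 2 * t) := by fun_prop
    rw [memLp_two_iff_integrable_sq_norm hc.aestronglyMeasurable]
    refine (integrable_exp_neg_mul_sq (b := 2 * (ν * t)) (by positivity)).congr
      (.of_forall fun η => ?_)
    simp only
    rw [norm_exp_neg_sq, ← Real.exp_nat_mul]
    congr 1
    push_cast; ring
  exact h1.integrable_mul hF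

/-- The damping makes the transform integrable, so Fourier inversion holds almost everywhere and, by
continuity, everywhere. The inversion integral is the Parseval pairing of `G` with the heat kernel
centred at `y`. Only `G ∈ L²` is used. -/
theorem eq_heatFlow_of_lineFourier {ν t : ℝ} (hν : 0 < ν) (ht : 0 < t) {g G : ℝ → ℝ}
    (hg : Continuous g) (h2g : MemLp (fun y => (g y : ℂ)) 2)
    (h2G : MemLp (fun y => (G y : ℂ)) 2)
    (h : ∀ᵐ η : ℝ, lineFourier (fun y => (g y : ℂ)) η =
      Complex.exp (-ν * η ^ 2 * t) * lineFourier (fun y => (G y : ℂ)) η) (y : ℝ) :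
    g y = heatFlow ν t G y := by
  have hFi := integrable_heat_mul hν ht (memLp_lineFourier h2G)
  set F : ℝ → ℂ := fun η => Complex.exp (-ν * η ^ 2 * t) * lineFourier (fun y => (G y : ℂ)) η
  have h1 := eq_integral_of_lineFourier_ae_eq h2g hFi h
  have hcF : Continuous fun y : ℝ => ((2 * Real.pi)⁻¹ : ℂ) *
      ∫ η : ℝ, Complex.exp (Complex.I * (η * y)) * F η := by
    refine continuous_const.mul (continuous_of_dominated (bound := fun η => ‖F η‖)
      (fun y => ?_) (fun y => .of_forall fun η => ?_) hFi.norm (.of_forall fun η => by fun_prop))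
    · have : Continuous fun η : ℝ => Complex.exp (Complex.I * (η * y)) := by fun_prop
      exact this.aestronglyMeasurable.mul hFi.1
    · rw [norm_mul, show Complex.I * (η * y) = ((η * y : ℝ) : ℂ) * Complex.I by push_cast; ring,
        Complex.norm_exp_ofReal_mul_I, one_mul]
  have hgc : Continuous fun y => (g y : ℂ) := Complex.continuous_ofReal.comp hg
  have h3 := congrFun ((hgc.ae_eq_iff_eq volume hcF).1 h1) y
  have hK := memLp_heatKernel hν ht y
  have hP := integral_conj_lineFourier hK h2G
  have h4 : ∫ η : ℝ, Complex.exp (Complex.I * (η * y)) * F η =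
      ∫ η, lineFourier (fun y => (G y : ℂ)) η *
        (starRingEnd ℂ) (lineFourier (fun y' => (heatKernel ν t y y' : ℂ)) η) := by
    refine integral_congr_ae ?_
    have hKi : Integrable fun y' => (heatKernel ν t y y' : ℂ) := (integrable_heatKernel hν ht y).ofReal
    filter_upwards [lineFourier_ae_eq_classical hKi hK] with η e
    rw [e, classicalFourier_heatKernel hν ht, map_mul, ← Complex.exp_conj, ← Complex.exp_conj]
    simp only [F, map_mul, map_neg, Complex.conj_I, Complex.conj_ofReal, map_pow, neg_neg]
    ring
  have hpi : (2 * Real.pi : ℂ) ≠ 0 := by exact_mod_cast two_pi_pos.ne'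
  rw [h4, hP, inv_mul_cancel_left₀ hpi] at h3
  have h5 : ∫ y', (G y' : ℂ) * (starRingEnd ℂ) (heatKernel ν t y y' : ℂ) =
      ((∫ y', heatKernel ν t y y' * G y' : ℝ) : ℂ) := by
    rw [← integral_complex_ofReal]
    refine integral_congr_ae (.of_forall fun y' => ?_)
    simp only [Complex.conj_ofReal]
    push_cast; ring
  rw [h5] at h3
  rw [heatFlow, if_neg ht.ne']
  exact_mod_cast h3

/-! ### The double-zero modes -/

section DoubleZero

variable {ν α β : ℝ} {uin : Fin 3 → ℝ × ℝ × ℝ → ℝ} {θin : ℝ × ℝ × ℝ → ℝ}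
  {u : Fin 3 → ℝ → ℝ × ℝ × ℝ → ℝ} {θ π : ℝ → ℝ × ℝ × ℝ → ℝ}

lemma eq_zero_of_memLp_const {c : ℂ} (h : MemLp (fun _ : ℝ => c) 2) : c = 0 := by
  rw [memLp_const_iff (by norm_num) (by norm_num)] at h
  simpa using h

/-- Averaging the divergence over `x` and `z` leaves only the `y`-derivative, so the average is
constant in `y`; a constant in `L²(ℝ)` is zero. -/
lemma coef_eq_zero_of_divergence {v : Fin 3 → ℝ × ℝ × ℝ → ℝ} (hv : ∀ i, ContDiff ℝ ∞ (v i))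
    (hp : ∀ i, IsPeriodic (v i)) (h2 : MemLp (v 1) 2 cell3) (hdiv : ∀ X, divergence v X = 0)
    (y : ℝ) : coef 0 0 (v 1) y = 0 := by
  have hX := (contDiff_dX (hv 0)).continuous
  have hY := (contDiff_dY (hv 1)).continuous
  have hZ := (contDiff_dZ (hv 2)).continuous
  have hd (y : ℝ) : coef 0 0 (dY (v 1)) y = 0 := by
    have e : (fun X => (dX (v 0) X + dY (v 1) X) + dZ (v 2) X) = fun _ => (0 : ℝ) := funext hdiv
    have h1 := congrFun (congrArg (coef 0 0) e) y
    rw [coef_add (f := fun X => dX (v 0) X + dY (v 1) X) (hX.add hY) hZ, coef_add hX hY, coef_dX (hv 0) (hp 0), coef_dZ (hv 2) (hp 2)] at h1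
    simpa [coef] using h1
  have hderiv (y : ℝ) : HasDerivAt (coef 0 0 (v 1)) 0 y := by
    have := hasDerivAt_coef (hv 1) 0 0 y
    rwa [hd] at this
  have hconst (z : ℝ) : coef 0 0 (v 1) z = coef 0 0 (v 1) y :=
    is_const_of_deriv_eq_zero (fun z => (hderiv z).differentiableAt)
      (fun z => (hderiv z).deriv) z y
  refine eq_zero_of_memLp_const ((memLp_congr_ae (.of_forall fun z => ?_)).1
    (memLp_coef (hv 1).continuous h2 0 0))
  exact hconst z

lemma IsLinearSolution.coef_u2_eq_zero (hin : IsInitialData uin θin)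
    (hsol : IsLinearSolution ν α β uin θin u θ π) {s : ℝ} (hs : 0 ≤ s) (y : ℝ) :
    coef 0 0 (u 1 s) y = 0 := by
  have hm : MemLp (u 1 s) 2 cell3 := hsol.memLp_fields hs 1
  rcases hs.eq_or_lt with rfl | hs
  · have : (fun i => u i 0) = uin := funext hsol.init_u
    rw [hsol.init_u] at hm ⊢
    exact coef_eq_zero_of_divergence hin.smooth_u hin.periodic_u hm hin.div_free y
  · exact coef_eq_zero_of_divergence (v := fun i => u i s) (fun i => contDiff_slice (hsol.smooth_u i) hs)
      (fun i => hsol.periodic_u i s hs.le) hm (hsol.div_free s hs) y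

/-- The averages of `∂_x π` and `∂_z π` vanish by periodicity, and `∂_y π` only enters the equation
of `u²`, whose average is already known to be zero. Thus `u¹` diffuses alone and `(u³, θ)` rotates.
-/
lemma IsLinearSolution.lineFourier_doubleZero (hin : IsInitialData uin θin)
    (hsol : IsLinearSolution ν α β uin θin u θ π) {t : ℝ} (ht : 0 ≤ t) :
    ∀ᵐ η : ℝ, lineFourier (coef 0 0 (u 0 t)) η =
        Complex.exp (-ν * η ^ 2 * t) * lineFourier (coef 0 0 (uin 0)) η ∧
      lineFourier (coef 0 0 (u 2 t)) η = Complex.exp (-ν * η ^ 2 * t) *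
        (Complex.cos (α * t) * lineFourier (coef 0 0 (uin 2)) η -
          Complex.sin (α * t) * lineFourier (coef 0 0 θin) η) ∧
      lineFourier (coef 0 0 (θ t)) η = Complex.exp (-ν * η ^ 2 * t) *
        (Complex.sin (α * t) * lineFourier (coef 0 0 (uin 2)) η +
          Complex.cos (α * t) * lineFourier (coef 0 0 θin) η) := by
  have hc : ∀ i, ContinuousOn (fun q : ℝ × (ℝ × ℝ × ℝ) => fields u θ i q.1 q.2)
      (Ici 0 ×ˢ univ) := by
    intro i
    fin_cases i
    exacts [hsol.cont_u 0, hsol.cont_u 1, hsol.cont_u 2, hsol.cont_θ]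
  have h2 : ∀ i, LocallyBoundedL2 (Ici 0) (fields u θ i) := by
    intro i
    fin_cases i
    exacts [hsol.energy_u 0, hsol.energy_u 1, hsol.energy_u 2, hsol.energy_θ]
  filter_upwards [exists_truncation_seq hc h2 (fun i t ht => hsol.periodic_fields ht i) 0 0 ht]
    with η ⟨χ, hχ, hsm, hcont, hlim⟩
  simp only [Int.cast_zero, zero_mul, sub_zero] at hsm hcont hlim
  have hfour (i : Fin 4) {s : ℝ} (hs : 0 ≤ s) : fourier3 (moving s (fields u θ i s)) 0 η 0 =
      lineFourier (coef 0 0 (fields u θ i s)) η := by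
    rw [fourier3_eq, ← exp_mul_coef_eq_coef_moving (hsol.periodic_fields hs i)]
    simp
  have l0 (i : Fin 4) := hlim i 0 (by simp)
  have l1 (i : Fin 4) := hlim i t (by simp)
  simp only [hfour _ le_rfl] at l0
  simp only [hfour _ ht] at l1
  have hR (i : Fin 4) : IsSmall t (fun n s =>
      ν * tf (deriv^[2] (χ n)) η (coef 0 0 (fields u θ i s)) +
      (-ν * (2 * Complex.I * η)) * tf (deriv^[1] (χ n)) η (coef 0 0 (fields u θ i s))) :=
    ((hsm i 2 (by simp)).mul ht continuousOn_const).add ht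
      ((hsm i 1 (by simp)).mul ht continuousOn_const)
  have D {v : ℝ → ℝ × ℝ × ℝ → ℝ} {s : ℝ} (hs : 0 < s) {S : ℝ × ℝ × ℝ → ℝ} (hS : Continuous S)
      (hv : ContDiffOn ℝ ∞ (fun q : ℝ × (ℝ × ℝ × ℝ) => v q.1 q.2) (Ioi 0 ×ˢ univ))
      (hp : IsPeriodic (v s))
      (heq : ∀ X, deriv (fun τ => v τ X) s + X.2.1 * dX (v s) X - ν * lap (v s) X + S X = 0)
      (n : ℕ) : HasDerivAt (fun τ => tf (χ n) η (coef 0 0 (v τ)))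
      (-ν * η ^ 2 * tf (χ n) η (coef 0 0 (v s)) +
        (ν * tf (deriv^[2] (χ n)) η (coef 0 0 (v s)) +
          (-ν * (2 * Complex.I * η)) * tf (deriv^[1] (χ n)) η (coef 0 0 (v s))) -
        tf (χ n) η (coef 0 0 S)) s := by
    have := hasDerivAt_tf_of_eq (hχ n) hv hs hp hS heq 0 0 η
    simp only [Int.cast_zero, zero_mul, sub_zero] at this
    convert! this using 1
    simp [symb]
    ring
  have c1 (s : ℝ) (hs : 0 ≤ s) (n : ℕ) : tf (χ n) η (coef 0 0 (u 1 s)) = 0 := by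
    rw [show coef 0 0 (u 1 s) = fun _ => 0 from funext fun y => hsol.coef_u2_eq_zero hin hs y]
    simp [tf]
  have D0 (n : ℕ) (s : ℝ) (hs : s ∈ Ioo 0 t) :
      HasDerivAt (fun s => tf (χ n) η (coef 0 0 (fields u θ 0 s)))
        (-ν * η ^ 2 * tf (χ n) η (coef 0 0 (fields u θ 0 s)) +
        (ν * tf (deriv^[2] (χ n)) η (coef 0 0 (fields u θ 0 s)) +
          (-ν * (2 * Complex.I * η)) * tf (deriv^[1] (χ n)) η (coef 0 0 (fields u θ 0 s)))) s := by
    have hπ := hsol.smooth_π s hs.1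
    have hcu := (contDiff_slice (hsol.smooth_u 1) hs.1).continuous
    have hX := (contDiff_dX hπ).continuous
    have := D hs.1 (S := fun X => dX (π s) X + (1 - β) * u 1 s X) (by fun_prop) (hsol.smooth_u 0)
      (hsol.periodic_u 0 s hs.1.le) (fun X => by linarith [hsol.eq_u1 s hs.1 X]) n
    rw [tf_coef_add (hχ n) hX (by fun_prop), tf_coef_const_mul,
      tf_coef_dX _ hπ (hsol.periodic_π s hs.1), c1 s hs.1.le] at this
    simpa [fields] using this
  have D2 (n : ℕ) (s : ℝ) (hs : s ∈ Ioo 0 t) :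
      HasDerivAt (fun s => tf (χ n) η (coef 0 0 (fields u θ 2 s)))
        (-ν * η ^ 2 * tf (χ n) η (coef 0 0 (fields u θ 2 s)) +
        (ν * tf (deriv^[2] (χ n)) η (coef 0 0 (fields u θ 2 s)) +
          (-ν * (2 * Complex.I * η)) * tf (deriv^[1] (χ n)) η (coef 0 0 (fields u θ 2 s))) -
          α * tf (χ n) η (coef 0 0 (fields u θ 3 s))) s := by
    have hπ := hsol.smooth_π s hs.1
    have hcu := (contDiff_slice hsol.smooth_θ hs.1).continuous
    have hX := (contDiff_dZ hπ).continuous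
    have := D hs.1 (S := fun X => dZ (π s) X + α * θ s X) (by fun_prop) (hsol.smooth_u 2)
      (hsol.periodic_u 2 s hs.1.le) (fun X => by linarith [hsol.eq_u3 s hs.1 X]) n
    rw [tf_coef_add (hχ n) hX (by fun_prop), tf_coef_const_mul,
      tf_coef_dZ _ hπ (hsol.periodic_π s hs.1)] at this
    simpa [fields] using this
  have D3 (n : ℕ) (s : ℝ) (hs : s ∈ Ioo 0 t) :
      HasDerivAt (fun s => tf (χ n) η (coef 0 0 (fields u θ 3 s)))
        (-ν * η ^ 2 * tf (χ n) η (coef 0 0 (fields u θ 3 s)) +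
        (ν * tf (deriv^[2] (χ n)) η (coef 0 0 (fields u θ 3 s)) +
          (-ν * (2 * Complex.I * η)) * tf (deriv^[1] (χ n)) η (coef 0 0 (fields u θ 3 s))) +
          α * tf (χ n) η (coef 0 0 (fields u θ 2 s))) s := by
    have hcu := (contDiff_slice (hsol.smooth_u 2) hs.1).continuous
    have := D hs.1 (S := fun X => (-α) * u 2 s X) (by fun_prop) hsol.smooth_θ
      (hsol.periodic_θ s hs.1.le) (fun X => by linarith [hsol.eq_θ s hs.1 X]) n
    rw [tf_coef_const_mul] at this
    simpa [fields] using this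
  have r0 := eq_exp_mul_of_approx (μ := -ν * η ^ 2) ht (hcont 0) (hR 0) D0 (l0 0) (l1 0)
  -- `u³ + σθ` with `σ = ±i` are the eigenvectors of the rotation.
  have osc (σ : ℂ) (hσ : σ ^ 2 = -1) : lineFourier (coef 0 0 (fields u θ 2 t)) η +
      σ * lineFourier (coef 0 0 (fields u θ 3 t)) η = Complex.exp ((-ν * η ^ 2 + σ * α) * t) *
      (lineFourier (coef 0 0 (fields u θ 2 0)) η +
      σ * lineFourier (coef 0 0 (fields u θ 3 0)) η) := by
    refine eq_exp_mul_of_approx ht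
      (q := fun n s => tf (χ n) η (coef 0 0 (fields u θ 2 s)) +
        σ * tf (χ n) η (coef 0 0 (fields u θ 3 s)))
      (fun n => (hcont 2 n).add (continuousOn_const.mul (hcont 3 n)))
      ((hR 2).add ht ((hR 3).mul ht (c := fun _ => σ) continuousOn_const)) (fun n s hs => ?_)
      ((l0 2).add ((l0 3).const_mul σ)) ((l1 2).add ((l1 3).const_mul σ))
    convert! (D2 n s hs).add ((D3 n s hs).const_mul σ) using 1
    linear_combination (α * tf (χ n) η (coef 0 0 (fields u θ 3 s))) * hσ
  have rp := osc Complex.I Complex.I_sq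
  have rm := osc (-Complex.I) (by rw [neg_sq, Complex.I_sq])
  have f0 : fields u θ 0 0 = uin 0 := hsol.init_u 0
  have f2 : fields u θ 2 0 = uin 2 := hsol.init_u 2
  have f3 : fields u θ 3 0 = θin := hsol.init_θ
  rw [f0] at r0
  rw [f2, f3] at rp rm
  have ep : Complex.exp ((-ν * η ^ 2 + Complex.I * α) * t) = Complex.exp (-ν * η ^ 2 * t) *
      (Complex.cos (α * t) + Complex.sin (α * t) * Complex.I) := by
    rw [← Complex.exp_mul_I, ← Complex.exp_add]; ring_nf
  have em : Complex.exp ((-ν * η ^ 2 + -Complex.I * α) * t) = Complex.exp (-ν * η ^ 2 * t) *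
      (Complex.cos (α * t) - Complex.sin (α * t) * Complex.I) := by
    have : Complex.cos (α * t) - Complex.sin (α * t) * Complex.I =
        Complex.exp (-(α * t) * Complex.I) := by
      rw [Complex.exp_mul_I, Complex.cos_neg, Complex.sin_neg]; ring
    rw [this, ← Complex.exp_add]; ring_nf
  rw [ep] at rp
  rw [em] at rm
  change lineFourier (coef 0 0 (u 2 t)) η + _ * lineFourier (coef 0 0 (θ t)) η = _ at rp rm
  refine ⟨r0, ?_, ?_⟩
  · linear_combination (rp + rm) / 2 + Complex.exp (-ν * η ^ 2 * t) *
      Complex.sin (α * t) * lineFourier (coef 0 0 θin) η * Complex.I_sq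
  · linear_combination -Complex.I * (rp - rm) / 2 + (lineFourier (coef 0 0 (θ t)) η -
      Complex.exp (-ν * η ^ 2 * t) * (Complex.sin (α * t) * lineFourier (coef 0 0 (uin 2)) η +
      Complex.cos (α * t) * lineFourier (coef 0 0 θin) η)) * Complex.I_sq

theorem doubleZeroFormula (hν : 0 < ν) (hin : IsInitialData uin θin)
    (hsol : IsLinearSolution ν α β uin θin u θ π) {t : ℝ} (ht : 0 ≤ t) (y : ℝ) :
    DoubleZeroFormula ν α uin θin u θ t y := by
  have hc (i : Fin 4) := hsol.continuous_fields ht i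
  have hu1 : doubleZero (u 1 t) y = 0 := by
    have := ofReal_doubleZero (hc 1) y
    have h2 := hsol.coef_u2_eq_zero hin ht y
    exact_mod_cast this.trans h2
  rcases ht.eq_or_lt with rfl | ht
  · simp only [DoubleZeroFormula, heatFlow, if_true, hu1]
    simp [hsol.init_u, hsol.init_θ]
  · have hm (i : Fin 4) := hsol.memLp_fields ht.le i
    have hd (i : Fin 4) : (fun y => (doubleZero (fields u θ i t) y : ℂ)) =
        coef 0 0 (fields u θ i t) := funext fun y => ofReal_doubleZero (hc i) y
    have hcin (i : Fin 3) := (hin.smooth_u i).continuous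
    have hcθ := hin.smooth_θ.continuous
    have hdin (i : Fin 3) : (fun y => (doubleZero (uin i) y : ℂ)) = coef 0 0 (uin i) :=
      funext fun y => ofReal_doubleZero (hcin i) y
    have hdθ : (fun y => (doubleZero θin y : ℂ)) = coef 0 0 θin :=
      funext fun y => ofReal_doubleZero hcθ y
    have m2 := memLp_coef (hcin 2) (hsol.memLp_in.1 2) 0 0
    have m3 := memLp_coef hcθ hsol.memLp_in.2 0 0
    have hlin (a b : ℝ) : MemLp (fun y => ((a * doubleZero (uin 2) y - b * doubleZero θin y : ℝ) : ℂ))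
        2 ∧ lineFourier (fun y => ((a * doubleZero (uin 2) y - b * doubleZero θin y : ℝ) : ℂ))
        =ᵐ[volume] fun η => a * lineFourier (coef 0 0 (uin 2)) η -
          b * lineFourier (coef 0 0 θin) η := by
      have e : (fun y => ((a * doubleZero (uin 2) y - b * doubleZero θin y : ℝ) : ℂ)) =
          fun y => a * coef 0 0 (uin 2) y - b * coef 0 0 θin y := by
        ext y
        rw [← hdin 2, ← hdθ]
        push_cast; rfl
      rw [e]
      have ma : MemLp (fun y => a * coef 0 0 (uin 2) y) 2 := m2.const_mul (a : ℂ)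
      have mb : MemLp (fun y => b * coef 0 0 θin y) 2 := m3.const_mul (b : ℂ)
      refine ⟨ma.sub mb, (lineFourier_sub ma mb).trans ?_⟩
      filter_upwards [lineFourier_const_mul (a : ℂ) m2, lineFourier_const_mul (b : ℂ) m3]
        with η h1 h2
      rw [h1, h2]
    have hF := hsol.lineFourier_doubleZero hin ht.le
    have key (i : Fin 4) {G : ℝ → ℝ} (h2G : MemLp (fun y => (G y : ℂ)) 2)
        (h : ∀ᵐ η : ℝ, lineFourier (coef 0 0 (fields u θ i t)) η =
          Complex.exp (-ν * η ^ 2 * t) * lineFourier (fun y => (G y : ℂ)) η) :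
        doubleZero (fields u θ i t) y = heatFlow ν t G y := by
      refine eq_heatFlow_of_lineFourier hν ht (continuous_doubleZero (hc i)) ?_ h2G ?_ y
      · rw [hd]; exact memLp_coef (hc i) (hm i) 0 0
      · rwa [hd]
    refine ⟨key 0 ?_ ?_, hu1, key 2 (hlin _ _).1 ?_, ?_⟩
    · rw [hdin]; exact memLp_coef (hcin 0) (hsol.memLp_in.1 0) 0 0
    · filter_upwards [hF] with η h
      rw [hdin]
      exact h.1
    · filter_upwards [hF, (hlin (Real.cos (α * t)) (Real.sin (α * t))).2] with η h e
      rw [e]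
      push_cast
      exact h.2.1
    -- `hlin` is stated for differences, hence the sign of the cosine.
    · have h3 := hlin (Real.sin (α * t)) (-Real.cos (α * t))
      have := key 3 h3.1 (by
        filter_upwards [hF, h3.2] with η h e
        rw [e]
        refine h.2.2.trans ?_
        push_cast
        ring)
      simp only [neg_mul, sub_neg_eq_add] at this
      exact this

end DoubleZero

/-! ### Oscillatory integrals -/

/-- All integrals of `f` over subintervals of `[a, b]` are bounded by `M`. -/
def OscBound (f : ℝ → ℂ) (a b M : ℝ) : Prop :=
  ∀ c d, a ≤ c → c ≤ d → d ≤ b → ‖∫ x in c..d, f x‖ ≤ M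

lemma OscBound.mono {f : ℝ → ℂ} {a b M a' b' M' : ℝ} (h : OscBound f a b M) (ha : a ≤ a')
    (hb : b' ≤ b) (hM : M ≤ M') : OscBound f a' b' M' :=
  fun c d hc hcd hd => (h c d (ha.trans hc) hcd (hd.trans hb)).trans hM

lemma OscBound.of_norm_le {f : ℝ → ℂ} {a b : ℝ} (h : ∀ x, ‖f x‖ ≤ 1) :
    OscBound f a b (b - a) := by
  intro c d hc hcd hd
  refine (intervalIntegral.norm_integral_le_of_norm_le_const (C := 1) fun x _ => h x).trans ?_
  rw [one_mul, abs_of_nonneg (sub_nonneg.2 hcd)]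
  linarith

lemma OscBound.append {f : ℝ → ℂ} {a b c M M' : ℝ} (hf : Continuous f) (h : OscBound f a b M)
    (h' : OscBound f b c M') (hM : 0 ≤ M) (hM' : 0 ≤ M') : OscBound f a c (M + M') := by
  intro x y hx hxy hy
  rcases le_total y b with h1 | h1
  · exact (h x y hx hxy h1).trans (by linarith)
  rcases le_total b x with h2 | h2
  · exact (h' x y h2 hxy hy).trans (by linarith)
  rw [← intervalIntegral.integral_add_adjacent_intervals (hf.intervalIntegrable x b)
    (hf.intervalIntegrable b y)]
  exact (norm_add_le _ _).trans (add_le_add (h x b hx h2 le_rfl) (h' b y le_rfl h1 hy))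

/-- A monotone factor of size at most `G` changes the bound by the factor `3 G`. -/
lemma OscBound.mul_monotone {f : ℝ → ℂ} {a b M G : ℝ} (hf : Continuous f) (h : OscBound f a b M)
    (hM : 0 ≤ M) {g g' : ℝ → ℝ} (hg : ∀ x ∈ Icc a b, HasDerivAt g (g' x) x)
    (hg' : ContinuousOn g' (Icc a b))
    (hs : (∀ x ∈ Icc a b, 0 ≤ g' x) ∨ (∀ x ∈ Icc a b, g' x ≤ 0))
    (hG : ∀ x ∈ Icc a b, |g x| ≤ G) :
    OscBound (fun x => f x * g x) a b (3 * G * M) := by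
  intro c d hc hcd hd
  have hsub : Icc c d ⊆ Icc a b := Icc_subset_Icc hc hd
  have hu : uIcc c d = Icc c d := uIcc_of_le hcd
  have hF (x : ℝ) : HasDerivAt (fun x => ∫ y in c..x, f y) (f x) x :=
    intervalIntegral.integral_hasDerivAt_right (hf.intervalIntegrable c x)
      hf.aestronglyMeasurable.stronglyMeasurableAtFilter hf.continuousAt
  have hgi : IntervalIntegrable g' volume c d := (hg'.mono hsub).intervalIntegrable_of_Icc hcd
  have hgc : IntervalIntegrable (fun x => (g' x : ℂ)) volume c d :=
    (Complex.continuous_ofReal.comp_continuousOn (hg'.mono hsub)).intervalIntegrable_of_Icc hcd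
  have hG0 : 0 ≤ G := (abs_nonneg _).trans (hG c ⟨hc, hcd.trans hd⟩)
  -- Integration by parts against the primitive of `f` from `c`, which is bounded by `M`. The
  -- boundary term gives `G M`, and the variation of the monotone `g`, at most `2G`, gives the rest.
  have key := intervalIntegral.integral_mul_deriv_eq_deriv_mul (a := c) (b := d)
    (u := fun x => (g x : ℂ)) (v := fun x => ∫ y in c..x, f y) (u' := fun x => (g' x : ℂ)) (v' := f)
    (fun x hx => (hg x (hsub (hu ▸ hx))).ofReal_comp) (fun x _ => hF x) hgc
    (hf.intervalIntegrable c d)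
  simp only [intervalIntegral.integral_same, mul_zero, sub_zero] at key
  have e : ∫ x in c..d, f x * g x = ∫ x in c..d, (g x : ℂ) * f x := by simp only [mul_comm]
  rw [e, key]
  have h1 : ‖(g d : ℂ) * ∫ y in c..d, f y‖ ≤ G * M := by
    rw [norm_mul, Complex.norm_real]
    exact mul_le_mul (hG d ⟨hc.trans hcd, hd⟩) (h c d hc hcd hd) (norm_nonneg _) hG0
  have h2 : ‖∫ x in c..d, (g' x : ℂ) * ∫ y in c..x, f y‖ ≤ 2 * G * M := by
    have h3 : ‖∫ x in c..d, (g' x : ℂ) * ∫ y in c..x, f y‖ ≤ ∫ x in c..d, |g' x| * M := by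
      refine intervalIntegral.norm_integral_le_of_norm_le hcd (.of_forall fun x hx => ?_)
        (hgi.abs.mul_const M)
      rw [norm_mul, Complex.norm_real]
      exact mul_le_mul_of_nonneg_left (h c x hc hx.1.le (hx.2.trans hd)) (abs_nonneg _)
    refine h3.trans ?_
    rw [intervalIntegral.integral_mul_const]
    refine mul_le_mul_of_nonneg_right ?_ hM
    have h4 : ∫ x in c..d, g' x = g d - g c :=
      intervalIntegral.integral_eq_sub_of_hasDerivAt (fun x hx => hg x (hsub (hu ▸ hx))) hgi
    have hc' := abs_le.1 (hG c ⟨hc, hcd.trans hd⟩)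
    have hd' := abs_le.1 (hG d ⟨hc.trans hcd, hd⟩)
    rcases hs with hs | hs
    · have : ∫ x in c..d, |g' x| = ∫ x in c..d, g' x :=
        intervalIntegral.integral_congr fun x hx => abs_of_nonneg (hs x (hsub (hu ▸ hx)))
      rw [this, h4]; linarith
    · have : ∫ x in c..d, |g' x| = ∫ x in c..d, -g' x :=
        intervalIntegral.integral_congr fun x hx => abs_of_nonpos (hs x (hsub (hu ▸ hx)))
      rw [this, intervalIntegral.integral_neg, h4]; linarith
  refine (norm_sub_le _ _).trans ?_
  linarith

/-- The first derivative test of van der Corput. -/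
lemma vanDerCorput_one {ψ ψ' ψ'' : ℝ → ℝ} (h1 : ∀ x, HasDerivAt ψ (ψ' x) x)
    (h2 : ∀ x, HasDerivAt ψ' (ψ'' x) x) (hc : Continuous ψ'') {a b μ : ℝ} (hab : a ≤ b)
    (hμ : 0 < μ) (hpos : ∀ x ∈ Icc a b, 0 ≤ ψ'' x)
    (hψ : (∀ x ∈ Icc a b, μ ≤ ψ' x) ∨ (∀ x ∈ Icc a b, ψ' x ≤ -μ)) :
    ‖∫ x in a..b, Complex.exp (Complex.I * ψ x)‖ ≤ 6 / μ := by
  have hψc : Continuous ψ := continuous_iff_continuousAt.2 fun x => (h1 x).continuousAt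
  have hψ'c : Continuous ψ' := continuous_iff_continuousAt.2 fun x => (h2 x).continuousAt
  have habs : ∀ x ∈ Icc a b, μ ≤ |ψ' x| := fun x hx => by
    rcases hψ with h | h
    · exact (h x hx).trans (le_abs_self _)
    · exact (le_neg.1 (h x hx)).trans (neg_le_abs _)
  have hne : ∀ x ∈ Icc a b, ψ' x ≠ 0 := fun x hx h => by
    have := habs x hx
    rw [h, abs_zero] at this
    linarith
  -- `f` is the derivative of a unimodular function, so its integrals are at most `2`; the monotone
  -- factor `1/ψ'` then gives `3 · (1/μ) · 2`.
  set f : ℝ → ℂ := fun x => ψ' x * Complex.exp (Complex.I * ψ x) with hf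
  have hfc : Continuous f := by fun_prop
  have hexp (x : ℝ) : HasDerivAt (fun x => -Complex.I * Complex.exp (Complex.I * ψ x)) (f x) x := by
    convert! (((h1 x).ofReal_comp.const_mul Complex.I).cexp).const_mul (-Complex.I) using 1
    simp only [hf]
    linear_combination (ψ' x * Complex.exp (Complex.I * ψ x)) * Complex.I_sq
  have hn (x : ℝ) : ‖-Complex.I * Complex.exp (Complex.I * ψ x)‖ = 1 := by
    rw [norm_mul, norm_neg, Complex.norm_I, mul_comm Complex.I, Complex.norm_exp_ofReal_mul_I,
      one_mul]
  have hosc : OscBound f a b 2 := fun c d _ _ _ => by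
    rw [intervalIntegral.integral_eq_sub_of_hasDerivAt (fun x _ => hexp x)
      (hfc.intervalIntegrable _ _)]
    refine (norm_sub_le _ _).trans ?_
    rw [hn, hn]; norm_num
  have := hosc.mul_monotone hfc (by norm_num) (g := fun x => (ψ' x)⁻¹)
    (g' := fun x => -ψ'' x / ψ' x ^ 2) (G := 1 / μ) (fun x hx => (h2 x).fun_inv (hne x hx))
    (hc.continuousOn.neg.div (hψ'c.pow 2).continuousOn fun x hx => pow_ne_zero 2 (hne x hx))
    (Or.inr fun x hx => div_nonpos_of_nonpos_of_nonneg (neg_nonpos.2 (hpos x hx)) (sq_nonneg _))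
    (fun x hx => by
      rw [abs_inv, one_div]
      exact inv_anti₀ hμ (habs x hx))
  have h3 := this a b le_rfl hab le_rfl
  have e : ∫ x in a..b, f x * ((ψ' x)⁻¹ : ℝ) = ∫ x in a..b, Complex.exp (Complex.I * ψ x) := by
    refine intervalIntegral.integral_congr fun x hx => ?_
    rw [uIcc_of_le hab] at hx
    have : (ψ' x : ℂ) ≠ 0 := by exact_mod_cast hne x hx
    simp only [hf]
    push_cast
    field_simp
  rw [e] at h3
  refine h3.trans (le_of_eq ?_)
  ring

/-- The second derivative test of van der Corput. -/
lemma vanDerCorput_two_aux {ψ ψ' ψ'' : ℝ → ℝ} (h1 : ∀ x, HasDerivAt ψ (ψ' x) x)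
    (h2 : ∀ x, HasDerivAt ψ' (ψ'' x) x) (hc : Continuous ψ'') {a b μ : ℝ} (hab : a ≤ b)
    (hμ : 0 < μ) (hpos : ∀ x ∈ Icc a b, μ ^ 2 ≤ ψ'' x) :
    ‖∫ x in a..b, Complex.exp (Complex.I * ψ x)‖ ≤ 14 / μ := by
  have hψc : Continuous ψ := continuous_iff_continuousAt.2 fun x => (h1 x).continuousAt
  have hψ'c : Continuous ψ' := continuous_iff_continuousAt.2 fun x => (h2 x).continuousAt
  have hE : Continuous fun x => Complex.exp (Complex.I * ψ x) := by fun_prop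
  have hgrow (x y : ℝ) (hx : a ≤ x) (hxy : x ≤ y) (hy : y ≤ b) :
      μ ^ 2 * (y - x) ≤ ψ' y - ψ' x := by
    have h3 : ∫ s in x..y, ψ'' s = ψ' y - ψ' x :=
      intervalIntegral.integral_eq_sub_of_hasDerivAt (fun s _ => h2 s) (hc.intervalIntegrable _ _)
    have h4 : ∫ _ in x..y, μ ^ 2 ≤ ∫ s in x..y, ψ'' s :=
      intervalIntegral.integral_mono_on hxy intervalIntegrable_const (hc.intervalIntegrable _ _)
        fun s hs => hpos s ⟨hx.trans hs.1, hs.2.trans hy⟩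
    rw [intervalIntegral.integral_const, smul_eq_mul, h3] at h4
    linarith
  -- `c` is the zero of the increasing `ψ'`, or an end point if there is none. At distance `1/μ`
  -- from it `|ψ'| ≥ μ`, so the first derivative test applies outside a window of length `2/μ`.
  obtain ⟨c, hca, hcb, hr, hl⟩ : ∃ c, a ≤ c ∧ c ≤ b ∧ (∀ x ∈ Ioc c b, μ ^ 2 * (x - c) ≤ ψ' x) ∧
      ∀ x ∈ Ico a c, ψ' x ≤ -(μ ^ 2 * (c - x)) := by
    rcases le_total 0 (ψ' a) with ha | ha
    · refine ⟨a, le_rfl, hab, fun x hx => ?_, fun x hx => absurd hx.2 hx.1.not_gt⟩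
      have := hgrow a x le_rfl hx.1.le hx.2
      linarith
    rcases le_total (ψ' b) 0 with hb | hb
    · refine ⟨b, hab, le_rfl, fun x hx => absurd hx.1 hx.2.not_gt, fun x hx => ?_⟩
      have := hgrow x b hx.1 hx.2.le le_rfl
      linarith
    · obtain ⟨c, hc, h0⟩ := intermediate_value_Icc hab hψ'c.continuousOn ⟨ha, hb⟩
      refine ⟨c, hc.1, hc.2, fun x hx => ?_, fun x hx => ?_⟩
      · have := hgrow c x hc.1 hx.1.le hx.2
        linarith
      · have := hgrow x c hx.1 hx.2.le hc.2
        linarith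
  have hμ1 : 0 < 1 / μ := by positivity
  have hμ2 : μ ^ 2 * (1 / μ) = μ := by field_simp
  set p := max a (c - 1 / μ) with hp
  set r := min b (c + 1 / μ) with hrd
  have hap : a ≤ p := le_max_left _ _
  have hpc : p ≤ c := max_le hca (by linarith)
  have hcr : c ≤ r := le_min hcb (by linarith)
  have hrb : r ≤ b := min_le_left _ _
  have i1 : ‖∫ x in a..p, Complex.exp (Complex.I * ψ x)‖ ≤ 6 / μ := by
    rcases le_total (c - 1 / μ) a with h | h
    · rw [hp, max_eq_left h, intervalIntegral.integral_same, norm_zero]; positivity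
    · have hp' : p = c - 1 / μ := max_eq_right h
      refine vanDerCorput_one h1 h2 hc hap hμ (fun x hx => (sq_nonneg μ).trans
        (hpos x ⟨hx.1, hx.2.trans (hpc.trans hcb)⟩)) (Or.inr fun x hx => ?_)
      have h3 := hl x ⟨hx.1, hx.2.trans_lt (by rw [hp']; linarith)⟩
      have h4 : μ ^ 2 * (1 / μ) ≤ μ ^ 2 * (c - x) :=
        mul_le_mul_of_nonneg_left (by linarith [hx.2]) (sq_nonneg μ)
      linarith
  have i3 : ‖∫ x in r..b, Complex.exp (Complex.I * ψ x)‖ ≤ 6 / μ := by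
    rcases le_total b (c + 1 / μ) with h | h
    · rw [hrd, min_eq_left h, intervalIntegral.integral_same, norm_zero]; positivity
    · have hr' : r = c + 1 / μ := min_eq_right h
      refine vanDerCorput_one h1 h2 hc hrb hμ (fun x hx => (sq_nonneg μ).trans
        (hpos x ⟨(hca.trans hcr).trans hx.1, hx.2⟩)) (Or.inl fun x hx => ?_)
      have h3 := hr x ⟨lt_of_lt_of_le (by rw [hr']; linarith) hx.1, hx.2⟩
      have h4 : μ ^ 2 * (1 / μ) ≤ μ ^ 2 * (x - c) :=
        mul_le_mul_of_nonneg_left (by linarith [hx.1]) (sq_nonneg μ)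
      linarith
  have i2 : ‖∫ x in p..r, Complex.exp (Complex.I * ψ x)‖ ≤ 2 / μ := by
    refine (intervalIntegral.norm_integral_le_of_norm_le_const (C := 1) fun x _ => ?_).trans ?_
    · rw [mul_comm, Complex.norm_exp_ofReal_mul_I]
    · rw [one_mul, abs_of_nonneg (by linarith)]
      have e1 : c - 1 / μ ≤ p := le_max_right _ _
      have e2 : r ≤ c + 1 / μ := min_le_right _ _
      have e3 : 2 / μ = 1 / μ + 1 / μ := by ring
      linarith
  rw [← intervalIntegral.integral_add_adjacent_intervals (hE.intervalIntegrable a p)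
    (hE.intervalIntegrable p b), ← intervalIntegral.integral_add_adjacent_intervals
    (hE.intervalIntegrable p r) (hE.intervalIntegrable r b)]
  refine (norm_add_le _ _).trans ((add_le_add_right (norm_add_le _ _) _).trans ?_)
  have e4 : 14 / μ = 6 / μ + (2 / μ + 6 / μ) := by ring
  linarith

lemma norm_integral_exp_neg (ψ : ℝ → ℝ) (a b : ℝ) :
    ‖∫ x in a..b, Complex.exp (Complex.I * (-ψ x : ℝ))‖ =
      ‖∫ x in a..b, Complex.exp (Complex.I * ψ x)‖ := by
  rw [← Complex.norm_conj (∫ x in a..b, Complex.exp (Complex.I * ψ x)),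
    ← intervalIntegral.intervalIntegral_conj]
  congr 2
  ext x
  rw [← Complex.exp_conj]
  simp

/-- The second derivative test of van der Corput. -/
lemma vanDerCorput_two {ψ ψ' ψ'' : ℝ → ℝ} (h1 : ∀ x, HasDerivAt ψ (ψ' x) x)
    (h2 : ∀ x, HasDerivAt ψ' (ψ'' x) x) (hc : Continuous ψ'') {a b μ : ℝ}
    (hμ : 0 < μ) (h : (∀ x ∈ Icc a b, μ ^ 2 ≤ ψ'' x) ∨ (∀ x ∈ Icc a b, ψ'' x ≤ -μ ^ 2)) :
    OscBound (fun x => Complex.exp (Complex.I * ψ x)) a b (14 / μ) := by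
  intro x y hx hxy hy
  rcases h with h | h
  · exact vanDerCorput_two_aux h1 h2 hc hxy hμ fun s hs => h s ⟨hx.trans hs.1, hs.2.trans hy⟩
  · rw [← norm_integral_exp_neg]
    exact vanDerCorput_two_aux (fun x => (h1 x).neg) (fun x => (h2 x).neg) hc.neg hxy hμ
      fun s hs => le_neg.1 (h s ⟨hx.trans hs.1, hs.2.trans hy⟩)

lemma vanDerCorput_of_weight {ψ ψ' w : ℝ → ℝ} {ε : ℝ} (h1 : ∀ x, HasDerivAt ψ (ψ' x) x)
    (h2 : ∀ x, HasDerivAt ψ' (ε * w x) x) (hc : Continuous w) {a b μ v : ℝ}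
    (hμ : 0 < μ) (hμv : μ ^ 2 ≤ |ε| * v)
    (h : (∀ x ∈ Icc a b, v ≤ w x) ∨ (∀ x ∈ Icc a b, w x ≤ -v)) :
    OscBound (fun x => Complex.exp (Complex.I * ψ x)) a b (14 / μ) := by
  refine vanDerCorput_two h1 h2 (continuous_const.mul hc) hμ ?_
  rcases le_total 0 ε with hε | hε
  · rw [abs_of_nonneg hε] at hμv
    rcases h with h | h
    · exact Or.inl fun x hx => hμv.trans (mul_le_mul_of_nonneg_left (h x hx) hε)
    · refine Or.inr fun x hx => (mul_le_mul_of_nonneg_left (h x hx) hε).trans ?_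
      linarith
  · rw [abs_of_nonpos hε] at hμv
    rcases h with h | h
    · refine Or.inr fun x hx => (mul_le_mul_of_nonpos_left (h x hx) hε).trans ?_
      linarith
    · refine Or.inl fun x hx => le_trans ?_ (mul_le_mul_of_nonpos_left (h x hx) hε)
      linarith

/-- The interpolation `min(x³, s³) ≤ x s²` at `x = 2^{-n}`. It sums the tail blocks geometrically at
the order `s²` of the main term, and is the reason for the ratio `8`. -/
lemma min_pow_le (s : ℝ) (n : ℕ) : min ((1 / 8 : ℝ) ^ n) (s ^ 3) ≤ (1 / 2) ^ n * s ^ 2 := by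
  have h8 : (1 / 8 : ℝ) ^ n = ((1 / 2) ^ n) ^ 3 := by
    rw [← pow_mul, mul_comm, pow_mul]; norm_num
  rw [h8]
  set x : ℝ := (1 / 2) ^ n
  have hx : 0 < x := by positivity
  rcases le_total x s with h | h
  · refine (min_le_left _ _).trans ?_
    have : x ^ 2 ≤ s ^ 2 := by gcongr
    nlinarith
  · refine (min_le_right _ _).trans ?_
    have := mul_le_mul_of_nonneg_right h (sq_nonneg s)
    linarith

/-- The constant of the dispersive estimate, in terms of the nondegeneracy of the phase. -/
def dispersiveConst (c : ℝ) : ℝ := 3 * (28 / c + 2) + 2 * (21 + 2688 / c)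

/-- Here `s² = |ε|^{-1/3}`. Near the simple zero `r₀` of the second derivative a window of radius
`s²` is estimated trivially; outside it, within `[0, 1]`, the second derivative is at least
`(c/s²)²` in modulus, and van der Corput gives the same order `s²`. Beyond `1` the second derivative
degenerates like `x^{-4}`, which the amplitude `1/(1+x²)` compensates block by block. Only second
derivatives enter, so any linear phase is allowed. -/
lemma dispersive_oscBound {ψ ψ' w : ℝ → ℝ} {ε s c r₀ : ℝ} (h1 : ∀ x, HasDerivAt ψ (ψ' x) x)
    (h2 : ∀ x, HasDerivAt ψ' (ε * w x) x) (hw : Continuous w) (hs : 0 < s) (hε : s ^ 6 * |ε| = 1)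
    (hc : 0 < c) (hr0 : 0 ≤ r₀) (hr1 : r₀ ≤ 1)
    (hw1 : ∀ x ∈ Icc 0 r₀, c ^ 2 * (r₀ - x) ≤ w x) (hw2 : ∀ x ∈ Icc r₀ 1, w x ≤ -(c ^ 2 * (x - r₀)))
    (hw3 : ∀ x, 1 ≤ x → w x ≤ -(c ^ 2 / x ^ 4)) (N : ℕ) :
    OscBound (fun x => Complex.exp (Complex.I * ψ x) * ((1 + x ^ 2)⁻¹ : ℝ)) 0 (8 ^ N)
      (dispersiveConst c * s ^ 2) := by
  have hψc : Continuous ψ := continuous_iff_continuousAt.2 fun x => (h1 x).continuousAt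
  have hE : Continuous fun x => Complex.exp (Complex.I * ψ x) := by fun_prop
  have hn (x : ℝ) : ‖Complex.exp (Complex.I * ψ x)‖ ≤ 1 := by
    rw [mul_comm, Complex.norm_exp_ofReal_mul_I]
  have hq (x : ℝ) : 1 + x ^ 2 ≠ 0 := by positivity
  have hcq : Continuous fun x : ℝ => (1 + x ^ 2)⁻¹ := by
    exact Continuous.inv₀ (by fun_prop) hq
  have hdq (x : ℝ) : HasDerivAt (fun x : ℝ => (1 + x ^ 2)⁻¹) (-(2 * x) / (1 + x ^ 2) ^ 2) x := by
    have := (((hasDerivAt_id x).pow 2).const_add 1).fun_inv (hq x)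
    simpa using this
  have hEq : Continuous fun x => Complex.exp (Complex.I * ψ x) * ((1 + x ^ 2)⁻¹ : ℝ) := by fun_prop
  have hcdq : Continuous fun x : ℝ => -(2 * x) / (1 + x ^ 2) ^ 2 :=
    Continuous.div (by fun_prop) (by fun_prop) fun x => pow_ne_zero 2 (hq x)
  have hmul {a b M G : ℝ} (ha : 0 ≤ a) (hM : 0 ≤ M) (hG : 1 ≤ G * (1 + a ^ 2))
      (h : OscBound (fun x => Complex.exp (Complex.I * ψ x)) a b M) :
      OscBound (fun x => Complex.exp (Complex.I * ψ x) * ((1 + x ^ 2)⁻¹ : ℝ)) a b (3 * G * M) := by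
    refine h.mul_monotone hE hM (fun x _ => hdq x) hcdq.continuousOn
      (Or.inr fun x hx => div_nonpos_of_nonpos_of_nonneg (by linarith [hx.1]) (sq_nonneg _))
      fun x hx => ?_
    rw [abs_of_pos (by positivity)]
    rw [inv_le_iff_one_le_mul₀ (by positivity)]
    have h3 : 0 ≤ G := by
      by_contra hG'
      have : G * (1 + a ^ 2) < 0 := mul_neg_of_neg_of_pos (not_le.1 hG') (by positivity)
      linarith
    refine hG.trans (mul_le_mul_of_nonneg_left ?_ h3)
    have : a ^ 2 ≤ x ^ 2 := pow_le_pow_left₀ ha hx.1 2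
    linarith
  -- the part near the stationary point of the derivative
  have hfirst : OscBound (fun x => Complex.exp (Complex.I * ψ x)) 0 1 ((28 / c + 2) * s ^ 2) := by
    set p := max 0 (r₀ - s ^ 2) with hp
    set r := min 1 (r₀ + s ^ 2) with hr
    have hs2 : 0 < s ^ 2 := by positivity
    have hpr : p ≤ r₀ := max_le hr0 (by linarith)
    have hrr : r₀ ≤ r := le_min hr1 (by linarith)
    have hμ : (c / s ^ 2) ^ 2 ≤ |ε| * (c ^ 2 * s ^ 2) := by
      have : |ε| = 1 / s ^ 6 := by rw [eq_div_iff (by positivity), mul_comm]; exact hε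
      rw [this]
      refine le_of_eq ?_
      field_simp
    have e14 : 14 / (c / s ^ 2) = 14 / c * s ^ 2 := by field_simp
    have o1 : OscBound (fun x => Complex.exp (Complex.I * ψ x)) 0 p (14 / c * s ^ 2) := by
      rcases le_total (r₀ - s ^ 2) 0 with h | h
      · rw [hp, max_eq_left h]
        refine (OscBound.of_norm_le hn).mono le_rfl le_rfl ?_
        rw [sub_zero]; positivity
      · have hp' : p = r₀ - s ^ 2 := max_eq_right h
        rw [← e14]
        refine vanDerCorput_of_weight h1 h2 hw (by positivity) hμ (Or.inl fun x hx => ?_)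
        refine le_trans (mul_le_mul_of_nonneg_left ?_ (sq_nonneg c)) (hw1 x ⟨hx.1, hx.2.trans hpr⟩)
        linarith [hx.2]
    have o3 : OscBound (fun x => Complex.exp (Complex.I * ψ x)) r 1 (14 / c * s ^ 2) := by
      rcases le_total 1 (r₀ + s ^ 2) with h | h
      · rw [hr, min_eq_left h]
        refine (OscBound.of_norm_le hn).mono le_rfl le_rfl ?_
        rw [sub_self]; positivity
      · have hr' : r = r₀ + s ^ 2 := min_eq_right h
        rw [← e14]
        refine vanDerCorput_of_weight h1 h2 hw (by positivity) hμ (Or.inr fun x hx => ?_)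
        refine (hw2 x ⟨hrr.trans hx.1, hx.2⟩).trans (neg_le_neg ?_)
        refine mul_le_mul_of_nonneg_left ?_ (sq_nonneg c)
        linarith [hx.1]
    have o2 : OscBound (fun x => Complex.exp (Complex.I * ψ x)) p r (2 * s ^ 2) := by
      refine (OscBound.of_norm_le hn).mono le_rfl le_rfl ?_
      have e1 : r₀ - s ^ 2 ≤ p := le_max_right _ _
      have e2 : r ≤ r₀ + s ^ 2 := min_le_right _ _
      linarith
    refine ((o1.append hE o2 (by positivity) (by positivity)).append hE o3 (by positivity)
      (by positivity)).mono le_rfl le_rfl (le_of_eq ?_)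
    ring
  -- On `[8^n, 8^{n+1}]` the trivial bound is `21 · 8^{-n}` with `21 = 3 · 7`, and van der Corput
  -- gives `(2688/c) s³` with `2688 = 3 · 14 · 8²`.
  have hblock (n : ℕ) : OscBound (fun x => Complex.exp (Complex.I * ψ x) * ((1 + x ^ 2)⁻¹ : ℝ))
      (8 ^ n) (8 ^ (n + 1)) ((21 + 2688 / c) * ((1 / 2) ^ n * s ^ 2)) := by
    have h8 : (0 : ℝ) < 8 ^ n := by positivity
    have h9 : (8 : ℝ) ^ (n + 1) = 8 * 8 ^ n := by rw [pow_succ]; ring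
    have h81 : (1 : ℝ) ≤ 8 ^ n := one_le_pow₀ (by norm_num)
    have hG : 1 ≤ ((8 : ℝ) ^ n)⁻¹ ^ 2 * (1 + ((8 : ℝ) ^ n) ^ 2) := by
      rw [mul_add, ← mul_pow, inv_mul_cancel₀ h8.ne']
      have : 0 ≤ ((8 : ℝ) ^ n)⁻¹ ^ 2 := by positivity
      linarith
    have b1 := hmul h8.le (by rw [pow_succ]; linarith) hG
      (OscBound.of_norm_le (a := 8 ^ n) (b := 8 ^ (n + 1)) hn)
    have b2 := hmul h8.le (M := 14 / (c / (s ^ 3 * (8 ^ (n + 1)) ^ 2))) (by positivity) hG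
      (vanDerCorput_of_weight (b := 8 ^ (n + 1)) h1 h2 hw (by positivity) (v := c ^ 2 / (8 ^ (n + 1)) ^ 4)
        (by
          have : |ε| = 1 / s ^ 6 := by rw [eq_div_iff (by positivity), mul_comm]; exact hε
          rw [this]
          refine le_of_eq ?_
          field_simp) (Or.inr fun x hx => (hw3 x (h81.trans hx.1)).trans (neg_le_neg ?_)))
    · have hmin := min_pow_le s n
      have h3 : (21 + 2688 / c) * min ((1 / 8) ^ n) (s ^ 3) ≤
          (21 + 2688 / c) * ((1 / 2) ^ n * s ^ 2) := by gcongr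
      have h18 : (1 / 8 : ℝ) ^ n = ((8 : ℝ) ^ n)⁻¹ := by rw [one_div, inv_pow]
      rcases le_total ((1 / 8 : ℝ) ^ n) (s ^ 3) with h | h
      · rw [min_eq_left h] at h3
        refine b1.mono le_rfl le_rfl (le_trans ?_ h3)
        have : 3 * ((8 : ℝ) ^ n)⁻¹ ^ 2 * (8 ^ (n + 1) - 8 ^ n) = 21 * (1 / 8) ^ n := by
          rw [h18, h9]; field_simp; ring
        rw [this]
        gcongr
        have : 0 ≤ 2688 / c := by positivity
        linarith
      · rw [min_eq_right h] at h3
        refine b2.mono le_rfl le_rfl (le_trans ?_ h3)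
        have : 3 * ((8 : ℝ) ^ n)⁻¹ ^ 2 * (14 / (c / (s ^ 3 * (8 ^ (n + 1)) ^ 2))) =
            2688 / c * s ^ 3 := by
          rw [h9]; field_simp; norm_num
        rw [this]
        gcongr
        linarith
    · have hx0 : 0 < x := h8.trans_le hx.1
      gcongr
      exact hx.2
  have hC : 0 ≤ 21 + 2688 / c := by positivity
  have htail (N : ℕ) : OscBound (fun x => Complex.exp (Complex.I * ψ x) * ((1 + x ^ 2)⁻¹ : ℝ))
      1 (8 ^ N) ((21 + 2688 / c) * ((2 - 2 * (1 / 2) ^ N) * s ^ 2)) := by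
    induction N with
    | zero =>
      intro x y hx hxy hy
      have : x = y := by rw [pow_zero] at hy; linarith
      subst this
      simp
    | succ N ih =>
      have hpow : (1 / 2 : ℝ) ^ N ≤ 1 := pow_le_one₀ (by norm_num) (by norm_num)
      refine (ih.append hEq (hblock N) ?_ (by positivity)).mono le_rfl le_rfl (le_of_eq ?_)
      · have : 0 ≤ 2 - 2 * (1 / 2 : ℝ) ^ N := by linarith
        positivity
      · rw [pow_succ]; ring
  have hz := hmul (G := 1) le_rfl (by positivity) (by norm_num) hfirst
  have hpow : (1 / 2 : ℝ) ^ N ≤ 1 := pow_le_one₀ (by norm_num) (by norm_num)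
  have h0 : 0 ≤ (21 + 2688 / c) * ((2 - 2 * (1 / 2) ^ N) * s ^ 2) := by
    have : 0 ≤ 2 - 2 * (1 / 2 : ℝ) ^ N := by linarith
    positivity
  refine (hz.append hEq (htail N) (by positivity) h0).mono le_rfl le_rfl ?_
  have : (2 - 2 * (1 / 2 : ℝ) ^ N) * s ^ 2 ≤ 2 * s ^ 2 := by
    gcongr
    have : 0 ≤ (1 / 2 : ℝ) ^ N := by positivity
    linarith
  have h2 := mul_le_mul_of_nonneg_left this hC
  unfold dispersiveConst
  linarith

/-! ### Amplitudes -/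

/-- `(a² x² + b)^{-1/2}`. -/
def invSqrt (a b x : ℝ) : ℝ := (Real.sqrt (a ^ 2 * x ^ 2 + b))⁻¹

section InvSqrt

variable {a b : ℝ}

lemma invSqrt_pos (hb : 0 < b) (x : ℝ) : 0 < invSqrt a b x := by
  have : 0 < a ^ 2 * x ^ 2 + b := by positivity
  unfold invSqrt
  positivity

lemma invSqrt_sq_mul (hb : 0 < b) (x : ℝ) : invSqrt a b x ^ 2 * (a ^ 2 * x ^ 2 + b) = 1 := by
  have : 0 < a ^ 2 * x ^ 2 + b := by positivity
  rw [invSqrt, inv_pow, Real.sq_sqrt this.le, inv_mul_cancel₀ this.ne']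

lemma invSqrt_neg (x : ℝ) : invSqrt a b (-x) = invSqrt a b x := by simp [invSqrt]

lemma hasDerivAt_invSqrt (hb : 0 < b) (x : ℝ) :
    HasDerivAt (invSqrt a b) (-(a ^ 2 * x * invSqrt a b x ^ 3)) x := by
  have hp : 0 < a ^ 2 * x ^ 2 + b := by positivity
  have h1 : HasDerivAt (fun x : ℝ => a ^ 2 * x ^ 2 + b) (a ^ 2 * (2 * x)) x := by
    simpa using ((hasDerivAt_pow 2 x).const_mul (a ^ 2)).add_const b
  have h2 := (h1.sqrt hp.ne').fun_inv (Real.sqrt_ne_zero'.2 hp)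
  have hs : Real.sqrt (a ^ 2 * x ^ 2 + b) ≠ 0 := Real.sqrt_ne_zero'.2 hp
  refine h2.congr_deriv ?_
  unfold invSqrt
  field_simp

lemma continuous_invSqrt (hb : 0 < b) : Continuous (invSqrt a b) :=
  continuous_iff_continuousAt.2 fun x => (hasDerivAt_invSqrt hb x).continuousAt

lemma le_invSqrt {c x : ℝ} (hb : 0 < b) (h : c ^ 2 * (a ^ 2 * x ^ 2 + b) ≤ 1) :
    c ≤ invSqrt a b x := by
  have hp : 0 < a ^ 2 * x ^ 2 + b := by positivity
  refine le_of_sq_le_sq ?_ (invSqrt_pos hb x).le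
  rw [← invSqrt_sq_mul (a := a) hb x] at h
  exact le_of_mul_le_mul_right h hp

end InvSqrt

/-- A bounded even or odd function that is monotone on the half line. -/
structure IsAmplitude (G : ℝ) (f : ℝ → ℝ) : Prop where
  exists_deriv : ∃ f' : ℝ → ℝ, (∀ x, HasDerivAt f (f' x) x) ∧ Continuous f' ∧
    ((∀ x, 0 ≤ x → 0 ≤ f' x) ∨ (∀ x, 0 ≤ x → f' x ≤ 0))
  bound : ∀ x, |f x| ≤ G
  parity : (∀ x, f (-x) = f x) ∨ (∀ x, f (-x) = -f x)

lemma IsAmplitude.continuous {G : ℝ} {f : ℝ → ℝ} (h : IsAmplitude G f) : Continuous f := by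
  obtain ⟨f', h', -⟩ := h.exists_deriv
  exact continuous_iff_continuousAt.2 fun x => (h' x).continuousAt

lemma isAmplitude_one {G : ℝ} (hG : 1 ≤ G) : IsAmplitude G fun _ => 1 where
  exists_deriv := ⟨fun _ => 0, fun x => hasDerivAt_const x 1, continuous_const, by simp⟩
  bound x := by simpa using hG
  parity := by simp

lemma isAmplitude_invSqrt {a b G : ℝ} (hb : 0 < b) (hG : 0 ≤ G) (hGb : 1 ≤ G ^ 2 * b) :
    IsAmplitude G (invSqrt a b) where
  exists_deriv := by
    refine ⟨_, hasDerivAt_invSqrt hb, ?_, Or.inr fun x hx => ?_⟩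
    · have := continuous_invSqrt (a := a) hb
      fun_prop
    · have := invSqrt_pos (a := a) hb x
      have : 0 ≤ a ^ 2 * x * invSqrt a b x ^ 3 := by positivity
      linarith
  bound x := by
    have h0 := invSqrt_pos (a := a) hb x
    rw [abs_of_pos h0]
    refine le_of_sq_le_sq ?_ hG
    have h1 := invSqrt_sq_mul (a := a) hb x
    have h2 : 0 ≤ invSqrt a b x ^ 2 * (a ^ 2 * x ^ 2) := by positivity
    refine le_of_mul_le_mul_right (a := b) ?_ hb
    linarith
  parity := Or.inl invSqrt_neg

lemma isAmplitude_mul_invSqrt {a b G : ℝ} (ha : 0 ≤ a) (hb : 0 < b) (hG : 1 ≤ G) :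
    IsAmplitude G fun x => a * x * invSqrt a b x where
  exists_deriv := by
    refine ⟨fun x => a * b * invSqrt a b x ^ 3, fun x => ?_, ?_, Or.inl fun x _ => ?_⟩
    · have := ((hasDerivAt_id x).const_mul a).mul (hasDerivAt_invSqrt (a := a) hb x)
      refine this.congr_deriv ?_
      have h1 := invSqrt_sq_mul (a := a) hb x
      simp only [id, mul_one]
      linear_combination (-(a * invSqrt a b x)) * h1
    · have := continuous_invSqrt (a := a) hb
      fun_prop
    · have := invSqrt_pos (a := a) hb x
      positivity
  bound x := by
    have h0 := invSqrt_pos (a := a) hb x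
    refine (abs_le_one_iff_mul_self_le_one.2 ?_).trans hG
    have h1 := invSqrt_sq_mul (a := a) hb x
    have h2 : 0 ≤ invSqrt a b x ^ 2 * b := by positivity
    linarith
  parity := Or.inr fun x => by simp [invSqrt_neg]

/-! ### The phase -/

/-- `√(a² x² + b) / √(1 + x²)`, the dispersion relation on the rays through the origin. -/
def phase (a b x : ℝ) : ℝ := (a ^ 2 * x ^ 2 + b) * invSqrt a b x * invSqrt 1 1 x

/-- The second derivative of the phase, up to the factor `a² - b`. -/
def phaseWeight (a b x : ℝ) : ℝ :=
  invSqrt 1 1 x ^ 5 * invSqrt a b x ^ 3 * (b - 2 * b * x ^ 2 - 3 * a ^ 2 * x ^ 4)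

lemma phase_neg (a b x : ℝ) : phase a b (-x) = phase a b x := by simp [phase, invSqrt_neg]

section Phase

variable {a b : ℝ}

/-- The factor `a² - b` is exposed because it measures the dispersion: for `b = a²` the phase is
constant and there is no decay. -/
lemma hasDerivAt_phase (hb : 0 < b) (x : ℝ) :
    HasDerivAt (phase a b) ((a ^ 2 - b) * (x * invSqrt 1 1 x ^ 3 * invSqrt a b x)) x := by
  have h1 : HasDerivAt (fun x : ℝ => a ^ 2 * x ^ 2 + b) (a ^ 2 * (2 * x)) x := by
    simpa using ((hasDerivAt_pow 2 x).const_mul (a ^ 2)).add_const b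
  refine ((h1.mul (hasDerivAt_invSqrt hb x)).mul
    (hasDerivAt_invSqrt (a := 1) one_pos x)).congr_deriv ?_
  have hm := invSqrt_sq_mul (a := a) hb x
  have hk := invSqrt_sq_mul (a := 1) one_pos x
  simp only [Pi.mul_apply]
  set m := invSqrt a b x
  set κ := invSqrt 1 1 x
  linear_combination (-(a ^ 2 * x * m * κ)) * hm - (a ^ 2 * x * m * κ) * hk

lemma hasDerivAt_phase_deriv (hb : 0 < b) (x : ℝ) :
    HasDerivAt (fun x => x * invSqrt 1 1 x ^ 3 * invSqrt a b x) (phaseWeight a b x) x := by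
  refine (((hasDerivAt_id x).mul ((hasDerivAt_invSqrt (a := 1) one_pos x).pow 3)).mul
    (hasDerivAt_invSqrt (a := a) hb x)).congr_deriv ?_
  have hm := invSqrt_sq_mul (a := a) hb x
  have hk := invSqrt_sq_mul (a := 1) one_pos x
  simp only [Pi.mul_apply, Pi.pow_apply, id, phaseWeight]
  set m := invSqrt a b x
  set κ := invSqrt 1 1 x
  push_cast
  linear_combination (-(κ ^ 3 * m) * (κ ^ 2 * (1 ^ 2 * x ^ 2 + 1)) + 3 * x ^ 2 * κ ^ 5 * m) * hm -
    (κ ^ 3 * m - a ^ 2 * x ^ 2 * κ ^ 3 * m ^ 3) * hk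

lemma continuous_phaseWeight (hb : 0 < b) : Continuous (phaseWeight a b) := by
  have h1 := continuous_invSqrt (a := a) hb
  have h2 := continuous_invSqrt (a := 1) one_pos
  unfold phaseWeight
  fun_prop

/-- The sign of the weight is that of `b - 2bx² - 3a²x⁴`, which is positive at `0`, negative at `1`
and divisible by `r - x` with a quotient bounded below. The constant must not depend on `b` in
`[1/R, R]`, so the slope at the zero is estimated explicitly. -/
lemma exists_phaseWeight_bounds (a : ℝ) {R : ℝ} (hR : 0 < R) : ∃ c : ℝ, 0 < c ∧
    ∀ b, R⁻¹ ≤ b → b ≤ R → ∃ r₀, 0 ≤ r₀ ∧ r₀ ≤ 1 ∧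
      (∀ x ∈ Icc 0 r₀, c ^ 2 * (r₀ - x) ≤ phaseWeight a b x) ∧
      (∀ x ∈ Icc r₀ 1, phaseWeight a b x ≤ -(c ^ 2 * (x - r₀))) ∧
      ∀ x, 1 ≤ x → phaseWeight a b x ≤ -(c ^ 2 / x ^ 4) := by
  set m₀ := (Real.sqrt (a ^ 2 + R))⁻¹ with hm₀
  have hm₀p : 0 < m₀ := by positivity
  have hm₀s : m₀ ^ 2 * (a ^ 2 + R) = 1 := by
    rw [hm₀, inv_pow, Real.sq_sqrt (by positivity), inv_mul_cancel₀ (by positivity)]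
  -- A lower bound for the quotient in `hfac`: the bracket is at least `2b ≥ 2/R`, and `r + x ≥ r ≥
  -- 1/(2 + 3a²R)`.
  set d := 2 * R⁻¹ * (1 / (2 + 3 * a ^ 2 * R)) with hd
  have hdp : 0 < d := by positivity
  refine ⟨Real.sqrt (min (m₀ ^ 3 / 32 * d) (m₀ / 32)), by positivity, fun b hb1 hb2 => ?_⟩
  rw [Real.sq_sqrt (by positivity)]
  set c := min (m₀ ^ 3 / 32 * d) (m₀ / 32)
  have hc1 : c ≤ m₀ ^ 3 / 32 * d := min_le_left _ _
  have hc2 : c ≤ m₀ / 32 := min_le_right _ _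
  have hb : 0 < b := lt_of_lt_of_le (by positivity) hb1
  obtain ⟨r, ⟨hr0, hr1⟩, hr⟩ : (0 : ℝ) ∈ (fun x : ℝ => b - 2 * b * x ^ 2 - 3 * a ^ 2 * x ^ 4) '' Icc 0 1 := by
    refine intermediate_value_Icc' zero_le_one (by fun_prop) ⟨?_, ?_⟩
    · have := sq_nonneg a
      norm_num; linarith
    · norm_num; exact hb.le
  have hr : b - 2 * b * r ^ 2 - 3 * a ^ 2 * r ^ 4 = 0 := hr
  have hrd : 1 / (2 + 3 * a ^ 2 * R) ≤ r := by
    rw [div_le_iff₀ (by positivity)]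
    have h1 : r ^ 2 ≤ r := by nlinarith
    have h2 : r ^ 4 ≤ r := by nlinarith [sq_nonneg r, sq_nonneg (r ^ 2)]
    have h3 : 1 ≤ R * b := by
      have := mul_le_mul_of_nonneg_left hb1 hR.le
      rwa [mul_inv_cancel₀ hR.ne'] at this
    have h4 : b ≤ 2 * b * r + 3 * a ^ 2 * r := by
      have e1 : 2 * b * r ^ 2 ≤ 2 * b * r := by gcongr
      have e2 : 3 * a ^ 2 * r ^ 4 ≤ 3 * a ^ 2 * r := by gcongr
      linarith
    have h5 : 3 * a ^ 2 * r ≤ (3 * a ^ 2 * r) * (R * b) := le_mul_of_one_le_right (by positivity) h3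
    refine le_of_mul_le_mul_right (a := b) ?_ hb
    linarith
  have hfac (x : ℝ) : b - 2 * b * x ^ 2 - 3 * a ^ 2 * x ^ 4 =
      (r - x) * ((r + x) * (2 * b + 3 * a ^ 2 * (r ^ 2 + x ^ 2))) := by linear_combination hr
  have hbig (x : ℝ) (hx : 0 ≤ x) : d ≤ (r + x) * (2 * b + 3 * a ^ 2 * (r ^ 2 + x ^ 2)) := by
    rw [hd, mul_comm]
    have : 0 ≤ 3 * a ^ 2 * (r ^ 2 + x ^ 2) := by positivity
    refine mul_le_mul (by linarith) (by linarith) (by positivity) (by positivity)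
  have hsmall (x : ℝ) (hx0 : 0 ≤ x) (hx1 : x ≤ 1) :
      m₀ ^ 3 / 32 ≤ invSqrt 1 1 x ^ 5 * invSqrt a b x ^ 3 := by
    have hx2 : x ^ 2 ≤ 1 := pow_le_one₀ hx0 hx1
    have h1 : 1 / 2 ≤ invSqrt 1 1 x := le_invSqrt one_pos (by linarith)
    have h2 : m₀ ≤ invSqrt a b x := by
      refine le_invSqrt hb ?_
      rw [← hm₀s]
      have : a ^ 2 * x ^ 2 ≤ a ^ 2 * 1 := by gcongr
      gcongr
      linarith
    have e1 : (1 / 2 : ℝ) ^ 5 ≤ invSqrt 1 1 x ^ 5 := by gcongr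
    have e2 : m₀ ^ 3 ≤ invSqrt a b x ^ 3 := by gcongr
    have := mul_le_mul e1 e2 (by positivity) (by positivity)
    linarith
  have hprod (x : ℝ) (hx0 : 0 ≤ x) (hx1 : x ≤ 1) : c ≤ invSqrt 1 1 x ^ 5 * invSqrt a b x ^ 3 *
      ((r + x) * (2 * b + 3 * a ^ 2 * (r ^ 2 + x ^ 2))) :=
    hc1.trans (mul_le_mul (hsmall x hx0 hx1) (hbig x hx0) hdp.le
      (le_trans (by positivity) (hsmall x hx0 hx1)))
  refine ⟨r, hr0, hr1, fun x hx => ?_, fun x hx => ?_, fun x hx => ?_⟩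
  · have := mul_le_mul_of_nonneg_right (hprod x hx.1 (hx.2.trans hr1)) (sub_nonneg.2 hx.2)
    rw [phaseWeight, hfac]
    linarith
  · have := mul_le_mul_of_nonneg_right (hprod x (hr0.trans hx.1) hx.2) (sub_nonneg.2 hx.1)
    rw [phaseWeight, hfac]
    linarith
  · have hx0 : 0 < x := by linarith
    have hx2 : 1 ≤ x ^ 2 := one_le_pow₀ hx
    have h1 : 1 / (2 * x) ≤ invSqrt 1 1 x := by
      refine le_invSqrt one_pos ?_
      rw [div_pow, one_pow, div_mul_eq_mul_div, div_le_one (by positivity)]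
      linarith
    have h2 : m₀ / x ≤ invSqrt a b x := by
      refine le_invSqrt hb ?_
      rw [div_pow, div_mul_eq_mul_div, div_le_one (by positivity)]
      have : m₀ ^ 2 * (a ^ 2 * x ^ 2 + b) ≤ m₀ ^ 2 * ((a ^ 2 + R) * x ^ 2) := by
        gcongr
        nlinarith
      refine this.trans (le_of_eq ?_)
      rw [← mul_assoc, hm₀s, one_mul]
    have h3 : x ^ 2 * (a ^ 2 * x ^ 2 + b) ≤ -(b - 2 * b * x ^ 2 - 3 * a ^ 2 * x ^ 4) := by
      have e1 : b ≤ b * x ^ 2 := le_mul_of_one_le_right hb.le hx2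
      have e2 : 0 ≤ a ^ 2 * x ^ 4 := by positivity
      linarith
    have hk := invSqrt_pos (a := 1) one_pos x
    have hm := invSqrt_pos (a := a) hb x
    have h4 := mul_le_mul_of_nonneg_left h3
      (show 0 ≤ invSqrt 1 1 x ^ 5 * invSqrt a b x ^ 3 by positivity)
    have h5 : invSqrt 1 1 x ^ 5 * invSqrt a b x ^ 3 * (x ^ 2 * (a ^ 2 * x ^ 2 + b)) =
        invSqrt 1 1 x ^ 5 * invSqrt a b x * x ^ 2 := by
      linear_combination (invSqrt 1 1 x ^ 5 * invSqrt a b x * x ^ 2) * invSqrt_sq_mul (a := a) hb x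
    have h6 : (1 / (2 * x)) ^ 5 * (m₀ / x) * x ^ 2 ≤ invSqrt 1 1 x ^ 5 * invSqrt a b x * x ^ 2 := by
      gcongr
    have h7 : (1 / (2 * x)) ^ 5 * (m₀ / x) * x ^ 2 = m₀ / 32 / x ^ 4 := by
      field_simp; norm_num
    have h8 : c / x ^ 4 ≤ m₀ / 32 / x ^ 4 := by gcongr
    unfold phaseWeight
    linarith

end Phase

/-! ### The kernel in the slope variable -/

lemma dispersiveConst_nonneg {c : ℝ} (hc : 0 < c) : 0 ≤ dispersiveConst c := by
  unfold dispersiveConst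
  positivity

lemma OscBound.mul_amplitude {f : ℝ → ℂ} {g : ℝ → ℝ} {M G b : ℝ} (hf : Continuous f)
    (h : OscBound f 0 b M) (hM : 0 ≤ M) (hg : IsAmplitude G g) :
    OscBound (fun x => f x * g x) 0 b (3 * G * M) := by
  obtain ⟨g', h1, h2, h3⟩ := hg.exists_deriv
  exact h.mul_monotone hf hM (fun x _ => h1 x) h2.continuousOn
    (h3.imp (fun h x hx => h x hx.1) fun h x hx => h x hx.1) fun x _ => hg.bound x

/-- The viscous damping in `η` is treated as a monotone amplitude bounded by `1`, so the dispersive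
constants do not depend on `ν`. -/
lemma isAmplitude_gaussian {p : ℝ} (hp : 0 ≤ p) : IsAmplitude 1 fun x => Real.exp (-(p * x ^ 2)) where
  exists_deriv := by
    refine ⟨fun x => Real.exp (-(p * x ^ 2)) * -(p * (2 * x)), fun x => ?_, by fun_prop,
      Or.inr fun x hx => ?_⟩
    · have := (((hasDerivAt_pow 2 x).const_mul p).fun_neg).exp
      simpa using this
    · have : 0 ≤ Real.exp (-(p * x ^ 2)) * (p * (2 * x)) := by positivity
      linarith
  bound x := by
    rw [abs_of_pos (Real.exp_pos _)]
    refine Real.exp_le_one_iff.2 ?_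
    have : 0 ≤ p * x ^ 2 := by positivity
    linarith
  parity := Or.inl fun x => by simp

/-- The damped multiplier of the simple-zero modes, as a function of the slope `x = η / l`. -/
def slopeMultiplier (a b τ p : ℝ) (f g : ℝ → ℝ) (x : ℝ) : ℂ :=
  Complex.exp (Complex.I * (τ * phase a b x : ℝ)) * ((1 + x ^ 2)⁻¹ : ℝ) *
    (Real.exp (-(p * x ^ 2)) : ℝ) * f x * g x

section Multiplier

variable {a b τ p G : ℝ} {f g : ℝ → ℝ}

lemma continuous_slopeMultiplier (hb : 0 < b) (hf : IsAmplitude G f) (hg : IsAmplitude G g) :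
    Continuous (slopeMultiplier a b τ p f g) := by
  have h1 : Continuous (phase a b) :=
    continuous_iff_continuousAt.2 fun x => (hasDerivAt_phase hb x).continuousAt
  have h2 : Continuous fun x : ℝ => (1 + x ^ 2)⁻¹ :=
    Continuous.inv₀ (by fun_prop) fun x => by positivity
  have h3 := hf.continuous
  have h4 := hg.continuous
  unfold slopeMultiplier
  fun_prop

lemma norm_slopeMultiplier_le (hp : 0 ≤ p) (hf : IsAmplitude G f) (hg : IsAmplitude G g) (x : ℝ) :
    ‖slopeMultiplier a b τ p f g x‖ ≤ (1 + x ^ 2)⁻¹ * G ^ 2 := by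
  have hG : 0 ≤ G := (abs_nonneg _).trans (hf.bound 0)
  have h1 : ‖Complex.exp (Complex.I * (τ * phase a b x : ℝ))‖ = 1 := by
    rw [mul_comm, Complex.norm_exp_ofReal_mul_I]
  have h2 := (isAmplitude_gaussian hp).bound x
  simp only [slopeMultiplier, norm_mul, h1, one_mul, Complex.norm_real, Real.norm_eq_abs]
  rw [abs_of_pos (show 0 < (1 + x ^ 2)⁻¹ by positivity)]
  calc (1 + x ^ 2)⁻¹ * |Real.exp (-(p * x ^ 2))| * |f x| * |g x|
      ≤ (1 + x ^ 2)⁻¹ * 1 * G * G := by gcongr <;> first | exact hf.bound x | exact hg.bound x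
    _ = (1 + x ^ 2)⁻¹ * G ^ 2 := by ring

lemma integrable_slopeMultiplier (hb : 0 < b) (hp : 0 ≤ p) (hf : IsAmplitude G f)
    (hg : IsAmplitude G g) : Integrable (slopeMultiplier a b τ p f g) :=
  (integrable_inv_one_add_sq.mul_const (G ^ 2)).mono'
    (continuous_slopeMultiplier hb hf hg).aestronglyMeasurable
    (Eventually.of_forall (norm_slopeMultiplier_le hp hf hg))

lemma integrable_exp_mul_slopeMultiplier (hb : 0 < b) (hp : 0 ≤ p) (hf : IsAmplitude G f)
    (hg : IsAmplitude G g) (y : ℝ) :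
    Integrable fun x : ℝ => Complex.exp (Complex.I * (x * y : ℝ)) * slopeMultiplier a b τ p f g x := by
  refine (integrable_slopeMultiplier hb hp hf hg).bdd_mul (c := 1) (by fun_prop)
    (Eventually.of_forall fun x => ?_)
  rw [mul_comm, Complex.norm_exp_ofReal_mul_I]

lemma slopeMultiplier_neg (hf : IsAmplitude G f) (hg : IsAmplitude G g) :
    (∀ x, slopeMultiplier a b τ p f g (-x) = slopeMultiplier a b τ p f g x) ∨
      ∀ x, slopeMultiplier a b τ p f g (-x) = -slopeMultiplier a b τ p f g x := by
  rcases hf.parity with h1 | h1 <;> rcases hg.parity with h2 | h2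
  · exact Or.inl fun x => by simp [slopeMultiplier, phase_neg, h1, h2]
  · exact Or.inr fun x => by simp [slopeMultiplier, phase_neg, h1, h2]
  · exact Or.inr fun x => by simp [slopeMultiplier, phase_neg, h1, h2]
  · exact Or.inl fun x => by simp [slopeMultiplier, phase_neg, h1, h2]

/-- The position `y` adds a linear phase, invisible to the second derivative, so the bound is
uniform in `y`. The Gaussian, `f` and `g` each cost a factor `3` times their bound, whence `27 G²`.
-/
lemma norm_integral_Ioi_slopeMultiplier_le {c s r₀ : ℝ} (hb : 0 < b) (hp : 0 ≤ p)
    (hf : IsAmplitude G f) (hg : IsAmplitude G g) (hs : 0 < s)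
    (hε : s ^ 6 * |τ * (a ^ 2 - b)| = 1) (hc : 0 < c) (hr0 : 0 ≤ r₀) (hr1 : r₀ ≤ 1)
    (hw1 : ∀ x ∈ Icc 0 r₀, c ^ 2 * (r₀ - x) ≤ phaseWeight a b x)
    (hw2 : ∀ x ∈ Icc r₀ 1, phaseWeight a b x ≤ -(c ^ 2 * (x - r₀)))
    (hw3 : ∀ x, 1 ≤ x → phaseWeight a b x ≤ -(c ^ 2 / x ^ 4)) (y : ℝ) :
    ‖∫ x in Ioi (0 : ℝ), Complex.exp (Complex.I * (x * y : ℝ)) * slopeMultiplier a b τ p f g x‖ ≤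
      27 * G ^ 2 * dispersiveConst c * s ^ 2 := by
  have hG : 0 ≤ G := (abs_nonneg _).trans (hf.bound 0)
  have hC := dispersiveConst_nonneg hc
  have h1 (x : ℝ) : HasDerivAt (fun x => τ * phase a b x + x * y)
      (τ * ((a ^ 2 - b) * (x * invSqrt 1 1 x ^ 3 * invSqrt a b x)) + y) x := by
    simpa using ((hasDerivAt_phase hb x).const_mul τ).fun_add ((hasDerivAt_id x).mul_const y)
  have h2 (x : ℝ) : HasDerivAt
      (fun x => τ * ((a ^ 2 - b) * (x * invSqrt 1 1 x ^ 3 * invSqrt a b x)) + y)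
      (τ * (a ^ 2 - b) * phaseWeight a b x) x := by
    have := (((hasDerivAt_phase_deriv (a := a) hb x).const_mul (a ^ 2 - b)).const_mul τ).add_const y
    exact this.congr_deriv (by ring)
  have hosc (N : ℕ) := dispersive_oscBound h1 h2 (continuous_phaseWeight hb) hs hε hc hr0 hr1
    hw1 hw2 hw3 N
  have hψ : Continuous fun x => τ * phase a b x + x * y :=
    continuous_iff_continuousAt.2 fun x => (h1 x).continuousAt
  have hq : Continuous fun x : ℝ => (1 + x ^ 2)⁻¹ :=
    Continuous.inv₀ (by fun_prop) fun x => by positivity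
  have hfc := hf.continuous
  have hgc := hg.continuous
  have hall (N : ℕ) := (((hosc N).mul_amplitude (by fun_prop) (by positivity)
    (isAmplitude_gaussian hp)).mul_amplitude (by fun_prop) (by positivity) hf).mul_amplitude
    (by fun_prop) (by positivity) hg
  have ht : Tendsto (fun N : ℕ => (8 : ℝ) ^ N) atTop atTop :=
    tendsto_pow_atTop_atTop_of_one_lt (by norm_num)
  have hlim := intervalIntegral_tendsto_integral_Ioi 0
    (integrable_exp_mul_slopeMultiplier (τ := τ) (a := a) hb hp hf hg y).integrableOn ht
  refine le_of_tendsto hlim.norm (Eventually.of_forall fun N => ?_)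
  refine le_trans (le_of_eq ?_) ((hall N 0 (8 ^ N) le_rfl (by positivity) le_rfl).trans
    (le_of_eq (by ring)))
  congr 1
  refine intervalIntegral.integral_congr fun x _ => ?_
  simp only [slopeMultiplier]
  rw [show Complex.I * ((τ * phase a b x + x * y : ℝ) : ℂ) = Complex.I * (x * y : ℝ) +
    Complex.I * (τ * phase a b x : ℝ) by push_cast; ring, Complex.exp_add]
  ring

/-- By parity of the multiplier the negative half line is the positive one with `-y` in place of
`y`, up to sign. -/
lemma norm_integral_slopeMultiplier_le {c s r₀ : ℝ} (hb : 0 < b) (hp : 0 ≤ p)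
    (hf : IsAmplitude G f) (hg : IsAmplitude G g) (hs : 0 < s)
    (hε : s ^ 6 * |τ * (a ^ 2 - b)| = 1) (hc : 0 < c) (hr0 : 0 ≤ r₀) (hr1 : r₀ ≤ 1)
    (hw1 : ∀ x ∈ Icc 0 r₀, c ^ 2 * (r₀ - x) ≤ phaseWeight a b x)
    (hw2 : ∀ x ∈ Icc r₀ 1, phaseWeight a b x ≤ -(c ^ 2 * (x - r₀)))
    (hw3 : ∀ x, 1 ≤ x → phaseWeight a b x ≤ -(c ^ 2 / x ^ 4)) (y : ℝ) :
    ‖∫ x : ℝ, Complex.exp (Complex.I * (x * y : ℝ)) * slopeMultiplier a b τ p f g x‖ ≤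
      54 * G ^ 2 * dispersiveConst c * s ^ 2 := by
  have hi := integrable_exp_mul_slopeMultiplier (τ := τ) (a := a) hb hp hf hg y
  have key := norm_integral_Ioi_slopeMultiplier_le hb hp hf hg hs hε hc hr0 hr1 hw1 hw2 hw3
  rw [← intervalIntegral.integral_Iic_add_Ioi (b := 0) hi.integrableOn hi.integrableOn,
    ← neg_zero, ← integral_comp_neg_Ioi, neg_zero]
  have hneg : ‖∫ x in Ioi (0 : ℝ), Complex.exp (Complex.I * ((-x) * y : ℝ)) *
      slopeMultiplier a b τ p f g (-x)‖ ≤ 27 * G ^ 2 * dispersiveConst c * s ^ 2 := by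
    refine le_trans (le_of_eq ?_) (key (-y))
    rcases slopeMultiplier_neg (a := a) (b := b) (τ := τ) (p := p) hf hg with h | h
    · simp only [h, neg_mul, mul_neg]
    · simp only [h, neg_mul, mul_neg, integral_neg, norm_neg]
  refine (norm_add_le _ _).trans ((add_le_add hneg (key y)).trans (le_of_eq ?_))
  ring

end Multiplier

/-! ### Multipliers with bounded kernel -/

lemma continuous_classicalFourier {H : ℝ → ℂ} (hH : Integrable H) :
    Continuous (classicalFourier H) := by
  refine continuous_of_dominated (bound := fun y => ‖H y‖) (fun η => ?_)
    (fun η => .of_forall fun y => ?_) hH.norm (.of_forall fun y => by fun_prop)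
  · exact (by fun_prop : Continuous fun y : ℝ =>
      Complex.exp (-Complex.I * (η * y))).aestronglyMeasurable.mul hH.aestronglyMeasurable
  · rw [norm_mul, show -Complex.I * ((η : ℂ) * y) = ((-(η * y) : ℝ) : ℂ) * Complex.I by
      push_cast; ring, Complex.norm_exp_ofReal_mul_I, one_mul]

lemma norm_classicalFourier_le (H : ℝ → ℂ) (η : ℝ) : ‖classicalFourier H η‖ ≤ ∫ y, ‖H y‖ := by
  refine (norm_integral_le_integral_norm _).trans (le_of_eq (integral_congr_ae (.of_forall fun y => ?_)))
  simp only
  rw [norm_mul, show -Complex.I * ((η : ℂ) * y) = ((-(η * y) : ℝ) : ℂ) * Complex.I by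
      push_cast; ring, Complex.norm_exp_ofReal_mul_I, one_mul]

lemma integrable_mul_classicalFourier {S H : ℝ → ℂ} (hS : Integrable S) (hH : Integrable H) :
    Integrable fun η => S η * classicalFourier H η :=
  hS.mul_bdd (c := ∫ y, ‖H y‖) (continuous_classicalFourier hH).aestronglyMeasurable
    (.of_forall (norm_classicalFourier_le H))

/-- A Fourier multiplier with kernel bounded by `K` maps `L¹` to `L^∞`. -/
lemma norm_integral_mul_classicalFourier_le {S H : ℝ → ℂ} (hS : Integrable S) (hH : Integrable H)
    {K : ℝ} (hK : ∀ y : ℝ, ‖∫ η : ℝ, Complex.exp (Complex.I * (η * y : ℝ)) * S η‖ ≤ K) (y : ℝ) :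
    ‖∫ η : ℝ, Complex.exp (Complex.I * (η * y)) * (S η * classicalFourier H η)‖ ≤
      K * ∫ y, ‖H y‖ := by
  have h1 : ∫ η : ℝ, Complex.exp (Complex.I * (η * y)) * (S η * classicalFourier H η) =
      ∫ η : ℝ, ∫ y' : ℝ, Complex.exp (Complex.I * (η * (y - y') : ℝ)) * (S η * H y') := by
    refine integral_congr_ae (.of_forall fun η => ?_)
    simp only [classicalFourier]
    rw [← integral_const_mul, ← integral_const_mul]
    refine integral_congr_ae (.of_forall fun y' => ?_)
    simp only
    rw [show Complex.I * ((η * (y - y') : ℝ) : ℂ) = Complex.I * (η * y) + -Complex.I * (η * y') by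
      push_cast; ring, Complex.exp_add]
    ring
  have h2 : Integrable (Function.uncurry fun η y' : ℝ =>
      Complex.exp (Complex.I * (η * (y - y') : ℝ)) * (S η * H y')) (volume.prod volume) := by
    refine (hS.mul_prod hH).bdd_mul (c := 1)
      (by fun_prop : Continuous fun p : ℝ × ℝ =>
        Complex.exp (Complex.I * (p.1 * (y - p.2) : ℝ))).aestronglyMeasurable (.of_forall fun p => ?_)
    rw [mul_comm, Complex.norm_exp_ofReal_mul_I]
  rw [h1, integral_integral_swap h2, ← integral_const_mul]
  refine norm_integral_le_of_norm_le (hH.norm.const_mul K) (.of_forall fun y' => ?_)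
  have h3 : ∫ η : ℝ, Complex.exp (Complex.I * (η * (y - y') : ℝ)) * (S η * H y') =
      (∫ η : ℝ, Complex.exp (Complex.I * (η * (y - y') : ℝ)) * S η) * H y' := by
    rw [← integral_mul_const]
    exact integral_congr_ae (.of_forall fun η => by ring)
  rw [h3, norm_mul]
  exact mul_le_mul_of_nonneg_right (hK _) (norm_nonneg _)

lemma classicalFourier_deriv {g g' : ℝ → ℂ} (hd : ∀ y, HasDerivAt g (g' y) y) (hg : Integrable g)
    (hg' : Integrable g') (η : ℝ) :
    classicalFourier g' η = Complex.I * η * classicalFourier g η := by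
  have e : deriv g = g' := funext fun y => (hd y).deriv
  have := congrFun (Real.fourier_deriv hg (fun y => (hd y).differentiableAt) (e ▸ hg'))
    (η / (2 * Real.pi))
  rw [e, fourier_div_two_pi, fourier_div_two_pi] at this
  rw [this, smul_eq_mul]
  have hpi : ((Real.pi : ℝ) : ℂ) ≠ 0 := by exact_mod_cast Real.pi_ne_zero
  push_cast
  field_simp

/-- A phase multiplier applied to `g`, in terms of the slope `η / l`. -/
def modeMultiplier (a b τ p : ℝ) (f₁ f₂ : ℝ → ℝ) (x : ℝ) : ℂ :=
  Complex.exp (Complex.I * (τ * phase a b x : ℝ)) * (Real.exp (-(p * x ^ 2)) : ℝ) * f₁ x * f₂ x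

section Mode

variable {a b τ p G l : ℝ} {f₁ f₂ : ℝ → ℝ} {g g' g'' : ℝ → ℂ}

/-- The transform of `l³g - lg''` is `l³(1 + x²) ĝ` with `x = η/l`. Two derivatives thus buy the
amplitude `1/(1+x²)`, and the extra power of `l` makes the sum over modes converge. -/
lemma modeMultiplier_mul_classicalFourier (hl : l ≠ 0) (h1 : ∀ y, HasDerivAt g (g' y) y)
    (h2 : ∀ y, HasDerivAt g' (g'' y) y) (hg : Integrable g) (hg' : Integrable g')
    (hg'' : Integrable g'') (η : ℝ) :
    modeMultiplier a b τ p f₁ f₂ (η / l) * classicalFourier g η =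
      ((l ^ 3)⁻¹ : ℝ) * (slopeMultiplier a b τ p f₁ f₂ (η / l) *
        classicalFourier (fun y => l ^ 3 * g y - l * g'' y) η) := by
  have e1 : classicalFourier (fun y => l ^ 3 * g y - l * g'' y) η =
      l ^ 3 * classicalFourier g η - l * classicalFourier g'' η := by
    unfold classicalFourier
    rw [← integral_const_mul, ← integral_const_mul, ← integral_sub]
    · exact integral_congr_ae (.of_forall fun y => by ring)
    all_goals
      refine Integrable.const_mul (Integrable.bdd_mul (c := 1) (by assumption)
        (by fun_prop : Continuous fun y : ℝ =>
          Complex.exp (-Complex.I * (η * y))).aestronglyMeasurable (.of_forall fun y => ?_)) _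
      rw [show -Complex.I * ((η : ℂ) * y) = ((-(η * y) : ℝ) : ℂ) * Complex.I by
        push_cast; ring, Complex.norm_exp_ofReal_mul_I]
  have e2 : classicalFourier g'' η = -η ^ 2 * classicalFourier g η := by
    rw [classicalFourier_deriv h2 hg' hg'', classicalFourier_deriv h1 hg hg']
    linear_combination (η ^ 2 * classicalFourier g η) * Complex.I_sq
  have hlc : (l : ℂ) ≠ 0 := by exact_mod_cast hl
  have hq : (1 : ℂ) + (η / l) ^ 2 ≠ 0 := by
    have : (1 : ℝ) + (η / l) ^ 2 ≠ 0 := by positivity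
    exact_mod_cast this
  have e3 : (l : ℂ) ^ 3 * classicalFourier g η - l * (-η ^ 2 * classicalFourier g η) =
      l ^ 3 * (1 + (η / l) ^ 2) * classicalFourier g η := by field_simp; ring
  rw [e1, e2, e3, slopeMultiplier, modeMultiplier]
  push_cast
  set E := Complex.exp (Complex.I * (τ * (phase a b (η / l) : ℂ)))
  set E' := Complex.exp (-(p * (η / l : ℂ) ^ 2))
  set q : ℂ := 1 + (η / l) ^ 2
  field_simp

lemma integrable_modeMultiplier_mul (hb : 0 < b) (hp : 0 ≤ p) (hf₁ : IsAmplitude G f₁)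
    (hf₂ : IsAmplitude G f₂) (hl : l ≠ 0) (h1 : ∀ y, HasDerivAt g (g' y) y)
    (h2 : ∀ y, HasDerivAt g' (g'' y) y) (hg : Integrable g) (hg' : Integrable g')
    (hg'' : Integrable g'') :
    Integrable fun η => modeMultiplier a b τ p f₁ f₂ (η / l) * classicalFourier g η := by
  simp only [modeMultiplier_mul_classicalFourier hl h1 h2 hg hg' hg'']
  exact (integrable_mul_classicalFourier
    ((integrable_slopeMultiplier (τ := τ) (a := a) hb hp hf₁ hf₂).comp_div hl)
    ((hg.const_mul _).sub (hg''.const_mul _))).const_mul _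

/-- The substitution `η = lx` gives `|l|` against `|l|⁻³`, hence the summable `l^{-2}`. -/
lemma norm_integral_modeMultiplier_mul_le {K : ℝ} (hb : 0 < b) (hp : 0 ≤ p)
    (hf₁ : IsAmplitude G f₁) (hf₂ : IsAmplitude G f₂) (hl : l ≠ 0)
    (hK : ∀ y : ℝ, ‖∫ x : ℝ, Complex.exp (Complex.I * (x * y : ℝ)) *
      slopeMultiplier a b τ p f₁ f₂ x‖ ≤ K)
    (h1 : ∀ y, HasDerivAt g (g' y) y)
    (h2 : ∀ y, HasDerivAt g' (g'' y) y) (hg : Integrable g) (hg' : Integrable g')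
    (hg'' : Integrable g'') (y : ℝ) :
    ‖∫ η : ℝ, Complex.exp (Complex.I * (η * y)) *
      (modeMultiplier a b τ p f₁ f₂ (η / l) * classicalFourier g η)‖ ≤
      K / l ^ 2 * ∫ y, ‖l ^ 3 * g y - l * g'' y‖ := by
  have hS := (integrable_slopeMultiplier (τ := τ) (a := a) hb hp hf₁ hf₂).comp_div hl
  have hK' (y : ℝ) : ‖∫ η : ℝ, Complex.exp (Complex.I * (η * y : ℝ)) *
      slopeMultiplier a b τ p f₁ f₂ (η / l)‖ ≤ |l| * K := by
    have := Measure.integral_comp_div (fun x : ℝ => Complex.exp (Complex.I * (x * (l * y) : ℝ)) *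
      slopeMultiplier a b τ p f₁ f₂ x) l
    have e (η : ℝ) : η / l * (l * y) = η * y := by field_simp
    simp only [e] at this
    rw [this, norm_smul, Real.norm_eq_abs, abs_abs]
    exact mul_le_mul_of_nonneg_left (hK _) (abs_nonneg l)
  have h := norm_integral_mul_classicalFourier_le hS
    ((hg.const_mul ((l : ℂ) ^ 3)).sub (hg''.const_mul (l : ℂ))) hK' y
  simp only [modeMultiplier_mul_classicalFourier hl h1 h2 hg hg' hg'']
  have e : ∫ η : ℝ, Complex.exp (Complex.I * (η * y)) * (((l ^ 3)⁻¹ : ℝ) *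
      (slopeMultiplier a b τ p f₁ f₂ (η / l) *
        classicalFourier (fun y => l ^ 3 * g y - l * g'' y) η)) =
      ((l ^ 3)⁻¹ : ℝ) * ∫ η : ℝ, Complex.exp (Complex.I * (η * y)) *
      (slopeMultiplier a b τ p f₁ f₂ (η / l) *
        classicalFourier (fun y => l ^ 3 * g y - l * g'' y) η) := by
    rw [← integral_const_mul]
    exact integral_congr_ae (.of_forall fun η => by ring)
  rw [e, norm_mul, Complex.norm_real, Real.norm_eq_abs, abs_inv, abs_pow]
  have ha : 0 < |l| := abs_pos.2 hl
  refine (mul_le_mul_of_nonneg_left h (by positivity)).trans (le_of_eq ?_)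
  rw [← sq_abs l]
  simp only [Pi.sub_apply]
  field_simp

end Mode

/-! ### The `W^{3,1}` norm of the simple-zero modes -/

lemma hasDerivAt_of_ofReal {g : ℝ → ℝ} {g' x : ℝ} (h : HasDerivAt (fun r => (g r : ℂ)) (g' : ℂ) x) :
    HasDerivAt g g' x := by
  simpa [Function.comp_def] using Complex.reCLM.hasFDerivAt.comp_hasDerivAt x h

lemma hasDerivAt_simpleZero_fst {f : ℝ × ℝ × ℝ → ℝ} (hf : ContDiff ℝ ∞ f) (y z : ℝ) :
    HasDerivAt (fun r => simpleZero f (r, z)) (simpleZero (dY f) (y, z)) y := by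
  have hc := hf.continuous
  have hc' := (contDiff_dY hf).continuous
  have h1 : HasDerivAt (fun r => zeroMode f (r, z)) (zeroMode (dY f) (y, z)) y := by
    refine hasDerivAt_of_ofReal ?_
    simp only [ofReal_zeroMode]
    refine HasDerivAt.const_mul _ (hasDerivAt_intervalIntegral (S := univ) isOpen_univ
      (F := fun r x => (f (x, r, z) : ℂ)) (F' := fun r x => (dY f (x, r, z) : ℂ))
      (by unfold Function.uncurry; fun_prop) (by unfold Function.uncurry; fun_prop) (fun r _ x => ?_)
      0 (2 * Real.pi) (mem_univ y))
    exact (hasDerivAt_dY hf x r z).ofReal_comp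
  have h2 : HasDerivAt (doubleZero f) (doubleZero (dY f) y) y := by
    refine hasDerivAt_of_ofReal ?_
    simp only [ofReal_doubleZero hc, ofReal_doubleZero hc']
    exact hasDerivAt_coef hf 0 0 y
  exact h1.fun_sub h2

lemma hasDerivAt_simpleZero_snd {f : ℝ × ℝ × ℝ → ℝ} (hf : ContDiff ℝ ∞ f) (hp : IsPeriodic f)
    (y z : ℝ) : HasDerivAt (fun r => simpleZero f (y, r)) (simpleZero (dZ f) (y, z)) z := by
  have hc := hf.continuous
  have hc' := (contDiff_dZ hf).continuous
  have h1 : HasDerivAt (fun r => zeroMode f (y, r)) (zeroMode (dZ f) (y, z)) z := by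
    refine hasDerivAt_of_ofReal ?_
    simp only [ofReal_zeroMode]
    refine HasDerivAt.const_mul _ (hasDerivAt_intervalIntegral (S := univ) isOpen_univ
      (F := fun r x => (f (x, y, r) : ℂ)) (F' := fun r x => (dZ f (x, y, r) : ℂ))
      (by unfold Function.uncurry; fun_prop) (by unfold Function.uncurry; fun_prop) (fun r _ x => ?_)
      0 (2 * Real.pi) (mem_univ z))
    exact (hasDerivAt_dZ hf x y r).ofReal_comp
  have h2 : doubleZero (dZ f) y = 0 := by
    have := ofReal_doubleZero hc' y
    rw [coef_dZ hf hp, Int.cast_zero, mul_zero, zero_mul] at this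
    exact_mod_cast this
  refine (h1.sub_const (doubleZero f y)).congr_deriv ?_
  simp only [simpleZero, h2, sub_zero]

lemma contDiff_iterate_dZ {f : ℝ × ℝ × ℝ → ℝ} (hf : ContDiff ℝ ∞ f) (n : ℕ) :
    ContDiff ℝ ∞ (dZ^[n] f) := by
  induction n with
  | zero => exact hf
  | succ n ih => rw [Function.iterate_succ_apply']; exact contDiff_dZ ih

lemma contDiff_iterate_dY {f : ℝ × ℝ × ℝ → ℝ} (hf : ContDiff ℝ ∞ f) (n : ℕ) :
    ContDiff ℝ ∞ (dY^[n] f) := by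
  induction n with
  | zero => exact hf
  | succ n ih => rw [Function.iterate_succ_apply']; exact contDiff_dY ih

lemma iteratedDeriv_simpleZero_snd {f : ℝ × ℝ × ℝ → ℝ} (hf : ContDiff ℝ ∞ f) (hp : IsPeriodic f)
    (y : ℝ) (n : ℕ) : iteratedDeriv n (fun r => simpleZero f (y, r)) =
      fun z => simpleZero (dZ^[n] f) (y, z) := by
  induction n generalizing f with
  | zero => simp
  | succ n ih =>
    rw [iteratedDeriv_succ', funext fun z => (hasDerivAt_simpleZero_snd hf hp y z).deriv,
      ih (contDiff_dZ hf) (hp.dZ hf)]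
    rfl

lemma iteratedDeriv_simpleZero_fst {f : ℝ × ℝ × ℝ → ℝ} (hf : ContDiff ℝ ∞ f)
    (z : ℝ) (n : ℕ) : iteratedDeriv n (fun r => simpleZero f (r, z)) =
      fun y => simpleZero (dY^[n] f) (y, z) := by
  induction n generalizing f with
  | zero => simp
  | succ n ih =>
    rw [iteratedDeriv_succ', funext fun y => (hasDerivAt_simpleZero_fst hf y z).deriv,
      ih (contDiff_dY hf)]
    rfl

lemma lintegral_simpleZero_le_w31Norm {f : ℝ × ℝ × ℝ → ℝ} (hf : ContDiff ℝ ∞ f)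
    (hp : IsPeriodic f) {i j : ℕ} (hij : i + j ≤ 3) :
    ∫⁻ Y, ‖simpleZero (dY^[i] (dZ^[j] f)) Y‖ₑ ∂cell2 ≤ w31Norm (simpleZero f) := by
  unfold w31Norm
  simp only [iteratedDeriv_simpleZero_snd hf hp]
  simp only [iteratedDeriv_simpleZero_fst (contDiff_iterate_dZ hf _)]
  refine le_trans ?_ (Finset.single_le_sum (fun _ _ => zero_le) (Finset.mem_range.2 (show i < 4 by omega)))
  exact Finset.single_le_sum
    (f := fun j => ∫⁻ Y, ‖simpleZero (dY^[i] (dZ^[j] f)) (Y.1, Y.2)‖ₑ ∂cell2)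
    (fun _ _ => zero_le) (Finset.mem_range.2 (show j < 4 - i by omega))

lemma lintegral_coef_le {f : ℝ × ℝ × ℝ → ℝ} (hf : Continuous f) {l : ℤ} (hl : l ≠ 0) :
    ∫⁻ y, ‖coef 0 l f y‖ₑ ≤ ∫⁻ Y, ‖simpleZero f Y‖ₑ ∂cell2 := by
  have hc := continuous_simpleZero hf
  rw [cell2_eq, lintegral_prod _ (by fun_prop)]
  refine lintegral_mono fun y => ?_
  have h := coef_simpleZero hf l y
  rw [if_neg hl] at h
  rw [← h, enorm_mul, intervalIntegral.integral_of_le two_pi_pos.le]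
  have h1 : ‖((2 * Real.pi)⁻¹ : ℂ)‖ₑ ≤ 1 := by
    have : ‖((2 * Real.pi)⁻¹ : ℂ)‖ ≤ 1 := by
      rw [norm_inv, norm_mul, Complex.norm_real, Complex.norm_ofNat, Real.norm_eq_abs,
        abs_of_pos Real.pi_pos]
      exact inv_le_one_of_one_le₀ (by linarith [Real.pi_gt_three])
    rw [← ofReal_norm]
    simpa using ENNReal.ofReal_le_ofReal this
  calc _ ≤ 1 * ∫⁻ z in Ioc 0 (2 * Real.pi),
        ‖(simpleZero f (y, z) : ℂ) * Complex.exp (-Complex.I * (l * z))‖ₑ :=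
        mul_le_mul' h1 (enorm_integral_le_lintegral_enorm _)
    _ = _ := by
        rw [one_mul]
        refine lintegral_congr fun z => ?_
        rw [show -Complex.I * ((l : ℂ) * z) = ((-(l * z) : ℝ) : ℂ) * Complex.I by push_cast; ring,
          ← ofReal_norm, norm_mul, Complex.norm_exp_ofReal_mul_I, mul_one, Complex.norm_real,
          ofReal_norm]

/-! ### Integrability of the coefficients of the data -/

section Coef

variable {f : ℝ × ℝ × ℝ → ℝ} {l : ℤ}

lemma lintegral_coef_le_w31Norm (hf : ContDiff ℝ ∞ f) (hp : IsPeriodic f) (hl : l ≠ 0) {i j : ℕ}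
    (hij : i + j ≤ 3) :
    ∫⁻ y, ‖coef 0 l (dY^[i] (dZ^[j] f)) y‖ₑ ≤ w31Norm (simpleZero f) :=
  (lintegral_coef_le (contDiff_iterate_dY (contDiff_iterate_dZ hf j) i).continuous hl).trans
    (lintegral_simpleZero_le_w31Norm hf hp hij)

lemma integrable_coef_of_w31Norm (hf : ContDiff ℝ ∞ f) (hp : IsPeriodic f) (hl : l ≠ 0)
    (hw : w31Norm (simpleZero f) ≠ ⊤) {i j : ℕ} (hij : i + j ≤ 3) :
    Integrable (coef 0 l (dY^[i] (dZ^[j] f))) :=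
  ⟨(continuous_coef (contDiff_iterate_dY (contDiff_iterate_dZ hf j) i).continuous 0 l).aestronglyMeasurable,
    (lintegral_coef_le_w31Norm hf hp hl hij).trans_lt hw.lt_top⟩

lemma integral_norm_coef_le_w31Norm (hf : ContDiff ℝ ∞ f) (hp : IsPeriodic f) (hl : l ≠ 0)
    (hw : w31Norm (simpleZero f) ≠ ⊤) {i j : ℕ} (hij : i + j ≤ 3) :
    ∫ y, ‖coef 0 l (dY^[i] (dZ^[j] f)) y‖ ≤ (w31Norm (simpleZero f)).toReal := by
  rw [integral_norm_eq_lintegral_enorm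
    (integrable_coef_of_w31Norm hf hp hl hw hij).aestronglyMeasurable]
  exact ENNReal.toReal_mono hw (lintegral_coef_le_w31Norm hf hp hl hij)

/-- Up to unimodular factors the two terms are the coefficients of `∂_z³ f` and `∂_y² ∂_z f`; this
is where three derivatives of the data are used. -/
lemma integral_norm_helmholtz_coef_le (hf : ContDiff ℝ ∞ f) (hp : IsPeriodic f) (hl : l ≠ 0)
    (hw : w31Norm (simpleZero f) ≠ ⊤) :
    ∫ y, ‖((l : ℝ) : ℂ) ^ 3 * coef 0 l f y - ((l : ℝ) : ℂ) * coef 0 l (dY (dY f)) y‖ ≤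
      2 * (w31Norm (simpleZero f)).toReal := by
  have hZ := contDiff_dZ hf
  have hZZ := contDiff_dZ hZ
  have e1 (y : ℝ) : coef 0 l (dY^[0] (dZ^[3] f)) y = (Complex.I * l) ^ 3 * coef 0 l f y := by
    show coef 0 l (dZ (dZ (dZ f))) y = _
    rw [coef_dZ hZZ ((hp.dZ hf).dZ hZ), coef_dZ hZ (hp.dZ hf), coef_dZ hf hp]
    ring
  have e2 (y : ℝ) : coef 0 l (dY (dZ f)) y = Complex.I * l * coef 0 l (dY f) y := by
    have h1 := hasDerivAt_coef hZ 0 l y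
    have h2 := (hasDerivAt_coef hf 0 l y).const_mul (Complex.I * l)
    rw [funext (coef_dZ hf hp 0 l)] at h1
    exact h1.unique h2
  have e3 (y : ℝ) : coef 0 l (dY^[2] (dZ^[1] f)) y = Complex.I * l * coef 0 l (dY (dY f)) y := by
    have h1 := hasDerivAt_coef (contDiff_dY hZ) 0 l y
    have h2 := (hasDerivAt_coef (contDiff_dY hf) 0 l y).const_mul (Complex.I * l)
    rw [funext e2] at h1
    exact h1.unique h2
  have i1 := (integrable_coef_of_w31Norm hf hp hl hw (i := 0) (j := 3) (by norm_num)).norm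
  have i2 := (integrable_coef_of_w31Norm hf hp hl hw (i := 2) (j := 1) (by norm_num)).norm
  have b1 := integral_norm_coef_le_w31Norm hf hp hl hw (i := 0) (j := 3) (by norm_num)
  have b2 := integral_norm_coef_le_w31Norm hf hp hl hw (i := 2) (j := 1) (by norm_num)
  refine (integral_mono_of_nonneg (.of_forall fun y => norm_nonneg _) (i1.add i2)
    (.of_forall fun y => ?_)).trans ?_
  · refine (norm_sub_le _ _).trans (le_of_eq ?_)
    simp only [Pi.add_apply, e1, e3, norm_mul, norm_pow, Complex.norm_I, one_mul, Complex.norm_real,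
      Real.norm_eq_abs, Complex.norm_intCast]
  · rw [integral_add' i1 i2]
    linarith

end Coef

/-! ### Dispersion of a single mode -/

/-! ### The dispersion relation in the slope variable -/

section Symbols

variable {ν α β t : ℝ}

lemma hSym_eq {η l : ℝ} (hβ : 0 < β * (β - 1)) (hl : l ≠ 0) :
    hSym α β η l = |l| * (invSqrt α (β * (β - 1)) (η / l))⁻¹ := by
  rw [hSym, invSqrt, inv_inv, ← Real.sqrt_sq_eq_abs, ← Real.sqrt_mul (sq_nonneg l)]
  congr 1
  field_simp

lemma absSym_eq {η l : ℝ} (hl : l ≠ 0) : absSym η l = |l| * (invSqrt 1 1 (η / l))⁻¹ := by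
  rw [absSym, invSqrt, inv_inv, ← Real.sqrt_sq_eq_abs, ← Real.sqrt_mul (sq_nonneg l)]
  congr 1
  field_simp

/-- Both symbols are homogeneous of degree one, so their quotient depends on the slope only. -/
lemma hSym_div_absSym {η l : ℝ} (hβ : 0 < β * (β - 1)) (hl : l ≠ 0) :
    hSym α β η l / absSym η l = phase α (β * (β - 1)) (η / l) := by
  have h1 := invSqrt_pos (a := α) hβ (η / l)
  have h2 := invSqrt_pos (a := 1) one_pos (η / l)
  have h3 := invSqrt_sq_mul (a := α) hβ (η / l)
  have ha : 0 < |l| := abs_pos.2 hl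
  rw [hSym_eq hβ hl, absSym_eq hl, phase]
  set m := invSqrt α (β * (β - 1)) (η / l)
  set κ := invSqrt 1 1 (η / l)
  have : |l| * m⁻¹ / (|l| * κ⁻¹) = κ / m := by field_simp
  rw [this, div_eq_iff h1.ne']
  linear_combination (-κ) * h3

lemma exp_lam2 {η l : ℝ} (hβ : 0 < β * (β - 1)) (hl : l ≠ 0) :
    Complex.exp (lam2 ν α β η l * t) = (Real.exp (-(ν * t * l ^ 2)) : ℝ) *
      modeMultiplier α (β * (β - 1)) t (ν * t * l ^ 2) (fun _ => 1) (fun _ => 1) (η / l) := by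
  have hlc : (l : ℂ) ≠ 0 := by exact_mod_cast hl
  rw [lam2, hSym_div_absSym hβ hl, modeMultiplier]
  simp only [Complex.ofReal_one, mul_one, Complex.ofReal_exp]
  rw [← Complex.exp_add, ← Complex.exp_add]
  congr 1
  push_cast
  field_simp
  ring

lemma exp_lam3 {η l : ℝ} (hβ : 0 < β * (β - 1)) (hl : l ≠ 0) :
    Complex.exp (lam3 ν α β η l * t) = (Real.exp (-(ν * t * l ^ 2)) : ℝ) *
      modeMultiplier α (β * (β - 1)) (-t) (ν * t * l ^ 2) (fun _ => 1) (fun _ => 1) (η / l) := by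
  have hlc : (l : ℂ) ≠ 0 := by exact_mod_cast hl
  rw [lam3, hSym_div_absSym hβ hl, modeMultiplier]
  simp only [Complex.ofReal_one, mul_one, Complex.ofReal_exp]
  rw [← Complex.exp_add, ← Complex.exp_add]
  congr 1
  push_cast
  field_simp
  ring

lemma modeMultiplier_eq (a b τ p : ℝ) (f₁ f₂ : ℝ → ℝ) (x : ℝ) : modeMultiplier a b τ p f₁ f₂ x =
    f₁ x * f₂ x * modeMultiplier a b τ p (fun _ => 1) (fun _ => 1) x := by
  simp only [modeMultiplier, Complex.ofReal_one]
  ring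

lemma sq_div_hSym_mul_absSym {η l : ℝ} (hβ : 0 < β * (β - 1)) (hl : l ≠ 0) :
    l ^ 2 / (hSym α β η l * absSym η l) =
      invSqrt α (β * (β - 1)) (η / l) * invSqrt 1 1 (η / l) := by
  have h1 := (invSqrt_pos (a := α) hβ (η / l)).ne'
  have h2 := (invSqrt_pos (a := 1) one_pos (η / l)).ne'
  have ha : |l| ≠ 0 := abs_ne_zero.2 hl
  rw [hSym_eq hβ hl, absSym_eq hl, ← sq_abs l]
  field_simp

end Symbols

/-! ### Pairs of counter-propagating waves -/

section Pair

variable {a b p G l : ℝ} {f₁ f₂ : ℝ → ℝ}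

/-- The two counter-propagating waves with amplitudes `c₁, c₂`, applied to the datum `g`. -/
def wavePair (a b t p l : ℝ) (f₁ f₂ : ℝ → ℝ) (c₁ c₂ : ℂ) (g : ℝ → ℂ) (η : ℝ) : ℂ :=
  (c₁ * modeMultiplier a b t p f₁ f₂ (η / l) + c₂ * modeMultiplier a b (-t) p f₁ f₂ (η / l)) *
    classicalFourier g η

/-- The kernels of both waves are bounded by `K`, for all admissible amplitudes. -/
def HasKernelBound (a b t p G K : ℝ) : Prop :=
  ∀ f₁ f₂ : ℝ → ℝ, IsAmplitude G f₁ → IsAmplitude G f₂ → ∀ τ, τ = t ∨ τ = -t → ∀ y : ℝ,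
    ‖∫ x : ℝ, Complex.exp (Complex.I * (x * y : ℝ)) * slopeMultiplier a b τ p f₁ f₂ x‖ ≤ K

/-- A twice differentiable integrable datum with integrable derivatives. -/
structure IsModeDatum (l N : ℝ) (g : ℝ → ℂ) : Prop where
  exists_deriv : ∃ g' g'' : ℝ → ℂ, (∀ y, HasDerivAt g (g' y) y) ∧ (∀ y, HasDerivAt g' (g'' y) y) ∧
    Integrable g ∧ Integrable g' ∧ Integrable g'' ∧ ∫ y, ‖(l : ℂ) ^ 3 * g y - l * g'' y‖ ≤ N

lemma wavePair_bound {t K N : ℝ} {g : ℝ → ℂ} (hb : 0 < b) (hp : 0 ≤ p) (hl : l ≠ 0)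
    (hK : HasKernelBound a b t p G K) (hf₁ : IsAmplitude G f₁) (hf₂ : IsAmplitude G f₂)
    (hg : IsModeDatum l N g) (c₁ c₂ : ℂ) :
    Integrable (wavePair a b t p l f₁ f₂ c₁ c₂ g) ∧
    ∀ y : ℝ, ‖∫ η : ℝ, Complex.exp (Complex.I * (η * y)) * wavePair a b t p l f₁ f₂ c₁ c₂ g η‖ ≤
      (‖c₁‖ + ‖c₂‖) * (K / l ^ 2 * N) := by
  obtain ⟨g', g'', h1, h2, i0, i1, i2, hN⟩ := hg.exists_deriv
  have hi (τ : ℝ) := integrable_modeMultiplier_mul (a := a) (τ := τ) hb hp hf₁ hf₂ hl h1 h2 i0 i1 i2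
  have hK0 : 0 ≤ K := (norm_nonneg _).trans (hK f₁ f₂ hf₁ hf₂ t (Or.inl rfl) 0)
  have hn (τ : ℝ) (hτ : τ = t ∨ τ = -t) (y : ℝ) :=
    (norm_integral_modeMultiplier_mul_le (a := a) (τ := τ) hb hp hf₁ hf₂ hl
    (hK f₁ f₂ hf₁ hf₂ τ hτ) h1 h2 i0 i1 i2 y).trans
    (mul_le_mul_of_nonneg_left hN (by positivity))
  have e (η : ℝ) : wavePair a b t p l f₁ f₂ c₁ c₂ g η =
      c₁ * (modeMultiplier a b t p f₁ f₂ (η / l) * classicalFourier g η) +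
      c₂ * (modeMultiplier a b (-t) p f₁ f₂ (η / l) * classicalFourier g η) := by
    rw [wavePair]; ring
  have hint : Integrable (wavePair a b t p l f₁ f₂ c₁ c₂ g) := by
    rw [funext e]
    exact ((hi t).const_mul c₁).add ((hi (-t)).const_mul c₂)
  refine ⟨hint, fun y => ?_⟩
  have hex {F : ℝ → ℂ} (hF : Integrable F) :
      Integrable fun η : ℝ => Complex.exp (Complex.I * (η * y)) * F η := by
    refine hF.bdd_mul (c := 1) (by fun_prop : Continuous fun η : ℝ =>
      Complex.exp (Complex.I * (η * y))).aestronglyMeasurable (.of_forall fun η => ?_)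
    rw [show Complex.I * ((η : ℂ) * y) = ((η * y : ℝ) : ℂ) * Complex.I by push_cast; ring,
      Complex.norm_exp_ofReal_mul_I]
  have e2 : ∫ η : ℝ, Complex.exp (Complex.I * (η * y)) * wavePair a b t p l f₁ f₂ c₁ c₂ g η =
      c₁ * (∫ η : ℝ, Complex.exp (Complex.I * (η * y)) *
        (modeMultiplier a b t p f₁ f₂ (η / l) * classicalFourier g η)) +
      c₂ * ∫ η : ℝ, Complex.exp (Complex.I * (η * y)) *
        (modeMultiplier a b (-t) p f₁ f₂ (η / l) * classicalFourier g η) := by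
    rw [← integral_const_mul, ← integral_const_mul, ← integral_add ((hex (hi t)).const_mul c₁)
      ((hex (hi (-t))).const_mul c₂)]
    refine integral_congr_ae (.of_forall fun η => ?_)
    simp only [e]
    ring
  rw [e2, add_mul]
  refine (norm_add_le _ _).trans ?_
  rw [norm_mul, norm_mul]
  exact add_le_add (mul_le_mul_of_nonneg_left (hn t (Or.inl rfl) y) (norm_nonneg _))
    (mul_le_mul_of_nonneg_left (hn (-t) (Or.inr rfl) y) (norm_nonneg _))

lemma hasKernelBound {c s r₀ t : ℝ} (hb : 0 < b) (hp : 0 ≤ p) (hs : 0 < s)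
    (hε : s ^ 6 * |t * (a ^ 2 - b)| = 1) (hc : 0 < c) (hr0 : 0 ≤ r₀) (hr1 : r₀ ≤ 1)
    (hw1 : ∀ x ∈ Icc 0 r₀, c ^ 2 * (r₀ - x) ≤ phaseWeight a b x)
    (hw2 : ∀ x ∈ Icc r₀ 1, phaseWeight a b x ≤ -(c ^ 2 * (x - r₀)))
    (hw3 : ∀ x, 1 ≤ x → phaseWeight a b x ≤ -(c ^ 2 / x ^ 4)) :
    HasKernelBound a b t p G (54 * G ^ 2 * dispersiveConst c * s ^ 2) := by
  intro f₁ f₂ hf₁ hf₂ τ hτ y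
  refine norm_integral_slopeMultiplier_le hb hp hf₁ hf₂ hs ?_ hc hr0 hr1 hw1 hw2 hw3 y
  rcases hτ with rfl | rfl
  · exact hε
  · rwa [neg_mul, abs_neg]

end Pair

lemma isModeDatum_coef {f : ℝ × ℝ × ℝ → ℝ} {l : ℤ} (hf : ContDiff ℝ ∞ f) (hp : IsPeriodic f)
    (hl : l ≠ 0) (hw : w31Norm (simpleZero f) ≠ ⊤) :
    IsModeDatum l (2 * (w31Norm (simpleZero f)).toReal) (coef 0 l f) where
  exists_deriv := ⟨coef 0 l (dY f), coef 0 l (dY (dY f)), hasDerivAt_coef hf 0 l,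
    hasDerivAt_coef (contDiff_dY hf) 0 l,
    integrable_coef_of_w31Norm hf hp hl hw (i := 0) (j := 0) (by norm_num),
    integrable_coef_of_w31Norm hf hp hl hw (i := 1) (j := 0) (by norm_num),
    integrable_coef_of_w31Norm hf hp hl hw (i := 2) (j := 0) (by norm_num),
    integral_norm_helmholtz_coef_le hf hp hl hw⟩

/-- A continuous `L²` function whose transform is a sum of three damped wave pairs. -/
lemma norm_le_of_lineFourier_eq_wavePairs {a b p t G K N₀ N₁ N₂ d l : ℝ} {f₁ f₂ f₃ f₄ f₅ f₆ : ℝ → ℝ}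
    {g₀ g₁ g₂ v : ℝ → ℂ} {c₀ c₀' c₁ c₁' c₂ c₂' : ℂ} (hb : 0 < b) (hp : 0 ≤ p) (hl : l ≠ 0)
    (hd : 0 ≤ d) (hK : HasKernelBound a b t p G K)
    (h₁ : IsAmplitude G f₁) (h₂ : IsAmplitude G f₂) (h₃ : IsAmplitude G f₃)
    (h₄ : IsAmplitude G f₄) (h₅ : IsAmplitude G f₅) (h₆ : IsAmplitude G f₆)
    (hg₀ : IsModeDatum l N₀ g₀) (hg₁ : IsModeDatum l N₁ g₁) (hg₂ : IsModeDatum l N₂ g₂)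
    (hv : Continuous v) (hv2 : MemLp v 2)
    (h : ∀ᵐ η : ℝ, lineFourier v η = d * (wavePair a b t p l f₁ f₂ c₀ c₀' g₀ η +
      wavePair a b t p l f₃ f₄ c₁ c₁' g₁ η + wavePair a b t p l f₅ f₆ c₂ c₂' g₂ η)) (y : ℝ) :
    ‖v y‖ ≤ d * (K / l ^ 2) * ((‖c₀‖ + ‖c₀'‖) * N₀ + (‖c₁‖ + ‖c₁'‖) * N₁ + (‖c₂‖ + ‖c₂'‖) * N₂) := by
  obtain ⟨i0, b0⟩ := wavePair_bound hb hp hl hK h₁ h₂ hg₀ c₀ c₀'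
  obtain ⟨i1, b1⟩ := wavePair_bound hb hp hl hK h₃ h₄ hg₁ c₁ c₁'
  obtain ⟨i2, b2⟩ := wavePair_bound hb hp hl hK h₅ h₆ hg₂ c₂ c₂'
  set W₀ := wavePair a b t p l f₁ f₂ c₀ c₀' g₀
  set W₁ := wavePair a b t p l f₃ f₄ c₁ c₁' g₁
  set W₂ := wavePair a b t p l f₅ f₆ c₂ c₂' g₂
  have hae := eq_integral_of_lineFourier_ae_eq hv2 (((i0.add i1).add i2).const_mul (d : ℂ)) h
  -- Fourier inversion gives the bound almost everywhere; the set where it holds is closed by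
  -- continuity of `v` and dense, hence everything.
  have hcl : IsClosed {y | ‖v y‖ ≤ d * (K / l ^ 2) *
      ((‖c₀‖ + ‖c₀'‖) * N₀ + (‖c₁‖ + ‖c₁'‖) * N₁ + (‖c₂‖ + ‖c₂'‖) * N₂)} :=
    isClosed_le hv.norm continuous_const
  have hdense : Dense {y | ‖v y‖ ≤ d * (K / l ^ 2) *
      ((‖c₀‖ + ‖c₀'‖) * N₀ + (‖c₁‖ + ‖c₁'‖) * N₁ + (‖c₂‖ + ‖c₂'‖) * N₂)} := by
    refine Measure.dense_of_ae (μ := volume) ?_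
    filter_upwards [hae] with y hy
    rw [hy]
    have hex {F : ℝ → ℂ} (hF : Integrable F) :
        Integrable fun η : ℝ => Complex.exp (Complex.I * (η * y)) * F η := by
      refine hF.bdd_mul (c := 1) (by fun_prop : Continuous fun η : ℝ =>
        Complex.exp (Complex.I * (η * y))).aestronglyMeasurable (.of_forall fun η => ?_)
      rw [show Complex.I * ((η : ℂ) * y) = ((η * y : ℝ) : ℂ) * Complex.I by push_cast; ring,
        Complex.norm_exp_ofReal_mul_I]
    have e : ∫ η : ℝ, Complex.exp (Complex.I * (η * y)) * (d * (W₀ + W₁ + W₂) η) =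
        d * ((∫ η : ℝ, Complex.exp (Complex.I * (η * y)) * W₀ η) +
          (∫ η : ℝ, Complex.exp (Complex.I * (η * y)) * W₁ η) +
          ∫ η : ℝ, Complex.exp (Complex.I * (η * y)) * W₂ η) := by
      rw [← integral_add (hex i0) (hex i1), ← integral_add (f := fun η : ℝ =>
          Complex.exp (Complex.I * (η * y)) * W₀ η + Complex.exp (Complex.I * (η * y)) * W₁ η)
          ((hex i0).add (hex i1)) (hex i2),
        ← integral_const_mul]
      refine integral_congr_ae (.of_forall fun η => ?_)
      simp only [Pi.add_apply]
      ring
    have h1 : ‖((2 * Real.pi)⁻¹ : ℂ)‖ ≤ 1 := by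
      rw [norm_inv, norm_mul, Complex.norm_real, Complex.norm_ofNat, Real.norm_eq_abs,
        abs_of_pos Real.pi_pos]
      exact inv_le_one_of_one_le₀ (by linarith [Real.pi_gt_three])
    rw [norm_mul]
    refine (mul_le_of_le_one_left (norm_nonneg _) h1).trans ?_
    rw [e, norm_mul, Complex.norm_real, Real.norm_eq_abs, abs_of_nonneg hd, mul_assoc]
    refine mul_le_mul_of_nonneg_left ?_ hd
    refine (norm_add₃_le.trans (add_le_add (add_le_add (b0 y) (b1 y)) (b2 y))).trans (le_of_eq ?_)
    ring
  exact (Set.ext_iff.1 (hcl.closure_eq.symm.trans hdense.closure_eq) y).2 trivial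

/-! ### Dispersive decay of a single mode of `u²` and `u³` -/

section DispersiveModes

variable {ν α β : ℝ} {uin : Fin 3 → ℝ × ℝ × ℝ → ℝ} {θin : ℝ × ℝ × ℝ → ℝ}
  {u : Fin 3 → ℝ → ℝ × ℝ × ℝ → ℝ} {θ π : ℝ → ℝ × ℝ × ℝ → ℝ}

lemma IsInitialData.classicalFourier_div (hin : IsInitialData uin θin) {l : ℤ} (hl : l ≠ 0)
    (hw : w31Norm (simpleZero (uin 1)) ≠ ⊤) (η : ℝ) :
    η * classicalFourier (coef 0 l (uin 1)) η + l * classicalFourier (coef 0 l (uin 2)) η = 0 := by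
  have h1 := classicalFourier_deriv (hasDerivAt_coef (hin.smooth_u 1) 0 l)
    (integrable_coef_of_w31Norm (hin.smooth_u 1) (hin.periodic_u 1) hl hw (i := 0) (j := 0) (by norm_num))
    (integrable_coef_of_w31Norm (hin.smooth_u 1) (hin.periodic_u 1) hl hw (i := 1) (j := 0) (by norm_num)) η
  have c0 := (contDiff_dX (hin.smooth_u 0)).continuous
  have c1 := (contDiff_dY (hin.smooth_u 1)).continuous
  have c2 := (contDiff_dZ (hin.smooth_u 2)).continuous
  have h2 (y : ℝ) : coef 0 l (dY (uin 1)) y = -(Complex.I * l) * coef 0 l (uin 2) y := by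
    have e : coef 0 l (divergence uin) y = 0 := by
      rw [show divergence uin = fun _ => 0 from funext hin.div_free]
      simp [coef]
    unfold divergence at e
    rw [coef_add (by fun_prop) c2, coef_add c0 c1, coef_dX (hin.smooth_u 0) (hin.periodic_u 0),
      coef_dZ (hin.smooth_u 2) (hin.periodic_u 2)] at e
    push_cast at e
    linear_combination e
  have h3 : classicalFourier (coef 0 l (dY (uin 1))) η =
      -(Complex.I * l) * classicalFourier (coef 0 l (uin 2)) η := by
    unfold classicalFourier
    rw [← integral_const_mul]
    refine integral_congr_ae (.of_forall fun y => ?_)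
    simp only [h2]
    ring
  rw [h3] at h1
  linear_combination Complex.I * h1 + (η * classicalFourier (coef 0 l (uin 1)) η +
    l * classicalFourier (coef 0 l (uin 2)) η) * Complex.I_sq

lemma fourier2_simpleZero_ae_eq {f : ℝ × ℝ × ℝ → ℝ} (hf : ContDiff ℝ ∞ f) (hp : IsPeriodic f)
    (h2 : MemLp f 2 cell3) {l : ℤ} (hl : l ≠ 0) (hw : w31Norm (simpleZero f) ≠ ⊤) :
    ∀ᵐ η : ℝ, fourier2 (simpleZero f) η l = classicalFourier (coef 0 l f) η := by
  filter_upwards [lineFourier_ae_eq_classical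
    (integrable_coef_of_w31Norm hf hp hl hw (i := 0) (j := 0) (by norm_num))
    (memLp_coef hf.continuous h2 0 l)] with η hη
  rw [fourier2_simpleZero hf.continuous hl]
  exact hη

/-- With `m, κ` the two inverse square roots at `x = η/l`, the coefficients of the explicit formula
are products of the bounded amplitudes `1, m, αxm, κ, xκ`. In `u³ = -x u²` the factor `x` is
absorbed into `κ` for the data `u¹, θ`, while `-x` times the datum `u²` is the datum `u³`, so no
unbounded amplitude occurs. -/
lemma IsLinearSolution.norm_coef_le (hin : IsInitialData uin θin)
    (h : IsLinearSolution ν α β uin θin u θ π) (hν : 0 < ν) (hα : 0 < α) (hβ : 0 < β * (β - 1))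
    {t : ℝ} (ht : 0 ≤ t) {l : ℤ} (hl : l ≠ 0) {G K : ℝ} (hG : 1 ≤ G)
    (hGβ : 1 ≤ G ^ 2 * (β * (β - 1)))
    (hK : HasKernelBound α (β * (β - 1)) t (ν * t * (l : ℝ) ^ 2) G K)
    (hw : ∀ i, w31Norm (simpleZero (uin i)) ≠ ⊤) (hwθ : w31Norm (simpleZero θin) ≠ ⊤) (y : ℝ) :
    ‖coef 0 l (u 1 t) y‖ ≤ Real.exp (-(ν * t * (l : ℝ) ^ 2)) * (K / (l : ℝ) ^ 2) *
      (|β| * (2 * (w31Norm (simpleZero (uin 0))).toReal) +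
        2 * (w31Norm (simpleZero (uin 1))).toReal + 2 * (w31Norm (simpleZero θin)).toReal) ∧
    ‖coef 0 l (u 2 t) y‖ ≤ Real.exp (-(ν * t * (l : ℝ) ^ 2)) * (K / (l : ℝ) ^ 2) *
      (|β| * (2 * (w31Norm (simpleZero (uin 0))).toReal) +
        2 * (w31Norm (simpleZero (uin 2))).toReal + 2 * (w31Norm (simpleZero θin)).toReal) := by
  have hlr : (l : ℝ) ≠ 0 := by exact_mod_cast hl
  have hlc : (l : ℂ) ≠ 0 := by exact_mod_cast hl
  have hp : 0 ≤ ν * t * (l : ℝ) ^ 2 := by positivity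
  have hG0 : 0 ≤ G := zero_le_one.trans hG
  have hd := (Real.exp_pos (-(ν * t * (l : ℝ) ^ 2))).le
  have D (i : Fin 3) := isModeDatum_coef (hin.smooth_u i) (hin.periodic_u i) hl (hw i)
  have Dθ := isModeDatum_coef hin.smooth_θ hin.periodic_θ hl hwθ
  have A0 := isAmplitude_one hG
  have A1 := isAmplitude_invSqrt (a := α) hβ hG0 hGβ
  have A2 := isAmplitude_mul_invSqrt hα.le hβ hG
  have A3 := isAmplitude_invSqrt (a := 1) one_pos hG0 (by rw [mul_one]; exact one_le_pow₀ hG)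
  have A4 := isAmplitude_mul_invSqrt zero_le_one one_pos hG
  have F (i : Fin 3) := fourier2_simpleZero_ae_eq (hin.smooth_u i) (hin.periodic_u i)
    (h.memLp_in.1 i) hl (hw i)
  have Fθ := fourier2_simpleZero_ae_eq hin.smooth_θ hin.periodic_θ h.memLp_in.2 hl hwθ
  have key : ∀ᵐ η : ℝ, lineFourier (coef 0 l (u 1 t)) η = (Real.exp (-(ν * t * (l : ℝ) ^ 2)) : ℝ) *
      (wavePair α (β * (β - 1)) t (ν * t * (l : ℝ) ^ 2) l (invSqrt α (β * (β - 1))) (invSqrt 1 1)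
        (Complex.I * β / 2) (-(Complex.I * β / 2)) (coef 0 l (uin 0)) η +
      wavePair α (β * (β - 1)) t (ν * t * (l : ℝ) ^ 2) l (fun _ => 1) (fun _ => 1)
        (1 / 2) (1 / 2) (coef 0 l (uin 1)) η +
      wavePair α (β * (β - 1)) t (ν * t * (l : ℝ) ^ 2) l
        (fun x => α * x * invSqrt α (β * (β - 1)) x) (invSqrt 1 1)
        (-(Complex.I / 2)) (Complex.I / 2) (coef 0 l θin) η) ∧
      lineFourier (coef 0 l (u 2 t)) η = (Real.exp (-(ν * t * (l : ℝ) ^ 2)) : ℝ) *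
      (wavePair α (β * (β - 1)) t (ν * t * (l : ℝ) ^ 2) l (invSqrt α (β * (β - 1)))
        (fun x => 1 * x * invSqrt 1 1 x)
        (-(Complex.I * β / 2)) (Complex.I * β / 2) (coef 0 l (uin 0)) η +
      wavePair α (β * (β - 1)) t (ν * t * (l : ℝ) ^ 2) l (fun _ => 1) (fun _ => 1)
        (1 / 2) (1 / 2) (coef 0 l (uin 2)) η +
      wavePair α (β * (β - 1)) t (ν * t * (l : ℝ) ^ 2) l
        (fun x => α * x * invSqrt α (β * (β - 1)) x) (fun x => 1 * x * invSqrt 1 1 x)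
        (Complex.I / 2) (-(Complex.I / 2)) (coef 0 l θin) η) := by
    filter_upwards [simpleZeroFormula hα hβ hin h ht hl, F 0, F 1, Fθ] with η hη f0 f1 fθ
    obtain ⟨-, e1, e2, -⟩ := hη
    have hdiv := hin.classicalFourier_div hl (hw 1) η
    have c1 : Continuous (u 1 t) := h.continuous_fields ht 1
    have c2 : Continuous (u 2 t) := h.continuous_fields ht 2
    rw [fourier2_simpleZero c1 hl] at e1
    rw [fourier2_simpleZero c2 hl, fourier2_simpleZero c1 hl] at e2
    rw [f0, f1, fθ, exp_lam2 hβ hlr, exp_lam3 hβ hlr] at e1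
    have hX : (l : ℂ) ^ 2 / (hSym α β η l * absSym η l) =
        invSqrt α (β * (β - 1)) (η / l) * invSqrt 1 1 (η / l) := by
      exact_mod_cast congrArg (fun x : ℝ => (x : ℂ)) (sq_div_hSym_mul_absSym (α := α) (η := η) hβ hlr)
    have hY : (η : ℂ) * l / (hSym α β η l * absSym η l) =
        η / l * (invSqrt α (β * (β - 1)) (η / l) * invSqrt 1 1 (η / l)) := by
      rw [← hX]
      field_simp
    unfold wavePair
    simp only [modeMultiplier_eq _ _ _ _ (invSqrt α (β * (β - 1))),
      modeMultiplier_eq _ _ _ _ (fun x => α * x * invSqrt α (β * (β - 1)) x)]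
    set M₁ := modeMultiplier α (β * (β - 1)) t (ν * t * (l : ℝ) ^ 2) (fun _ => 1) (fun _ => 1) (η / l)
    set M₂ := modeMultiplier α (β * (β - 1)) (-t) (ν * t * (l : ℝ) ^ 2) (fun _ => 1) (fun _ => 1) (η / l)
    set d := Real.exp (-(ν * t * (l : ℝ) ^ 2))
    set m := invSqrt α (β * (β - 1)) (η / l)
    set κ := invSqrt 1 1 (η / l)
    set a₀ := classicalFourier (coef 0 l (uin 0)) η
    set a₁ := classicalFourier (coef 0 l (uin 1)) η
    set a₂ := classicalFourier (coef 0 l (uin 2)) η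
    set b := classicalFourier (coef 0 l θin) η
    -- Incompressibility of the data, which exchanges the unbounded `x û²` for `û³`.
    have ea : a₂ = -(η / l : ℂ) * a₁ := by
      field_simp
      linear_combination hdiv
    have e3 : lineFourier (coef 0 l (u 1 t)) η =
        d * ((Complex.I * β / 2 * (m * κ * M₁) + -(Complex.I * β / 2) * (m * κ * M₂)) * a₀ +
          (1 / 2 * M₁ + 1 / 2 * M₂) * a₁ +
          (-(Complex.I / 2) * (α * (η / l) * m * κ * M₁) +
            Complex.I / 2 * (α * (η / l) * m * κ * M₂)) * b) := by
      linear_combination e1 + (Complex.I * β / 2 * d * (M₁ - M₂) * a₀) * hX +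
        (Complex.I * α / 2 * d * (M₂ - M₁) * b) * hY
    refine ⟨?_, ?_⟩
    · rw [e3]
      push_cast
      ring
    · rw [e2, e3, ea]
      push_cast
      ring
  have hnβ : ‖Complex.I * β / 2‖ = |β| / 2 := by
    rw [norm_div, norm_mul, Complex.norm_I, one_mul, Complex.norm_real, Complex.norm_ofNat]
    rfl
  have hnI : ‖Complex.I / 2‖ = 1 / 2 := by rw [norm_div, Complex.norm_I, Complex.norm_ofNat]
  have hn1 : ‖(1 / 2 : ℂ)‖ = 1 / 2 := by rw [norm_div, norm_one, Complex.norm_ofNat]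
  have b1 := norm_le_of_lineFourier_eq_wavePairs hβ hp hlr hd hK A1 A3 A0 A0 A2 A3 (D 0) (D 1) Dθ
    (continuous_coef (h.continuous_fields ht 1) 0 l)
    (memLp_coef (h.continuous_fields ht 1) (h.memLp_fields ht 1) 0 l)
    (key.mono fun η hη => hη.1) y
  have b2 := norm_le_of_lineFourier_eq_wavePairs hβ hp hlr hd hK A1 A4 A0 A0 A2 A4 (D 0) (D 2) Dθ
    (continuous_coef (h.continuous_fields ht 2) 0 l)
    (memLp_coef (h.continuous_fields ht 2) (h.memLp_fields ht 2) 0 l)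
    (key.mono fun η hη => hη.2) y
  rw [norm_neg, norm_neg, hnβ, hnI, hn1] at b1 b2
  refine ⟨b1.trans (le_of_eq ?_), b2.trans (le_of_eq ?_)⟩ <;> ring

end DispersiveModes

/-! ### Summation over the modes -/

/-- A continuous periodic function with summable Fourier coefficients is the pointwise sum of its
Fourier series. -/
lemma norm_le_tsum_of_periodic {g : ℝ → ℂ} (hg : Continuous g) (hp : Function.Periodic g (2 * Real.pi))
    {b : ℤ → ℝ} (hb : Summable b) (h : ∀ l : ℤ, ‖((2 * Real.pi)⁻¹ : ℂ) *
      ∫ z in (0 : ℝ)..(2 * Real.pi), g z * Complex.exp (-Complex.I * (l * z))‖ ≤ b l) (z : ℝ) :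
    ‖g z‖ ≤ ∑' l, b l := by
  have : Fact (0 < 2 * Real.pi) := ⟨two_pi_pos⟩
  have hcont : Continuous (hp.lift) := Continuous.quotient_lift hg _
  set f : C(AddCircle (2 * Real.pi), ℂ) := ⟨hp.lift, hcont⟩ with hf
  have hfz (z : ℝ) : f (z : AddCircle (2 * Real.pi)) = g z := rfl
  have hpi : ((Real.pi : ℝ) : ℂ) ≠ 0 := by exact_mod_cast Real.pi_ne_zero
  have hcoef (l : ℤ) : fourierCoeff f l = ((2 * Real.pi)⁻¹ : ℂ) *
      ∫ z in (0 : ℝ)..(2 * Real.pi), g z * Complex.exp (-Complex.I * (l * z)) := by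
    rw [fourierCoeff_eq_intervalIntegral _ _ 0, zero_add, one_div, Complex.real_smul]
    push_cast
    congr 1
    refine intervalIntegral.integral_congr fun z _ => ?_
    simp only [hfz, fourier_coe_apply, smul_eq_mul]
    rw [mul_comm]
    congr 2
    push_cast
    field_simp
  have hbound (l : ℤ) : ‖fourierCoeff f l‖ ≤ b l := by rw [hcoef]; exact h l
  have hs : Summable (fourierCoeff f) := .of_norm_bounded hb hbound
  have hsum := has_pointwise_sum_fourier_series_of_summable hs (z : AddCircle (2 * Real.pi))
  rw [← hfz z, ← hsum.tsum_eq]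
  refine tsum_of_norm_bounded hb.hasSum fun l => ?_
  rw [norm_smul, fourier_coe_apply,
    show 2 * (Real.pi : ℂ) * Complex.I * l * z / (2 * Real.pi : ℝ) = ((l * z : ℝ) : ℂ) * Complex.I by
      push_cast; field_simp, Complex.norm_exp_ofReal_mul_I, mul_one]
  exact hbound l

lemma abs_simpleZero_le {f : ℝ × ℝ × ℝ → ℝ} (hf : Continuous f) (hp : IsPeriodic f) {X y : ℝ}
    (h : ∀ l : ℤ, l ≠ 0 → ‖coef 0 l f y‖ ≤ X / (l : ℝ) ^ 2) (z : ℝ) :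
    |simpleZero f (y, z)| ≤ X * ∑' l : ℤ, 1 / (l : ℝ) ^ 2 := by
  have hs := continuous_simpleZero hf
  have hper : Function.Periodic (fun z => (simpleZero f (y, z) : ℂ)) (2 * Real.pi) := fun z => by
    simp only [simpleZero, zeroMode, (hp _ y z).2]
  have := norm_le_tsum_of_periodic (g := fun z => (simpleZero f (y, z) : ℂ)) (by fun_prop) hper
    (b := fun l : ℤ => X * (1 / (l : ℝ) ^ 2))
    ((Real.summable_one_div_int_pow.2 one_lt_two).mul_left X) (fun l => ?_) z
  · rwa [Complex.norm_real, Real.norm_eq_abs, tsum_mul_left] at this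
  · rw [coef_simpleZero hf]
    split_ifs with hl
    -- At `l = 0` the coefficient is zero, and so is the bound, by the convention `1 / 0 = 0`.
    · simp [hl]
    · rw [mul_one_div]
      exact h l hl

lemma le_vecNorm {n : ℕ} (a : Fin n → ℝ≥0∞) (i : Fin n) : a i ≤ vecNorm a := by
  refine (ENNReal.pow_le_pow_left_iff two_ne_zero).1 ?_
  rw [vecNorm_sq]
  exact Finset.single_le_sum (f := fun i => a i ^ 2) (fun _ _ => zero_le) (Finset.mem_univ i)

lemma vecNorm_pair_le {a b c : ℝ≥0∞} (ha : a ≤ c) (hb : b ≤ c) : vecNorm ![a, b] ≤ 2 * c := by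
  refine (ENNReal.pow_le_pow_left_iff two_ne_zero).1 ?_
  rw [vecNorm_sq, Fin.sum_univ_two]
  calc a ^ 2 + b ^ 2 ≤ c ^ 2 + c ^ 2 := by gcongr
    _ ≤ (c ^ 2 + c ^ 2) + (c ^ 2 + c ^ 2) := le_self_add
    _ = (2 * c) ^ 2 := by ring

lemma eLpNorm_simpleZero_top_le {f : ℝ × ℝ × ℝ → ℝ} (hf : Continuous f) (hp : IsPeriodic f) {X : ℝ}
    (h : ∀ l : ℤ, l ≠ 0 → ∀ y, ‖coef 0 l f y‖ ≤ X / (l : ℝ) ^ 2) :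
    eLpNorm (simpleZero f) ⊤ cell2 ≤ ENNReal.ofReal (X * ∑' l : ℤ, 1 / (l : ℝ) ^ 2) := by
  rw [eLpNorm_exponent_top]
  exact eLpNormEssSup_le_of_ae_bound (.of_forall fun Y =>
    abs_simpleZero_le hf hp (fun l hl => h l hl Y.1) Y.2)

lemma abs_le_of_mul_sub_one_le {β R : ℝ} (hR : 0 ≤ R) (h : β * (β - 1) ≤ R) : |β| ≤ 2 + R := by
  by_contra! hc
  have h1 : |β| * (|β| - 1) ≤ β * (β - 1) := by
    have e1 : |β| * |β| = β * β := abs_mul_abs_self β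
    have e2 := le_abs_self β
    rw [mul_sub, mul_sub, e1]
    linarith
  have h2 : (2 + R) * (1 + R) ≤ |β| * (|β| - 1) := by
    refine mul_le_mul hc.le (by linarith) (by linarith) (abs_nonneg β)
  nlinarith

theorem dispersiveBound {α R : ℝ} (hα : 0 < α) (hR : 0 < R) : ∃ C : ℝ, 0 < C ∧
    ∀ (ν β : ℝ) (uin : Fin 3 → ℝ × ℝ × ℝ → ℝ) (θin : ℝ × ℝ × ℝ → ℝ)
      (u : Fin 3 → ℝ → ℝ × ℝ × ℝ → ℝ) (θ π : ℝ → ℝ × ℝ × ℝ → ℝ),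
      0 < ν → R⁻¹ ≤ β * (β - 1) → β * (β - 1) ≤ R → β * (β - 1) ≠ α ^ 2 →
      IsInitialData uin θin → IsLinearSolution ν α β uin θin u θ π →
      ∀ t : ℝ, 0 < t → DispersiveBound C ν α β uin θin u t := by
  obtain ⟨c, hc, hw⟩ := exists_phaseWeight_bounds α hR
  set S := ∑' l : ℤ, 1 / (l : ℝ) ^ 2 with hS
  have hS0 : 0 ≤ S := tsum_nonneg fun l => by positivity
  have hdc := dispersiveConst_nonneg hc
  -- `108 = 2 · 54` combines the two components; `2R + 8` comes from `|β| ≤ 2 + R`, and `α^{-1/3}`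
  -- from `t|B_β - α²| = αqt`.
  set A := 108 * (1 + R) ^ 2 * dispersiveConst c * α ^ (-(1 / 3) : ℝ) * S * (2 * R + 8) with hA
  have hA0 : 0 ≤ A := by positivity
  refine ⟨A + 1, by positivity, fun ν β uin θin u θ π hν hb1 hb2 hne hin h t ht => ?_⟩
  have hβ : 0 < β * (β - 1) := lt_of_lt_of_le (by positivity) hb1
  obtain ⟨r₀, hr0, hr1, hw1, hw2, hw3⟩ := hw _ hb1 hb2
  unfold DispersiveBound
  set q := |β * (β - 1) - α ^ 2| / α * t with hq
  have habs : 0 < |β * (β - 1) - α ^ 2| := abs_pos.2 (sub_ne_zero.2 hne)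
  have hq0 : 0 < q := by positivity
  have hqα : 0 < α * q := by positivity
  set V := vecNorm ![w31Norm (simpleZero (uin 0)), w31Norm (simpleZero (uin 1)),
    w31Norm (simpleZero (uin 2)), w31Norm (simpleZero θin)] with hV
  have hpos : 0 < (A + 1) * Real.exp (-ν * t) * q ^ (-(1 / 3) : ℝ) := by positivity
  rcases eq_or_ne V ⊤ with hVt | hVt
  · rw [hVt, ENNReal.mul_top (ENNReal.ofReal_pos.2 hpos).ne']
    exact le_top
  have hle (i : Fin 4) := le_vecNorm ![w31Norm (simpleZero (uin 0)), w31Norm (simpleZero (uin 1)),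
    w31Norm (simpleZero (uin 2)), w31Norm (simpleZero θin)] i
  have hwi (i : Fin 3) : w31Norm (simpleZero (uin i)) ≤ V := by
    fin_cases i
    exacts [hle 0, hle 1, hle 2]
  have hwθ : w31Norm (simpleZero θin) ≤ V := hle 3
  have hv (i : Fin 3) := ENNReal.toReal_mono hVt (hwi i)
  have hvθ := ENNReal.toReal_mono hVt hwθ
  set v := V.toReal with hv_def
  have hv0 : 0 ≤ v := ENNReal.toReal_nonneg
  -- the scale of the stationary point
  set s := (α * q) ^ (-(1 / 6) : ℝ) with hs
  have hs0 : 0 < s := by positivity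
  have hs6 : s ^ 6 * |t * (α ^ 2 - β * (β - 1))| = 1 := by
    have e1 : |t * (α ^ 2 - β * (β - 1))| = α * q := by
      rw [abs_mul, abs_of_pos ht, abs_sub_comm, hq]
      field_simp
    rw [e1, hs, ← Real.rpow_natCast, ← Real.rpow_mul hqα.le]
    norm_num
    rw [Real.rpow_neg_one, inv_mul_cancel₀ hqα.ne']
  have hs2 : s ^ 2 = α ^ (-(1 / 3) : ℝ) * q ^ (-(1 / 3) : ℝ) := by
    rw [hs, ← Real.rpow_natCast, ← Real.rpow_mul hqα.le, Real.mul_rpow hα.le hq0.le]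
    norm_num
  set K := 54 * (1 + R) ^ 2 * dispersiveConst c * s ^ 2 with hK
  have hK0 : 0 ≤ K := by positivity
  -- The amplitude `m` is at most `B_β^{-1/2} ≤ R^{1/2}`, so `G = 1 + R` bounds all amplitudes.
  have hGβ : 1 ≤ (1 + R) ^ 2 * (β * (β - 1)) := by
    have h1 : R * R⁻¹ ≤ (1 + R) ^ 2 * (β * (β - 1)) := by
      refine mul_le_mul ?_ hb1 (by positivity) (by positivity)
      nlinarith
    rwa [mul_inv_cancel₀ hR.ne'] at h1
  have hβR := abs_le_of_mul_sub_one_le hR.le hb2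
  set X := Real.exp (-ν * t) * K * ((2 * R + 8) * v) with hX
  have hmode (l : ℤ) (hl : l ≠ 0) (y : ℝ) := h.norm_coef_le hin hν hα hβ ht.le hl
    (G := 1 + R) (K := K) (by linarith) hGβ
    (hasKernelBound hβ (by positivity) hs0 hs6 hc hr0 hr1 hw1 hw2 hw3)
    (fun i => ne_top_of_le_ne_top hVt (hwi i)) (ne_top_of_le_ne_top hVt hwθ) y
  have hfin (l : ℤ) (hl : l ≠ 0) (i : Fin 3) :
      Real.exp (-(ν * t * (l : ℝ) ^ 2)) * (K / (l : ℝ) ^ 2) *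
      (|β| * (2 * (w31Norm (simpleZero (uin 0))).toReal) +
        2 * (w31Norm (simpleZero (uin i))).toReal + 2 * (w31Norm (simpleZero θin)).toReal) ≤
      X / (l : ℝ) ^ 2 := by
    have hl1 : (1 : ℝ) ≤ (l : ℝ) ^ 2 := by
      have : (0 : ℤ) < l ^ 2 := by positivity
      exact_mod_cast this
    have e1 : Real.exp (-(ν * t * (l : ℝ) ^ 2)) ≤ Real.exp (-ν * t) := by
      refine Real.exp_le_exp.2 ?_
      have := mul_le_mul_of_nonneg_left hl1 (mul_pos hν ht).le
      linarith
    have e2 : |β| * (2 * (w31Norm (simpleZero (uin 0))).toReal) ≤ (2 + R) * (2 * v) := by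
      have := hv 0
      gcongr
    have e3 : |β| * (2 * (w31Norm (simpleZero (uin 0))).toReal) +
        2 * (w31Norm (simpleZero (uin i))).toReal + 2 * (w31Norm (simpleZero θin)).toReal ≤
        (2 * R + 8) * v := by
      have := hv i
      linarith
    calc _ ≤ Real.exp (-ν * t) * (K / (l : ℝ) ^ 2) * ((2 * R + 8) * v) := by gcongr
      _ = X / (l : ℝ) ^ 2 := by rw [hX]; ring
  have b1 := eLpNorm_simpleZero_top_le (f := u 1 t) (h.continuous_fields ht.le 1)
    (h.periodic_fields ht.le 1) (X := X) fun l hl y => (hmode l hl y).1.trans (hfin l hl 1)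
  have b2 := eLpNorm_simpleZero_top_le (f := u 2 t) (h.continuous_fields ht.le 2)
    (h.periodic_fields ht.le 2) (X := X) fun l hl y => (hmode l hl y).2.trans (hfin l hl 2)
  refine (vecNorm_pair_le b1 b2).trans ?_
  rw [← ENNReal.ofReal_toReal hVt, ← ENNReal.ofReal_mul hpos.le, ← ENNReal.ofReal_ofNat,
    ← ENNReal.ofReal_mul zero_le_two]
  refine ENNReal.ofReal_le_ofReal ?_
  have e : 2 * (X * S) = A * Real.exp (-ν * t) * q ^ (-(1 / 3) : ℝ) * v := by
    rw [hX, hK, hs2, hA]; ring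
  rw [e]
  gcongr
  linarith

end RotatingBoussinesq

end

theorem theorem1p1 :
    -- non-zero modes: the constant depends only on `s`, `α` and a bound `K` for `(β - 1) / β`
    (∀ s α K : ℝ, 0 ≤ s → 0 < α → ∃ C : ℝ, 0 < C ∧
      ∀ (ν β : ℝ) (uin : Fin 3 → ℝ × ℝ × ℝ → ℝ) (θin : ℝ × ℝ × ℝ → ℝ)
        (u : Fin 3 → ℝ → ℝ × ℝ × ℝ → ℝ) (θ π : ℝ → ℝ × ℝ × ℝ → ℝ),
        0 < ν → 0 < β * (β - 1) → (β - 1) / β ≤ K →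
        IsInitialData uin θin → IsLinearSolution ν α β uin θin u θ π →
        ∀ t : ℝ, 0 ≤ t → NonzeroModeBounds C s ν β uin θin u θ t) ∧
    -- simple-zero and double-zero modes
    (∀ (ν α β : ℝ) (uin : Fin 3 → ℝ × ℝ × ℝ → ℝ) (θin : ℝ × ℝ × ℝ → ℝ)
        (u : Fin 3 → ℝ → ℝ × ℝ × ℝ → ℝ) (θ π : ℝ → ℝ × ℝ × ℝ → ℝ),
        0 < ν → 0 < α → 0 < β * (β - 1) →
        IsInitialData uin θin → IsLinearSolution ν α β uin θin u θ π →
        ∀ t : ℝ, 0 ≤ t →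
          (∀ l : ℤ, l ≠ 0 → ∀ᵐ η : ℝ, SimpleZeroFormula ν α β uin θin u θ t η l) ∧
          (∀ y : ℝ, DoubleZeroFormula ν α uin θin u θ t y)) ∧
    -- dispersion: the constant depends only on `α` and a bound `R` for `B_β` and `1 / B_β`
    (∀ α R : ℝ, 0 < α → 0 < R → ∃ C : ℝ, 0 < C ∧
      ∀ (ν β : ℝ) (uin : Fin 3 → ℝ × ℝ × ℝ → ℝ) (θin : ℝ × ℝ × ℝ → ℝ)
        (u : Fin 3 → ℝ → ℝ × ℝ × ℝ → ℝ) (θ π : ℝ → ℝ × ℝ × ℝ → ℝ),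
        0 < ν → R⁻¹ ≤ β * (β - 1) → β * (β - 1) ≤ R → β * (β - 1) ≠ α ^ 2 →
        IsInitialData uin θin → IsLinearSolution ν α β uin θin u θ π →
        ∀ t : ℝ, 0 < t → DispersiveBound C ν α β uin θin u t) := by
  refine ⟨fun s α K _ _ => ?_, fun ν α β uin θin u θ π hν hα hβ hin hsol t ht => ⟨fun l hl =>
    simpleZeroFormula hα hβ hin hsol ht hl, doubleZeroFormula hν hin hsol ht⟩, fun α R hα hR =>
    dispersiveBound hα hR⟩
  -- `κ = √(max K 1)` is positive and satisfies `κ² ≥ (β - 1)/β`; the maximum is needed because `K`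
  -- may be any real number.
  refine ⟨Real.sqrt (8 * Real.exp (2 + 2 * Real.pi * Real.sqrt (max K 1))), by positivity,
    fun ν β uin θin u θ π hν hβ hK hin hsol t ht =>
      nonzeroModeBounds hin hsol hν hβ (by positivity) ?_ ht⟩
  rw [Real.sq_sqrt (by positivity)]
  exact hK.trans (le_max_left _ _)
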